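/- **Proposition 6.3.** Let $0<q<1$ and $\tau,\sigma\in\mathbb R$. Let $A_q(SU(2))$ be the universal unital $C^*$-algebra generated by $\alpha,\gamma$ subject to $\alpha\gamma=q\gamma\alpha$, $\alpha\gamma^*=q\gamma^*\alpha$, $\gamma\gamma^*=\gamma^*\gamma$, $\alpha^*\alpha+\gamma^*\gamma=1=\alpha\alpha^*+q^2\gamma\gamma^*$. Let $\Delta$ be its comultiplication, i.e. the unital $*$-homomorphism with $\Delta(\alpha)=\alpha\otimes\alpha-q\gamma^*\otimes\gamma$, $\Delta(\gamma)=\gamma\otimes\alpha+\alpha^*\otimes\gamma$, and let $h$ be the Haar functional, i.e. the bounded linear functional determined by $h(1)=1$ and $(\mathrm{id}\otimes h)\Delta(a)=h(a)1=(h\otimes\mathrm{id})\Delta(a)$ for all $a$. Let $$\rho_{\tau,\sigma}=\tfrac12\Bigl(\alpha^2+(\alpha^*)^2+q\gamma^2+q(\gamma^*)^2+iq(q^{-\sigma}-q^{\sigma})(\alpha^*\gamma-\gamma^*\alpha)-iq(q^{-\tau}-q^{\tau})(\gamma\alpha-\alpha^*\gamma^*)-q(q^{-\sigma}-q^{\sigma})(q^{-\tau}-q^{\tau})\gamma^*\gamma\Bigr),$$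 which is self-adjoint. Write $(a;r)_k=\prod_{i=0}^{k-1}(1-ar^i)$ for $k\in\mathbb Z_{\ge0}\cup\{\infty\}$, and $(a_1,\dots,a_m;r)_k=\prod_j(a_j;r)_k$. For $0<r<1$ and nonzero real $a,b$ with $ab<0$, let $$p_n(\cos\theta;a,b|r)=a^{-n}(ab;r)_n\sum_{k=0}^n\frac{(r^{-n},ae^{i\theta},ae^{-i\theta};r)_k}{(r,ab;r)_k}\,r^k$$ be the Al-Salam–Chihara polynomials (polynomials in $x=\cos\theta$, so defined for all real $x$), let $$P_t(x,y;a,b|r)=\sum_{k=0}^\infty t^k\,\frac{p_k(x;a,b|r)\,p_k(y;a,b|r)}{(r,ab;r)_k}$$ be their Poisson kernel, and let $dm(x;a,b,0,0|r)$ be their normalised orthogonality measure, $$\int_{\mathbb R}f\,dm=\frac1{2\pi h_0}\int_0^\pi f(\cos\theta)\frac{(e^{2i\theta},e^{-2i\theta};r)_\infty}{(ae^{i\theta},ae^{-i\theta},be^{i\theta},be^{-i\theta};r)_\infty}\,d\theta+\frac1{h_0}\sum_{k\ge0,\ |ar^k|>1}f\Bigl(\frac{ar^k+a^{-1}r^{-k}}2\Bigr)w_k(a;b)+\frac1{h_0}\sum_{k\ge0,\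 |br^k|>1}f\Bigl(\frac{br^k+b^{-1}r^{-k}}2\Bigr)w_k(b;a),$$ where $h_0=1/(r,ab;r)_\infty$ and $$w_k(a;b)=\frac{(a^{-2};r)_\infty}{(r,ab,b/a;r)_\infty}\,\frac{1-a^2r^{2k}}{1-a^2}\,\frac{(a^2,ab;r)_k}{(r,ar/b;r)_k}\,\frac{r^{-k^2}}{(a^3b)^k}.$$ Put $dm_1(x)=dm(x;q^{1+\sigma-\tau},-q^{1-\sigma-\tau},0,0|q^2)$ and $dm_2(x)=dm(x;q^{1-\sigma+\tau},-q^{1+\sigma+\tau},0,0|q^2)$. Then the spectrum of $\rho_{\tau,\sigma}$ is the union of the supports of $dm_1$ and $dm_2$; the series $P_{q^2}(x,x;q^{1+\sigma-\tau},-q^{1-\sigma-\tau}|q^2)$ and $P_{q^2}(x,x;q^{1-\sigma+\tau},-q^{1+\sigma+\tau}|q^2)$ converge absolutely for every $x$ in the support of $dm_1$, respectively $dm_2$; and for every continuous complex-valued function $p$ on the spectrum of $\rho_{\tau,\sigma}$ both integrands below are integrable and $$h\bigl(p(\rho_{\tau,\sigma})\bigr)=\frac{1-q^2}{1+q^{2\tau}}\int_{\mathbb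 R}p(x)\,P_{q^2}(x,x;q^{1+\sigma-\tau},-q^{1-\sigma-\tau}|q^2)\,dm_1(x)+\frac{1-q^2}{1+q^{-2\tau}}\int_{\mathbb R}p(x)\,P_{q^2}(x,x;q^{1-\sigma+\tau},-q^{1+\sigma+\tau}|q^2)\,dm_2(x).$$ -/

import Mathlib

open scoped ENNReal TensorProduct

noncomputable section

/-! ### The C⋆-algebra of the quantum group `SU(2)` -/

/-- The defining relations of the quantum `SU(2)` group for a pair of elements
(`a` plays the role of `α` and `c` that of `γ`). -/
structure QSU2Relations (q : ℝ) {A : Type*} [Ring A] [StarRing A] [Algebra ℂ A]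
    (a c : A) : Prop where
  comm : a * c = (q : ℂ) • (c * a)
  comm_star : a * star c = (q : ℂ) • (star c * a)
  normal : c * star c = star c * c
  star_mul : star a * a + star c * c = 1
  mul_star : a * star a + (q : ℂ) ^ 2 • (c * star c) = 1

/-- A nonzero unital C⋆-algebra together with two elements that satisfy the relations. -/
structure QSU2Pair (q : ℝ) : Type 1 where
  B : Type
  [cstar : CStarAlgebra B]
  [nontriv : Nontrivial B]
  a : B
  c : B
  rel : QSU2Relations q a c

attribute [instance] QSU2Pair.cstar QSU2Pair.nontriv

/-- The `ℓ^∞`-product of all C⋆-algebras carrying a pair that satisfies the relations. -/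
abbrev QSU2Product (q : ℝ) : Type 1 := lp (fun i : QSU2Pair q => i.B) ∞

instance (q : ℝ) : CStarAlgebra (QSU2Product q) where

theorem QSU2Relations.norm_le {q : ℝ} {B : Type*} [CStarAlgebra B] [Nontrivial B] {a c : B}
    (h : QSU2Relations q a c) : ‖a‖ ≤ 1 ∧ ‖c‖ ≤ 1 := by
  let _ : PartialOrder B := CStarAlgebra.spectralOrder B
  have _ : StarOrderedRing B := CStarAlgebra.spectralOrderedRing B
  have key : ∀ x y : B, star x * x + star y * y = 1 → ‖x‖ ≤ 1 := by
    intro x y hxy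
    have h1 : star x * x ≤ 1 := by
      rw [← hxy]
      exact le_add_of_nonneg_right (star_mul_self_nonneg y)
    have h2 : ‖star x * x‖ ≤ ‖(1 : B)‖ :=
      CStarAlgebra.norm_le_norm_of_nonneg_of_le (star_mul_self_nonneg x) h1
    rw [CStarRing.norm_star_mul_self, norm_one] at h2
    nlinarith [norm_nonneg x]
  exact ⟨key a c h.star_mul, key c a (by rw [add_comm]; exact h.star_mul)⟩

/-- The tuple of all `a`'s. -/
def QSU2Product.a (q : ℝ) : QSU2Product q :=
  ⟨fun i => i.a, memℓp_infty ⟨1, by rintro _ ⟨i, rfl⟩; exact i.rel.norm_le.1⟩⟩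

/-- The tuple of all `c`'s. -/
def QSU2Product.c (q : ℝ) : QSU2Product q :=
  ⟨fun i => i.c, memℓp_infty ⟨1, by rintro _ ⟨i, rfl⟩; exact i.rel.norm_le.2⟩⟩

/-- The closed unital ⋆-subalgebra generated by the two universal tuples. -/
def QSU2Sub (q : ℝ) : StarSubalgebra ℂ (QSU2Product q) :=
  (StarAlgebra.adjoin ℂ {QSU2Product.a q, QSU2Product.c q}).topologicalClosure

instance (q : ℝ) : IsClosed (QSU2Sub q : Set (QSU2Product q)) :=
  StarSubalgebra.isClosed_topologicalClosure _

/-- The C⋆-algebra `A_q(SU(2))`: the universal unital C⋆-algebra generated by two elements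
`α`, `γ` subject to `QSU2Relations`. See `QSU2.relations` and `QSU2.universal`. -/
def QSU2 (q : ℝ) : Type 1 := QSU2Sub q

instance (q : ℝ) : CStarAlgebra (QSU2 q) := inferInstanceAs (CStarAlgebra (QSU2Sub q))

namespace QSU2

/-- The generator `α`. -/
def α (q : ℝ) : QSU2 q :=
  (⟨QSU2Product.a q, StarSubalgebra.le_topologicalClosure _
    (StarAlgebra.subset_adjoin ℂ _ (by simp))⟩ : QSU2Sub q)

/-- The generator `γ`. -/
def γ (q : ℝ) : QSU2 q :=
  (⟨QSU2Product.c q, StarSubalgebra.le_topologicalClosure _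
    (StarAlgebra.subset_adjoin ℂ _ (by simp))⟩ : QSU2Sub q)

/-- The generators satisfy the relations. -/
theorem relations (q : ℝ) : QSU2Relations q (α q) (γ q) where
  comm := Subtype.ext (Subtype.ext (funext fun i => i.rel.comm))
  comm_star := Subtype.ext (Subtype.ext (funext fun i => i.rel.comm_star))
  normal := Subtype.ext (Subtype.ext (funext fun i => i.rel.normal))
  star_mul := Subtype.ext (Subtype.ext (funext fun i => i.rel.star_mul))
  mul_star := Subtype.ext (Subtype.ext (funext fun i => i.rel.mul_star))

/-- Evaluation at one pair. -/
def eval {q : ℝ} (i : QSU2Pair q) : QSU2 q →⋆ₐ[ℂ] i.B where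
  toFun x := (x : QSU2Sub q).1.1 i
  map_one' := rfl
  map_mul' _ _ := rfl
  map_zero' := rfl
  map_add' _ _ := rfl
  commutes' _ := rfl
  map_star' _ := rfl

/-- The universal property of `A_q(SU(2))`. -/
theorem universal (q : ℝ) (B : Type) [CStarAlgebra B] (a c : B)
    (h : QSU2Relations q a c) :
    ∃! π : QSU2 q →⋆ₐ[ℂ] B, π (α q) = a ∧ π (γ q) = c := by
  rcases subsingleton_or_nontrivial B with hB | hB
  · refine ⟨{ toFun := fun _ => 0, map_one' := Subsingleton.elim _ _,
              map_mul' := fun _ _ => Subsingleton.elim _ _, map_zero' := rfl,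
              map_add' := fun _ _ => Subsingleton.elim _ _,
              commutes' := fun _ => Subsingleton.elim _ _,
              map_star' := fun _ => Subsingleton.elim _ _ },
      ⟨Subsingleton.elim _ _, Subsingleton.elim _ _⟩, fun π _ => ?_⟩
    ext x
    exact Subsingleton.elim _ _
  · refine ⟨eval ⟨B, a, c, h⟩, ⟨rfl, rfl⟩, ?_⟩
    rintro π ⟨hπa, hπc⟩
    have hb : ∀ f : QSU2 q →⋆ₐ[ℂ] B, Continuous f := fun f =>
      AddMonoidHomClass.continuous_of_bound f 1 fun x => by
        simpa only [one_mul] using NonUnitalStarAlgHom.norm_apply_le f x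
    refine StarAlgHom.ext_topologicalClosure
      (S := StarAlgebra.adjoin ℂ {QSU2Product.a q, QSU2Product.c q})
      (φ := (π : QSU2Sub q →⋆ₐ[ℂ] B)) (ψ := eval (⟨B, a, c, h⟩ : QSU2Pair q)) (hb π) (hb _) ?_
    refine StarAlgHom.ext_adjoin ?_
    rintro ⟨x, hx⟩ hx'
    rcases hx' with hx' | hx'
    · obtain rfl : x = QSU2Product.a q := hx'
      exact hπa
    · obtain rfl : x = QSU2Product.c q := hx'
      exact hπc

/-! ### The Haar functional -/

/-- Names for the generators `α, α⋆, γ, γ⋆`. -/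
inductive Gen
  | alpha
  | alphaStar
  | gamma
  | gammaStar

/-- The value in `A_q(SU(2))` of a noncommutative polynomial in `α, α⋆, γ, γ⋆`. The values form
a dense ⋆-subalgebra. -/
def value (q : ℝ) : FreeAlgebra ℂ Gen →ₐ[ℂ] QSU2 q :=
  FreeAlgebra.lift ℂ fun
    | .alpha => α q
    | .alphaStar => star (α q)
    | .gamma => γ q
    | .gammaStar => star (γ q)

/-- The comultiplication `Δ` on noncommutative polynomials in the generators, determined by
`Δ α = α ⊗ α - q γ⋆ ⊗ γ`, `Δ γ = γ ⊗ α + α⋆ ⊗ γ`, and by being a unital ⋆-homomorphism.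
On polynomials it takes values in the algebraic tensor product. -/
def comul (q : ℝ) : FreeAlgebra ℂ Gen →ₐ[ℂ] QSU2 q ⊗[ℂ] QSU2 q :=
  FreeAlgebra.lift ℂ fun
    | .alpha => α q ⊗ₜ[ℂ] α q - (q : ℂ) • (star (γ q) ⊗ₜ[ℂ] γ q)
    | .alphaStar => star (α q) ⊗ₜ[ℂ] star (α q) - (q : ℂ) • (γ q ⊗ₜ[ℂ] star (γ q))
    | .gamma => γ q ⊗ₜ[ℂ] α q + star (α q) ⊗ₜ[ℂ] γ q
    | .gammaStar => star (γ q) ⊗ₜ[ℂ] star (α q) + α q ⊗ₜ[ℂ] star (γ q)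

/-- `h` is the Haar functional of the quantum `SU(2)` group: a bounded linear functional with
`h 1 = 1` and `(id ⊗ h) (Δ x) = h x • 1 = (h ⊗ id) (Δ x)`. By continuity it is the same
to require the invariance on the dense ⋆-subalgebra of polynomials in the generators. -/
structure IsHaarFunctional {q : ℝ} (h : QSU2 q →L[ℂ] ℂ) : Prop where
  map_one : h 1 = 1
  right_inv : ∀ w : FreeAlgebra ℂ Gen,
    TensorProduct.rid ℂ (QSU2 q) ((h : QSU2 q →ₗ[ℂ] ℂ).lTensor (QSU2 q) (comul q w)) =
      h (value q w) • (1 : QSU2 q)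
  left_inv : ∀ w : FreeAlgebra ℂ Gen,
    TensorProduct.lid ℂ (QSU2 q) ((h : QSU2 q →ₗ[ℂ] ℂ).rTensor (QSU2 q) (comul q w)) =
      h (value q w) • (1 : QSU2 q)

/-! ### The spherical element -/

/-- The coefficient `q^{-s} - q^s`. -/
def qDiff (q s : ℝ) : ℝ := q ^ (-s) - q ^ s

/-- The element `ρ_{τ,σ}` of `A_q(SU(2))`. -/
def rho (q τ σ : ℝ) : QSU2 q :=
  (1 / 2 : ℂ) • (α q ^ 2 + star (α q) ^ 2 + (q : ℂ) • γ q ^ 2 + (q : ℂ) • star (γ q) ^ 2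
    + (Complex.I * q * qDiff q σ) • (star (α q) * γ q - star (γ q) * α q)
    - (Complex.I * q * qDiff q τ) • (γ q * α q - star (α q) * star (γ q))
    - ((q : ℂ) * qDiff q σ * qDiff q τ) • (star (γ q) * γ q))

theorem rho_isSelfAdjoint (q τ σ : ℝ) : IsSelfAdjoint (rho q τ σ) := by
  unfold IsSelfAdjoint rho
  simp only [star_smul, star_add, star_sub, star_mul, star_pow, star_star, Complex.star_def,
    Complex.conj_I, Complex.conj_ofReal, map_div₀, map_one, map_ofNat]
  congr 1
  module

end QSU2

/-! ### Al-Salam–Chihara polynomials, their Poisson kernel and orthogonality measure -/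

/-- The `q`-shifted factorial `(a; q)_k`. -/
def qPoch {R : Type*} [CommRing R] (a q : R) (k : ℕ) : R :=
  ∏ i ∈ Finset.range k, (1 - a * q ^ i)

/-- The `q`-shifted factorial `(a; q)_∞`. -/
def qPochInf {R : Type*} [CommRing R] [TopologicalSpace R] (a q : R) : R :=
  ∏' i : ℕ, (1 - a * q ^ i)

namespace AlSalamChihara

/-- The Al-Salam–Chihara polynomial
`p_n(x; a, b | q) = a^{-n} (ab; q)_n ₃φ₂(q^{-n}, a e^{iθ}, a e^{-iθ}; ab, 0; q, q)`, `x = cos θ`,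
where `(a e^{iθ}, a e^{-iθ}; q)_k = ∏_{i<k} (1 - 2 a x q^i + a² q^{2i})`. -/
def poly (n : ℕ) (x a b q : ℝ) : ℝ :=
  a⁻¹ ^ n * qPoch (a * b) q n *
    ∑ k ∈ Finset.range (n + 1),
      qPoch (q⁻¹ ^ n) q k * (∏ i ∈ Finset.range k, (1 - 2 * a * x * q ^ i + a ^ 2 * q ^ (2 * i)))
        / (qPoch q q k * qPoch (a * b) q k) * q ^ k

/-- The general term of the Poisson kernel. -/
def poissonTerm (t x y a b q : ℝ) (k : ℕ) : ℝ :=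
  t ^ k * (poly k x a b q * poly k y a b q / (qPoch q q k * qPoch (a * b) q k))

/-- The Poisson kernel `P_t(x, y; a, b | q)`. -/
def poisson (t x y a b q : ℝ) : ℝ := ∑' k : ℕ, poissonTerm t x y a b q k

/-- The total mass `h₀(a, b, 0, 0 | q) = 1 / (q, ab; q)_∞`. -/
def h₀ (a b q : ℝ) : ℝ := 1 / (qPochInf q q * qPochInf (a * b) q)

/-- The weight `w(cos θ; a, b, 0, 0 | q)`; the quotient is a real number for real `a, b, q`. -/
def weight (θ a b q : ℝ) : ℝ :=
  (qPochInf (Complex.exp (2 * Complex.I * θ)) (q : ℂ) *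
      qPochInf (Complex.exp (-(2 * Complex.I * θ))) (q : ℂ) /
    (qPochInf (a * Complex.exp (Complex.I * θ)) (q : ℂ) *
      qPochInf (a * Complex.exp (-(Complex.I * θ))) (q : ℂ) *
      qPochInf (b * Complex.exp (Complex.I * θ)) (q : ℂ) *
      qPochInf (b * Complex.exp (-(Complex.I * θ))) (q : ℂ))).re

/-- The unnormalised mass `w_k(a; b, 0, 0 | q)` at `(a q^k + a^{-1} q^{-k}) / 2`: the limit for
`c, d → 0` of the mass for the Askey–Wilson measure. -/
def mass (k : ℕ) (a b q : ℝ) : ℝ :=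
  qPochInf (a ^ 2)⁻¹ q / (qPochInf q q * qPochInf (a * b) q * qPochInf (b / a) q)
    * ((1 - a ^ 2 * q ^ (2 * k)) / (1 - a ^ 2))
    * (qPoch (a ^ 2) q k * qPoch (a * b) q k / (qPoch q q k * qPoch (a * q / b) q k))
    / ((a ^ 3 * b) ^ k * q ^ (k ^ 2))

open Classical in
/-- The discrete part of the orthogonality measure that comes from the parameter `a`:
mass points at `(a q^k + a^{-1} q^{-k}) / 2` for all `k` with `|a q^k| > 1`. -/
def discretePart (a b q : ℝ) : MeasureTheory.Measure ℝ :=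
  MeasureTheory.Measure.sum fun k : ℕ =>
    if 1 < |a * q ^ k| then
      ENNReal.ofReal (mass k a b q / h₀ a b q) •
        MeasureTheory.Measure.dirac ((a * q ^ k + (a * q ^ k)⁻¹) / 2)
    else 0

/-- The normalised orthogonality measure `dm(x; a, b, 0, 0 | q)` for the Al-Salam–Chihara
polynomials (`a, b` nonzero real, `ab < 1`). -/
def measure (a b q : ℝ) : MeasureTheory.Measure ℝ :=
  (((MeasureTheory.volume.restrict (Set.Ioo 0 Real.pi)).withDensity fun θ =>
      ENNReal.ofReal (weight θ a b q / (2 * Real.pi * h₀ a b q))).map Real.cos)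
    + discretePart a b q + discretePart b a q

end AlSalamChihara

/-- `dm₁(x) = dm(x; q^{1+σ-τ}, -q^{1-σ-τ}, 0, 0 | q²)`. -/
def dm₁ (q τ σ : ℝ) : MeasureTheory.Measure ℝ :=
  AlSalamChihara.measure (q ^ (1 + σ - τ)) (-q ^ (1 - σ - τ)) (q ^ 2)

/-- `dm₂(x) = dm(x; q^{1-σ+τ}, -q^{1+σ+τ}, 0, 0 | q²)`. -/
def dm₂ (q τ σ : ℝ) : MeasureTheory.Measure ℝ :=
  AlSalamChihara.measure (q ^ (1 - σ + τ)) (-q ^ (1 + σ + τ)) (q ^ 2)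

end

/-! Put r = q² and d = q^(-τ) - q^τ. The argument has three strands: an algebraic trace formula for
the Haar functional on powers of ρ, the orthogonality of the Al-Salam–Chihara polynomials, and a
control of the kernel of one representation, which gives the spectrum.

Trace formula. The element splits as ρ = S + S' + μT, where μ = q(q^(-σ) - q^σ)/2, ST = rTS, TS' =
rS'T, and S'S and SS' are quadratic polynomials in T (`rho_eq`, `QRel.ladderRel`). Weighted shifts
on finitely supported sequences obey the same relations, with T acting as l r^k on the k-th basis
vector, as soon as l² + dl = 1, that is for l = -q^(-τ) and l = q^τ (`ladderRel_model`). In these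
two models S + S' + μT is the Jacobi operator of the polynomials with the parameters of dm₁ and dm₂.
A Haar functional is invariant under α ↦ zα, γ ↦ zγ and annihilates the image of a twisted
derivation (`IsHaarFunctional.isHaarLike`). Rotation invariance kills the normally ordered monomials
that contain S or S'; the derivation gives a recurrence for the moments of T, which the two roots l
solve. Hence h(ρ^n) is a sum over k of (1 - r) r^k times the k-th diagonal entries of the n-th
powers of the two Jacobi operators, weighted by 1/(1 + q^(2τ)) and 1/(1 + q^(-2τ))
(`IsHaarLike.hasSum_pow`). By orthogonality such an entry is the integral of x^n against a squared
normalised polynomial, and summing over k produces the Poisson kernel at t = r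
(`IsHaarLike.map_rho_pow`). Weierstrass approximation passes from powers to continuous functions.

Orthogonality. The three-term recurrence reduces it to showing that the measure has mass one and
that polynomials of positive degree integrate to zero (`gram_eq_of_recurrence`). Multiplication by 1
- 2ax + a² carries the measure for a to a multiple of the one for aq (`measure_withDensity`). Inside
the unit disc a contour shift, the limit a → 0 and the iteration q ↦ q² compute the mass. Parameters
outside are reached one power of q at a time; each step adds one atom, and the q-binomial theorem
shows that its weight is the right one (`isNormalized_of_shift`).

Spectrum. The spectral claim must not presuppose a Haar functional. A functional `haar` on ℓ²(ℕ × ℤ)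
is written down and shown to have the two invariance properties, so the integration formula holds
for it. Positivity of the formula gives one inclusion. For the other, a function of ρ that vanishes
on the supports lies in the kernel of the representation. Since γ*γ has a spectral gap between q²
and 1, a vacuum projection exists, and with it one finds xγ = 0 for every x in the kernel
(`mul_gamma_eq_zero`). There ρ acts as (α² + α*²)/2, of norm at most one, so no spectrum outside
[-1, 1] can hide in the kernel, while [-1, 1] itself lies in the supports. -/

noncomputable section

/-! ### Infinite `q`-shifted factorials -/

section QPochInf

open Filter Topology

variable {𝕜 : Type*} [RCLike 𝕜]

theorem qPoch_zero {R : Type*} [CommRing R] (a q : R) : qPoch a q 0 = 1 := by simp [qPoch]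

theorem qPoch_succ {R : Type*} [CommRing R] (a q : R) (n : ℕ) :
    qPoch a q (n + 1) = qPoch a q n * (1 - a * q ^ n) := by
  simp [qPoch, Finset.prod_range_succ]

theorem qPoch_succ' {R : Type*} [CommRing R] (a q : R) (n : ℕ) :
    qPoch a q (n + 1) = (1 - a) * qPoch (a * q) q n := by
  simp only [qPoch, Finset.prod_range_succ', pow_zero, mul_one]
  rw [mul_comm]
  congr 1
  exact Finset.prod_congr rfl fun i _ => by ring

theorem summable_norm_qPoch (a : 𝕜) {q : 𝕜} (hq : ‖q‖ < 1) :
    Summable fun i : ℕ => ‖-(a * q ^ i)‖ := by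
  simp only [norm_neg, norm_mul, norm_pow]
  exact (summable_geometric_of_lt_one (norm_nonneg _) hq).mul_left _

theorem qPochInf_eq (a q : 𝕜) : qPochInf a q = ∏' i : ℕ, (1 + -(a * q ^ i)) := by
  simp [qPochInf, sub_eq_add_neg]

theorem hasProd_qPochInf (a : 𝕜) {q : 𝕜} (hq : ‖q‖ < 1) :
    HasProd (fun i : ℕ => 1 - a * q ^ i) (qPochInf a q) := by
  have := (multipliable_one_add_of_summable (summable_norm_qPoch a hq)).hasProd
  simpa only [qPochInf, ← sub_eq_add_neg] using this

theorem tendsto_qPoch (a : 𝕜) {q : 𝕜} (hq : ‖q‖ < 1) :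
    Tendsto (qPoch a q) atTop (𝓝 (qPochInf a q)) :=
  (hasProd_qPochInf a hq).tendsto_prod_nat

theorem qPochInf_shift (a : 𝕜) {q : 𝕜} (hq : ‖q‖ < 1) :
    qPochInf a q = (1 - a) * qPochInf (a * q) q := by
  have h1 := (tendsto_qPoch a hq).comp (tendsto_add_atTop_nat 1)
  have h2 := (tendsto_qPoch (a * q) hq).const_mul (1 - a)
  refine tendsto_nhds_unique h1 (h2.congr fun n => ?_)
  simp [qPoch_succ']

/-- The bound involves only the norms of a and q. It is therefore uniform on circles and survives
the limit in which the base itself tends to 0, which is how the weight integral gets evaluated. -/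
theorem norm_qPochInf_sub_one_le (a : 𝕜) {q : 𝕜} (hq : ‖q‖ < 1) :
    ‖qPochInf a q - 1‖ ≤ Real.exp (‖a‖ / (1 - ‖q‖)) - 1 := by
  refine le_of_tendsto ((tendsto_qPoch a hq).sub_const 1).norm (Eventually.of_forall fun n => ?_)
  have := Finset.norm_prod_one_add_sub_one_le (Finset.range n) (fun i => -(a * q ^ i))
  simp only [← sub_eq_add_neg] at this
  refine this.trans (sub_le_sub_right (Real.exp_le_exp.2 ?_) 1)
  have hs := (summable_norm_qPoch a hq).sum_le_tsum (Finset.range n) (fun i _ => norm_nonneg _)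
  refine hs.trans (le_of_eq ?_)
  simp only [norm_neg, norm_mul, norm_pow]
  rw [tsum_mul_left, tsum_geometric_of_lt_one (norm_nonneg _) hq, div_eq_mul_inv]

theorem qPochInf_ne_zero {a q : 𝕜} (hq : ‖q‖ < 1) (h : ∀ i : ℕ, a * q ^ i ≠ 1) :
    qPochInf a q ≠ 0 := by
  rw [qPochInf_eq]
  refine tprod_one_add_ne_zero_of_summable (fun i => ?_) (summable_norm_qPoch a hq)
  rw [← sub_eq_add_neg]
  exact sub_ne_zero.2 (h i).symm

theorem ofReal_qPochInf (a : ℝ) {q : ℝ} (hq : ‖q‖ < 1) :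
    ((qPochInf a q : ℝ) : ℂ) = qPochInf (a : ℂ) (q : ℂ) := by
  have h1 := (Complex.continuous_ofReal.tendsto _).comp (tendsto_qPoch a hq)
  have h2 := tendsto_qPoch (a : ℂ) (q := (q : ℂ)) (by simpa using hq)
  exact tendsto_nhds_unique h1 (h2.congr fun n => by simp [qPoch])

theorem conj_qPochInf (a : ℂ) {q : ℝ} (hq : ‖q‖ < 1) :
    starRingEnd ℂ (qPochInf a (q : ℂ)) = qPochInf (starRingEnd ℂ a) (q : ℂ) := by
  have hq' : ‖(q : ℂ)‖ < 1 := by simpa using hq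
  have h1 := (Complex.continuous_conj.tendsto _).comp (tendsto_qPoch a hq')
  have h2 := tendsto_qPoch (starRingEnd ℂ a) hq'
  exact tendsto_nhds_unique h1 (h2.congr fun n => by simp [qPoch])

theorem norm_qPochInf_le (z : ℂ) {q : ℝ} (hq0 : 0 ≤ q) (hq : q < 1) :
    ‖qPochInf z (q : ℂ)‖ ≤ qPochInf (-‖z‖) q := by
  have hq' : ‖q‖ < 1 := by rwa [Real.norm_of_nonneg hq0]
  have h1 := (tendsto_qPoch z (q := (q : ℂ)) (by simpa using hq')).norm
  have h2 := tendsto_qPoch (-‖z‖) hq'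
  refine le_of_tendsto_of_tendsto' h1 h2 fun n => ?_
  rw [qPoch, qPoch, norm_prod]
  refine Finset.prod_le_prod (fun _ _ => norm_nonneg _) fun i _ => ?_
  refine (norm_sub_le _ _).trans (le_of_eq ?_)
  simp [abs_of_nonneg hq0]

theorem le_norm_qPochInf {z : ℂ} {q : ℝ} (hq0 : 0 ≤ q) (hq : q < 1) {s : ℝ} (hs : s ≤ 1)
    (hz : ‖z‖ ≤ s) : qPochInf s q ≤ ‖qPochInf z (q : ℂ)‖ := by
  have hq' : ‖q‖ < 1 := by rwa [Real.norm_of_nonneg hq0]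
  have h1 := (tendsto_qPoch z (q := (q : ℂ)) (by simpa using hq')).norm
  have h2 := tendsto_qPoch s hq'
  refine le_of_tendsto_of_tendsto' h2 h1 fun n => ?_
  rw [qPoch, qPoch, norm_prod]
  have hs0 : 0 ≤ s := (norm_nonneg z).trans hz
  refine Finset.prod_le_prod (fun i _ => ?_) fun i _ => ?_
  · have : q ^ i ≤ 1 := pow_le_one₀ hq0 hq.le
    have : s * q ^ i ≤ 1 := mul_le_one₀ hs (by positivity) this
    linarith
  · have h3 := norm_sub_norm_le (1 : ℂ) (z * (q : ℂ) ^ i)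
    have h4 : ‖z * (q : ℂ) ^ i‖ ≤ s * q ^ i := by
      rw [norm_mul, norm_pow, Complex.norm_real, Real.norm_of_nonneg hq0]
      gcongr
    rw [norm_one] at h3
    linarith

theorem qPoch_pos {a q : ℝ} (hq0 : 0 ≤ q) (hq : q ≤ 1) (ha : a < 1) (n : ℕ) :
    0 < qPoch a q n := by
  refine Finset.prod_pos fun i _ => ?_
  have h1 : q ^ i ≤ 1 := pow_le_one₀ hq0 hq
  have h2 : 0 ≤ q ^ i := by positivity
  nlinarith [mul_le_mul_of_nonneg_right ha.le h2]

theorem qPochInf_pos {a q : ℝ} (hq0 : 0 ≤ q) (hq : q < 1) (ha : a < 1) : 0 < qPochInf a q := by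
  have hq' : ‖q‖ < 1 := by rwa [Real.norm_of_nonneg hq0]
  have h0 : 0 ≤ qPochInf a q :=
    ge_of_tendsto' (tendsto_qPoch a hq') fun n => (qPoch_pos hq0 hq.le ha n).le
  refine lt_of_le_of_ne h0 (Ne.symm (qPochInf_ne_zero hq' fun i => ?_))
  have h1 : q ^ i ≤ 1 := pow_le_one₀ hq0 hq.le
  have h2 : 0 ≤ q ^ i := by positivity
  nlinarith [mul_le_mul_of_nonneg_right ha.le h2]

theorem qPoch_self_pos {q : ℝ} (hq0 : 0 ≤ q) (hq : q < 1) (n : ℕ) : 0 < qPoch q q n :=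
  qPoch_pos hq0 hq.le hq n

theorem qPochInf_self_le_qPoch {q : ℝ} (hq0 : 0 ≤ q) (hq : q < 1) (n : ℕ) :
    qPochInf q q ≤ qPoch q q n := by
  have hq' : ‖q‖ < 1 := by rwa [Real.norm_of_nonneg hq0]
  have hanti : Antitone (qPoch q q) := antitone_nat_of_succ_le fun n => by
    rw [qPoch_succ]
    have := qPoch_self_pos hq0 hq n
    have h2 : 0 ≤ q * q ^ n := by positivity
    nlinarith
  exact hanti.le_of_tendsto (tendsto_qPoch q hq') n

theorem qPoch_self_le_one {q : ℝ} (hq0 : 0 ≤ q) (hq : q < 1) (n : ℕ) : qPoch q q n ≤ 1 := by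
  refine Finset.prod_le_one (fun i _ => ?_) fun i _ => ?_
  · have : q * q ^ i ≤ 1 := mul_le_one₀ hq.le (by positivity) (pow_le_one₀ hq0 hq.le)
    linarith
  · have : 0 ≤ q * q ^ i := by positivity
    linarith

theorem one_le_qPoch_of_nonpos {a q : ℝ} (hq0 : 0 ≤ q) (ha : a ≤ 0) (n : ℕ) :
    1 ≤ qPoch a q n := by
  induction n with
  | zero => simp [qPoch_zero]
  | succ n ih =>
    rw [qPoch_succ]
    have : a * q ^ n ≤ 0 := mul_nonpos_of_nonpos_of_nonneg ha (by positivity)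
    nlinarith

theorem qPoch_le_qPochInf_of_nonpos {a q : ℝ} (hq0 : 0 ≤ q) (hq : q < 1) (ha : a ≤ 0) (n : ℕ) :
    qPoch a q n ≤ qPochInf a q := by
  have hq' : ‖q‖ < 1 := by rwa [Real.norm_of_nonneg hq0]
  have hmono : Monotone (qPoch a q) := monotone_nat_of_le_succ fun n => by
    rw [qPoch_succ]
    have := one_le_qPoch_of_nonpos hq0 ha n
    have h2 : a * q ^ n ≤ 0 := mul_nonpos_of_nonpos_of_nonneg ha (by positivity)
    nlinarith
  exact hmono.ge_of_tendsto (tendsto_qPoch a hq') n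

/-- A locally uniform limit of polynomials. Holomorphy in the first argument is what permits the
contour shift. -/
theorem differentiable_qPochInf {q : ℂ} (hq : ‖q‖ < 1) :
    Differentiable ℂ fun z : ℂ => qPochInf z q := by
  intro z
  have hlu : TendstoLocallyUniformlyOn (fun n (z : ℂ) => qPoch z q n) (fun z => qPochInf z q)
      atTop (Metric.ball 0 (‖z‖ + 1)) := by
    have h := Summable.hasProdLocallyUniformlyOn_nat_one_add (R := ℂ)
      (f := fun (i : ℕ) (z : ℂ) => -(z * q ^ i)) (K := Metric.ball (0 : ℂ) (‖z‖ + 1))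
      Metric.isOpen_ball (u := fun i => (‖z‖ + 1) * ‖q‖ ^ i)
      ((summable_geometric_of_lt_one (norm_nonneg _) hq).mul_left _)
      (Eventually.of_forall fun n x hx => by
        rw [norm_neg, norm_mul, norm_pow]
        have : ‖x‖ ≤ ‖z‖ + 1 := (mem_ball_zero_iff.1 hx).le
        gcongr) (fun n => by fun_prop)
    have h2 := h.tendstoLocallyUniformlyOn_finsetRange
    simpa only [qPochInf, qPoch, sub_eq_add_neg] using h2
  have hd := hlu.differentiableOn (Eventually.of_forall fun n => by
    unfold qPoch
    fun_prop) Metric.isOpen_ball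
  exact hd.differentiableAt (Metric.isOpen_ball.mem_nhds (by simp))

theorem continuous_qPochInf {q : ℂ} (hq : ‖q‖ < 1) : Continuous fun z : ℂ => qPochInf z q :=
  (differentiable_qPochInf hq).continuous

theorem continuous_qPochInf_real {q : ℝ} (hq : ‖q‖ < 1) : Continuous fun z : ℝ => qPochInf z q := by
  have h := Complex.continuous_re.comp
    ((continuous_qPochInf (q := (q : ℂ)) (by simpa using hq)).comp Complex.continuous_ofReal)
  refine h.congr fun z => ?_
  simp only [Function.comp, ← ofReal_qPochInf z hq, Complex.ofReal_re]

theorem qPochInf_zero (q : 𝕜) : qPochInf 0 q = 1 := by simp [qPochInf]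

/-- The `q`-binomial theorem. -/
theorem tsum_qBinomial {a x q : ℝ} (hq0 : 0 ≤ q) (hq : q < 1) (ha : a ≤ 0) (hx : |x| < 1) :
    HasSum (fun n : ℕ => x ^ n * qPoch a q n / qPoch q q n) (qPochInf (a * x) q / qPochInf x q) := by
  have hq' : ‖q‖ < 1 := by rwa [Real.norm_of_nonneg hq0]
  set c : ℕ → ℝ := fun n => qPoch a q n / qPoch q q n with hc
  set C := qPochInf a q / qPochInf q q with hC
  have hcC : ∀ n, |c n| ≤ C := fun n => by
    have h1 := one_le_qPoch_of_nonpos hq0 ha n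
    have h2 := qPoch_self_pos hq0 hq n
    rw [hc, hC, abs_of_nonneg (by positivity)]
    have := qPochInf_pos hq0 hq hq
    exact div_le_div₀ (by linarith [qPoch_le_qPochInf_of_nonpos hq0 hq ha n])
      (qPoch_le_qPochInf_of_nonpos hq0 hq ha n) this (qPochInf_self_le_qPoch hq0 hq n)
  have hsum : ∀ y : ℝ, |y| < 1 → Summable fun n => c n * y ^ n := fun y hy => by
    refine Summable.of_norm_bounded ((summable_geometric_of_lt_one (abs_nonneg y) hy).mul_left C)
      fun n => ?_
    rw [norm_mul, norm_pow, Real.norm_eq_abs, Real.norm_eq_abs]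
    gcongr
    exact hcC n
  set f : ℝ → ℝ := fun y => ∑' n, c n * y ^ n with hf
  -- This is the coefficient recursion (1 - q^(n+1)) c_(n+1) = (1 - a q^n) c_n in the language of
  -- generating functions.
  have hfe : ∀ y : ℝ, |y| < 1 → (1 - y) * f y = (1 - a * y) * f (q * y) := fun y hy => by
    have hqy : |q * y| < 1 := by
      rw [abs_mul, abs_of_nonneg hq0]
      nlinarith [abs_nonneg y]
    have h1 := (hsum y hy).hasSum
    have h2 := (hsum _ hqy).hasSum
    have h3 : HasSum (fun n => c (n + 1) * y ^ (n + 1)) (f y - 1) := by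
      have := (hasSum_nat_add_iff' 1).2 h1
      simpa [hc, qPoch_zero] using this
    have h4 : HasSum (fun n => c (n + 1) * (q * y) ^ (n + 1)) (f (q * y) - 1) := by
      have := (hasSum_nat_add_iff' 1).2 h2
      simpa [hc, qPoch_zero] using this
    have h5 := h3.sub h4
    have h6 := (h1.mul_left y).sub (h2.mul_left (a * y))
    have h7 : (fun n => c (n + 1) * y ^ (n + 1) - c (n + 1) * (q * y) ^ (n + 1)) =
        fun n => y * (c n * y ^ n) - a * y * (c n * (q * y) ^ n) := by
      funext n
      have hn := (qPoch_self_pos hq0 hq n).ne'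
      have hn1 := (qPoch_self_pos hq0 hq (n + 1)).ne'
      rw [qPoch_succ] at hn1
      have hn2 : 1 - q * q ^ n ≠ 0 := right_ne_zero_of_mul hn1
      have hn3 : 1 - q ^ (n + 1) ≠ 0 := by rwa [pow_succ']
      simp only [hc, qPoch_succ, ← pow_succ']
      field_simp
      ring
    rw [h7] at h5
    have := h5.unique h6
    linarith
  have hcont : ContinuousAt f 0 := by
    have : ContinuousOn f (Metric.closedBall 0 (1 / 2)) := by
      refine continuousOn_tsum (u := fun n => C * (1 / 2) ^ n) (fun n => by fun_prop)
        ((summable_geometric_of_lt_one (by norm_num) (by norm_num)).mul_left C) fun n y hy => ?_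
      rw [norm_mul, norm_pow, Real.norm_eq_abs]
      have : ‖y‖ ≤ 1 / 2 := by simpa using hy
      gcongr
      · exact (abs_nonneg _).trans (hcC 0)
      · exact hcC n
    exact this.continuousAt (Metric.closedBall_mem_nhds _ (by norm_num))
  have hf0 : f 0 = 1 := by
    simp only [hf]
    rw [tsum_eq_single 0 (fun n hn => by simp [hn])]
    simp [hc, qPoch_zero]
  -- Iterating the functional equation pushes the argument to q^n x → 0, where f is continuous with
  -- value 1.
  have hiter : ∀ n : ℕ, qPoch x q n * f x = qPoch (a * x) q n * f (q ^ n * x) := fun n => by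
    induction n with
    | zero => simp [qPoch_zero]
    | succ n ih =>
      have hqn : |q ^ n * x| < 1 := by
        rw [abs_mul, abs_of_nonneg (by positivity)]
        have : q ^ n ≤ 1 := pow_le_one₀ hq0 hq.le
        nlinarith [abs_nonneg x]
      have h1 := hfe _ hqn
      rw [qPoch_succ, qPoch_succ, mul_right_comm, ih]
      have : q * (q ^ n * x) = q ^ (n + 1) * x := by ring
      rw [this] at h1
      linear_combination (qPoch (a * x) q n) * h1
  have hlim : Tendsto (fun n : ℕ => f (q ^ n * x)) atTop (𝓝 1) := by
    rw [← hf0]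
    refine hcont.tendsto.comp ?_
    simpa using (tendsto_pow_atTop_nhds_zero_of_lt_one hq0 hq).mul_const x
  have hfin := tendsto_nhds_unique (((tendsto_qPoch x hq').mul_const (f x)).congr hiter)
    ((tendsto_qPoch (a * x) hq').mul hlim)
  have hxne : qPochInf x q ≠ 0 := (qPochInf_pos hq0 hq (abs_lt.1 hx).2).ne'
  have hfx : f x = qPochInf (a * x) q / qPochInf x q := by
    rw [eq_div_iff hxne]
    linarith
  rw [← hfx]
  have hfun : (fun n : ℕ => x ^ n * qPoch a q n / qPoch q q n) = fun n => c n * x ^ n := by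
    funext n
    simp only [hc]
    ring
  rw [hfun]
  exact (hsum x hx).hasSum

end QPochInf

/-! ### Al-Salam–Chihara polynomials through their recurrence -/

namespace AlSalamChihara

open Filter Topology

/-- The Al-Salam–Chihara polynomials, defined by their three-term recurrence. -/
def recPoly (x a b q : ℝ) : ℕ → ℝ
  | 0 => 1
  | 1 => 2 * x - (a + b)
  | n + 2 => (2 * x - (a + b) * q ^ (n + 1)) * recPoly x a b q (n + 1)
      - (1 - q ^ (n + 1)) * (1 - a * b * q ^ n) * recPoly x a b q n

theorem recPoly_zero (x a b q : ℝ) : recPoly x a b q 0 = 1 := rfl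

theorem recPoly_one (x a b q : ℝ) : recPoly x a b q 1 = 2 * x - (a + b) := rfl

theorem recPoly_add_two (x a b q : ℝ) (n : ℕ) : recPoly x a b q (n + 2) =
    (2 * x - (a + b) * q ^ (n + 1)) * recPoly x a b q (n + 1)
      - (1 - q ^ (n + 1)) * (1 - a * b * q ^ n) * recPoly x a b q n := rfl

theorem recPoly_comm (x a b q : ℝ) (n : ℕ) : recPoly x a b q n = recPoly x b a q n := by
  induction n using Nat.twoStepInduction with
  | zero => rfl
  | one => simp only [recPoly_one]; ring
  | more n h1 h2 => rw [recPoly_add_two, recPoly_add_two, h1, h2]; ring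

/-- The three-term recurrence, in the form `2 x P_n = …`; the last term vanishes for `n = 0`. -/
theorem two_mul_recPoly (x a b q : ℝ) (n : ℕ) : 2 * x * recPoly x a b q n =
    recPoly x a b q (n + 1) + (a + b) * q ^ n * recPoly x a b q n
      + (1 - q ^ n) * (1 - a * b * q ^ (n - 1 : ℕ)) * recPoly x a b q (n - 1) := by
  cases n with
  | zero => simp [recPoly_zero, recPoly_one]
  | succ n => rw [recPoly_add_two]; simp only [Nat.add_sub_cancel]; ring

/-- The connection relation between a and aq and the Christoffel relation for the factor 1 - 2ax +
a² need each other in the induction step, so they are proved together. -/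
theorem recPoly_contiguous_aux (x a b q : ℝ) (n : ℕ) :
    recPoly x a b q (n + 1) =
      recPoly x (a * q) b q (n + 1) - a * (1 - q ^ (n + 1)) * recPoly x (a * q) b q n ∧
    (1 - 2 * a * x + a ^ 2) * recPoly x (a * q) b q n =
      (1 - a * b * q ^ n) * recPoly x a b q n - a * recPoly x a b q (n + 1) := by
  induction n with
  | zero =>
    simp only [zero_add, recPoly_zero, recPoly_one, pow_zero, pow_one]
    constructor <;> ring
  | succ n ih =>
    obtain ⟨h1, h2⟩ := ih
    have h3 : (1 - 2 * a * x + a ^ 2) * recPoly x (a * q) b q (n + 1) =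
        (1 - a * b * q ^ (n + 1)) * recPoly x a b q (n + 1) - a * recPoly x a b q (n + 2) := by
      rw [recPoly_add_two]
      linear_combination (-(1 - 2 * a * x + a ^ 2)) * h1 + a * (1 - q ^ (n + 1)) * h2
    refine ⟨?_, h3⟩
    rw [recPoly_add_two, recPoly_add_two]
    linear_combination (2 * x - (a + b) * q ^ (n + 1) - a * (1 - q ^ (n + 1))) * h1
      + (1 - q ^ (n + 1)) * h2

theorem recPoly_contiguous (x a b q : ℝ) (n : ℕ) : recPoly x a b q (n + 1) =
    recPoly x (a * q) b q (n + 1) - a * (1 - q ^ (n + 1)) * recPoly x (a * q) b q n :=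
  (recPoly_contiguous_aux x a b q n).1

theorem recPoly_christoffel (x a b q : ℝ) (n : ℕ) :
    (1 - 2 * a * x + a ^ 2) * recPoly x (a * q) b q n =
      (1 - a * b * q ^ n) * recPoly x a b q n - a * recPoly x a b q (n + 1) :=
  (recPoly_contiguous_aux x a b q n).2

/-- The value at the point `(a + a⁻¹) / 2`. -/
theorem recPoly_special {x a q : ℝ} (b : ℝ) (ha : a ≠ 0) (hx : 1 - 2 * a * x + a ^ 2 = 0) (n : ℕ) :
    recPoly x a b q n = a⁻¹ ^ n * qPoch (a * b) q n := by
  induction n with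
  | zero => simp [recPoly_zero, qPoch_zero]
  | succ n ih =>
    have h := recPoly_christoffel x a b q n
    rw [hx, zero_mul] at h
    have h2 : recPoly x a b q (n + 1) = a⁻¹ * ((1 - a * b * q ^ n) * recPoly x a b q n) := by
      field_simp
      linarith
    rw [h2, ih, qPoch_succ]
    ring

theorem continuous_recPoly (a b q : ℝ) (n : ℕ) : Continuous fun x => recPoly x a b q n := by
  induction n using Nat.twoStepInduction with
  | zero => simp only [recPoly_zero]; fun_prop
  | one => simp only [recPoly_one]; fun_prop
  | more n h1 h2 => simp only [recPoly_add_two]; fun_prop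

/-- Both `poly` and `recPoly` satisfy the Christoffel relation, hence they agree. -/
theorem poly_eq_recPoly (x b : ℝ) {a q : ℝ} (hq0 : 0 < q) (hq1 : q < 1) (ha : a ≠ 0)
    (hab : a * b ≤ 0) (n : ℕ) : poly n x a b q = recPoly x a b q n := by
  induction n generalizing a with
  | zero => simp [poly, recPoly_zero, qPoch_zero]
  | succ n ih =>
    have hab' : a * q * b ≤ 0 := by
      have := mul_nonpos_of_nonpos_of_nonneg hab hq0.le
      linarith [this]
    have h := recPoly_christoffel x a b q n
    rw [← ih ha hab, ← ih (mul_ne_zero ha hq0.ne') hab'] at h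
    -- The induction hypothesis is used at a and at aq, so the Christoffel relation can be solved
    -- for degree n + 1. What remains is that relation for the explicit sums.
    suffices hp : (1 - 2 * a * x + a ^ 2) * poly n x (a * q) b q =
        (1 - a * b * q ^ n) * poly n x a b q - a * poly (n + 1) x a b q by
      have : a * poly (n + 1) x a b q = a * recPoly x a b q (n + 1) := by linarith
      exact mul_left_cancel₀ ha this
    set φ : ℝ → ℕ → ℝ := fun a k =>
      ∏ i ∈ Finset.range k, (1 - 2 * a * x * q ^ i + a ^ 2 * q ^ (2 * i)) with hφ
    have hφs : ∀ k, φ a (k + 1) = (1 - 2 * a * x + a ^ 2) * φ (a * q) k := fun k => by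
      simp only [hφ, Finset.prod_range_succ']
      rw [mul_comm]
      congr 1
      · ring
      · refine Finset.prod_congr rfl fun i _ => ?_
        ring
    have hr : ∀ k, qPoch q q k ≠ 0 := fun k => (qPoch_self_pos hq0.le hq1 k).ne'
    have hA : ∀ k, qPoch (a * b) q k ≠ 0 := fun k =>
      (zero_lt_one.trans_le (one_le_qPoch_of_nonpos hq0.le hab k)).ne'
    have hA' : ∀ k, qPoch (a * q * b) q k ≠ 0 := fun k =>
      (zero_lt_one.trans_le (one_le_qPoch_of_nonpos hq0.le hab' k)).ne'
    set s : ℕ → ℝ := fun m => ∑ k ∈ Finset.range (m + 1),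
      qPoch (q⁻¹ ^ m) q k * φ a k / (qPoch q q k * qPoch (a * b) q k) * q ^ k with hs
    set s' : ℝ := ∑ k ∈ Finset.range (n + 1),
      qPoch (q⁻¹ ^ n) q k * φ (a * q) k / (qPoch q q k * qPoch (a * q * b) q k) * q ^ k with hs'
    -- Hence the degree-n sum may be extended by one zero term and subtracted from the degree-(n +
    -- 1) sum term by term.
    have hvan : qPoch (q⁻¹ ^ n) q (n + 1) = 0 := by
      rw [qPoch_succ, inv_pow, inv_mul_cancel₀ (pow_ne_zero _ hq0.ne'), sub_self, mul_zero]
    have hsn : s n = ∑ k ∈ Finset.range (n + 2),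
        qPoch (q⁻¹ ^ n) q k * φ a k / (qPoch q q k * qPoch (a * b) q k) * q ^ k := by
      rw [Finset.sum_range_succ _ (n + 1), hvan]
      simp [hs]
    have hdiff : (1 - a * b) * q ^ n * (s (n + 1) - s n) = -((1 - 2 * a * x + a ^ 2) * s') := by
      rw [hsn]
      simp only [hs]
      rw [← Finset.sum_sub_distrib, Finset.sum_range_succ', hs', Finset.mul_sum]
      simp only [qPoch_zero, sub_self, add_zero]
      rw [Finset.mul_sum, ← Finset.sum_neg_distrib]
      refine Finset.sum_congr rfl fun k _ => ?_
      have e1 : qPoch (q⁻¹ ^ (n + 1)) q (k + 1) = (1 - q⁻¹ ^ (n + 1)) * qPoch (q⁻¹ ^ n) q k := by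
        rw [qPoch_succ', pow_succ, mul_assoc, inv_mul_cancel₀ hq0.ne', mul_one]
      have e2 : qPoch (a * b) q (k + 1) = (1 - a * b) * qPoch (a * q * b) q k := by
        rw [qPoch_succ', mul_right_comm]
      have e3 : 1 - q ^ (k + 1) ≠ 0 := by
        have := right_ne_zero_of_mul (qPoch_succ q q k ▸ hr (k + 1))
        rwa [pow_succ']
      have h1ab : 1 - a * b ≠ 0 := by linarith
      rw [e1, e2, hφs, qPoch_succ, qPoch_succ, ← pow_succ']
      have := hr k
      have := hA' k
      have hq := hq0.ne'
      generalize qPoch (q⁻¹ ^ n) q k = w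
      generalize qPoch q q k = u at *
      generalize qPoch (a * q * b) q k = v at *
      generalize 1 - a * b = z at *
      generalize 1 - 2 * a * x + a ^ 2 = y at *
      generalize φ (a * q) k = p
      simp only [inv_pow]
      field_simp
      ring
    have hpn : ∀ m, poly m x a b q = a⁻¹ ^ m * qPoch (a * b) q m * s m := fun m => rfl
    have hpn' : poly n x (a * q) b q = (a * q)⁻¹ ^ n * qPoch (a * q * b) q n * s' := rfl
    have hshift : qPoch (a * b) q (n + 1) = (1 - a * b) * qPoch (a * q * b) q n := by
      rw [qPoch_succ', mul_right_comm]
    rw [hpn, hpn, hpn']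
    have h1ab : 1 - a * b ≠ 0 := by linarith
    have h2 : (1 - a * b * q ^ n) * qPoch (a * b) q n = (1 - a * b) * qPoch (a * q * b) q n := by
      rw [← hshift, qPoch_succ]; ring
    rw [hshift, mul_inv, mul_pow, pow_succ]
    have hqn : q ^ n ≠ 0 := pow_ne_zero _ hq0.ne'
    have h3 : (1 - 2 * a * x + a ^ 2) * s' = (1 - a * b) * q ^ n * (s n - s (n + 1)) := by
      linarith
    calc (1 - 2 * a * x + a ^ 2) * (a⁻¹ ^ n * q⁻¹ ^ n * qPoch (a * q * b) q n * s')
        = a⁻¹ ^ n * q⁻¹ ^ n * qPoch (a * q * b) q n * ((1 - 2 * a * x + a ^ 2) * s') := by ring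
      _ = a⁻¹ ^ n * qPoch (a * q * b) q n * (1 - a * b) * (q⁻¹ ^ n * q ^ n) *
            (s n - s (n + 1)) := by rw [h3]; ring
      _ = a⁻¹ ^ n * ((1 - a * b) * qPoch (a * q * b) q n) * s n
            - (a * a⁻¹) * a⁻¹ ^ n * ((1 - a * b) * qPoch (a * q * b) q n) * s (n + 1) := by
          rw [inv_pow q, inv_mul_cancel₀ hqn, mul_inv_cancel₀ ha]; ring
      _ = _ := by rw [← h2]; ring

/-- The Gram matrix of a sequence that satisfies a three-term recurrence is determined by its
first row. -/
theorem gram_eq_of_recurrence {A C : ℕ → ℝ} {L : ℕ → ℕ → ℝ} (hC : C 0 = 0)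
    (h : ∀ m n, L (m + 1) n + A m * L m n + C m * L (m - 1) n =
      L m (n + 1) + A n * L m n + C n * L m (n - 1))
    (h0 : ∀ n, L 0 n = if n = 0 then 1 else 0) (m n : ℕ) :
    L m n = if m = n then ∏ i ∈ Finset.range m, C (i + 1) else 0 := by
  induction m using Nat.strong_induction_on generalizing n with
  | _ m ih =>
    cases m with
    | zero => rw [h0]; simp [eq_comm]
    | succ m =>
      -- Symmetry of multiplication by the variable, at (m, n), expresses row m + 1 through rows m
      -- and m - 1. The truncated index at 0 is harmless because C 0 = 0.
      have e1 := h m n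
      rw [ih m (by lia) n, ih m (by lia) (n + 1), ih m (by lia) (n - 1)] at e1
      rcases m with _ | m
      · rw [hC] at e1
        rcases n with _ | _ | n
        · simp at e1 ⊢; linarith
        · simp at e1 ⊢; linarith
        · simp at e1 ⊢; linarith
      · simp only [Nat.add_sub_cancel] at e1
        rw [ih m (by lia) n] at e1
        rcases n with _ | n
        · rcases m with _ | m
          · simp [hC] at e1 ⊢; linarith
          · simp [hC] at e1 ⊢; linarith
        · simp only [Nat.add_sub_cancel] at e1
          by_cases h1 : n = m
          · subst h1; simp at e1 ⊢; linarith
          by_cases h2 : n = m + 1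
          · subst h2
            simp [show m ≠ m + 1 + 1 by lia] at e1 ⊢
            rw [Finset.prod_range_succ]; linarith
          by_cases h3 : n = m + 2
          · subst h3
            simp [show m ≠ m + 2 + 1 by lia] at e1 ⊢; linarith
          by_cases h4 : n + 1 = m
          · subst h4
            simp [Finset.prod_range_succ, show n + 1 + 1 ≠ n by lia] at e1 ⊢; linarith
          · rw [if_neg (by lia), if_neg (by lia), if_neg (by lia), if_neg (by lia)] at e1
            rw [if_neg (by lia)]; linarith

/-- Inside the interval `[-1, 1]` the polynomials grow subexponentially. -/
theorem summable_pow_mul_recPoly_sq {x q t : ℝ} (a b : ℝ) (hx : x ^ 2 ≤ 1) (hq0 : 0 ≤ q)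
    (hq1 : q < 1) (ht0 : 0 ≤ t) (ht1 : t < 1) :
    Summable fun n => t ^ n * recPoly x a b q n ^ 2 := by
  set P := recPoly x a b q with hP
  -- z = e^(iθ) with x = cos θ. As q^n → 0 the recurrence tends to the one with characteristic roots
  -- z and its conjugate.
  set z : ℂ := ⟨x, √(1 - x ^ 2)⟩ with hz
  have hzz : z * starRingEnd ℂ z = 1 := by
    rw [Complex.mul_conj, Complex.normSq_mk, Real.mul_self_sqrt (by linarith)]
    norm_cast
    ring
  have hz1 : ‖z‖ = 1 := by
    have : ‖z‖ ^ 2 = 1 := by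
      rw [← Complex.normSq_eq_norm_sq, hz, Complex.normSq_mk, Real.mul_self_sqrt (by linarith)]
      ring
    nlinarith [norm_nonneg z]
  have hz2 : (2 * x : ℂ) = z + starRingEnd ℂ z := by
    rw [Complex.add_conj]; simp [hz]
  set D := |a + b| + 1 + 2 * |a * b| with hD
  have hD0 : 0 ≤ D := by positivity
  -- Removing the root z leaves a sequence that is multiplied by the conjugate root at each step, up
  -- to an error of order q^n.
  set y : ℕ → ℂ := fun n => P (n + 1) - z * P n with hy
  have hPn : ∀ n, |P n| ≤ |P (n + 1)| + ‖y n‖ := fun n => by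
    have h1 : z * P n = P (n + 1) - y n := by simp only [hy]; ring
    have h2 : ‖z * P n‖ ≤ ‖(P (n + 1) : ℂ)‖ + ‖y n‖ := by rw [h1]; exact norm_sub_le _ _
    simpa [hz1] using h2
  have hPs : ∀ n, |P (n + 1)| ≤ |P n| + ‖y n‖ := fun n => by
    have h1 : (P (n + 1) : ℂ) = z * P n + y n := by simp only [hy]; ring
    have h2 : ‖(P (n + 1) : ℂ)‖ ≤ ‖z * P n‖ + ‖y n‖ := by rw [h1]; exact norm_add_le _ _
    simpa [hz1] using h2
  have hyn : ∀ n, ‖y (n + 1)‖ ≤ ‖y n‖ + D * q ^ n * (2 * |P (n + 1)| + ‖y n‖) := fun n => by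
    have hrec : (P (n + 2) : ℂ) = (2 * x - (a + b) * q ^ (n + 1)) * P (n + 1)
        - (1 - q ^ (n + 1)) * (1 - a * b * q ^ n) * P n := by
      rw [hP, recPoly_add_two]; push_cast; ring
    have h1 : y (n + 1) = starRingEnd ℂ z * y n + (((-((a + b) * q) * P (n + 1)
        + (q + a * b - a * b * q ^ (n + 1)) * P n) * q ^ n : ℝ) : ℂ) := by
      simp only [hy]
      rw [hrec, hz2]
      push_cast
      linear_combination (P n : ℂ) * hzz
    have h2 : ‖y (n + 1)‖ ≤ ‖y n‖ + |(-((a + b) * q) * P (n + 1)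
        + (q + a * b - a * b * q ^ (n + 1)) * P n) * q ^ n| := by
      rw [h1]
      refine (norm_add_le _ _).trans ?_
      rw [norm_mul, RCLike.norm_conj, hz1, one_mul, Complex.norm_real, Real.norm_eq_abs]
    refine h2.trans (add_le_add_right ?_ _)
    have hqn : 0 ≤ q ^ n := pow_nonneg hq0 n
    have hqn1 : q ^ (n + 1) ≤ 1 := pow_le_one₀ hq0 hq1.le
    have hqn2 : 0 ≤ q ^ (n + 1) := pow_nonneg hq0 _
    have h3 : |-((a + b) * q)| ≤ D := by
      rw [abs_neg, abs_mul, abs_of_nonneg hq0]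
      nlinarith [abs_nonneg (a + b), abs_nonneg (a * b)]
    have h4 : |q + a * b - a * b * q ^ (n + 1)| ≤ D := by
      have : q + a * b - a * b * q ^ (n + 1) = q + a * b * (1 - q ^ (n + 1)) := by ring
      rw [this]
      refine (abs_add_le _ _).trans ?_
      rw [abs_mul, abs_of_nonneg hq0, abs_of_nonneg (by linarith : 0 ≤ 1 - q ^ (n + 1))]
      nlinarith [abs_nonneg (a + b), abs_nonneg (a * b)]
    rw [abs_mul, abs_of_nonneg hqn]
    have h5 : |-((a + b) * q) * P (n + 1) + (q + a * b - a * b * q ^ (n + 1)) * P n| ≤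
        D * (2 * |P (n + 1)| + ‖y n‖) := by
      refine (abs_add_le _ _).trans ?_
      rw [abs_mul, abs_mul]
      calc _ ≤ D * |P (n + 1)| + D * (|P (n + 1)| + ‖y n‖) := by
            gcongr
            exact hPn n
        _ = _ := by ring
    calc _ ≤ D * (2 * |P (n + 1)| + ‖y n‖) * q ^ n := by gcongr
      _ = _ := by ring
  -- At x = ±1 the roots coincide and linear growth occurs. Giving y a large weight K in the norm N
  -- reduces the growth factor to 1 + 1/K + O(q^n), and K is taken so large that t beats its square.
  obtain ⟨K, hK1, hK⟩ : ∃ K : ℝ, 1 ≤ K ∧ t * (1 + 1 / K) ^ 2 < 1 := by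
    have hlim : Tendsto (fun n : ℕ => t * (1 + 1 / ((n : ℝ) + 1)) ^ 2) atTop (𝓝 (t * (1 + 0) ^ 2)) :=
      ((tendsto_one_div_add_atTop_nhds_zero_nat.const_add 1).pow 2).const_mul t
    obtain ⟨n, hn⟩ := (hlim.eventually (gt_mem_nhds (by simpa using ht1 : t * (1 + 0) ^ 2 < 1))).exists
    exact ⟨n + 1, by linarith [Nat.cast_nonneg (α := ℝ) n], hn⟩
  set N : ℕ → ℝ := fun n => |P (n + 1)| + K * ‖y n‖ with hN
  have hN0 : ∀ n, 0 ≤ N n := fun n => by positivity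
  set ρ : ℕ → ℝ := fun n => 1 + 1 / K + 2 * (1 + K) * D * q ^ n with hρ
  have hNs : ∀ n, N (n + 1) ≤ ρ n * N n := fun n => by
    have h1 := hPs (n + 1)
    have h2 := hyn n
    have hqn : 0 ≤ q ^ n := pow_nonneg hq0 n
    set E := D * q ^ n with hE
    have hE0 : 0 ≤ E := by positivity
    have hK0 : 0 < K := by linarith
    have e1 : N (n + 1) ≤ |P (n + 1)| + (1 + K) * ‖y (n + 1)‖ := by
      simp only [hN]; linarith
    have e2 : N (n + 1) ≤ |P (n + 1)| + (1 + K) * (‖y n‖ + E * (2 * |P (n + 1)| + ‖y n‖)) :=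
      e1.trans (by gcongr)
    have hρ' : ρ n = 1 + 1 / K + 2 * (1 + K) * E := by simp only [hρ, hE]; ring
    rw [hρ']
    refine e2.trans ?_
    simp only [hN]
    have e3 : (1 + 1 / K + 2 * (1 + K) * E) * (|P (n + 1)| + K * ‖y n‖) =
        |P (n + 1)| + (1 + K) * (‖y n‖ + E * (2 * |P (n + 1)| + ‖y n‖))
        + (1 / K * |P (n + 1)| + (1 + K) * E * ‖y n‖ * (2 * K - 1)) := by
      field_simp; ring
    rw [e3]
    have : 0 ≤ 2 * K - 1 := by linarith
    have : 0 ≤ 1 / K * |P (n + 1)| + (1 + K) * E * ‖y n‖ * (2 * K - 1) := by positivity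
    linarith
  have hρlim : Tendsto (fun n => t * ρ n ^ 2) atTop (𝓝 (t * (1 + 1 / K) ^ 2)) := by
    have h1 : Tendsto ρ atTop (𝓝 (1 + 1 / K + 2 * (1 + K) * D * 0)) :=
      ((tendsto_pow_atTop_nhds_zero_of_lt_one hq0 hq1).const_mul _).const_add _
    rw [mul_zero, add_zero] at h1
    exact (h1.pow 2).const_mul t
  obtain ⟨l, hl1, hl2⟩ := exists_between hK
  have hsum : Summable fun n => t ^ n * N n ^ 2 := by
    refine summable_of_ratio_norm_eventually_le hl2 ?_
    filter_upwards [hρlim.eventually (ge_mem_nhds hl1)] with n hn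
    have hKpos : 0 < K := by linarith
    have hρ0 : 0 ≤ ρ n := by simp only [hρ]; positivity
    rw [Real.norm_of_nonneg (by positivity), Real.norm_of_nonneg (by positivity)]
    calc t ^ (n + 1) * N (n + 1) ^ 2 ≤ t ^ (n + 1) * (ρ n * N n) ^ 2 := by
          have := hNs n
          have := hN0 (n + 1)
          gcongr
      _ = t * ρ n ^ 2 * (t ^ n * N n ^ 2) := by ring
      _ ≤ l * (t ^ n * N n ^ 2) := by gcongr
  rw [← summable_nat_add_iff 1]
  refine Summable.of_nonneg_of_le (fun n => by positivity) (fun n => ?_) (hsum.mul_left t)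
  have h1 : P (n + 1) ^ 2 ≤ N n ^ 2 := by
    rw [sq_le_sq, abs_of_nonneg (hN0 n)]
    have hKpos : 0 < K := by linarith
    have : 0 ≤ K * ‖y n‖ := by positivity
    simp only [hN]; linarith
  calc t ^ (n + 1) * P (n + 1) ^ 2 ≤ t ^ (n + 1) * N n ^ 2 := by gcongr
    _ = t * (t ^ n * N n ^ 2) := by ring

end AlSalamChihara

/-! ### The weight function -/

namespace AlSalamChihara

open Filter Topology MeasureTheory

variable {q : ℝ}

theorem conj_exp_I_mul (θ : ℝ) :
    starRingEnd ℂ (Complex.exp (Complex.I * θ)) = Complex.exp (-(Complex.I * θ)) := by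
  rw [← Complex.exp_conj]; simp

theorem norm_exp_I_mul (θ : ℝ) : ‖Complex.exp (Complex.I * θ)‖ = 1 := by
  rw [mul_comm]; exact Complex.norm_exp_ofReal_mul_I θ

/-- The factors come in complex conjugate pairs, so the quotient is already real before the real
part is taken. Sign, symmetry in a and b and measurability are read off from this form. -/
theorem weight_eq (hq0 : 0 < q) (hq1 : q < 1) (θ a b : ℝ) : weight θ a b q =
    ‖qPochInf (Complex.exp (2 * Complex.I * θ)) (q : ℂ)‖ ^ 2 /
      (‖qPochInf (a * Complex.exp (Complex.I * θ)) (q : ℂ)‖ ^ 2 *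
        ‖qPochInf (b * Complex.exp (Complex.I * θ)) (q : ℂ)‖ ^ 2) := by
  have hq : ‖q‖ < 1 := by rwa [Real.norm_of_nonneg hq0.le]
  have key : ∀ z : ℂ, qPochInf z (q : ℂ) * qPochInf (starRingEnd ℂ z) (q : ℂ) =
      ((‖qPochInf z (q : ℂ)‖ ^ 2 : ℝ) : ℂ) := fun z => by
    rw [← conj_qPochInf z hq, Complex.mul_conj, Complex.normSq_eq_norm_sq]
  have c2 : Complex.exp (-(2 * Complex.I * θ)) =
      starRingEnd ℂ (Complex.exp (2 * Complex.I * θ)) := by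
    rw [← Complex.exp_conj]; simp [Complex.conj_ofNat]
  have c1 : ∀ a : ℝ, (a : ℂ) * Complex.exp (-(Complex.I * θ)) =
      starRingEnd ℂ (a * Complex.exp (Complex.I * θ)) := fun a => by
    rw [map_mul, conj_exp_I_mul, Complex.conj_ofReal]
  rw [weight, c2, c1, c1, key, mul_assoc, mul_assoc, key, ← mul_assoc, key, ← Complex.ofReal_mul,
    ← Complex.ofReal_div, Complex.ofReal_re]

theorem weight_comm (hq0 : 0 < q) (hq1 : q < 1) (θ a b : ℝ) :
    weight θ a b q = weight θ b a q := by
  rw [weight_eq hq0 hq1, weight_eq hq0 hq1, mul_comm (‖_‖ ^ 2)]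

theorem weight_nonneg (hq0 : 0 < q) (hq1 : q < 1) (θ a b : ℝ) : 0 ≤ weight θ a b q := by
  rw [weight_eq hq0 hq1]; positivity

theorem normSq_one_sub_exp (θ a : ℝ) :
    ‖1 - a * Complex.exp (Complex.I * θ)‖ ^ 2 = 1 - 2 * a * Real.cos θ + a ^ 2 := by
  rw [mul_comm Complex.I, Complex.exp_mul_I, ← Complex.normSq_eq_norm_sq, Complex.normSq_apply]
  simp only [Complex.sub_re, Complex.sub_im, Complex.one_re, Complex.one_im, Complex.mul_re,
    Complex.mul_im, Complex.add_re, Complex.add_im, Complex.ofReal_re, Complex.ofReal_im,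
    Complex.I_re, Complex.I_im, Complex.cos_ofReal_re, Complex.cos_ofReal_im,
    Complex.sin_ofReal_re, Complex.sin_ofReal_im]
  linear_combination a ^ 2 * Real.sin_sq_add_cos_sq θ

theorem christoffel_factor_pos {θ : ℝ} (hθ : θ ∈ Set.Ioo 0 Real.pi) (a : ℝ) :
    0 < 1 - 2 * a * Real.cos θ + a ^ 2 := by
  have h1 := Real.sin_pos_of_pos_of_lt_pi hθ.1 hθ.2
  nlinarith [Real.sin_sq_add_cos_sq θ, sq_nonneg (a - Real.cos θ), sq_pos_of_pos h1]

theorem qPochInf_mul_exp_ne_zero (hq0 : 0 < q) (hq1 : q < 1) {θ : ℝ}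
    (hθ : θ ∈ Set.Ioo 0 Real.pi) (a : ℝ) :
    qPochInf (a * Complex.exp (Complex.I * θ)) (q : ℂ) ≠ 0 := by
  have hq : ‖(q : ℂ)‖ < 1 := by rwa [Complex.norm_real, Real.norm_of_nonneg hq0.le]
  refine qPochInf_ne_zero hq fun i hi => ?_
  have h1 := normSq_one_sub_exp θ (a * q ^ i)
  have h2 : ((a * q ^ i : ℝ) : ℂ) * Complex.exp (Complex.I * θ) = 1 := by
    rw [← hi]; push_cast; ring
  rw [h2, sub_self, norm_zero] at h1
  have := christoffel_factor_pos hθ (a * q ^ i)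
  norm_num at h1
  linarith

/-- The Christoffel factor equals |1 - a e^(iθ)|², the square of the first factor of the infinite
product in the denominator. -/
theorem weight_shift (hq0 : 0 < q) (hq1 : q < 1) {θ : ℝ} (hθ : θ ∈ Set.Ioo 0 Real.pi) (a b : ℝ) :
    (1 - 2 * a * Real.cos θ + a ^ 2) * weight θ a b q = weight θ (a * q) b q := by
  have hq : ‖(q : ℂ)‖ < 1 := by rwa [Complex.norm_real, Real.norm_of_nonneg hq0.le]
  have h1 := christoffel_factor_pos hθ a
  have h3 := qPochInf_mul_exp_ne_zero hq0 hq1 hθ (a * q)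
  have h4 := qPochInf_mul_exp_ne_zero hq0 hq1 hθ b
  rw [weight_eq hq0 hq1, weight_eq hq0 hq1,
    qPochInf_shift ((a : ℂ) * Complex.exp (Complex.I * θ)) hq, norm_mul, mul_pow,
    normSq_one_sub_exp]
  have h5 : ((a * q : ℝ) : ℂ) * Complex.exp (Complex.I * θ) =
    a * Complex.exp (Complex.I * θ) * q := by push_cast; ring
  rw [h5] at h3 ⊢
  have h6 := norm_ne_zero_iff.2 h3
  have h7 := norm_ne_zero_iff.2 h4
  field_simp

theorem weight_pos (hq0 : 0 < q) (hq1 : q < 1) {θ : ℝ} (hθ : θ ∈ Set.Ioo 0 Real.pi) (a b : ℝ) :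
    0 < weight θ a b q := by
  have hq : ‖(q : ℂ)‖ < 1 := by rwa [Complex.norm_real, Real.norm_of_nonneg hq0.le]
  rw [weight_eq hq0 hq1]
  have h3 := norm_pos_iff.2 (qPochInf_mul_exp_ne_zero hq0 hq1 hθ a)
  have h4 := norm_pos_iff.2 (qPochInf_mul_exp_ne_zero hq0 hq1 hθ b)
  have h5 : qPochInf (Complex.exp (2 * Complex.I * θ)) (q : ℂ) ≠ 0 := by
    refine qPochInf_ne_zero hq fun i hi => ?_
    have hn : ‖Complex.exp (2 * Complex.I * θ)‖ = 1 := by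
      have : (2 * Complex.I * θ : ℂ) = Complex.I * ((2 * θ : ℝ) : ℂ) := by push_cast; ring
      rw [this, norm_exp_I_mul]
    rcases i with _ | i
    · rw [pow_zero, mul_one] at hi
      have h0 : Complex.exp (Complex.I * θ) ^ 2 = 1 := by
        rw [← hi, ← Complex.exp_nat_mul]; congr 1; push_cast; ring
      have h6 := Real.sin_pos_of_pos_of_lt_pi hθ.1 hθ.2
      have h7 : (Complex.exp (Complex.I * θ)).im = Real.sin θ := by
        rw [mul_comm, Complex.exp_ofReal_mul_I_im]
      rcases mul_self_eq_one_iff.1 ((sq _).symm.trans h0) with h | h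
      · rw [h] at h7; simp at h7; linarith
      · rw [h] at h7; simp at h7; linarith
    · have h8 := congrArg norm hi
      rw [norm_mul, hn, one_mul, norm_pow, Complex.norm_real, Real.norm_of_nonneg hq0.le,
        norm_one] at h8
      have := pow_lt_one₀ hq0.le hq1 (n := i + 1) (by lia)
      linarith
  have h6 := norm_pos_iff.2 h5
  positivity

theorem measurable_weight (hq0 : 0 < q) (hq1 : q < 1) (a b : ℝ) :
    Measurable fun θ => weight θ a b q := by
  have hq : ‖(q : ℂ)‖ < 1 := by rwa [Complex.norm_real, Real.norm_of_nonneg hq0.le]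
  have hc := (continuous_qPochInf hq).measurable
  simp only [weight_eq hq0 hq1]
  refine Measurable.div ?_ (Measurable.mul ?_ ?_)
  · exact (hc.comp (by fun_prop : Measurable fun θ : ℝ => Complex.exp (2 * Complex.I * θ))).norm.pow_const 2
  · exact (hc.comp (by fun_prop : Measurable fun θ : ℝ => (a : ℂ) * Complex.exp (Complex.I * θ))).norm.pow_const 2
  · exact (hc.comp (by fun_prop : Measurable fun θ : ℝ => (b : ℂ) * Complex.exp (Complex.I * θ))).norm.pow_const 2

/-- A bound for the weight that is uniform in the parameters inside the unit disc. -/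
theorem weight_le (hq0 : 0 < q) (hq1 : q < 1) {a b c : ℝ} (ha : |a| ≤ c) (hb : |b| ≤ c)
    (hc : c < 1) (θ : ℝ) : weight θ a b q ≤ qPochInf (-1) q ^ 2 / qPochInf c q ^ 4 := by
  have hn : ‖Complex.exp (2 * Complex.I * θ)‖ = 1 := by
    have : (2 * Complex.I * θ : ℂ) = Complex.I * ((2 * θ : ℝ) : ℂ) := by push_cast; ring
    rw [this, norm_exp_I_mul]
  have h1 := norm_qPochInf_le (Complex.exp (2 * Complex.I * θ)) hq0.le hq1
  rw [hn] at h1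
  have h2 : ∀ a : ℝ, |a| ≤ c →
      qPochInf c q ≤ ‖qPochInf (a * Complex.exp (Complex.I * θ)) (q : ℂ)‖ := fun a ha =>
    le_norm_qPochInf hq0.le hq1 hc.le (by
      rw [norm_mul, norm_exp_I_mul, mul_one, Complex.norm_real]; exact ha)
  have h3 := qPochInf_pos hq0.le hq1 hc
  rw [weight_eq hq0 hq1]
  have h4 := h2 a ha
  have h5 := h2 b hb
  have : qPochInf c q ^ 4 = qPochInf c q ^ 2 * qPochInf c q ^ 2 := by ring
  rw [this]
  gcongr

/-- The weight has zeros at z = ±1 in its numerator; this lets them dominate the denominators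
uniformly as a → 1 and, with -z and -b, as b → -1. -/
theorem half_norm_le {a : ℝ} (ha0 : 0 ≤ a) (ha1 : a ≤ 1) {z : ℂ} (hz : ‖z‖ = 1) :
    ‖1 - z‖ ≤ 2 * ‖1 - a * z‖ := by
  have h1 : ‖1 - z‖ ≤ ‖1 - a * z‖ + ‖(1 - a : ℝ) * z‖ := by
    have : 1 - z = (1 - a * z) - ((1 - a : ℝ) : ℂ) * z := by push_cast; ring
    conv_lhs => rw [this]
    exact norm_sub_le _ _
  rw [norm_mul, hz, mul_one, Complex.norm_real, Real.norm_of_nonneg (by linarith)] at h1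
  have h2 := norm_sub_norm_le (1 : ℂ) (a * z)
  rw [norm_mul, hz, mul_one, Complex.norm_real, Real.norm_of_nonneg ha0, norm_one] at h2
  linarith

/-- A bound for the weight that is uniform on `a ∈ [0, 1]`, `b ∈ [-1, 0]`. -/
theorem weight_le' (hq0 : 0 < q) (hq1 : q < 1) {a b : ℝ} (ha0 : 0 ≤ a) (ha1 : a ≤ 1) (hb0 : b ≤ 0)
    (hb1 : -1 ≤ b) {θ : ℝ} (hθ : θ ∈ Set.Ioo 0 Real.pi) :
    weight θ a b q ≤ 16 * qPochInf (-q) q ^ 2 / qPochInf q q ^ 4 := by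
  have hq : ‖(q : ℂ)‖ < 1 := by rwa [Complex.norm_real, Real.norm_of_nonneg hq0.le]
  set z := Complex.exp (Complex.I * θ) with hz
  have hz1 : ‖z‖ = 1 := norm_exp_I_mul θ
  have hz2 : Complex.exp (2 * Complex.I * θ) = z ^ 2 := by
    rw [hz, ← Complex.exp_nat_mul]; congr 1; push_cast; ring
  have hpos := qPochInf_pos hq0.le hq1 hq1
  have e1 : ‖qPochInf (z ^ 2) (q : ℂ)‖ ≤ ‖1 - z‖ * ‖1 + z‖ * qPochInf (-q) q := by
    rw [qPochInf_shift _ hq, norm_mul, ← norm_mul (1 - z)]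
    have : (1 - z) * (1 + z) = 1 - z ^ 2 := by ring
    rw [this]
    gcongr
    have := norm_qPochInf_le (z ^ 2 * q) hq0.le hq1
    rwa [norm_mul, norm_pow, hz1, one_pow, one_mul, Complex.norm_real,
      Real.norm_of_nonneg hq0.le] at this
  have e2 : ∀ a : ℝ, |a| ≤ 1 → ‖1 - a * z‖ * qPochInf q q ≤ ‖qPochInf (a * z) (q : ℂ)‖ :=
    fun a ha => by
      rw [qPochInf_shift _ hq, norm_mul]
      gcongr
      refine le_norm_qPochInf hq0.le hq1 hq1.le ?_
      rw [norm_mul, norm_mul, hz1, mul_one, Complex.norm_real, Complex.norm_real,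
        Real.norm_of_nonneg hq0.le]
      exact mul_le_of_le_one_left hq0.le ha
  have ha2 := e2 a (by rwa [abs_of_nonneg ha0])
  have hb2 := e2 b (by rw [abs_of_nonpos hb0]; linarith)
  have ha3 := half_norm_le ha0 ha1 hz1
  have hb3 := half_norm_le (a := -b) (by linarith) (by linarith) (z := -z) (by rwa [norm_neg])
  rw [sub_neg_eq_add] at hb3
  have hb4 : (1 : ℂ) - ((-b : ℝ) : ℂ) * -z = 1 - b * z := by push_cast; ring
  rw [hb4] at hb3
  rw [weight_eq hq0 hq1, hz2]
  have p1 := norm_pos_iff.2 (qPochInf_mul_exp_ne_zero hq0 hq1 hθ a)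
  have p2 := norm_pos_iff.2 (qPochInf_mul_exp_ne_zero hq0 hq1 hθ b)
  rw [← hz] at p1 p2
  rw [div_le_div_iff₀ (by positivity) (by positivity)]
  -- The factors |1 - z| and |1 + z| of the numerator are absorbed by |1 - az| and |1 - bz|; all
  -- other factors are bounded uniformly.
  have f1 : ‖qPochInf (z ^ 2) (q : ℂ)‖ * qPochInf q q ^ 2 ≤ 4 * qPochInf (-q) q *
      (‖qPochInf (a * z) (q : ℂ)‖ * ‖qPochInf (b * z) (q : ℂ)‖) := by
    have hm : 0 < qPochInf (-q) q := qPochInf_pos hq0.le hq1 (by linarith)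
    calc _ ≤ ‖1 - z‖ * ‖1 + z‖ * qPochInf (-q) q * qPochInf q q ^ 2 := by gcongr
      _ ≤ (2 * ‖1 - a * z‖) * (2 * ‖1 - b * z‖) * qPochInf (-q) q * qPochInf q q ^ 2 := by gcongr
      _ = 4 * qPochInf (-q) q * ((‖1 - a * z‖ * qPochInf q q) * (‖1 - b * z‖ * qPochInf q q)) := by
          ring
      _ ≤ _ := by gcongr
  calc _ = (‖qPochInf (z ^ 2) (q : ℂ)‖ * qPochInf q q ^ 2) ^ 2 := by ring
    _ ≤ (4 * qPochInf (-q) q *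
      (‖qPochInf (a * z) (q : ℂ)‖ * ‖qPochInf (b * z) (q : ℂ)‖)) ^ 2 := by gcongr
    _ = _ := by ring

end AlSalamChihara

/-! ### The total mass inside the unit disc, by a contour shift -/

namespace AlSalamChihara

open Filter Topology MeasureTheory

variable {q : ℝ}

theorem norm_ofReal_lt_one (hq0 : 0 < q) (hq1 : q < 1) : ‖(q : ℂ)‖ < 1 := by
  rwa [Complex.norm_real, Real.norm_of_nonneg hq0.le]

/-- The complex product that restricts to the weight on the unit circle. -/
theorem weight_eq_re (θ a b : ℝ) :
    weight θ a b q = (qPochInf (Complex.exp (Complex.I * θ) ^ 2) (q : ℂ) *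
      qPochInf ((Complex.exp (Complex.I * θ))⁻¹ ^ 2) (q : ℂ) /
      (qPochInf (a * Complex.exp (Complex.I * θ)) (q : ℂ) *
        qPochInf (a * (Complex.exp (Complex.I * θ))⁻¹) (q : ℂ) *
        qPochInf (b * Complex.exp (Complex.I * θ)) (q : ℂ) *
        qPochInf (b * (Complex.exp (Complex.I * θ))⁻¹) (q : ℂ))).re := by
  rw [weight, ← Complex.exp_neg, ← Complex.exp_nat_mul, ← Complex.exp_nat_mul]
  have h1 : ((2 : ℕ) : ℂ) * (Complex.I * θ) = 2 * Complex.I * θ := by push_cast; ring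
  have h2 : ((2 : ℕ) : ℂ) * -(Complex.I * θ) = -(2 * Complex.I * θ) := by push_cast; ring
  rw [h1, h2]

/-- Cauchy's theorem in an annulus for g(z)/z, because dθ = dz/(iz) on every circle about 0. -/
theorem intervalIntegral_circle_eq {g : ℂ → ℂ} {r R : ℝ} (hr : 0 < r) (hrR : r ≤ R)
    (hg : ∀ z : ℂ, r ≤ ‖z‖ → ‖z‖ ≤ R → DifferentiableAt ℂ g z) :
    ∫ θ in (0 : ℝ)..2 * Real.pi, g (R * Complex.exp (Complex.I * θ)) =
      ∫ θ in (0 : ℝ)..2 * Real.pi, g (r * Complex.exp (Complex.I * θ)) := by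
  have h := Complex.circleIntegral_sub_center_inv_smul_eq_of_differentiable_on_annulus_off_countable
    (c := 0) hr hrR (f := g) (s := ∅) Set.countable_empty
    (fun z hz => (hg z (by simpa using hz.2) (by simpa using hz.1)).continuousAt.continuousWithinAt)
    (fun z hz => hg z (by simpa using (not_le.1 fun h => hz.1.2 (by simpa using h)).le)
      (by simpa using (mem_ball_zero_iff.1 hz.1.1).le))
  have key : ∀ ρ : ℝ, 0 < ρ → (∮ z in C(0, ρ), (z - 0)⁻¹ • g z) =
      Complex.I * ∫ θ in (0 : ℝ)..2 * Real.pi, g (ρ * Complex.exp (Complex.I * θ)) := by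
    intro ρ hρ
    rw [circleIntegral, ← intervalIntegral.integral_const_mul]
    refine intervalIntegral.integral_congr fun θ _ => ?_
    have h1 : circleMap 0 ρ θ = ρ * Complex.exp (Complex.I * θ) := by
      rw [circleMap, zero_add, mul_comm (θ : ℂ)]
    have h2 : (ρ : ℂ) * Complex.exp (Complex.I * θ) ≠ 0 :=
      mul_ne_zero (by exact_mod_cast hρ.ne') (Complex.exp_ne_zero _)
    simp only [deriv_circleMap, smul_eq_mul, sub_zero, h1]
    have h3 : (ρ : ℂ) ≠ 0 := by exact_mod_cast hρ.ne'
    field_simp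
  rw [key R (hr.trans_le hrR), key r hr] at h
  exact mul_left_cancel₀ Complex.I_ne_zero h

theorem weight_two_pi_sub (θ a b : ℝ) : weight (2 * Real.pi - θ) a b q = weight θ a b q := by
  have h : Complex.exp (Complex.I * ((2 * Real.pi - θ : ℝ) : ℂ)) =
      (Complex.exp (Complex.I * θ))⁻¹ := by
    rw [← Complex.exp_neg]
    push_cast
    rw [mul_sub, sub_eq_add_neg, Complex.exp_add]
    have : Complex.I * (2 * Real.pi) = 2 * Real.pi * Complex.I := by ring
    rw [this, Complex.exp_two_pi_mul_I, one_mul]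
  rw [weight_eq_re, weight_eq_re, h, inv_inv]
  congr 2 <;> ring

theorem intervalIntegral_weight_eq_half (f : ℝ → ℝ) (a b : ℝ)
    (hi : IntervalIntegrable (fun θ => f (Real.cos θ) * weight θ a b q) volume 0 (2 * Real.pi)) :
    ∫ θ in (0 : ℝ)..2 * Real.pi, f (Real.cos θ) * weight θ a b q =
      2 * ∫ θ in (0 : ℝ)..Real.pi, f (Real.cos θ) * weight θ a b q := by
  have hpi := Real.pi_pos
  have h1 : IntervalIntegrable (fun θ => f (Real.cos θ) * weight θ a b q) volume 0 Real.pi :=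
    hi.mono_set (by
      rw [Set.uIcc_of_le hpi.le, Set.uIcc_of_le (by linarith)]
      exact Set.Icc_subset_Icc_right (by linarith))
  have h2 : IntervalIntegrable (fun θ => f (Real.cos θ) * weight θ a b q) volume Real.pi
      (2 * Real.pi) :=
    hi.mono_set (by
      rw [Set.uIcc_of_le (by linarith), Set.uIcc_of_le (by linarith)]
      exact Set.Icc_subset_Icc_left hpi.le)
  rw [← intervalIntegral.integral_add_adjacent_intervals h1 h2]
  have h3 := intervalIntegral.integral_comp_sub_left
    (fun θ => f (Real.cos θ) * weight θ a b q) (2 * Real.pi) (a := 0) (b := Real.pi)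
  simp only [weight_two_pi_sub, Real.cos_two_pi_sub] at h3
  rw [h3]
  have h4 : 2 * Real.pi - Real.pi = Real.pi := by ring
  rw [h4, sub_zero]
  ring

/-- Contour shift: the first polynomial is orthogonal to the constants. -/
theorem integral_weight_mul_recPoly_one (hq0 : 0 < q) (hq1 : q < 1) {a b : ℝ} (ha : |a| < 1)
    (hb : |b| < 1) :
    ∫ θ in (0 : ℝ)..Real.pi, (2 * Real.cos θ - (a + b)) * weight θ a b q = 0 := by
  have hq := norm_ofReal_lt_one hq0 hq1
  set s : ℝ := √q with hs
  have hs0 : 0 < s := Real.sqrt_pos.2 hq0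
  have hss : s * s = q := Real.mul_self_sqrt hq0.le
  have hs1 : s < 1 := by nlinarith
  set E : ℂ → ℂ := fun z => qPochInf z (q : ℂ) with hE
  have hEd : Differentiable ℂ E := differentiable_qPochInf hq
  have hEs : ∀ z, E z = (1 - z) * E (z * q) := fun z => qPochInf_shift z hq
  -- The weight with a and b replaced by a√q and b√q and an unsymmetric numerator. The factor √q
  -- keeps the arguments in the denominator below 1 in norm for √q ≤ |z| ≤ 1/√q, so g is holomorphic
  -- there.
  set g : ℂ → ℂ := fun z => z⁻¹ * E (z ^ 2) * E (q * z⁻¹ ^ 2) /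
    (E (a * s * z) * E (a * s * z⁻¹) * E (b * s * z) * E (b * s * z⁻¹)) with hg
  have hne : ∀ w : ℂ, ‖w‖ < 1 → E w ≠ 0 := fun w hw => by
    refine qPochInf_ne_zero hq fun i hi => ?_
    have := congrArg norm hi
    rw [norm_mul, norm_pow, norm_one] at this
    have h2 : ‖(q : ℂ)‖ ^ i ≤ 1 := pow_le_one₀ (norm_nonneg _) hq.le
    nlinarith [norm_nonneg w]
  have hss' : s ≤ s⁻¹ := hs1.le.trans (one_le_inv_iff₀.2 ⟨hs0, hs1.le⟩)
  have hgd : ∀ z : ℂ, s ≤ ‖z‖ → ‖z‖ ≤ s⁻¹ → DifferentiableAt ℂ g z := fun z hz1 hz2 => by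
      have hz0 : z ≠ 0 := norm_pos_iff.1 (hs0.trans_le hz1)
      have hz3 : s * ‖z‖ ≤ 1 := by
        calc s * ‖z‖ ≤ s * s⁻¹ := by gcongr
          _ = 1 := mul_inv_cancel₀ hs0.ne'
      have hz4 : s * ‖z‖⁻¹ ≤ 1 := by
        rw [← div_eq_mul_inv, div_le_one (hs0.trans_le hz1)]; exact hz1
      have hb1 : ∀ c : ℝ, |c| < 1 → E (c * s * z) ≠ 0 := fun c hc => hne _ (by
        rw [norm_mul, norm_mul, Complex.norm_real, Complex.norm_real, Real.norm_of_nonneg hs0.le,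
          mul_assoc]
        exact (mul_le_of_le_one_right (norm_nonneg _) hz3).trans_lt hc)
      have hb2 : ∀ c : ℝ, |c| < 1 → E (c * s * z⁻¹) ≠ 0 := fun c hc => hne _ (by
        rw [norm_mul, norm_mul, Complex.norm_real, Complex.norm_real, Real.norm_of_nonneg hs0.le,
          mul_assoc, norm_inv]
        exact (mul_le_of_le_one_right (norm_nonneg _) hz4).trans_lt hc)
      have hden : E (a * s * z) * E (a * s * z⁻¹) * E (b * s * z) * E (b * s * z⁻¹) ≠ 0 :=
        mul_ne_zero (mul_ne_zero (mul_ne_zero (hb1 a ha) (hb2 a ha)) (hb1 b hb)) (hb2 b hb)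
      have hinv : DifferentiableAt ℂ (fun z : ℂ => z⁻¹) z := differentiableAt_inv hz0
      have hcomp : ∀ {f : ℂ → ℂ}, DifferentiableAt ℂ f z → DifferentiableAt ℂ (fun z => E (f z)) z :=
        fun hf => (hEd _).comp z hf
      refine DifferentiableAt.div ?_ ?_ hden
      · exact (hinv.mul (hcomp (by fun_prop))).mul (hcomp ((hinv.pow 2).const_mul _))
      · exact (((hcomp (by fun_prop)).mul (hcomp (hinv.const_mul _))).mul
          (hcomp (by fun_prop))).mul (hcomp (hinv.const_mul _))
  have hshift := intervalIntegral_circle_eq (g := g) hs0 hss' hgd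
  -- The values of g on the two boundary circles differ, up to the factor s, by 2 cos θ - (a + b)
  -- times the weight on the unit circle. Their means agree by the contour shift.
  have hpt : ∀ θ : ℝ, s * (g (s * Complex.exp (Complex.I * θ)) -
      g ((s⁻¹ : ℝ) * Complex.exp (Complex.I * θ))) =
      ((2 * Real.cos θ - (a + b) : ℝ) : ℂ) * (E (Complex.exp (Complex.I * θ) ^ 2) *
      E ((Complex.exp (Complex.I * θ))⁻¹ ^ 2) /
      (E (a * Complex.exp (Complex.I * θ)) * E (a * (Complex.exp (Complex.I * θ))⁻¹) *
        E (b * Complex.exp (Complex.I * θ)) * E (b * (Complex.exp (Complex.I * θ))⁻¹))) := by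
    intro θ
    have hcos : ((2 * Real.cos θ - (a + b) : ℝ) : ℂ) = Complex.exp (Complex.I * θ) +
        (Complex.exp (Complex.I * θ))⁻¹ - (a + b) := by
      push_cast
      rw [Complex.cos, ← Complex.exp_neg]
      ring_nf
    rw [hcos]
    have hz1 := norm_exp_I_mul θ
    set z := Complex.exp (Complex.I * θ) with hz
    have hz0 : z ≠ 0 := Complex.exp_ne_zero _
    have hsc : (s : ℂ) ≠ 0 := by exact_mod_cast hs0.ne'
    have hqs : (q : ℂ) = s * s := by rw [← hss]; push_cast; ring
    have hqc : (q : ℂ) ≠ 0 := by exact_mod_cast hq0.ne'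
    have n1 : ∀ c : ℝ, |c| < 1 → E (c * z * q) ≠ 0 ∧ E (c * z⁻¹ * q) ≠ 0 ∧ 1 - c * z ≠ 0 ∧
        1 - c * z⁻¹ ≠ 0 := by
      intro c hc
      have m1 : ‖(c : ℂ) * z‖ < 1 := by rwa [norm_mul, hz1, mul_one, Complex.norm_real]
      have m2 : ‖(c : ℂ) * z⁻¹‖ < 1 := by
        rwa [norm_mul, norm_inv, hz1, inv_one, mul_one, Complex.norm_real]
      have k1 := hne _ m1
      have k2 := hne _ m2
      rw [hEs] at k1 k2
      exact ⟨right_ne_zero_of_mul k1, right_ne_zero_of_mul k2, left_ne_zero_of_mul k1,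
        left_ne_zero_of_mul k2⟩
    obtain ⟨a1, a2, a3, a4⟩ := n1 a ha
    obtain ⟨b1, b2, b3, b4⟩ := n1 b hb
    have i1 : (s * z)⁻¹ = (s : ℂ)⁻¹ * z⁻¹ := mul_inv _ _
    have i2 : (((s⁻¹ : ℝ) : ℂ) * z)⁻¹ = (s : ℂ) * z⁻¹ := by
      rw [mul_inv, Complex.ofReal_inv, inv_inv]
    have A : g (s * z) = (s : ℂ)⁻¹ * z⁻¹ * E (z ^ 2 * q) * ((1 - z⁻¹ ^ 2) * E (z⁻¹ ^ 2 * q)) /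
        (E (a * z * q) * ((1 - a * z⁻¹) * E (a * z⁻¹ * q)) *
          (E (b * z * q) * ((1 - b * z⁻¹) * E (b * z⁻¹ * q)))) := by
      simp only [hg]
      have e1 : (s * z) ^ 2 = z ^ 2 * q := by rw [hqs]; ring
      have e2 : q * (s * z)⁻¹ ^ 2 = z⁻¹ ^ 2 := by rw [i1, hqs]; field_simp
      have e3 : ∀ c : ℂ, c * s * (s * z) = c * z * q := fun c => by rw [hqs]; ring
      have e4 : ∀ c : ℂ, c * s * (s * z)⁻¹ = c * z⁻¹ := fun c => by rw [i1]; field_simp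
      rw [e1, e2, e3, e3, e4, e4, hEs (z⁻¹ ^ 2), hEs (a * z⁻¹), hEs (b * z⁻¹), i1]
      ring_nf
    have B : g ((s⁻¹ : ℝ) * z) = s * z⁻¹ * (-(z ^ 2 * (q : ℂ)⁻¹) * (1 - z ^ 2) * E (z ^ 2 * q) *
          E (z⁻¹ ^ 2 * q)) / (((1 - a * z) * E (a * z * q)) * E (a * z⁻¹ * q) *
          (((1 - b * z) * E (b * z * q)) * E (b * z⁻¹ * q))) := by
      simp only [hg]
      have e1 : (((s⁻¹ : ℝ) : ℂ) * z) ^ 2 = z ^ 2 * (q : ℂ)⁻¹ := by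
        rw [hqs]; push_cast; field_simp
      have e2 : q * (((s⁻¹ : ℝ) : ℂ) * z)⁻¹ ^ 2 = z⁻¹ ^ 2 * q * q := by rw [i2, hqs]; ring
      have e3 : ∀ c : ℂ, c * s * (((s⁻¹ : ℝ) : ℂ) * z) = c * z := fun c => by
        push_cast; field_simp
      have e4 : ∀ c : ℂ, c * s * (((s⁻¹ : ℝ) : ℂ) * z)⁻¹ = c * z⁻¹ * q := fun c => by
        rw [i2, hqs]; ring
      rw [e1, e2, e3, e3, e4, e4, hEs (a * z), hEs (b * z), i2, hEs (z ^ 2 * (q : ℂ)⁻¹),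
        inv_mul_cancel_right₀ hqc, hEs (z ^ 2), hEs (z⁻¹ ^ 2 * q)]
      have e5 : (1 - z ^ 2 * (q : ℂ)⁻¹) = -(z ^ 2 * (q : ℂ)⁻¹) * (1 - z⁻¹ ^ 2 * q) := by
        field_simp; ring
      rw [e5]
      congr 1 <;> ring
    rw [A, B, hEs (z ^ 2), hEs (z⁻¹ ^ 2), hEs (a * z), hEs (b * z), hEs (a * z⁻¹),
      hEs (b * z⁻¹)]
    have a5 : z - a ≠ 0 := fun h => a4 (by rw [← sub_eq_zero.1 h]; field_simp; ring)
    have b5 : z - b ≠ 0 := fun h => b4 (by rw [← sub_eq_zero.1 h]; field_simp; ring)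
    have a6 : 1 - a * z⁻¹ = (z - a) * z⁻¹ := by field_simp
    have b6 : 1 - b * z⁻¹ = (z - b) * z⁻¹ := by field_simp
    rw [a6, b6, hqs]
    generalize E (z ^ 2 * (s * s)) = w1
    generalize E (z⁻¹ ^ 2 * (s * s)) = w2
    rw [hqs] at a1 a2 b1 b2
    generalize E (a * z * (s * s)) = w3 at *
    generalize E (a * z⁻¹ * (s * s)) = w4 at *
    generalize E (b * z * (s * s)) = w5 at *
    generalize E (b * z⁻¹ * (s * s)) = w6 at *
    generalize ha7 : 1 - a * z = u at *
    generalize hb7 : 1 - b * z = v at *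
    field_simp
    rw [← ha7, ← hb7]
    ring
  have hcirc : ∀ ρ : ℝ, s ≤ ρ → ρ ≤ s⁻¹ →
      Continuous fun θ : ℝ => g (ρ * Complex.exp (Complex.I * θ)) := fun ρ h1 h2 => by
    refine continuous_iff_continuousAt.2 fun θ => ContinuousAt.comp (g := g) ?_ (by fun_prop)
    have hn : ‖(ρ : ℂ) * Complex.exp (Complex.I * θ)‖ = ρ := by
      rw [norm_mul, norm_exp_I_mul, mul_one, Complex.norm_real,
        Real.norm_of_nonneg (hs0.le.trans h1)]
    exact (hgd _ (by rw [hn]; exact h1) (by rw [hn]; exact h2)).continuousAt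
  have hcont := (hcirc s le_rfl hss').sub (hcirc s⁻¹ hss' le_rfl)
  have hre : ∀ θ : ℝ, (2 * Real.cos θ - (a + b)) * weight θ a b q = Complex.reCLM
      (s * (g (s * Complex.exp (Complex.I * θ)) - g ((s⁻¹ : ℝ) * Complex.exp (Complex.I * θ)))) := by
    intro θ
    rw [hpt, Complex.reCLM_apply, Complex.re_ofReal_mul, weight_eq_re]
  have hint : ∫ θ in (0 : ℝ)..2 * Real.pi, (2 * Real.cos θ - (a + b)) * weight θ a b q = 0 := by
    simp only [hre]
    rw [ContinuousLinearMap.intervalIntegral_comp_comm]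
    · rw [intervalIntegral.integral_const_mul, intervalIntegral.integral_sub, hshift, sub_self,
        mul_zero, map_zero]
      · exact (hcirc s le_rfl hss').intervalIntegrable _ _
      · exact (hcirc s⁻¹ hss' le_rfl).intervalIntegrable _ _
    · exact (hcont.const_mul _).intervalIntegrable _ _
  have hhalf := intervalIntegral_weight_eq_half (q := q) (fun x => 2 * x - (a + b)) a b ?_
  · rw [hint] at hhalf
    linarith
  · simp only [hre]
    exact (Complex.reCLM.continuous.comp (hcont.const_mul _)).intervalIntegrable _ _

end AlSalamChihara

/-! ### Evaluation of the weight integral for parameters in the closed unit disc -/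

namespace AlSalamChihara

open Filter Topology MeasureTheory

variable {q : ℝ}

/-- The unnormalised mass of the absolutely continuous part. -/
def weightIntegral (a b q : ℝ) : ℝ := ∫ θ in (0 : ℝ)..Real.pi, weight θ a b q

theorem weightIntegral_comm (hq0 : 0 < q) (hq1 : q < 1) (a b : ℝ) :
    weightIntegral a b q = weightIntegral b a q := by
  simp only [weightIntegral, weight_comm hq0 hq1 _ a b]

theorem ae_uIoc_pi_of_Ioo {p : ℝ → Prop} (h : ∀ θ ∈ Set.Ioo 0 Real.pi, p θ) :
    ∀ᵐ θ : ℝ, θ ∈ Set.uIoc 0 Real.pi → p θ := by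
  have : ∀ᵐ θ : ℝ, θ ≠ Real.pi := by simp [ae_iff]
  filter_upwards [this] with θ h1 h2
  rw [Set.uIoc_of_le Real.pi_pos.le] at h2
  exact h θ ⟨h2.1, lt_of_le_of_ne h2.2 h1⟩

theorem intervalIntegrable_of_bound_Ioo {f : ℝ → ℝ} (hf : Measurable f) {C : ℝ}
    (h : ∀ θ ∈ Set.Ioo 0 Real.pi, |f θ| ≤ C) : IntervalIntegrable f volume 0 Real.pi := by
  refine (intervalIntegrable_const (c := C)).mono_fun hf.aestronglyMeasurable ?_
  rw [EventuallyLE, ae_restrict_iff' measurableSet_uIoc]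
  refine ae_uIoc_pi_of_Ioo fun θ hθ => ?_
  exact (h θ hθ).trans (le_abs_self C)

theorem tendsto_weight (hq0 : 0 < q) (hq1 : q < 1) {θ : ℝ} (hθ : θ ∈ Set.Ioo 0 Real.pi)
    {a b : ℝ} {u v : ℕ → ℝ} (hu : Tendsto u atTop (𝓝 a)) (hv : Tendsto v atTop (𝓝 b)) :
    Tendsto (fun n => weight θ (u n) (v n) q) atTop (𝓝 (weight θ a b q)) := by
  have hc := continuous_qPochInf (norm_ofReal_lt_one hq0 hq1)
  have key : ∀ {a : ℝ} {u : ℕ → ℝ}, Tendsto u atTop (𝓝 a) → Tendsto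
      (fun n => ‖qPochInf (u n * Complex.exp (Complex.I * θ)) (q : ℂ)‖ ^ 2) atTop
      (𝓝 (‖qPochInf (a * Complex.exp (Complex.I * θ)) (q : ℂ)‖ ^ 2)) := fun hu => by
    refine ((hc.tendsto _).comp ?_).norm.pow 2
    exact ((Complex.continuous_ofReal.tendsto _).comp hu).mul_const _
  simp only [weight_eq hq0 hq1]
  refine tendsto_const_nhds.div ((key hu).mul (key hv)) ?_
  have h3 := norm_pos_iff.2 (qPochInf_mul_exp_ne_zero hq0 hq1 hθ a)
  have h4 := norm_pos_iff.2 (qPochInf_mul_exp_ne_zero hq0 hq1 hθ b)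
  positivity

theorem tendsto_weightIntegral (hq0 : 0 < q) (hq1 : q < 1) {a b C : ℝ} {u v : ℕ → ℝ}
    (hu : Tendsto u atTop (𝓝 a)) (hv : Tendsto v atTop (𝓝 b))
    (hC : ∀ n, ∀ θ ∈ Set.Ioo 0 Real.pi, weight θ (u n) (v n) q ≤ C) :
    Tendsto (fun n => weightIntegral (u n) (v n) q) atTop (𝓝 (weightIntegral a b q)) := by
  refine intervalIntegral.tendsto_integral_filter_of_dominated_convergence (fun _ => C)
    (Eventually.of_forall fun n => (measurable_weight hq0 hq1 _ _).aestronglyMeasurable)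
    (Eventually.of_forall fun n => ae_uIoc_pi_of_Ioo fun θ hθ => ?_)
    intervalIntegrable_const (ae_uIoc_pi_of_Ioo fun θ hθ => tendsto_weight hq0 hq1 hθ hu hv)
  rw [Real.norm_of_nonneg (weight_nonneg hq0 hq1 _ _ _)]
  exact hC n θ hθ

theorem intervalIntegrable_weight (hq0 : 0 < q) (hq1 : q < 1) {a b : ℝ} (ha : |a| < 1)
    (hb : |b| < 1) : IntervalIntegrable (fun θ => weight θ a b q) volume 0 Real.pi := by
  refine intervalIntegrable_of_bound_Ioo (measurable_weight hq0 hq1 a b)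
    (C := qPochInf (-1) q ^ 2 / qPochInf (max |a| |b|) q ^ 4) fun θ _ => ?_
  rw [abs_of_nonneg (weight_nonneg hq0 hq1 _ _ _)]
  exact weight_le hq0 hq1 (le_max_left _ _) (le_max_right _ _) (max_lt ha hb) θ

/-- The Christoffel factor is (1 - ab) - a(2 cos θ - (a + b)), and its second part integrates to
zero against the weight. -/
theorem weightIntegral_shift (hq0 : 0 < q) (hq1 : q < 1) {a b : ℝ} (ha : |a| < 1)
    (hb : |b| < 1) : weightIntegral (a * q) b q = (1 - a * b) * weightIntegral a b q := by
  have h0 := integral_weight_mul_recPoly_one hq0 hq1 ha hb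
  have hi := intervalIntegrable_weight hq0 hq1 ha hb
  have h1 : weightIntegral (a * q) b q =
      ∫ θ in (0 : ℝ)..Real.pi, ((1 - a * b) * weight θ a b q -
        a * ((2 * Real.cos θ - (a + b)) * weight θ a b q)) := by
    refine intervalIntegral.integral_congr_ae (ae_uIoc_pi_of_Ioo fun θ hθ => ?_)
    rw [← weight_shift hq0 hq1 hθ]
    ring
  rw [h1, intervalIntegral.integral_sub (hi.const_mul _)
    ((hi.continuousOn_mul (by fun_prop)).const_mul _), intervalIntegral.integral_const_mul,
    intervalIntegral.integral_const_mul, h0, weightIntegral]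
  ring

theorem abs_mul_pow_le (hq0 : 0 < q) (hq1 : q < 1) (a : ℝ) (n : ℕ) : |a * q ^ n| ≤ |a| := by
  rw [abs_mul, abs_of_nonneg (pow_nonneg hq0.le n)]
  exact mul_le_of_le_one_right (abs_nonneg a) (pow_le_one₀ hq0.le hq1.le)

/-- Iterate the shift a ↦ aq: the parameter tends to 0 and the factors build up (ab; q)_∞. -/
theorem weightIntegral_zero_left (hq0 : 0 < q) (hq1 : q < 1) {a b : ℝ} (ha : |a| < 1)
    (hb : |b| < 1) : weightIntegral 0 b q = qPochInf (a * b) q * weightIntegral a b q := by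
  have hq : ‖q‖ < 1 := by rwa [Real.norm_of_nonneg hq0.le]
  have h1 : ∀ n : ℕ, weightIntegral (a * q ^ n) b q =
      qPoch (a * b) q n * weightIntegral a b q := fun n => by
    induction n with
    | zero => simp [qPoch_zero]
    | succ n ih =>
      rw [pow_succ, ← mul_assoc,
        weightIntegral_shift hq0 hq1 ((abs_mul_pow_le hq0 hq1 a n).trans_lt ha) hb, ih, qPoch_succ]
      ring
  have h2 : Tendsto (fun n : ℕ => a * q ^ n) atTop (𝓝 0) := by
    simpa using (tendsto_pow_atTop_nhds_zero_of_lt_one hq0.le hq1).const_mul a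
  have h3 := tendsto_weightIntegral hq0 hq1 h2 (tendsto_const_nhds (x := b)) fun n θ _ =>
    weight_le hq0 hq1 ((abs_mul_pow_le hq0 hq1 a n).trans (le_max_left _ |b|))
      (le_max_right |a| _) (max_lt ha hb) θ
  refine tendsto_nhds_unique h3 (Tendsto.congr (fun n => (h1 n).symm) ?_)
  exact (tendsto_qPoch _ hq).mul_const _

theorem weightIntegral_eq_zero_zero (hq0 : 0 < q) (hq1 : q < 1) {a b : ℝ} (ha : |a| < 1)
    (hb : |b| < 1) : weightIntegral 0 0 q = qPochInf (a * b) q * weightIntegral a b q := by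
  rw [← weightIntegral_zero_left hq0 hq1 ha hb, weightIntegral_comm hq0 hq1 0 b,
    weightIntegral_zero_left hq0 hq1 (b := 0) hb (by simp), mul_zero, qPochInf_zero, one_mul]

theorem qPochInf_mul_qPochInf_neg (z : ℂ) (hq : ‖(q : ℂ)‖ < 1) :
    qPochInf z (q : ℂ) * qPochInf (-z) (q : ℂ) = qPochInf (z ^ 2) ((q : ℂ) ^ 2) := by
  have hq2 : ‖(q : ℂ) ^ 2‖ < 1 := by rw [norm_pow]; exact pow_lt_one₀ (norm_nonneg _) hq two_ne_zero
  refine tendsto_nhds_unique ((tendsto_qPoch z hq).mul (tendsto_qPoch (-z) hq))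
    ((tendsto_qPoch (z ^ 2) hq2).congr fun n => ?_)
  rw [qPoch, qPoch, qPoch, ← Finset.prod_mul_distrib]
  exact Finset.prod_congr rfl fun i _ => by ring

theorem qPochInf_even_odd (z : ℂ) (hq : ‖(q : ℂ)‖ < 1) :
    qPochInf z (q : ℂ) = qPochInf z ((q : ℂ) ^ 2) * qPochInf (z * q) ((q : ℂ) ^ 2) := by
  have hq2 : ‖(q : ℂ) ^ 2‖ < 1 := by rw [norm_pow]; exact pow_lt_one₀ (norm_nonneg _) hq two_ne_zero
  have h1 := (tendsto_qPoch z hq).comp (tendsto_id.const_mul_atTop' (r := 2) (by norm_num))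
  refine tendsto_nhds_unique h1
    (((tendsto_qPoch z hq2).mul (tendsto_qPoch (z * q) hq2)).congr fun n => ?_)
  simp only [Function.comp, id]
  induction n with
  | zero => simp [qPoch_zero]
  | succ n ih =>
    have : 2 * (n + 1) = 2 * n + 1 + 1 := by ring
    rw [this, qPoch_succ, qPoch_succ, qPoch_succ (q := (q : ℂ)), qPoch_succ (q := (q : ℂ)), ← ih]
    ring

/-- For parameters ±√q the denominator is |(q z²; q²)_∞|², which cancels every second factor of (z²;
q)_∞ and leaves the parameter-free weight with base q². -/
theorem weight_sqrt (hq0 : 0 < q) (hq1 : q < 1) {θ : ℝ} (hθ : θ ∈ Set.Ioo 0 Real.pi) :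
    weight θ (√q) (-√q) q = weight θ 0 0 (q ^ 2) := by
  have hq := norm_ofReal_lt_one hq0 hq1
  have hq20 : 0 < q ^ 2 := by positivity
  have hq21 : q ^ 2 < 1 := pow_lt_one₀ hq0.le hq1 two_ne_zero
  rw [weight_eq hq0 hq1, weight_eq hq20 hq21]
  have h1 := norm_ne_zero_iff.2 (qPochInf_mul_exp_ne_zero hq0 hq1 hθ (√q))
  have h2 := norm_ne_zero_iff.2 (qPochInf_mul_exp_ne_zero hq0 hq1 hθ (-√q))
  have e1 : Complex.exp (2 * Complex.I * θ) = Complex.exp (Complex.I * θ) ^ 2 := by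
    rw [← Complex.exp_nat_mul]; congr 1; push_cast; ring
  have e2 : (((√q : ℝ) : ℂ) * Complex.exp (Complex.I * θ)) ^ 2 =
      Complex.exp (Complex.I * θ) ^ 2 * q := by
    rw [mul_pow, ← Complex.ofReal_pow, Real.sq_sqrt hq0.le, mul_comm]
  have e3 : ((-√q : ℝ) : ℂ) * Complex.exp (Complex.I * θ) =
      -(((√q : ℝ) : ℂ) * Complex.exp (Complex.I * θ)) := by push_cast; ring
  rw [← mul_pow, ← norm_mul]
  rw [e3] at h2 ⊢
  have h3 : ‖qPochInf (((√q : ℝ) : ℂ) * Complex.exp (Complex.I * θ)) (q : ℂ) *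
      qPochInf (-(((√q : ℝ) : ℂ) * Complex.exp (Complex.I * θ))) (q : ℂ)‖ ≠ 0 := by
    rw [norm_mul]; exact mul_ne_zero h1 h2
  rw [qPochInf_mul_qPochInf_neg _ hq, e2] at h3 ⊢
  rw [e1, qPochInf_even_odd _ hq, norm_mul]
  simp only [Complex.ofReal_zero, zero_mul, qPochInf_zero, norm_one, one_pow, mul_one, div_one,
    Complex.ofReal_pow]
  field_simp

theorem qPochInf_self_sq (hq0 : 0 < q) (hq1 : q < 1) :
    qPochInf (q ^ 2) (q ^ 2) = qPochInf q q * qPochInf (-q) q := by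
  have hq : ‖q‖ < 1 := by rwa [Real.norm_of_nonneg hq0.le]
  have hq2 : ‖q ^ 2‖ < 1 := by rw [norm_pow]; exact pow_lt_one₀ (norm_nonneg _) hq two_ne_zero
  have h := qPochInf_mul_qPochInf_neg (q := q) (q : ℂ) (norm_ofReal_lt_one hq0 hq1)
  have h2 := ofReal_qPochInf (q ^ 2) hq2
  have h3 := ofReal_qPochInf (-q) hq
  rw [Complex.ofReal_pow] at h2
  rw [Complex.ofReal_neg] at h3
  rw [← ofReal_qPochInf q hq, ← h3, ← h2] at h
  exact_mod_cast h.symm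

/-- Value of the integral for vanishing parameters, by iterating `q ↦ q²`. -/
theorem weightIntegral_zero_zero (hq0 : 0 < q) (hq1 : q < 1) :
    weightIntegral 0 0 q * qPochInf q q = 2 * Real.pi := by
  -- The parameters ±√q can be removed in two ways, by passing to base q² or to zero parameters.
  -- Comparison shows that the product is invariant under q ↦ q².
  have step : ∀ q : ℝ, 0 < q → q < 1 →
      weightIntegral 0 0 (q ^ 2) * qPochInf (q ^ 2) (q ^ 2) = weightIntegral 0 0 q * qPochInf q q := by
    intro q hq0 hq1
    have hs : |√q| < 1 := by
      rw [abs_of_nonneg (Real.sqrt_nonneg q), Real.sqrt_lt' one_pos]; simpa using hq1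
    have h1 := weightIntegral_eq_zero_zero hq0 hq1 hs (b := -√q) (by rwa [abs_neg])
    have h2 : weightIntegral (√q) (-√q) q = weightIntegral 0 0 (q ^ 2) :=
      intervalIntegral.integral_congr_ae (ae_uIoc_pi_of_Ioo fun θ hθ => weight_sqrt hq0 hq1 hθ)
    rw [h2, mul_neg, Real.mul_self_sqrt hq0.le] at h1
    rw [h1, qPochInf_self_sq hq0 hq1]
    ring
  set u : ℕ → ℝ := fun n => q ^ (2 ^ n) with hu
  have hu0 : ∀ n, 0 < u n := fun n => by positivity
  have hu1 : ∀ n, u n < 1 := fun n => pow_lt_one₀ hq0.le hq1 (by positivity)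
  have hulim : Tendsto u atTop (𝓝 0) :=
    (tendsto_pow_atTop_nhds_zero_of_lt_one hq0.le hq1).comp
      (tendsto_pow_atTop_atTop_of_one_lt (by norm_num))
  have hconst : ∀ n, weightIntegral 0 0 (u n) * qPochInf (u n) (u n) =
      weightIntegral 0 0 q * qPochInf q q := fun n => by
    induction n with
    | zero => simp [hu]
    | succ n ih =>
      rw [← ih, ← step _ (hu0 n) (hu1 n)]
      have : u (n + 1) = u n ^ 2 := by simp only [hu]; rw [← pow_mul, pow_succ]
      rw [this]
  have hexp : Tendsto (fun n => Real.exp (u n / (1 - u n)) - 1) atTop (𝓝 0) := by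
    have : Tendsto (fun n => Real.exp (u n / (1 - u n)) - 1) atTop
        (𝓝 (Real.exp (0 / (1 - 0)) - 1)) :=
      ((Real.continuous_exp.tendsto _).comp (hulim.div (hulim.const_sub 1) (by norm_num))).sub_const 1
    simpa using this
  have hden : Tendsto (fun n => qPochInf (u n) (u n)) atTop (𝓝 1) := by
    rw [tendsto_iff_norm_sub_tendsto_zero]
    refine squeeze_zero (fun _ => norm_nonneg _) (fun n => ?_) hexp
    have hn : ‖u n‖ = u n := Real.norm_of_nonneg (hu0 n).le
    have := norm_qPochInf_sub_one_le (u n) (q := u n) (by rw [hn]; exact hu1 n)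
    rwa [hn] at this
  -- As the base tends to 0, (z²; q)_∞ tends to 1 - z², an elementary integrand.
  have hnum : Tendsto (fun n => weightIntegral 0 0 (u n)) atTop
      (𝓝 (∫ θ in (0 : ℝ)..Real.pi, ‖1 - Complex.exp (2 * Complex.I * θ)‖ ^ 2)) := by
    have hw : ∀ n θ, weight θ 0 0 (u n) = ‖qPochInf (Complex.exp (2 * Complex.I * θ)) (u n : ℂ)‖ ^ 2 :=
      fun n θ => by rw [weight_eq (hu0 n) (hu1 n)]; simp [qPochInf_zero]
    have hn1 : ∀ θ : ℝ, ‖Complex.exp (2 * Complex.I * θ)‖ = 1 := fun θ => by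
      have : (2 * Complex.I * θ : ℂ) = Complex.I * ((2 * θ : ℝ) : ℂ) := by push_cast; ring
      rw [this, norm_exp_I_mul]
    have hbase : ∀ (n : ℕ) (θ : ℝ), ‖qPochInf (Complex.exp (2 * Complex.I * θ) * u n) (u n : ℂ) - 1‖ ≤
        Real.exp (u n / (1 - u n)) - 1 := fun n θ => by
      have hn := norm_ofReal_lt_one (hu0 n) (hu1 n)
      have := norm_qPochInf_sub_one_le (Complex.exp (2 * Complex.I * θ) * u n) hn
      rwa [norm_mul, hn1, one_mul, Complex.norm_real, Real.norm_of_nonneg (hu0 n).le] at this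
    obtain ⟨C, hC⟩ := hexp.bddAbove_range
    refine intervalIntegral.tendsto_integral_filter_of_dominated_convergence
      (fun _ => (2 * (C + 1)) ^ 2)
      (Eventually.of_forall fun n => (measurable_weight (hu0 n) (hu1 n) _ _).aestronglyMeasurable)
      (Eventually.of_forall fun n => Eventually.of_forall fun θ _ => ?_)
      intervalIntegrable_const (Eventually.of_forall fun θ _ => ?_)
    · rw [hw, Real.norm_of_nonneg (by positivity),
        qPochInf_shift _ (norm_ofReal_lt_one (hu0 n) (hu1 n)), norm_mul]
      have h1 : ‖1 - Complex.exp (2 * Complex.I * θ)‖ ≤ 2 := by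
        refine (norm_sub_le _ _).trans ?_
        rw [hn1, norm_one]; norm_num
      have h2 : ‖qPochInf (Complex.exp (2 * Complex.I * θ) * u n) (u n : ℂ)‖ ≤ C + 1 := by
        have e1 := hbase n θ
        have e2 : Real.exp (u n / (1 - u n)) - 1 ≤ C := hC ⟨n, rfl⟩
        have e3 := norm_sub_norm_le (qPochInf (Complex.exp (2 * Complex.I * θ) * u n) (u n : ℂ)) 1
        rw [norm_one] at e3
        linarith
      gcongr
    · simp only [hw]
      refine Tendsto.pow (Tendsto.norm ?_) 2
      have h1 : Tendsto (fun n => qPochInf (Complex.exp (2 * Complex.I * θ) * u n) (u n : ℂ)) atTop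
          (𝓝 1) := by
        rw [tendsto_iff_norm_sub_tendsto_zero]
        exact squeeze_zero (fun _ => norm_nonneg _) (fun n => hbase n θ) hexp
      have h2 := h1.const_mul (1 - Complex.exp (2 * Complex.I * θ))
      rw [mul_one] at h2
      exact h2.congr fun n => (qPochInf_shift _ (norm_ofReal_lt_one (hu0 n) (hu1 n))).symm
  have hval : ∫ θ in (0 : ℝ)..Real.pi, ‖1 - Complex.exp (2 * Complex.I * θ)‖ ^ 2 = 2 * Real.pi := by
    have h1 : ∀ θ : ℝ, ‖1 - Complex.exp (2 * Complex.I * θ)‖ ^ 2 = 2 - 2 * Real.cos (2 * θ) := by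
      intro θ
      have := normSq_one_sub_exp (2 * θ) 1
      have e : (2 * Complex.I * θ : ℂ) = Complex.I * ((2 * θ : ℝ) : ℂ) := by push_cast; ring
      rw [e]
      rw [Complex.ofReal_one, one_mul] at this
      rw [this]
      ring
    simp only [h1]
    rw [intervalIntegral.integral_sub intervalIntegrable_const
      ((by fun_prop : Continuous fun θ : ℝ => 2 * Real.cos (2 * θ)).intervalIntegrable _ _),
      intervalIntegral.integral_const_mul, intervalIntegral.integral_comp_mul_left _ two_ne_zero]
    simp
    ring
  have hlim := hnum.mul hden
  rw [hval, mul_one] at hlim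
  exact tendsto_nhds_unique (tendsto_const_nhds.congr fun n => (hconst n).symm) hlim

/-- Radial limit t ↑ 1 from parameters ta, tb inside the disc. The signs of a and b place the
possible zeros of the denominator at z = 1 and z = -1 respectively, where the numerator vanishes
too, so the integrands are dominated. -/
theorem weightIntegral_eq (hq0 : 0 < q) (hq1 : q < 1) {a b : ℝ} (ha0 : 0 ≤ a) (ha1 : a ≤ 1)
    (hb0 : b ≤ 0) (hb1 : -1 ≤ b) :
    weightIntegral a b q * (qPochInf q q * qPochInf (a * b) q) = 2 * Real.pi := by
  have hq : ‖q‖ < 1 := by rwa [Real.norm_of_nonneg hq0.le]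
  set t : ℕ → ℝ := fun n => 1 - 1 / ((n : ℝ) + 1) with ht
  have htlim : Tendsto t atTop (𝓝 1) := by
    simpa [ht] using (tendsto_one_div_add_atTop_nhds_zero_nat (𝕜 := ℝ)).const_sub 1
  have ht0 : ∀ n, 0 ≤ t n := fun n => by
    simp only [ht, sub_nonneg]
    rw [div_le_one (by positivity)]
    linarith [Nat.cast_nonneg (α := ℝ) n]
  have ht1 : ∀ n, t n < 1 := fun n => by
    simp only [ht]
    have : 0 < 1 / ((n : ℝ) + 1) := by positivity
    linarith
  have hta : Tendsto (fun n => t n * a) atTop (𝓝 a) := by simpa using htlim.mul_const a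
  have htb : Tendsto (fun n => t n * b) atTop (𝓝 b) := by simpa using htlim.mul_const b
  have h1 := tendsto_weightIntegral hq0 hq1 hta htb fun n θ hθ =>
    weight_le' hq0 hq1 (mul_nonneg (ht0 n) ha0) (by nlinarith [ht0 n, ht1 n])
      (mul_nonpos_of_nonneg_of_nonpos (ht0 n) hb0) (by nlinarith [ht0 n, ht1 n]) hθ
  have h2 := (continuous_qPochInf_real hq).tendsto (a * b) |>.comp (hta.mul htb)
  have h3 := h1.mul (h2.const_mul (qPochInf q q))
  refine tendsto_nhds_unique h3 (tendsto_const_nhds.congr fun n => ?_)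
  have e1 : |t n * a| < 1 := by
    rw [abs_of_nonneg (mul_nonneg (ht0 n) ha0)]; nlinarith [ht0 n, ht1 n]
  have e2 : |t n * b| < 1 := by
    rw [abs_of_nonpos (mul_nonpos_of_nonneg_of_nonpos (ht0 n) hb0)]; nlinarith [ht0 n, ht1 n]
  rw [← weightIntegral_zero_zero hq0 hq1, weightIntegral_eq_zero_zero hq0 hq1 e1 e2]
  simp only [Function.comp]
  ring

end AlSalamChihara

/-! ### The point masses -/

namespace AlSalamChihara

open Filter Topology MeasureTheory

variable {q : ℝ}

theorem christoffel_factor_eq {z : ℝ} (hz : z ≠ 0) (a : ℝ) :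
    1 - 2 * a * ((z + z⁻¹) / 2) + a ^ 2 = (1 - a * z) * (1 - a * z⁻¹) := by
  have := mul_inv_cancel₀ hz
  linear_combination (-a ^ 2) * this

theorem one_lt_sq_of_one_lt_abs {x : ℝ} (hx : 1 < |x|) : 1 < x ^ 2 := by
  rw [← sq_abs]; nlinarith

theorem one_lt_abs_of_mul_pow (hq0 : 0 < q) (hq1 : q < 1) {a : ℝ} {k : ℕ}
    (h : 1 < |a * q ^ k|) : 1 < |a| := h.trans_le (abs_mul_pow_le hq0 hq1 a k)

theorem h₀_inv_pos (hq0 : 0 < q) (hq1 : q < 1) {a b : ℝ} (hab : a * b < 0) :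
    0 < qPochInf q q * qPochInf (a * b) q :=
  mul_pos (qPochInf_pos hq0.le hq1 hq1) (qPochInf_pos hq0.le hq1 (hab.trans one_pos))

theorem h₀_pos (hq0 : 0 < q) (hq1 : q < 1) {a b : ℝ} (hab : a * b < 0) : 0 < h₀ a b q :=
  one_div_pos.2 (h₀_inv_pos hq0 hq1 hab)

theorem h₀_comm (a b : ℝ) : h₀ a b q = h₀ b a q := by rw [h₀, h₀, mul_comm a b]

theorem h₀_shift (hq0 : 0 < q) (hq1 : q < 1) {a b : ℝ} (hab : a * b < 0) :
    h₀ (a * q) b q = (1 - a * b) * h₀ a b q := by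
  have hq : ‖q‖ < 1 := by rwa [Real.norm_of_nonneg hq0.le]
  have h := h₀_inv_pos hq0 hq1 hab
  rw [h₀, h₀]
  rw [qPochInf_shift (a * b) hq] at h ⊢
  have h1 := left_ne_zero_of_mul h.ne'
  have h2 := right_ne_zero_of_mul h.ne'
  have h3 := left_ne_zero_of_mul h2
  have h4 := right_ne_zero_of_mul h2
  have e : a * q * b = a * b * q := by ring
  rw [e]
  field_simp

/-- The only factors of doubtful sign are paired off: each (1 - a²q^i)/(a³b) with i < k is a
quotient of two negative numbers, since |a q^k| > 1 and ab < 0. -/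
theorem mass_pos (hq0 : 0 < q) (hq1 : q < 1) {a b : ℝ} (hab : a * b < 0) {k : ℕ}
    (hk : 1 < |a * q ^ k|) : 0 < mass k a b q := by
  have ha := one_lt_abs_of_mul_pow hq0 hq1 hk
  have ha0 : a ≠ 0 := fun h => by simp [h] at hab
  have hb0 : b ≠ 0 := fun h => by simp [h] at hab
  have ha2 := one_lt_sq_of_one_lt_abs ha
  have hk2 := one_lt_sq_of_one_lt_abs hk
  have hba : b / a < 0 := by
    have : b / a = a * b / a ^ 2 := by field_simp
    rw [this]; exact div_neg_of_neg_of_pos hab (by positivity)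
  have hqab : a * q / b < 0 := by
    have : a * q / b = a * b * (q / b ^ 2) := by field_simp
    rw [this]; exact mul_neg_of_neg_of_pos hab (by positivity)
  have p1 : 0 < qPochInf (a ^ 2)⁻¹ q := qPochInf_pos hq0.le hq1 (inv_lt_one_of_one_lt₀ ha2)
  have p2 := h₀_inv_pos hq0 hq1 hab
  have p3 : 0 < qPochInf (b / a) q := qPochInf_pos hq0.le hq1 (hba.trans one_pos)
  have p4 : 0 < (1 - a ^ 2 * q ^ (2 * k)) / (1 - a ^ 2) := by
    refine div_pos_of_neg_of_neg ?_ (by linarith)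
    have : a ^ 2 * q ^ (2 * k) = (a * q ^ k) ^ 2 := by ring
    rw [this]; linarith
  have p5 : 0 < qPoch (a ^ 2) q k / (a ^ 3 * b) ^ k := by
    have : qPoch (a ^ 2) q k / (a ^ 3 * b) ^ k =
        ∏ i ∈ Finset.range k, ((1 - a ^ 2 * q ^ i) / (a ^ 3 * b)) := by
      rw [Finset.prod_div_distrib, Finset.prod_const, Finset.card_range, qPoch]
    rw [this]
    refine Finset.prod_pos fun i hi => div_pos_of_neg_of_neg ?_ ?_
    · have h1 : q ^ (2 * k) ≤ q ^ i :=
        pow_le_pow_of_le_one hq0.le hq1.le (by have := Finset.mem_range.1 hi; lia)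
      have h2 : a ^ 2 * q ^ (2 * k) = (a * q ^ k) ^ 2 := by ring
      nlinarith
    · have : a ^ 3 * b = a ^ 2 * (a * b) := by ring
      rw [this]; exact mul_neg_of_pos_of_neg (by positivity) hab
  have p6 := qPoch_pos hq0.le hq1.le (hab.trans one_pos) k
  have p7 := qPoch_self_pos hq0.le hq1 k
  have p8 := qPoch_pos hq0.le hq1.le (hqab.trans one_pos) k
  have e : mass k a b q = qPochInf (a ^ 2)⁻¹ q / (qPochInf q q * qPochInf (a * b) q *
      qPochInf (b / a) q) * ((1 - a ^ 2 * q ^ (2 * k)) / (1 - a ^ 2)) *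
      (qPoch (a ^ 2) q k / (a ^ 3 * b) ^ k) * (qPoch (a * b) q k /
      (qPoch q q k * qPoch (a * q / b) q k)) / q ^ (k ^ 2) := by
    rw [mass]; ring
  rw [e]
  positivity

/-- Discrete counterpart of `weight_shift`. As a q^(k+1) = (aq) q^k, the atom of index k + 1 for a
is the atom of index k for aq. -/
theorem mass_shift_left (hq0 : 0 < q) (hq1 : q < 1) {a b : ℝ} (hab : a * b < 0) {k : ℕ}
    (hk : 1 < |a * q ^ (k + 1)|) :
    mass (k + 1) a b q * (1 - 2 * a * ((a * q ^ (k + 1) + (a * q ^ (k + 1))⁻¹) / 2) + a ^ 2) =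
      mass k (a * q) b q := by
  have hq : ‖q‖ < 1 := by rwa [Real.norm_of_nonneg hq0.le]
  have ha := one_lt_abs_of_mul_pow hq0 hq1 hk
  have ha0 : a ≠ 0 := fun h => by simp [h] at hab
  have hb0 : b ≠ 0 := fun h => by simp [h] at hab
  have hqne := hq0.ne'
  have haq : 1 < |a * q| := by
    refine one_lt_abs_of_mul_pow hq0 hq1 (k := k) ?_
    rwa [mul_assoc, ← pow_succ']
  have ha2 := one_lt_sq_of_one_lt_abs ha
  have haq2 := one_lt_sq_of_one_lt_abs haq
  have hqab : a * q / b < 0 := by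
    have : a * q / b = a * b * (q / b ^ 2) := by field_simp
    rw [this]; exact mul_neg_of_neg_of_pos hab (by positivity)
  have hqab' : a * q * q / b < 0 := by
    have : a * q * q / b = a * b * (q * q / b ^ 2) := by field_simp
    rw [this]; exact mul_neg_of_neg_of_pos hab (by positivity)
  have habq : a * b * q < 0 := mul_neg_of_neg_of_pos hab hq0
  have hbaq : b / (a * q) < 0 := by
    have : b / (a * q) = a * b / (a ^ 2 * q) := by field_simp
    rw [this]; exact div_neg_of_neg_of_pos hab (by positivity)
  rw [christoffel_factor_eq (by positivity)]
  rw [mass, mass]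
  have e1 : qPochInf ((a * q) ^ 2)⁻¹ q =
      (1 - ((a * q) ^ 2)⁻¹) * ((1 - (a ^ 2 * q)⁻¹) * qPochInf (a ^ 2)⁻¹ q) := by
    rw [qPochInf_shift ((a * q) ^ 2)⁻¹ hq]
    have : ((a * q) ^ 2)⁻¹ * q = (a ^ 2 * q)⁻¹ := by field_simp
    rw [this, qPochInf_shift (a ^ 2 * q)⁻¹ hq]
    have : (a ^ 2 * q)⁻¹ * q = (a ^ 2)⁻¹ := by field_simp
    rw [this]
  have e2 : qPochInf (b / (a * q)) q = (1 - b / (a * q)) * qPochInf (b / a) q := by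
    rw [qPochInf_shift _ hq]
    have : b / (a * q) * q = b / a := by field_simp
    rw [this]
  have e3 : qPochInf (a * b) q = (1 - a * b) * qPochInf (a * q * b) q := by
    rw [qPochInf_shift _ hq, mul_right_comm]
  have e4 : qPoch (a * b) q (k + 1) = (1 - a * b) * qPoch (a * q * b) q k := by
    rw [qPoch_succ', mul_right_comm]
  have e5 : qPoch (a * q / b) q (k + 1) = (1 - a * q / b) * qPoch (a * q * q / b) q k := by
    rw [qPoch_succ']
    congr 2
    ring
  have e6 : qPoch (a ^ 2) q (k + 1) * (1 - a ^ 2 * q ^ (k + 1)) =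
      (1 - a ^ 2) * (1 - a ^ 2 * q) * qPoch ((a * q) ^ 2) q k := by
    rw [← qPoch_succ, qPoch_succ', qPoch_succ']
    have : a ^ 2 * q * q = (a * q) ^ 2 := by ring
    rw [this]; ring
  have f1 : 1 - a * (a * q ^ (k + 1)) = 1 - a ^ 2 * q ^ (k + 1) := by ring
  have p1 : qPochInf (a ^ 2)⁻¹ q ≠ 0 := (qPochInf_pos hq0.le hq1 (inv_lt_one_of_one_lt₀ ha2)).ne'
  have p2 : qPochInf (b / a) q ≠ 0 := by
    refine right_ne_zero_of_mul (a := 1 - b / (a * q)) ?_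
    rw [← e2]; exact (qPochInf_pos hq0.le hq1 (hbaq.trans one_pos)).ne'
  have p3 : qPochInf (a * q * b) q ≠ 0 := by
    rw [mul_right_comm]; exact (qPochInf_pos hq0.le hq1 (habq.trans one_pos)).ne'
  have p4 : qPoch (a * q * b) q k ≠ 0 := by
    rw [mul_right_comm]; exact (qPoch_pos hq0.le hq1.le (habq.trans one_pos) k).ne'
  have p5 := (qPoch_pos hq0.le hq1.le (hqab'.trans one_pos) k).ne'
  have p6 := (qPoch_self_pos hq0.le hq1 k).ne'
  have p7 : 1 - q ^ (k + 1) ≠ 0 := by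
    have := pow_lt_one₀ hq0.le hq1 (n := k + 1) (by lia)
    linarith
  have p8 := (qPochInf_pos hq0.le hq1 hq1).ne'
  have p9 : 1 - a * b ≠ 0 := by linarith
  have p10 : 1 - a ^ 2 ≠ 0 := by linarith
  have p11 : 1 - (a * q) ^ 2 ≠ 0 := by linarith
  have p12 : b - a * q ≠ 0 := by
    have h : (1 - a * q / b) * b ≠ 0 := mul_ne_zero (by linarith) hb0
    rwa [sub_mul, one_mul, div_mul_cancel₀ _ hb0] at h
  rw [f1, e1, e2, e3, e4, e5, qPoch_succ q, ← pow_succ' q k]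
  have f2 : a * (a * q ^ (k + 1))⁻¹ = (q ^ (k + 1))⁻¹ := by field_simp
  rw [f2]
  have hx : q ^ (2 * (k + 1)) = (q ^ (k + 1)) ^ 2 := by ring
  have hx2 : q ^ ((k + 1) ^ 2) = q ^ (k ^ 2) * q ^ (2 * k + 1) := by rw [← pow_add]; ring_nf
  have e7 : qPoch (a ^ 2) q (k + 1) / (1 - a ^ 2) * (1 - a ^ 2 * q ^ (k + 1)) =
      (1 - a ^ 2 * q) * qPoch ((a * q) ^ 2) q k := by
    rw [div_mul_eq_mul_div, e6]; field_simp
  generalize qPoch ((a * q) ^ 2) q k = w1 at *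
  generalize qPoch (a ^ 2) q (k + 1) = w2 at *
  generalize qPochInf (a ^ 2)⁻¹ q = w3 at *
  generalize qPochInf (b / a) q = w4 at *
  generalize qPochInf (a * q * b) q = w5 at *
  generalize qPoch (a * q * b) q k = w6 at *
  generalize qPoch (a * q * q / b) q k = w7 at *
  generalize qPoch q q k = w8 at *
  generalize qPochInf q q = w9 at *
  have e8 : w2 * (1 - a ^ 2 * q ^ (k + 1)) = (1 - a ^ 2) * (1 - a ^ 2 * q) * w1 := e6
  have hL : ∀ A B C D E u v : ℝ, A / B * (C / (1 - a ^ 2)) * (w2 * D / E) / u *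
      ((1 - a ^ 2 * q ^ (k + 1)) * v) =
      (w2 / (1 - a ^ 2) * (1 - a ^ 2 * q ^ (k + 1))) * (A / B * C * (D / E) / u * v) := by
    intros; ring
  rw [hL, e7, hx, hx2]
  have g1 : 1 - a ^ 2 * (q ^ (k + 1)) ^ 2 = 1 - (a * q) ^ 2 * q ^ (2 * k) := by ring
  have g2 : 1 - ((a * q) ^ 2)⁻¹ = -(1 - (a * q) ^ 2) / (a * q) ^ 2 := by field_simp; ring
  have g3 : 1 - (a ^ 2 * q)⁻¹ = -(1 - a ^ 2 * q) / (a ^ 2 * q) := by field_simp; ring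
  have g4 : 1 - a * q / b = (b - a * q) / b := by field_simp
  have g5 : 1 - b / (a * q) = -(b - a * q) / (a * q) := by field_simp; ring
  have g6 : 1 - (q ^ (k + 1))⁻¹ = -(1 - q ^ (k + 1)) / q ^ (k + 1) := by field_simp; ring
  have g7 : ((a * q) ^ 3 * b) ^ k = (a ^ 3 * b) ^ k * q ^ (3 * k) := by
    rw [pow_mul, ← mul_pow]; ring
  have g8 : (a ^ 3 * b) ^ (k + 1) = (a ^ 3 * b) ^ k * (a ^ 3 * b) := pow_succ _ _
  have g9 : q ^ (3 * k) = q ^ (2 * k) * q ^ k := by rw [← pow_add]; ring_nf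
  have g10 : q ^ (2 * k + 1) = q ^ (2 * k) * q := pow_succ _ _
  have g11 : q ^ (k + 1) = q ^ k * q := pow_succ _ _
  have h1 : (a ^ 3 * b) ^ k ≠ 0 := by positivity
  rw [g1, g2, g3, g4, g5, g6, g7, g8, g9, g10]
  generalize 1 - (a * q) ^ 2 * q ^ (2 * k) = v1 at *
  generalize 1 - (a * q) ^ 2 = v2 at *
  generalize 1 - a ^ 2 * q = v3 at *
  generalize 1 - q ^ (k + 1) = v4 at *
  generalize b - a * q = v5 at *
  generalize 1 - a * b = v6 at *
  generalize (a ^ 3 * b) ^ k = v7 at *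
  rw [g11]
  have h2 : q ^ k ≠ 0 := by positivity
  have h3 : q ^ (2 * k) ≠ 0 := by positivity
  have h4 : q ^ (k ^ 2) ≠ 0 := by positivity
  generalize q ^ (2 * k) = v8 at *
  generalize q ^ (k ^ 2) = v9 at *
  generalize q ^ k = v10 at *
  field_simp

/-- Atoms coming from b stay in place under a ↦ aq with the same index; only their masses change,
again by the Christoffel factor. -/
theorem mass_shift_right (hq0 : 0 < q) (hq1 : q < 1) {a b : ℝ} (hab : a * b < 0) {k : ℕ}
    (hk : 1 < |b * q ^ k|) :
    mass k b a q * (1 - 2 * a * ((b * q ^ k + (b * q ^ k)⁻¹) / 2) + a ^ 2) =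
      mass k b (a * q) q := by
  have hq : ‖q‖ < 1 := by rwa [Real.norm_of_nonneg hq0.le]
  have hb := one_lt_sq_of_one_lt_abs (one_lt_abs_of_mul_pow hq0 hq1 hk)
  have ha0 : a ≠ 0 := fun h => by simp [h] at hab
  have hb0 : b ≠ 0 := fun h => by simp [h] at hab
  have hqne := hq0.ne'
  have hrat : a / b < 0 := by
    have : a / b = a * b / b ^ 2 := by field_simp
    rw [this]; exact div_neg_of_neg_of_pos hab (by positivity)
  have hrat' : b / a < 0 := by
    have : b / a = a * b / a ^ 2 := by field_simp
    rw [this]; exact div_neg_of_neg_of_pos hab (by positivity)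
  have hba : b * a < 0 := by rwa [mul_comm]
  rw [christoffel_factor_eq (by positivity), mass, mass]
  have e1 : qPochInf (a / b) q = (1 - a / b) * qPochInf (a * q / b) q := by
    rw [qPochInf_shift _ hq, div_mul_eq_mul_div]
  have e2 : qPochInf (b * a) q = (1 - b * a) * qPochInf (b * (a * q)) q := by
    rw [qPochInf_shift _ hq, mul_assoc]
  have e3 : qPoch (b * a) q k * (1 - b * a * q ^ k) = (1 - b * a) * qPoch (b * (a * q)) q k := by
    rw [← qPoch_succ, qPoch_succ', mul_assoc]
  have e4 : qPoch (b / a) q k * (1 - b / a * q ^ k) = (1 - b / a) * qPoch (b * q / a) q k := by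
    rw [← qPoch_succ, qPoch_succ', div_mul_eq_mul_div]
  have e5 : b * q / (a * q) = b / a := by field_simp
  have p1 := (qPoch_pos hq0.le hq1.le (hrat'.trans one_pos) k).ne'
  have p2 := (qPoch_pos hq0.le hq1.le (hba.trans one_pos) k).ne'
  have p3 : qPochInf (b * (a * q)) q ≠ 0 := by
    refine right_ne_zero_of_mul (a := 1 - b * a) ?_
    rw [← e2]; exact (qPochInf_pos hq0.le hq1 (hba.trans one_pos)).ne'
  have p4 : qPochInf (a * q / b) q ≠ 0 := by
    refine right_ne_zero_of_mul (a := 1 - a / b) ?_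
    rw [← e1]; exact (qPochInf_pos hq0.le hq1 (hrat.trans one_pos)).ne'
  have hqk : 0 < q ^ k := by positivity
  have p5 : 1 - b / a * q ^ k ≠ 0 := by nlinarith
  have p6 : 1 - b / a ≠ 0 := by linarith
  have p7 : 1 - a / b ≠ 0 := by linarith
  have p8 : 1 - b * a ≠ 0 := by linarith
  have p9 := (qPoch_self_pos hq0.le hq1 k).ne'
  have p10 := (qPochInf_pos hq0.le hq1 hq1).ne'
  have p11 : 1 - b ^ 2 ≠ 0 := by linarith
  have e6 : qPoch (b * q / a) q k = qPoch (b / a) q k * (1 - b / a * q ^ k) / (1 - b / a) := by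
    rw [e4, mul_div_cancel_left₀ _ p6]
  have e7 : qPoch (b * (a * q)) q k = qPoch (b * a) q k * (1 - b * a * q ^ k) / (1 - b * a) := by
    rw [e3, mul_div_cancel_left₀ _ p8]
  rw [e1, e2, e5, e6, e7]
  have f1 : (b ^ 3 * (a * q)) ^ k = (b ^ 3 * a) ^ k * q ^ k := by ring
  rw [f1]
  have p12 : a - b * q ^ k ≠ 0 := by
    have h := mul_ne_zero p5 ha0
    have e : (1 - b / a * q ^ k) * a = a - b * q ^ k := by field_simp
    rwa [e] at h
  have p13 : a - b ≠ 0 := by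
    have h := mul_ne_zero p6 ha0
    rwa [sub_mul, one_mul, div_mul_cancel₀ _ ha0] at h
  have p14 : b - a ≠ 0 := fun h => p13 (by linarith)
  have g1 : 1 - b / a * q ^ k = (a - b * q ^ k) / a := by field_simp
  have g2 : 1 - b / a = (a - b) / a := by field_simp
  have g3 : 1 - a / b = (b - a) / b := by field_simp
  have g4 : 1 - a * (b * q ^ k)⁻¹ = -((a - b * q ^ k) / (b * q ^ k)) := by field_simp; ring
  rw [g1, g2, g3, g4]
  generalize a - b * q ^ k = u at *
  generalize hv : a - b = v at *
  have hv' : b - a = -v := by linarith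
  rw [hv'] at *
  generalize 1 - b * a = w at *
  generalize qPochInf (b * (a * q)) q = w1 at *
  generalize qPochInf (a * q / b) q = w2 at *
  generalize qPochInf q q = w3 at *
  generalize qPoch (b / a) q k = w4 at *
  generalize qPoch (b * a) q k = w5 at *
  generalize qPoch q q k = w6 at *
  generalize 1 - b ^ 2 = w7 at *
  field_simp

end AlSalamChihara

/-! ### The orthogonality measure -/

namespace AlSalamChihara

open Filter Topology MeasureTheory

variable {q : ℝ}

theorem lintegral_discretePart (a b q : ℝ) {f : ℝ → ℝ≥0∞} (hf : Measurable f) :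
    ∫⁻ x, f x ∂discretePart a b q = ∑' k : ℕ, if 1 < |a * q ^ k| then
      ENNReal.ofReal (mass k a b q / h₀ a b q) * f ((a * q ^ k + (a * q ^ k)⁻¹) / 2) else 0 := by
  rw [discretePart, lintegral_sum_measure]
  refine tsum_congr fun k => ?_
  split_ifs
  · rw [lintegral_smul_measure, lintegral_dirac' _ hf, smul_eq_mul]
  · rw [lintegral_zero_measure]

theorem lintegral_measure (hq0 : 0 < q) (hq1 : q < 1) (a b : ℝ) {f : ℝ → ℝ≥0∞}
    (hf : Measurable f) : ∫⁻ x, f x ∂measure a b q =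
      (∫⁻ θ in Set.Ioo 0 Real.pi,
        ENNReal.ofReal (weight θ a b q / (2 * Real.pi * h₀ a b q)) * f (Real.cos θ)) +
      (∑' k : ℕ, if 1 < |a * q ^ k| then
        ENNReal.ofReal (mass k a b q / h₀ a b q) * f ((a * q ^ k + (a * q ^ k)⁻¹) / 2) else 0) +
      (∑' k : ℕ, if 1 < |b * q ^ k| then
        ENNReal.ofReal (mass k b a q / h₀ b a q) * f ((b * q ^ k + (b * q ^ k)⁻¹) / 2) else 0) := by
  rw [measure, lintegral_add_measure, lintegral_add_measure, lintegral_discretePart a b q hf,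
    lintegral_discretePart b a q hf, lintegral_map hf Real.measurable_cos,
    lintegral_withDensity_eq_lintegral_mul _
      ((measurable_weight hq0 hq1 a b).div_const _).ennreal_ofReal (hf.fun_comp Real.measurable_cos)]
  rfl

theorem measure_comm (hq0 : 0 < q) (hq1 : q < 1) (a b : ℝ) : measure a b q = measure b a q := by
  rw [measure, measure, add_assoc, add_assoc, add_comm (discretePart a b q)]
  simp only [weight_comm hq0 hq1 _ a b, h₀_comm a b]

theorem ae_measure (hq0 : 0 < q) (hq1 : q < 1) (a b : ℝ) {p : ℝ → Prop}
    (hp : MeasurableSet {x | p x})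
    (h : ∀ θ ∈ Set.Ioo 0 Real.pi, p (Real.cos θ))
    (ha : ∀ k, 1 < |a * q ^ k| → p ((a * q ^ k + (a * q ^ k)⁻¹) / 2))
    (hb : ∀ k, 1 < |b * q ^ k| → p ((b * q ^ k + (b * q ^ k)⁻¹) / 2)) :
    ∀ᵐ x ∂measure a b q, p x := by
  have hn : ∀ x, p x → ({x | p x}ᶜ).indicator (1 : ℝ → ℝ≥0∞) x = 0 := fun x hx => by simp [hx]
  rw [ae_iff, ← Set.compl_ofPred, ← lintegral_indicator_one hp.compl, lintegral_measure hq0 hq1]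
  · simp only [add_eq_zero, ENNReal.tsum_eq_zero]
    refine ⟨⟨?_, fun k => ?_⟩, fun k => ?_⟩
    · refine (setLIntegral_congr_fun (g := fun _ => 0) measurableSet_Ioo fun θ hθ => ?_).trans (by simp)
      simp only [hn _ (h θ hθ), mul_zero]
    · split_ifs with hk
      · rw [hn _ (ha k hk), mul_zero]
      · rfl
    · split_ifs with hk
      · rw [hn _ (hb k hk), mul_zero]
      · rfl
  · exact measurable_one.indicator hp.compl

/-- The Christoffel transformation: `weight_shift` for the continuous part, `mass_shift_left` and
`mass_shift_right` for the atoms. The factor vanishes at the first atom of a, which therefore drops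
out. -/
theorem measure_withDensity (hq0 : 0 < q) (hq1 : q < 1) {a b : ℝ} (hab : a * b < 0) :
    (measure a b q).withDensity (fun x => ENNReal.ofReal (1 - 2 * a * x + a ^ 2)) =
      ENNReal.ofReal (1 - a * b) • measure (a * q) b q := by
  have hd : Measurable fun x : ℝ => ENNReal.ofReal (1 - 2 * a * x + a ^ 2) := by fun_prop
  have habq : a * q * b < 0 := by
    rw [mul_right_comm]; exact mul_neg_of_neg_of_pos hab hq0
  have hba : b * a < 0 := by rwa [mul_comm]
  have hpos : 0 < 1 - a * b := by linarith
  have hh := h₀_pos hq0 hq1 hab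
  have ha0 : a ≠ 0 := fun h => by simp [h] at hab
  have key : ∀ x : ℝ, x / h₀ a b q = (1 - a * b) * (x / h₀ (a * q) b q) := fun x => by
    rw [h₀_shift hq0 hq1 hab]; field_simp
  refine Measure.ext_of_lintegral _ fun f hf => ?_
  rw [lintegral_withDensity_eq_lintegral_mul _ hd hf, lintegral_smul_measure,
    lintegral_measure hq0 hq1 a b (hd.mul hf), lintegral_measure hq0 hq1 _ b hf, smul_add, smul_add]
  congr 1
  · congr 1
    · rw [smul_eq_mul, ← lintegral_const_mul]
      · refine setLIntegral_congr_fun measurableSet_Ioo fun θ hθ => ?_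
        simp only [Pi.mul_apply]
        rw [← mul_assoc, ← mul_assoc, ← ENNReal.ofReal_mul hpos.le, ← ENNReal.ofReal_mul,
          ← weight_shift hq0 hq1 hθ]
        · congr 2
          rw [h₀_shift hq0 hq1 hab]
          have := Real.pi_pos
          field_simp
        · have := weight_nonneg hq0 hq1 θ a b
          have := Real.pi_pos
          positivity
      · exact ((measurable_weight hq0 hq1 _ b).div_const _).ennreal_ofReal.mul
          (hf.comp Real.measurable_cos)
    · rw [tsum_eq_zero_add' ENNReal.summable, smul_eq_mul, ← ENNReal.tsum_mul_left]
      rw [pow_zero, mul_one, Pi.mul_apply, christoffel_factor_eq ha0, mul_inv_cancel₀ ha0,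
        sub_self, mul_zero, ENNReal.ofReal_zero, zero_mul, mul_zero, ite_self, zero_add]
      refine tsum_congr fun k => ?_
      have e : a * q * q ^ k = a * q ^ (k + 1) := by ring
      rw [e]
      split_ifs with hk
      · rw [Pi.mul_apply, ← mul_assoc, ← mul_assoc, ← ENNReal.ofReal_mul hpos.le,
          ← ENNReal.ofReal_mul (div_nonneg (mass_pos hq0 hq1 hab hk).le hh.le),
          div_mul_eq_mul_div, mass_shift_left hq0 hq1 hab hk, key]
      · rw [mul_zero]
  · rw [smul_eq_mul, ← ENNReal.tsum_mul_left]
    refine tsum_congr fun k => ?_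
    split_ifs with hk
    · rw [Pi.mul_apply, ← mul_assoc, ← mul_assoc, ← ENNReal.ofReal_mul hpos.le,
        ← ENNReal.ofReal_mul (div_nonneg (mass_pos hq0 hq1 hba hk).le (by rw [h₀_comm]; exact hh.le)),
        div_mul_eq_mul_div, mass_shift_right hq0 hq1 hab hk, h₀_comm b a, h₀_comm b (a * q), key]
    · rw [mul_zero]

/-- Away from the first mass point the Christoffel factor is bounded below. -/
theorem exists_christoffel_bound (hq0 : 0 < q) (hq1 : q < 1) {a b : ℝ} (hab : a * b < 0)
    (ha : 1 < |a|) : ∃ c > 0, (∀ θ ∈ Set.Ioo 0 Real.pi, c ≤ 1 - 2 * a * Real.cos θ + a ^ 2) ∧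
      (∀ k, 1 < |a * q ^ (k + 1)| →
        c ≤ 1 - 2 * a * ((a * q ^ (k + 1) + (a * q ^ (k + 1))⁻¹) / 2) + a ^ 2) ∧
      (∀ k, 1 < |b * q ^ k| → c ≤ 1 - 2 * a * ((b * q ^ k + (b * q ^ k)⁻¹) / 2) + a ^ 2) := by
  have ha0 : a ≠ 0 := fun h => by simp [h] at hab
  have hb0 : b ≠ 0 := fun h => by simp [h] at hab
  have hq2 : 1 < q⁻¹ := (one_lt_inv₀ hq0).2 hq1
  have hp : 0 < (|a| - 1) ^ 2 := by have : 0 < |a| - 1 := by linarith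
                                    positivity
  have hp2 : 0 < (q⁻¹ - 1) ^ 2 := by have : 0 < q⁻¹ - 1 := by linarith
                                     positivity
  refine ⟨min ((|a| - 1) ^ 2) (min ((q⁻¹ - 1) ^ 2) 1), by positivity, fun θ _ => ?_, fun k hk => ?_,
    fun k hk => ?_⟩
  · refine (min_le_left _ _).trans ?_
    have h1 : a * Real.cos θ ≤ |a| := by
      refine (le_abs_self _).trans ?_
      rw [abs_mul]
      exact mul_le_of_le_one_right (abs_nonneg _) (Real.abs_cos_le_one θ)
    nlinarith [sq_abs a]
  · refine ((min_le_right _ _).trans (min_le_left _ _)).trans ?_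
    have hpow : q ^ (k + 1) ≠ 0 := by positivity
    rw [christoffel_factor_eq (by positivity)]
    have h1 := one_lt_sq_of_one_lt_abs hk
    have h2 : q⁻¹ ≤ (q ^ (k + 1))⁻¹ := by
      rw [inv_le_inv₀ hq0 (by positivity), pow_succ']
      exact mul_le_of_le_one_right hq0.le (pow_le_one₀ hq0.le hq1.le)
    have e1 : a * (a * q ^ (k + 1))⁻¹ = (q ^ (k + 1))⁻¹ := by field_simp
    have e2 : a * (a * q ^ (k + 1)) = (a * q ^ (k + 1)) ^ 2 * (q ^ (k + 1))⁻¹ := by field_simp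
    rw [e1, e2]
    have h3 : q⁻¹ ≤ (a * q ^ (k + 1)) ^ 2 * (q ^ (k + 1))⁻¹ := by nlinarith
    nlinarith
  · refine ((min_le_right _ _).trans (min_le_right _ _)).trans ?_
    have hpow : 0 < q ^ k := by positivity
    rw [christoffel_factor_eq (by positivity)]
    have e1 : a * (b * q ^ k) = a * b * q ^ k := by ring
    have e2 : a * (b * q ^ k)⁻¹ = a * b * ((b ^ 2 * q ^ k)⁻¹) := by field_simp
    rw [e1, e2]
    have h1 : a * b * q ^ k < 0 := mul_neg_of_neg_of_pos hab hpow
    have h2 : a * b * (b ^ 2 * q ^ k)⁻¹ < 0 := mul_neg_of_neg_of_pos hab (by positivity)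
    nlinarith

end AlSalamChihara

/-! ### Normalisation and orthogonality -/

namespace AlSalamChihara

open Filter Topology MeasureTheory

variable {q : ℝ}

theorem exists_ae_abs_le (hq0 : 0 < q) (hq1 : q < 1) (a b : ℝ) :
    ∃ R, ∀ᵐ x ∂measure a b q, |x| ≤ R := by
  have key : ∀ (c : ℝ) (k : ℕ), 1 < |c * q ^ k| →
      |(c * q ^ k + (c * q ^ k)⁻¹) / 2| ≤ |c| := fun c k hk => by
    have h1 := abs_mul_pow_le hq0 hq1 c k
    have h2 : |(c * q ^ k)⁻¹| ≤ 1 := by rw [abs_inv]; exact inv_le_one_of_one_le₀ hk.le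
    rw [abs_div, abs_two]
    have := abs_add_le (c * q ^ k) (c * q ^ k)⁻¹
    linarith
  refine ⟨1 + |a| + |b|, ae_measure hq0 hq1 a b ?_ (fun θ _ => ?_) (fun k hk => ?_) fun k hk => ?_⟩
  · exact measurableSet_le continuous_abs.measurable measurable_const
  · have := Real.abs_cos_le_one θ
    have := abs_nonneg a
    have := abs_nonneg b
    linarith
  · have := key a k hk
    have := abs_nonneg b
    linarith
  · have := key b k hk
    have := abs_nonneg a
    linarith

theorem integrable_of_continuous (hq0 : 0 < q) (hq1 : q < 1) {a b : ℝ}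
    [IsFiniteMeasure (measure a b q)] {E : Type*} [NormedAddCommGroup E] [SecondCountableTopology E]
    {f : ℝ → E} (hf : Continuous f) :
    Integrable f (measure a b q) := by
  obtain ⟨R, hR⟩ := exists_ae_abs_le hq0 hq1 a b
  obtain ⟨C, hC⟩ := (isCompact_Icc (a := -R) (b := R)).exists_bound_of_continuousOn hf.continuousOn
  refine Integrable.of_bound hf.aestronglyMeasurable C ?_
  filter_upwards [hR] with x hx
  exact hC x (abs_le.1 hx)

/-- The measure is finite and the polynomials of positive degree integrate to zero. -/
structure IsNormalized (a b q : ℝ) : Prop where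
  finite : IsFiniteMeasure (measure a b q)
  integral : ∀ n, ∫ x, recPoly x a b q n ∂measure a b q = if n = 0 then 1 else 0

theorem IsNormalized.comm (hq0 : 0 < q) (hq1 : q < 1) {a b : ℝ} (h : IsNormalized a b q) :
    IsNormalized b a q where
  finite := by rw [measure_comm hq0 hq1]; exact h.finite
  integral n := by
    rw [measure_comm hq0 hq1, ← h.integral n]
    simp only [recPoly_comm _ b a]

/-- Multiplication by 2x is symmetric for the integral, so the Gram matrix is fixed by its first
row, and that row is what `IsNormalized` provides. -/
theorem IsNormalized.integral_mul {a b : ℝ} (hq0 : 0 < q) (hq1 : q < 1) (h : IsNormalized a b q)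
    (m n : ℕ) : ∫ x, recPoly x a b q m * recPoly x a b q n ∂measure a b q =
      if m = n then qPoch q q m * qPoch (a * b) q m else 0 := by
  have := h.finite
  have hi : ∀ m n, Integrable (fun x => recPoly x a b q m * recPoly x a b q n) (measure a b q) :=
    fun m n => integrable_of_continuous hq0 hq1
      ((continuous_recPoly a b q m).mul (continuous_recPoly a b q n))
  rw [gram_eq_of_recurrence (A := fun n => (a + b) * q ^ n)
    (C := fun n => (1 - q ^ n) * (1 - a * b * q ^ (n - 1 : ℕ)))
    (L := fun m n => ∫ x, recPoly x a b q m * recPoly x a b q n ∂measure a b q) (by simp) ?_ ?_ m n]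
  · congr 1
    rw [qPoch, qPoch, ← Finset.prod_mul_distrib]
    refine Finset.prod_congr rfl fun i _ => ?_
    rw [Nat.add_sub_cancel, pow_succ']
  · intro m n
    have hadd : ∀ (c d : ℝ) (i j k l m n : ℕ),
        ∫ x, recPoly x a b q i * recPoly x a b q j ∂measure a b q +
          c * ∫ x, recPoly x a b q k * recPoly x a b q l ∂measure a b q +
          d * ∫ x, recPoly x a b q m * recPoly x a b q n ∂measure a b q =
        ∫ x, (recPoly x a b q i * recPoly x a b q j + c * (recPoly x a b q k * recPoly x a b q l) +
          d * (recPoly x a b q m * recPoly x a b q n)) ∂measure a b q := fun c d i j k l m n => by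
      rw [← integral_const_mul, ← integral_const_mul, ← integral_add (hi _ _) ((hi _ _).const_mul _)]
      exact (integral_add ((hi _ _).add ((hi _ _).const_mul _)) ((hi _ _).const_mul _)).symm
    simp only [hadd]
    refine integral_congr_ae (ae_of_all _ fun x => ?_)
    have h1 := two_mul_recPoly x a b q m
    have h2 := two_mul_recPoly x a b q n
    simp only
    linear_combination recPoly x a b q m * h2 - recPoly x a b q n * h1
  · intro n
    simpa only [recPoly_zero, one_mul] using h.integral n

/-- Bochner version of `measure_withDensity`; positivity of the factor almost everywhere is needed
because a density is truncated at 0. -/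
theorem integral_shift (hq0 : 0 < q) (hq1 : q < 1) {a b : ℝ} (hab : a * b < 0) (f : ℝ → ℝ)
    (hpos : ∀ᵐ x ∂measure a b q, 0 ≤ 1 - 2 * a * x + a ^ 2) :
    ∫ x, (1 - 2 * a * x + a ^ 2) * f x ∂measure a b q =
      (1 - a * b) * ∫ x, f x ∂measure (a * q) b q := by
  have h := congrArg (fun m => ∫ x, f x ∂m) (measure_withDensity hq0 hq1 hab)
  rw [integral_smul_measure, ENNReal.toReal_ofReal (by linarith), smul_eq_mul,
    integral_withDensity_eq_integral_toReal_smul (by fun_prop) (by simp)] at h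
  rw [← h]
  refine integral_congr_ae ?_
  filter_upwards [hpos] with x hx
  rw [ENNReal.toReal_ofReal hx, smul_eq_mul]

theorem christoffel_nonneg_ae (hq0 : 0 < q) (hq1 : q < 1) {a b : ℝ} (hab : a * b < 0)
    (ha : 1 < |a|) : ∀ᵐ x ∂measure a b q, 0 ≤ 1 - 2 * a * x + a ^ 2 := by
  obtain ⟨c, hc, h1, h2, h3⟩ := exists_christoffel_bound hq0 hq1 hab ha
  have ha0 : a ≠ 0 := fun h => by simp [h] at hab
  refine ae_measure hq0 hq1 a b (measurableSet_le measurable_const (by fun_prop))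
    (fun θ hθ => hc.le.trans (h1 θ hθ)) (fun k hk => ?_) (fun k hk => hc.le.trans (h3 k hk))
  cases k with
  | zero => simp only [pow_zero, mul_one]
            rw [christoffel_factor_eq ha0, mul_inv_cancel₀ ha0, sub_self, mul_zero]
  | succ k => exact hc.le.trans (h2 k hk)

theorem mass_zero_div_h₀ (hq0 : 0 < q) (hq1 : q < 1) {a b : ℝ} (hab : a * b < 0) (ha : 1 < |a|) :
    mass 0 a b q / h₀ a b q = qPochInf (a ^ 2)⁻¹ q / qPochInf (b / a) q := by
  have h := h₀_inv_pos hq0 hq1 hab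
  have ha2 := one_lt_sq_of_one_lt_abs ha
  have h2 : 1 - a ^ 2 ≠ 0 := by linarith
  rw [mass, h₀]
  simp only [qPoch_zero, mul_zero, pow_zero, mul_one, div_one, zero_pow two_ne_zero,
    div_self h2]
  rw [div_div_eq_mul_div, div_one, mul_comm (qPochInf q q * _) (qPochInf (b / a) q), ← div_div,
    div_mul_cancel₀ _ h.ne']

/-- The Christoffel factor vanishes at this point and is bounded below on the rest of the mass, so
no other part of the measure contributes. -/
theorem measure_singleton (hq0 : 0 < q) (hq1 : q < 1) {a b : ℝ} (hab : a * b < 0)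
    (ha : 1 < |a|) : measure a b q {(a + a⁻¹) / 2} =
      ENNReal.ofReal (qPochInf (a ^ 2)⁻¹ q / qPochInf (b / a) q) := by
  obtain ⟨c, hc, h1, h2, h3⟩ := exists_christoffel_bound hq0 hq1 hab ha
  have ha0 : a ≠ 0 := fun h => by simp [h] at hab
  have hne : ∀ x, c ≤ 1 - 2 * a * x + a ^ 2 →
      ({(a + a⁻¹) / 2} : Set ℝ).indicator (1 : ℝ → ℝ≥0∞) x = 0 := fun x hx => by
    refine Set.indicator_of_notMem (fun h => ?_) _
    rw [Set.mem_singleton_iff.1 h, christoffel_factor_eq ha0, mul_inv_cancel₀ ha0, sub_self,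
      mul_zero] at hx
    exact hc.not_ge hx
  rw [← lintegral_indicator_one (measurableSet_singleton _), lintegral_measure hq0 hq1 a b
    (measurable_one.indicator (measurableSet_singleton _))]
  rw [tsum_eq_zero_add' ENNReal.summable]
  have e1 : ∫⁻ θ in Set.Ioo 0 Real.pi, ENNReal.ofReal (weight θ a b q / (2 * Real.pi * h₀ a b q)) *
      ({(a + a⁻¹) / 2} : Set ℝ).indicator 1 (Real.cos θ) = 0 := by
    refine (setLIntegral_congr_fun (g := fun _ => 0) measurableSet_Ioo fun θ hθ => ?_).trans
      (by simp)
    simp only [hne _ (h1 θ hθ), mul_zero]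
  rw [e1, ENNReal.tsum_eq_zero.2 fun k => ?_, ENNReal.tsum_eq_zero.2 fun k => ?_]
  · simp only [pow_zero, mul_one, if_pos ha, zero_add, add_zero]
    rw [Set.indicator_of_mem (Set.mem_singleton _), Pi.one_apply, mul_one,
      mass_zero_div_h₀ hq0 hq1 hab ha]
  · split_ifs with hk
    · rw [hne _ (h3 k hk), mul_zero]
    · rfl
  · split_ifs with hk
    · rw [hne _ (h2 k hk), mul_zero]
    · rfl

end AlSalamChihara

/-! ### Normalisation for parameters of modulus at most one, and tools for the outward step -/

namespace AlSalamChihara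

open Filter Topology MeasureTheory

variable {q : ℝ}

theorem discretePart_eq_zero (hq0 : 0 < q) (hq1 : q < 1) {a : ℝ} (b : ℝ) (ha : |a| ≤ 1) :
    discretePart a b q = 0 := by
  have h : ∀ k : ℕ, ¬ 1 < |a * q ^ k| := fun k =>
    not_lt.2 ((abs_mul_pow_le hq0 hq1 a k).trans ha)
  simp only [discretePart, if_neg (h _), Measure.sum_zero]

theorem measure_univ_of_le_one (hq0 : 0 < q) (hq1 : q < 1) {a b : ℝ} (ha0 : 0 < a) (ha : a ≤ 1)
    (hb0 : b < 0) (hb : -1 ≤ b) : measure a b q Set.univ = 1 := by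
  have hab := mul_neg_of_pos_of_neg ha0 hb0
  have hh := h₀_pos hq0 hq1 hab
  have hpi := Real.pi_pos
  rw [measure, discretePart_eq_zero hq0 hq1 b (abs_le.2 ⟨by linarith, ha⟩),
    discretePart_eq_zero hq0 hq1 a (abs_le.2 ⟨hb, by linarith⟩), add_zero, add_zero,
    Measure.map_apply Real.measurable_cos MeasurableSet.univ, Set.preimage_univ,
    withDensity_apply _ MeasurableSet.univ, Measure.restrict_univ,
    ← ofReal_integral_eq_lintegral_ofReal]
  · rw [integral_div, ← integral_Ioc_eq_integral_Ioo, ← intervalIntegral.integral_of_le hpi.le,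
      ENNReal.ofReal_eq_one]
    change weightIntegral a b q / _ = 1
    have h := weightIntegral_eq hq0 hq1 ha0.le ha hb0.le hb
    rw [h₀, ← h]
    have h1 := (h₀_inv_pos hq0 hq1 hab).ne'
    rw [mul_one_div, mul_div_cancel_right₀ _ h1, div_self]
    exact left_ne_zero_of_mul (h.trans_ne (by positivity))
  · have h := intervalIntegrable_of_bound_Ioo (measurable_weight hq0 hq1 a b)
      (C := 16 * qPochInf (-q) q ^ 2 / qPochInf q q ^ 4) fun θ hθ => by
        rw [abs_of_nonneg (weight_nonneg hq0 hq1 θ a b)]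
        exact weight_le' hq0 hq1 ha0.le ha hb0.le hb hθ
    rw [intervalIntegrable_iff_integrableOn_Ioo_of_le hpi.le] at h
    exact h.div_const _
  · refine ae_of_all _ fun θ => ?_
    have := weight_nonneg hq0 hq1 θ a b
    positivity

/-- Integrating the Christoffel relation computes the integral of p_(n+1) for a from those of p_n
for a and for aq. Once all measures along a, aq, aq², … have mass one, induction on the degree runs
for all of them at once. -/
theorem IsNormalized.of_forall_pow (hq0 : 0 < q) (hq1 : q < 1) {a b : ℝ} (hab : a * b < 0)
    (h : ∀ j : ℕ, measure (a * q ^ j) b q Set.univ = 1)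
    (hpos : ∀ j : ℕ, ∀ᵐ x ∂measure (a * q ^ j) b q,
      0 ≤ 1 - 2 * (a * q ^ j) * x + (a * q ^ j) ^ 2) :
    IsNormalized a b q := by
  have hf : ∀ j, IsFiniteMeasure (measure (a * q ^ j) b q) := fun j => ⟨by rw [h j]; simp⟩
  have key : ∀ n j, ∫ x, recPoly x (a * q ^ j) b q n ∂measure (a * q ^ j) b q =
      if n = 0 then 1 else 0 := by
    intro n
    induction n with
    | zero => intro j; simp [recPoly_zero, measureReal_def, h j]
    | succ n ih =>
      intro j
      have := hf j
      have hqj : 0 < q ^ j := by positivity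
      have hab' : a * q ^ j * b < 0 := by
        rw [mul_right_comm]; exact mul_neg_of_neg_of_pos hab hqj
      have ha0 : a * q ^ j ≠ 0 := fun h => by simp [h] at hab'
      have e := integral_shift hq0 hq1 hab' (fun x => recPoly x (a * q ^ j * q) b q n) (hpos j)
      have e1 : a * q ^ j * q = a * q ^ (j + 1) := by ring
      simp only [recPoly_christoffel] at e
      rw [e1, ih (j + 1), integral_sub, integral_const_mul, integral_const_mul, ih j] at e
      · have e2 : (1 - a * q ^ j * b * q ^ n) * (if n = 0 then 1 else 0 : ℝ) =
            (1 - a * q ^ j * b) * (if n = 0 then 1 else 0 : ℝ) := by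
          split_ifs with hn
          · simp [hn]
          · simp
        rw [e2, sub_eq_self] at e
        rw [if_neg (Nat.succ_ne_zero n)]
        exact (mul_eq_zero.1 e).resolve_left ha0
      · exact integrable_of_continuous hq0 hq1 ((continuous_recPoly _ _ _ _).const_mul _)
      · exact integrable_of_continuous hq0 hq1 ((continuous_recPoly _ _ _ _).const_mul _)
  refine ⟨by simpa using hf 0, fun n => by simpa using key n 0⟩

theorem christoffel_nonneg_of_abs_le {x : ℝ} (hx : |x| ≤ 1) (a : ℝ) :
    0 ≤ 1 - 2 * a * x + a ^ 2 := by
  have := abs_le.1 hx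
  nlinarith [sq_nonneg (a - x)]

theorem ae_abs_le_one (hq0 : 0 < q) (hq1 : q < 1) {a b : ℝ} (ha : |a| ≤ 1) (hb : |b| ≤ 1) :
    ∀ᵐ x ∂measure a b q, |x| ≤ 1 :=
  ae_measure hq0 hq1 a b (measurableSet_le continuous_abs.measurable measurable_const)
    (fun θ _ => Real.abs_cos_le_one θ)
    (fun k hk => absurd (hk.trans_le (abs_mul_pow_le hq0 hq1 a k)) (not_lt.2 ha))
    (fun k hk => absurd (hk.trans_le (abs_mul_pow_le hq0 hq1 b k)) (not_lt.2 hb))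

theorem isNormalized_of_abs_le_one (hq0 : 0 < q) (hq1 : q < 1) {a b : ℝ} (ha0 : 0 < a)
    (ha : a ≤ 1) (hb0 : b < 0) (hb : -1 ≤ b) : IsNormalized a b q := by
  have h1 : ∀ j : ℕ, 0 < a * q ^ j := fun j => by positivity
  have h2 : ∀ j : ℕ, a * q ^ j ≤ 1 := fun j =>
    mul_le_one₀ ha (by positivity) (pow_le_one₀ hq0.le hq1.le)
  refine .of_forall_pow hq0 hq1 (mul_neg_of_pos_of_neg ha0 hb0)
    (fun j => measure_univ_of_le_one hq0 hq1 (h1 j) (h2 j) hb0 hb) fun j => ?_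
  filter_upwards [ae_abs_le_one hq0 hq1 (abs_le.2 ⟨by linarith [h1 j], h2 j⟩)
    (abs_le.2 ⟨hb, by linarith⟩)] with x hx
  exact christoffel_nonneg_of_abs_le hx _

/-- Off the first atom the measure is at most (1 - ab)/c times the finite one for aq, and the atom
itself has finite mass. -/
theorem isFiniteMeasure_of_shift (hq0 : 0 < q) (hq1 : q < 1) {a b c : ℝ} (hab : a * b < 0)
    (ha : 1 < |a|) (hc : 0 < c)
    (hx : ∀ᵐ x ∂measure a b q, x ≠ (a + a⁻¹) / 2 → c ≤ 1 - 2 * a * x + a ^ 2)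
    [hf : IsFiniteMeasure (measure (a * q) b q)] : IsFiniteMeasure (measure a b q) := by
  have h1 : ENNReal.ofReal c * measure a b q {(a + a⁻¹) / 2}ᶜ ≤
      ENNReal.ofReal (1 - a * b) * measure (a * q) b q Set.univ := by
    have h := congrArg (fun m => m Set.univ) (measure_withDensity hq0 hq1 hab)
    simp only [Measure.smul_apply, smul_eq_mul, withDensity_apply _ MeasurableSet.univ,
      Measure.restrict_univ] at h
    rw [← h, ← lintegral_indicator_one (measurableSet_singleton _).compl, ← lintegral_const_mul]
    · refine lintegral_mono_ae ?_
      filter_upwards [hx] with x hx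
      by_cases hxa : x = (a + a⁻¹) / 2
      · rw [Set.indicator_of_notMem (by simpa using hxa), mul_zero]; exact zero_le
      · rw [Set.indicator_of_mem (by simpa using hxa), Pi.one_apply, mul_one]
        exact ENNReal.ofReal_le_ofReal (hx hxa)
    · exact measurable_one.indicator (measurableSet_singleton _).compl
  have h2 : measure a b q {(a + a⁻¹) / 2}ᶜ < ∞ := by
    by_contra h
    rw [not_lt, top_le_iff] at h
    rw [h, ENNReal.mul_top (by simpa using hc), top_le_iff] at h1
    exact ENNReal.mul_ne_top ENNReal.ofReal_ne_top (measure_ne_top _ _) h1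
  refine ⟨?_⟩
  rw [← measure_add_measure_compl (measurableSet_singleton ((a + a⁻¹) / 2)),
    measure_singleton hq0 hq1 hab ha]
  exact ENNReal.add_lt_top.2 ⟨ENNReal.ofReal_lt_top, h2⟩

/-- Telescoping of the connection relation `recPoly_contiguous`. The coefficients are, up to norms,
the values of the polynomials at the atom x₀ = (a + a⁻¹)/2, so this is the Christoffel–Darboux
kernel with one argument at x₀, in closed form. -/
theorem sum_recPoly_eq {x a b : ℝ} (hq0 : 0 < q) (hq1 : q < 1) (ha0 : a ≠ 0) (N : ℕ) :
    ∑ n ∈ Finset.range (N + 1), a⁻¹ ^ n / qPoch q q n * recPoly x a b q n =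
      a⁻¹ ^ N / qPoch q q N * recPoly x (a * q) b q N := by
  induction N with
  | zero => simp [recPoly_zero]
  | succ N ih =>
    have h1 := (qPoch_self_pos hq0.le hq1 N).ne'
    have h2 : 1 - q ^ (N + 1) ≠ 0 := by
      have := pow_lt_one₀ hq0.le hq1 (n := N + 1) (by lia)
      linarith
    rw [Finset.sum_range_succ, ih, recPoly_contiguous, qPoch_succ, ← pow_succ', pow_succ a⁻¹ N]
    generalize a⁻¹ ^ N = u
    field_simp
    ring

end AlSalamChihara

/-! ### Normalisation for parameters outside the unit disc -/

namespace AlSalamChihara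

open Filter Topology MeasureTheory

variable {q : ℝ}

/-- The kernel at (x₀, x₀), x₀ = (a + a⁻¹)/2. By the q-binomial theorem its limit is the reciprocal
of the mass of the atom x₀, as it should be for an orthogonality measure. -/
theorem tendsto_sum_qBinomial (hq0 : 0 < q) (hq1 : q < 1) {a b : ℝ} (hab : a * b < 0)
    (ha : 1 < |a|) : Tendsto (fun N => ∑ n ∈ Finset.range (N + 1),
      a⁻¹ ^ n / qPoch q q n * (a⁻¹ ^ n * qPoch (a * b) q n)) atTop
      (𝓝 (qPochInf (b / a) q / qPochInf (a ^ 2)⁻¹ q)) := by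
  have ha0 : a ≠ 0 := fun h => by simp [h] at hab
  have ha2 := one_lt_sq_of_one_lt_abs ha
  have h := (tsum_qBinomial hq0.le hq1 hab.le (x := (a ^ 2)⁻¹) (by
    rw [abs_of_pos (by positivity)]; exact inv_lt_one_of_one_lt₀ ha2)).tendsto_sum_nat
  have e : a * b * (a ^ 2)⁻¹ = b / a := by field_simp
  rw [e] at h
  refine ((tendsto_add_atTop_iff_nat 1).2 h).congr fun N => ?_
  refine Finset.sum_congr rfl fun n _ => ?_
  rw [← inv_pow, ← pow_mul, mul_comm 2 n, pow_mul]
  ring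

/-- The integral of `p_n` in terms of the total mass. -/
theorem integral_recPoly_of_shift (hq0 : 0 < q) (hq1 : q < 1) {a b : ℝ} (hab : a * b < 0)
    (ha : 1 < |a|) (h : IsNormalized (a * q) b q) [IsFiniteMeasure (measure a b q)] (n : ℕ) :
    ∫ x, recPoly x a b q n ∂measure a b q = (if n = 0 then 1 else 0) +
      a⁻¹ ^ n * qPoch (a * b) q n * ((measure a b q).real Set.univ - 1) := by
  have ha0 : a ≠ 0 := fun h => by simp [h] at hab
  induction n with
  | zero => simp [recPoly_zero, qPoch_zero]
  | succ n ih =>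
    have e := integral_shift hq0 hq1 hab (fun x => recPoly x (a * q) b q n)
      (christoffel_nonneg_ae hq0 hq1 hab ha)
    simp only [recPoly_christoffel] at e
    rw [h.integral, integral_sub, integral_const_mul, integral_const_mul, ih] at e
    · have e2 : (1 - a * b * q ^ n) * (if n = 0 then 1 else 0 : ℝ) =
          (1 - a * b) * (if n = 0 then 1 else 0 : ℝ) := by
        split_ifs with hn
        · simp [hn]
        · simp
      rw [if_neg (Nat.succ_ne_zero n), qPoch_succ, pow_succ]
      refine mul_left_cancel₀ ha0 ?_
      have e3 : a * a⁻¹ = 1 := mul_inv_cancel₀ ha0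
      rw [mul_add, e2] at e
      linear_combination (a⁻¹ ^ n * qPoch (a * b) q n * (1 - a * b * q ^ n) *
        ((measure a b q).real Set.univ - 1)) * (-e3) - e
    · exact integrable_of_continuous hq0 hq1 ((continuous_recPoly _ _ _ _).const_mul _)
    · exact integrable_of_continuous hq0 hq1 ((continuous_recPoly _ _ _ _).const_mul _)

/-- Off the atom |p| ≤ 1 + p², and p² is at most c⁻¹ times the Christoffel factor times p², whose
integral is a known norm for the parameter aq. The bound does not depend on N. -/
theorem abs_setIntegral_recPoly_le (hq0 : 0 < q) (hq1 : q < 1) {a b c : ℝ} (hab : a * b < 0)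
    (ha : 1 < |a|) (hc : 0 < c) (h : IsNormalized (a * q) b q) [IsFiniteMeasure (measure a b q)]
    (hx : ∀ᵐ x ∂measure a b q, x ≠ (a + a⁻¹) / 2 → c ≤ 1 - 2 * a * x + a ^ 2) (N : ℕ) :
    |∫ x in {(a + a⁻¹) / 2}ᶜ, recPoly x (a * q) b q N ∂measure a b q| ≤
      (measure a b q).real Set.univ + c⁻¹ * ((1 - a * b) * qPochInf (a * b) q) := by
  have habq : a * q * b < 0 := by rw [mul_right_comm]; exact mul_neg_of_neg_of_pos hab hq0
  have hnn := christoffel_nonneg_ae hq0 hq1 hab ha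
  have hcont := continuous_recPoly (a * q) b q N
  have hi2 : Integrable (fun x => (1 - 2 * a * x + a ^ 2) * recPoly x (a * q) b q N ^ 2)
      (measure a b q) := integrable_of_continuous hq0 hq1 (by fun_prop)
  have h1 : ∫ x, (1 - 2 * a * x + a ^ 2) * recPoly x (a * q) b q N ^ 2 ∂measure a b q ≤
      (1 - a * b) * qPochInf (a * b) q := by
    rw [integral_shift hq0 hq1 hab (fun x => recPoly x (a * q) b q N ^ 2) hnn]
    refine mul_le_mul_of_nonneg_left ?_ (by linarith)
    simp only [sq]
    rw [h.integral_mul hq0 hq1, if_pos rfl]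
    calc qPoch q q N * qPoch (a * q * b) q N ≤ 1 * qPochInf (a * q * b) q :=
          mul_le_mul (qPoch_self_le_one hq0.le hq1 N)
            (qPoch_le_qPochInf_of_nonpos hq0.le hq1 habq.le N)
            (qPoch_pos hq0.le hq1.le (habq.trans one_pos) N).le one_pos.le
      _ ≤ qPochInf (a * b) q := by
          rw [one_mul, qPochInf_shift (a * b) (by rwa [Real.norm_of_nonneg hq0.le]),
            mul_right_comm a b q]
          have := qPochInf_pos hq0.le hq1 (habq.trans one_pos)
          nlinarith
  calc |∫ x in {(a + a⁻¹) / 2}ᶜ, recPoly x (a * q) b q N ∂measure a b q|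
      ≤ ∫ x in {(a + a⁻¹) / 2}ᶜ, |recPoly x (a * q) b q N| ∂measure a b q :=
        abs_integral_le_integral_abs
    _ ≤ ∫ x in {(a + a⁻¹) / 2}ᶜ, (1 + c⁻¹ * ((1 - 2 * a * x + a ^ 2) *
          recPoly x (a * q) b q N ^ 2)) ∂measure a b q := by
        refine integral_mono_ae
          (integrable_of_continuous hq0 hq1 (continuous_abs.comp hcont)).integrableOn
          ((integrable_const _).add (hi2.const_mul _)).integrableOn ?_
        rw [EventuallyLE, ae_restrict_iff' (measurableSet_singleton _).compl]
        filter_upwards [hx] with x hx hxa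
        have h2 := hx hxa
        have h3 : 1 ≤ c⁻¹ * (1 - 2 * a * x + a ^ 2) := by
          have h := mul_le_mul_of_nonneg_left h2 (inv_nonneg.2 hc.le)
          rwa [inv_mul_cancel₀ hc.ne'] at h
        rw [← mul_assoc, ← sq_abs (recPoly x (a * q) b q N)]
        have h4 := sq_nonneg |recPoly x (a * q) b q N|
        nlinarith [sq_nonneg (|recPoly x (a * q) b q N| - 1)]
    _ ≤ ∫ x, (1 + c⁻¹ * ((1 - 2 * a * x + a ^ 2) *
          recPoly x (a * q) b q N ^ 2)) ∂measure a b q := by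
        refine setIntegral_le_integral ((integrable_const _).add (hi2.const_mul _)) ?_
        filter_upwards [hnn] with x hx
        simp only [Pi.zero_apply]
        positivity
    _ ≤ _ := by
        rw [integral_add (integrable_const _) (hi2.const_mul _), integral_const,
          integral_const_mul, smul_eq_mul, mul_one]
        have := mul_le_mul_of_nonneg_left h1 (inv_nonneg.2 hc.le)
        linarith

/-- Only the total mass F is unknown. The kernel of `sum_recPoly_eq` is integrated in two ways:
through the integrals of the p_n, which involve F, and by separating the atom from a remainder of
order a^(-N). In the limit 1 + (F - 1)κ = 1, where κ > 0 is the reciprocal mass of the atom. -/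
theorem isNormalized_of_shift (hq0 : 0 < q) (hq1 : q < 1) {a b : ℝ} (hab : a * b < 0)
    (ha : 1 < |a|) (h : IsNormalized (a * q) b q) : IsNormalized a b q := by
  have ha0 : a ≠ 0 := fun h => by simp [h] at hab
  obtain ⟨c, hc, h1, h2, h3⟩ := exists_christoffel_bound hq0 hq1 hab ha
  have hx : ∀ᵐ x ∂measure a b q, x ≠ (a + a⁻¹) / 2 → c ≤ 1 - 2 * a * x + a ^ 2 := by
    refine ae_measure hq0 hq1 a b ?_ (fun θ hθ _ => h1 θ hθ) (fun k hk hne => ?_)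
      (fun k hk _ => h3 k hk)
    · exact (measurableSet_singleton ((a + a⁻¹) / 2)).compl.imp
        (measurableSet_le measurable_const (by fun_prop))
    · cases k with
      | zero => simp at hne
      | succ k => exact h2 k hk
  have hfin := h.finite
  have := isFiniteMeasure_of_shift hq0 hq1 hab ha hc hx
  set F := (measure a b q).real Set.univ with hF
  set κ := qPochInf (b / a) q / qPochInf (a ^ 2)⁻¹ q with hκ
  have ha2 := one_lt_sq_of_one_lt_abs ha
  have hba : b / a < 0 := by
    have : b / a = a * b / a ^ 2 := by field_simp
    rw [this]; exact div_neg_of_neg_of_pos hab (by positivity)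
  have hκ0 : 0 < κ := div_pos (qPochInf_pos hq0.le hq1 (hba.trans one_pos))
    (qPochInf_pos hq0.le hq1 (inv_lt_one_of_one_lt₀ ha2))
  have hw : (measure a b q).real {(a + a⁻¹) / 2} = κ⁻¹ := by
    rw [measureReal_def, measure_singleton hq0 hq1 hab ha, ENNReal.toReal_ofReal, hκ, inv_div]
    rw [← inv_div]; exact inv_nonneg.2 hκ0.le
  have hlim := tendsto_sum_qBinomial hq0 hq1 hab ha
  set K : ℕ → ℝ := fun N => ∑ n ∈ Finset.range (N + 1),
    a⁻¹ ^ n / qPoch q q n * (a⁻¹ ^ n * qPoch (a * b) q n) with hK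
  have hfac : 1 - 2 * a * ((a + a⁻¹) / 2) + a ^ 2 = 0 := by
    rw [christoffel_factor_eq ha0, mul_inv_cancel₀ ha0, sub_self, mul_zero]
  have hint : ∀ N, ∫ x, a⁻¹ ^ N / qPoch q q N * recPoly x (a * q) b q N ∂measure a b q =
      1 + (F - 1) * K N := fun N => by
    simp only [← sum_recPoly_eq hq0 hq1 ha0 (b := b)]
    rw [integral_finsetSum _ fun n _ =>
      integrable_of_continuous hq0 hq1 ((continuous_recPoly _ _ _ _).const_mul _)]
    simp only [integral_const_mul, integral_recPoly_of_shift hq0 hq1 hab ha h, mul_add,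
      Finset.sum_add_distrib, hK, Finset.mul_sum]
    congr 1
    · rw [Finset.sum_range_succ']
      simp [qPoch_zero]
    · refine Finset.sum_congr rfl fun n _ => ?_
      ring
  have hat : ∀ N, a⁻¹ ^ N / qPoch q q N * recPoly ((a + a⁻¹) / 2) (a * q) b q N = K N := fun N => by
    rw [← sum_recPoly_eq hq0 hq1 ha0]
    simp only [recPoly_special b ha0 hfac, hK]
  -- The kernel takes the value K N at the atom; the rest of the integral is small because |a| > 1.
  have hrem : ∀ N, 1 + (F - 1) * K N = κ⁻¹ * K N + a⁻¹ ^ N / qPoch q q N *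
      ∫ x in {(a + a⁻¹) / 2}ᶜ, recPoly x (a * q) b q N ∂measure a b q := fun N => by
    rw [← hint N, ← integral_add_compl (measurableSet_singleton ((a + a⁻¹) / 2))
      (integrable_of_continuous hq0 hq1 ((continuous_recPoly _ _ _ _).const_mul _)),
      integral_singleton, hat, hw, smul_eq_mul, integral_const_mul]
  have hzero : Tendsto (fun N => a⁻¹ ^ N / qPoch q q N *
      ∫ x in {(a + a⁻¹) / 2}ᶜ, recPoly x (a * q) b q N ∂measure a b q) atTop (𝓝 0) := by
    have hai : |a⁻¹| < 1 := by rw [abs_inv]; exact inv_lt_one_of_one_lt₀ ha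
    have hp := qPochInf_pos hq0.le hq1 hq1
    refine squeeze_zero_norm (a := fun N => |a⁻¹| ^ N * ((qPochInf q q)⁻¹ *
      (F + c⁻¹ * ((1 - a * b) * qPochInf (a * b) q)))) (fun N => ?_) ?_
    · have hN := qPoch_self_pos hq0.le hq1 N
      rw [norm_mul, norm_div, norm_pow, Real.norm_eq_abs, Real.norm_eq_abs, Real.norm_eq_abs,
        abs_of_pos hN, div_eq_mul_inv, mul_assoc]
      refine mul_le_mul_of_nonneg_left ?_ (by positivity)
      refine mul_le_mul ?_ (abs_setIntegral_recPoly_le hq0 hq1 hab ha hc h hx N) (abs_nonneg _)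
        (by positivity)
      exact inv_anti₀ hp (qPochInf_self_le_qPoch hq0.le hq1 N)
    · simpa using (tendsto_pow_atTop_nhds_zero_of_lt_one (abs_nonneg _) hai).mul_const
        ((qPochInf q q)⁻¹ * (F + c⁻¹ * ((1 - a * b) * qPochInf (a * b) q)))
  have hF1 : F = 1 := by
    have l1 : Tendsto (fun N => 1 + (F - 1) * K N) atTop (𝓝 (1 + (F - 1) * κ)) :=
      (hlim.const_mul _).const_add _
    have l2 : Tendsto (fun N => 1 + (F - 1) * K N) atTop (𝓝 (κ⁻¹ * κ + 0)) := by
      simp only [hrem]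
      exact (hlim.const_mul _).add hzero
    have := tendsto_nhds_unique l1 l2
    rw [inv_mul_cancel₀ hκ0.ne', add_zero, add_eq_left] at this
    linarith [(mul_eq_zero.1 this).resolve_right hκ0.ne']
  refine ⟨inferInstance, fun n => ?_⟩
  rw [integral_recPoly_of_shift hq0 hq1 hab ha h, ← hF, hF1, sub_self, mul_zero, add_zero]

theorem isNormalized_of_mul_pow (hq0 : 0 < q) (hq1 : q < 1) {a b : ℝ} (hab : a * b < 0) {k : ℕ}
    (hk : |a * q ^ k| ≤ 1) (h : ∀ c, |c| ≤ 1 → c * b < 0 → IsNormalized c b q) :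
    IsNormalized a b q := by
  induction k generalizing a with
  | zero => exact h a (by simpa using hk) hab
  | succ k ih =>
    by_cases ha : |a| ≤ 1
    · exact h a ha hab
    · have e : a * q ^ (k + 1) = a * q * q ^ k := by ring
      have habq : a * q * b < 0 := by rw [mul_right_comm]; exact mul_neg_of_neg_of_pos hab hq0
      exact isNormalized_of_shift hq0 hq1 hab (not_le.1 ha) (ih habq (e ▸ hk))

theorem exists_abs_mul_pow_le_one (hq0 : 0 < q) (hq1 : q < 1) (a : ℝ) :
    ∃ k : ℕ, |a * q ^ k| ≤ 1 := by
  have h : Tendsto (fun k => |a * q ^ k|) atTop (𝓝 |a * 0|) :=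
    ((tendsto_pow_atTop_nhds_zero_of_lt_one hq0.le hq1).const_mul a).abs
  rw [mul_zero, abs_zero] at h
  exact ((h.eventually_lt_const one_pos).exists).imp fun _ h => h.le

/-- The orthogonality measure is a probability measure and the polynomials of positive degree
integrate to zero. -/
theorem isNormalized (hq0 : 0 < q) (hq1 : q < 1) {a b : ℝ} (hab : a * b < 0) :
    IsNormalized a b q := by
  have h0 : ∀ c d : ℝ, |c| ≤ 1 → |d| ≤ 1 → c * d < 0 → IsNormalized c d q := by
    intro c d hc hd hcd
    rw [abs_le] at hc hd
    rcases mul_neg_iff.1 hcd with ⟨h1, h2⟩ | ⟨h1, h2⟩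
    · exact isNormalized_of_abs_le_one hq0 hq1 h1 hc.2 h2 hd.1
    · exact (isNormalized_of_abs_le_one hq0 hq1 h2 hd.2 h1 hc.1).comm hq0 hq1
  obtain ⟨k, hk⟩ := exists_abs_mul_pow_le_one hq0 hq1 a
  obtain ⟨l, hl⟩ := exists_abs_mul_pow_le_one hq0 hq1 b
  refine isNormalized_of_mul_pow hq0 hq1 hab hk fun c hc hcb => ?_
  refine (isNormalized_of_mul_pow hq0 hq1 (mul_comm c b ▸ hcb) hl fun d hd hdc => ?_).comm hq0 hq1
  exact h0 d c hd hc hdc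

end AlSalamChihara

/-! ### The Poisson kernel on the diagonal, and the support of the measure -/

namespace AlSalamChihara

open Filter Topology MeasureTheory

variable {q : ℝ}

theorem poissonTerm_eq (hq0 : 0 < q) (hq1 : q < 1) {a b : ℝ} (hab : a * b < 0) (t x : ℝ) (k : ℕ) :
    poissonTerm t x x a b q k =
      t ^ k * (recPoly x a b q k * recPoly x a b q k / (qPoch q q k * qPoch (a * b) q k)) := by
  have ha0 : a ≠ 0 := fun h => by simp [h] at hab
  rw [poissonTerm, poly_eq_recPoly x b hq0 hq1 ha0 hab.le]

theorem norm_recPoly_pos (hq0 : 0 < q) (hq1 : q < 1) {a b : ℝ} (hab : a * b < 0) (k : ℕ) :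
    0 < qPoch q q k * qPoch (a * b) q k :=
  mul_pos (qPoch_self_pos hq0.le hq1 k) (qPoch_pos hq0.le hq1.le (hab.trans one_pos) k)

theorem poissonTerm_nonneg (hq0 : 0 < q) (hq1 : q < 1) {a b t : ℝ} (hab : a * b < 0) (ht : 0 ≤ t)
    (x : ℝ) (k : ℕ) : 0 ≤ poissonTerm t x x a b q k := by
  rw [poissonTerm_eq hq0 hq1 hab]
  exact mul_nonneg (pow_nonneg ht k)
    (div_nonneg (mul_self_nonneg _) (norm_recPoly_pos hq0 hq1 hab k).le)

theorem continuous_poissonTerm (hq0 : 0 < q) (hq1 : q < 1) {a b : ℝ} (hab : a * b < 0) (t : ℝ)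
    (k : ℕ) : Continuous fun x => poissonTerm t x x a b q k := by
  simp only [poissonTerm_eq hq0 hq1 hab]
  have := continuous_recPoly a b q k
  fun_prop

theorem integral_poissonTerm (hq0 : 0 < q) (hq1 : q < 1) {a b : ℝ} (hab : a * b < 0) (t : ℝ)
    (k : ℕ) : ∫ x, poissonTerm t x x a b q k ∂measure a b q = t ^ k := by
  simp only [poissonTerm_eq hq0 hq1 hab]
  rw [integral_const_mul, integral_div, (isNormalized hq0 hq1 hab).integral_mul hq0 hq1,
    if_pos rfl, div_self (norm_recPoly_pos hq0 hq1 hab k).ne', mul_one]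

/-- The Poisson kernel as an extended nonnegative real. -/
def ePoisson (t x a b q : ℝ) : ℝ≥0∞ := ∑' k, ENNReal.ofReal (poissonTerm t x x a b q k)

theorem toReal_ePoisson (hq0 : 0 < q) (hq1 : q < 1) {a b t : ℝ} (hab : a * b < 0) (ht : 0 ≤ t)
    (x : ℝ) : (ePoisson t x a b q).toReal = poisson t x x a b q := by
  rw [ePoisson, ENNReal.tsum_toReal_eq fun k => ENNReal.ofReal_ne_top, poisson]
  exact tsum_congr fun k => ENNReal.toReal_ofReal (poissonTerm_nonneg hq0 hq1 hab ht x k)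

theorem measurable_ePoisson (hq0 : 0 < q) (hq1 : q < 1) {a b : ℝ} (hab : a * b < 0) (t : ℝ) :
    Measurable fun x => ePoisson t x a b q :=
  Measurable.tsum fun k =>
    (continuous_poissonTerm hq0 hq1 hab t k).measurable.ennreal_ofReal

/-- The k-th term integrates to t^k, so the total is a geometric series. -/
theorem lintegral_ePoisson_ne_top (hq0 : 0 < q) (hq1 : q < 1) {a b t : ℝ} (hab : a * b < 0)
    (ht : 0 ≤ t) (ht1 : t < 1) : ∫⁻ x, ePoisson t x a b q ∂measure a b q ≠ ∞ := by
  have := (isNormalized hq0 hq1 hab).finite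
  have h : ∀ k, ∫⁻ x, ENNReal.ofReal (poissonTerm t x x a b q k) ∂measure a b q =
      ENNReal.ofReal (t ^ k) := fun k => by
    rw [← ofReal_integral_eq_lintegral_ofReal, integral_poissonTerm hq0 hq1 hab]
    · exact integrable_of_continuous hq0 hq1 (continuous_poissonTerm hq0 hq1 hab t k)
    · exact ae_of_all _ fun x => poissonTerm_nonneg hq0 hq1 hab ht x k
  simp only [ePoisson]
  rw [lintegral_tsum fun k =>
    (continuous_poissonTerm hq0 hq1 hab t k).measurable.ennreal_ofReal.aemeasurable]
  simp only [h]
  rw [← ENNReal.ofReal_tsum_of_nonneg (fun k => pow_nonneg ht k)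
    (summable_geometric_of_lt_one ht ht1)]
  exact ENNReal.ofReal_ne_top

theorem summable_poissonTerm_of_ne_top (hq0 : 0 < q) (hq1 : q < 1) {a b t x : ℝ} (hab : a * b < 0)
    (ht : 0 ≤ t) (h : ePoisson t x a b q ≠ ∞) : Summable (poissonTerm t x x a b q) := by
  refine (ENNReal.summable_toReal h).congr fun k => ?_
  exact ENNReal.toReal_ofReal (poissonTerm_nonneg hq0 hq1 hab ht x k)

theorem integrable_poisson (hq0 : 0 < q) (hq1 : q < 1) {a b t : ℝ} (hab : a * b < 0)
    (ht : 0 ≤ t) (ht1 : t < 1) :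
    Integrable (fun x => poisson t x x a b q) (measure a b q) := by
  simp only [← toReal_ePoisson hq0 hq1 hab ht]
  exact integrable_toReal_of_lintegral_ne_top (measurable_ePoisson hq0 hq1 hab t).aemeasurable
    (lintegral_ePoisson_ne_top hq0 hq1 hab ht ht1)

/-- Finiteness almost everywhere says nothing about a given point of the continuous part, so here
the subexponential growth of the polynomials is used; the squared norms stay above (q; q)_∞. -/
theorem summable_poissonTerm_of_mem_Icc (hq0 : 0 < q) (hq1 : q < 1) {a b t x : ℝ}
    (hab : a * b < 0) (ht : 0 ≤ t) (ht1 : t < 1) (hx : x ^ 2 ≤ 1) :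
    Summable (poissonTerm t x x a b q) := by
  have hp := qPochInf_pos hq0.le hq1 hq1
  refine ((summable_pow_mul_recPoly_sq a b hx hq0.le hq1 ht ht1).mul_right
    (qPochInf q q)⁻¹).of_nonneg_of_le (poissonTerm_nonneg hq0 hq1 hab ht x) fun k => ?_
  rw [poissonTerm_eq hq0 hq1 hab, mul_assoc, ← sq, div_eq_mul_inv]
  have h1 : qPochInf q q ≤ qPoch q q k * qPoch (a * b) q k := by
    have h2 := qPochInf_self_le_qPoch hq0.le hq1 k
    have h3 := one_le_qPoch_of_nonpos hq0.le hab.le k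
    nlinarith
  have := inv_anti₀ hp h1
  gcongr

theorem measure_atom_pos (hq0 : 0 < q) (hq1 : q < 1) {a b : ℝ} (hab : a * b < 0) {k : ℕ}
    (hk : 1 < |a * q ^ k|) : 0 < measure a b q {(a * q ^ k + (a * q ^ k)⁻¹) / 2} := by
  rw [measure, Measure.add_apply, Measure.add_apply, discretePart,
    Measure.sum_apply _ (measurableSet_singleton _)]
  refine lt_of_lt_of_le ?_ ((le_add_self.trans' (ENNReal.le_tsum k)).trans le_self_add)
  rw [if_pos hk, Measure.smul_apply, Measure.dirac_apply_of_mem (Set.mem_singleton _), smul_eq_mul,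
    mul_one]
  exact ENNReal.ofReal_pos.2 (div_pos (mass_pos hq0 hq1 hab hk) (h₀_pos hq0 hq1 hab))

/-- The polynomials may grow exponentially at an atom, but a kernel with finite integral is finite
wherever the measure has positive mass. -/
theorem summable_poissonTerm_atom (hq0 : 0 < q) (hq1 : q < 1) {a b t x : ℝ} (hab : a * b < 0)
    (ht : 0 ≤ t) (ht1 : t < 1) (hx : 0 < measure a b q {x}) :
    Summable (poissonTerm t x x a b q) := by
  refine summable_poissonTerm_of_ne_top hq0 hq1 hab ht fun h => ?_
  have h1 := ae_lt_top (measurable_ePoisson hq0 hq1 hab t)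
    (lintegral_ePoisson_ne_top hq0 hq1 hab ht ht1)
  have h2 : measure a b q {x} ≤ 0 := by
    rw [ae_iff] at h1
    rw [← h1]
    refine measure_mono fun y hy => ?_
    rw [Set.mem_singleton_iff.1 hy]
    simp [h]
  exact h2.not_gt hx

theorem finite_atoms (hq0 : 0 < q) (hq1 : q < 1) (a : ℝ) : {k : ℕ | 1 < |a * q ^ k|}.Finite := by
  obtain ⟨k, hk⟩ := exists_abs_mul_pow_le_one hq0 hq1 a
  refine (Set.finite_lt_nat k).subset fun l hl => ?_
  by_contra h
  obtain ⟨m, rfl⟩ := Nat.exists_eq_add_of_le (not_lt.1 h)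
  have h1 : 1 < |a * q ^ (k + m)| := hl
  rw [pow_add, ← mul_assoc] at h1
  exact absurd (h1.trans_le (abs_mul_pow_le hq0 hq1 _ m)) (not_lt.2 hk)

theorem support_subset (hq0 : 0 < q) (hq1 : q < 1) (a b : ℝ) : (measure a b q).support ⊆
    Set.Icc (-1) 1 ∪ ((fun k : ℕ => (a * q ^ k + (a * q ^ k)⁻¹) / 2) '' {k | 1 < |a * q ^ k|} ∪
      (fun k : ℕ => (b * q ^ k + (b * q ^ k)⁻¹) / 2) '' {k | 1 < |b * q ^ k|}) := by
  have hc : IsClosed (Set.Icc (-1) 1 ∪ ((fun k : ℕ => (a * q ^ k + (a * q ^ k)⁻¹) / 2) ''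
      {k | 1 < |a * q ^ k|} ∪
      (fun k : ℕ => (b * q ^ k + (b * q ^ k)⁻¹) / 2) '' {k | 1 < |b * q ^ k|})) :=
    isClosed_Icc.union (((finite_atoms hq0 hq1 a).image _).isClosed.union
      ((finite_atoms hq0 hq1 b).image _).isClosed)
  refine Measure.support_subset_of_isClosed hc (ae_measure hq0 hq1 a b hc.measurableSet
    (fun θ _ => .inl ⟨Real.neg_one_le_cos θ, Real.cos_le_one θ⟩) (fun k hk => .inr (.inl ⟨k, hk, rfl⟩))
    (fun k hk => .inr (.inr ⟨k, hk, rfl⟩)))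

theorem summable_poissonTerm (hq0 : 0 < q) (hq1 : q < 1) {a b t x : ℝ} (hab : a * b < 0)
    (ht : 0 ≤ t) (ht1 : t < 1) (hx : x ∈ (measure a b q).support) :
    Summable (poissonTerm t x x a b q) := by
  rcases support_subset hq0 hq1 a b hx with h | ⟨k, hk, rfl⟩ | ⟨k, hk, rfl⟩
  · exact summable_poissonTerm_of_mem_Icc hq0 hq1 hab ht ht1 (by nlinarith [h.1, h.2])
  · exact summable_poissonTerm_atom hq0 hq1 hab ht ht1 (measure_atom_pos hq0 hq1 hab hk)
  · refine summable_poissonTerm_atom hq0 hq1 hab ht ht1 ?_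
    rw [measure_comm hq0 hq1]
    exact measure_atom_pos hq0 hq1 (mul_comm a b ▸ hab) hk

theorem Icc_subset_support (hq0 : 0 < q) (hq1 : q < 1) {a b : ℝ} (hab : a * b < 0) :
    Set.Icc (-1) 1 ⊆ (measure a b q).support := by
  have hIoo : Set.Ioo (-1 : ℝ) 1 ⊆ (measure a b q).support := fun x hx => by
    rw [Measure.mem_support_iff_forall]
    intro U hU
    obtain ⟨V, hVU, hV, hxV⟩ := mem_nhds_iff.1 hU
    refine lt_of_lt_of_le ?_ (measure_mono hVU)
    rw [measure, Measure.add_apply, Measure.add_apply]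
    refine lt_of_lt_of_le ?_ (le_self_add.trans le_self_add)
    rw [Measure.map_apply Real.measurable_cos hV.measurableSet, pos_iff_ne_zero]
    intro h0
    have hmeas : Measurable fun θ => ENNReal.ofReal (weight θ a b q / (2 * Real.pi * h₀ a b q)) :=
      ((measurable_weight hq0 hq1 a b).div_const _).ennreal_ofReal
    have h1 := (withDensity_apply_eq_zero hmeas).1 h0
    rw [Measure.restrict_apply' measurableSet_Ioo] at h1
    have hO : IsOpen (Real.cos ⁻¹' V ∩ Set.Ioo 0 Real.pi) :=
      (hV.preimage Real.continuous_cos).inter isOpen_Ioo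
    have hne : (Real.cos ⁻¹' V ∩ Set.Ioo 0 Real.pi).Nonempty :=
      ⟨Real.arccos x, by rwa [Set.mem_preimage, Real.cos_arccos hx.1.le hx.2.le],
        Real.arccos_pos.2 hx.2, by
          rw [← Real.arccos_neg_one]
          exact Real.strictAntiOn_arccos ⟨le_refl _, by norm_num⟩ ⟨hx.1.le, hx.2.le⟩ hx.1⟩
    refine (hO.measure_pos volume hne).ne' (measure_mono_null ?_ h1)
    intro θ hθ
    refine ⟨⟨?_, hθ.1⟩, hθ.2⟩
    have h2 := weight_pos hq0 hq1 hθ.2 a b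
    have h3 := h₀_pos hq0 hq1 hab
    have := Real.pi_pos
    exact (ENNReal.ofReal_pos.2 (by positivity)).ne'
  rw [← closure_Ioo (by norm_num : (-1 : ℝ) ≠ 1)]
  exact closure_minimal hIoo Measure.isClosed_support

/-- The term k = 0 equals 1 and the others are nonnegative. Thus the kernel does not shrink the
support of the measure. -/
theorem one_le_poisson (hq0 : 0 < q) (hq1 : q < 1) {a b t x : ℝ} (hab : a * b < 0)
    (ht : 0 ≤ t) (hx : Summable (poissonTerm t x x a b q)) : 1 ≤ poisson t x x a b q := by
  have h := hx.le_tsum 0 fun k _ => poissonTerm_nonneg hq0 hq1 hab ht x k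
  rw [poissonTerm_eq hq0 hq1 hab] at h
  simpa [recPoly_zero, qPoch_zero, poisson] using h

theorem exists_bound_of_continuousOn {a b : ℝ} (hq0 : 0 < q) (hq1 : q < 1) {f : ℝ → ℂ}
    (hf : ContinuousOn f (measure a b q).support) :
    ∃ C, ∀ᵐ x ∂measure a b q, ‖f x‖ ≤ C := by
  obtain ⟨R, hR⟩ := exists_ae_abs_le hq0 hq1 a b
  have hs : (measure a b q).support ⊆ Set.Icc (-R) R :=
    Measure.support_subset_of_isClosed isClosed_Icc (by
      filter_upwards [hR] with x hx using abs_le.1 hx)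
  obtain ⟨C, hC⟩ := (isCompact_Icc.of_isClosed_subset Measure.isClosed_support hs
    ).exists_bound_of_continuousOn hf
  exact ⟨C, by filter_upwards [Measure.support_mem_ae] with x hx using hC x hx⟩

theorem aestronglyMeasurable_of_continuousOn_support {m : Measure ℝ} {f : ℝ → ℂ}
    (hf : ContinuousOn f m.support) : AEStronglyMeasurable f m := by
  have h := hf.aestronglyMeasurable (μ := m) Measure.isClosed_support.measurableSet
  have hr : m.restrict m.support = m :=
    Measure.restrict_eq_self_of_ae_mem (s := m.support) Measure.support_mem_ae
  rwa [hr] at h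

theorem integrable_mul_poisson (hq0 : 0 < q) (hq1 : q < 1) {a b t : ℝ} (hab : a * b < 0)
    (ht : 0 ≤ t) (ht1 : t < 1) {f : ℝ → ℂ} (hf : ContinuousOn f (measure a b q).support) :
    Integrable (fun x => f x * (poisson t x x a b q : ℂ)) (measure a b q) := by
  obtain ⟨C, hC⟩ := exists_bound_of_continuousOn hq0 hq1 hf
  exact (integrable_poisson hq0 hq1 hab ht ht1).ofReal.bdd_mul
    (aestronglyMeasurable_of_continuousOn_support hf) hC

theorem hasSum_integral_mul_poisson (hq0 : 0 < q) (hq1 : q < 1) {a b t : ℝ} (hab : a * b < 0)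
    (ht : 0 ≤ t) (ht1 : t < 1) {f : ℝ → ℂ} (hf : ContinuousOn f (measure a b q).support) :
    HasSum (fun k => ∫ x, f x * (poissonTerm t x x a b q k : ℂ) ∂measure a b q)
      (∫ x, f x * (poisson t x x a b q : ℂ) ∂measure a b q) := by
  have := (isNormalized hq0 hq1 hab).finite
  obtain ⟨C, hC⟩ := exists_bound_of_continuousOn hq0 hq1 hf
  have hi : ∀ k, Integrable (fun x => poissonTerm t x x a b q k) (measure a b q) := fun k =>
    integrable_of_continuous hq0 hq1 (continuous_poissonTerm hq0 hq1 hab t k)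
  have hfi : ∀ k, Integrable (fun x => f x * (poissonTerm t x x a b q k : ℂ)) (measure a b q) :=
    fun k => (hi k).ofReal.bdd_mul (aestronglyMeasurable_of_continuousOn_support hf) hC
  have h := hasSum_integral_of_summable_integral_norm hfi ?_
  · simpa only [tsum_mul_left, poisson, Complex.ofReal_tsum] using h
  · refine ((summable_geometric_of_lt_one ht ht1).mul_left C).of_nonneg_of_le
      (fun k => integral_nonneg fun x => norm_nonneg _) fun k => ?_
    rw [← integral_poissonTerm hq0 hq1 hab, ← integral_const_mul]
    refine integral_mono_ae (hfi k).norm ((hi k).const_mul C) ?_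
    filter_upwards [hC] with x hx
    rw [norm_mul, Complex.norm_real,
      Real.norm_of_nonneg (poissonTerm_nonneg hq0 hq1 hab ht x k)]
    exact mul_le_mul_of_nonneg_right hx (poissonTerm_nonneg hq0 hq1 hab ht x k)

end AlSalamChihara

/-! ### The Jacobi operator -/

namespace AlSalamChihara

open Filter Topology MeasureTheory Finsupp

variable {q : ℝ}

/-- The raising part `e_k ↦ e_{k+1} / 2` of the Jacobi operator. -/
def raising : Module.End ℂ (ℕ →₀ ℂ) := linearCombination ℂ fun k => single (k + 1) (1 / 2)

/-- The lowering part of the Jacobi operator. -/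
def lowering (ab r : ℝ) : Module.End ℂ (ℕ →₀ ℂ) :=
  linearCombination ℂ fun k =>
    single (k - 1) (((1 / 2 * ((1 - r ^ k) * (1 - ab * r ^ (k - 1 : ℕ))) : ℝ)) : ℂ)

/-- The diagonal operator `e_k ↦ l r^k e_k`. -/
def diagonal (l r : ℝ) : Module.End ℂ (ℕ →₀ ℂ) :=
  linearCombination ℂ fun k => single k ((l * r ^ k : ℝ) : ℂ)

theorem raising_single (k : ℕ) (c : ℂ) : raising (single k c) = single (k + 1) (c * (1 / 2)) := by
  rw [raising, linearCombination_single, smul_single, smul_eq_mul]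

theorem lowering_single (ab r : ℝ) (k : ℕ) (c : ℂ) : lowering ab r (single k c) =
    single (k - 1) (c * ((1 / 2 * ((1 - r ^ k) * (1 - ab * r ^ (k - 1 : ℕ))) : ℝ))) := by
  rw [lowering, linearCombination_single, smul_single, smul_eq_mul]

theorem diagonal_single (l r : ℝ) (k : ℕ) (c : ℂ) :
    diagonal l r (single k c) = single k (c * ((l * r ^ k : ℝ) : ℂ)) := by
  rw [diagonal, linearCombination_single, smul_single, smul_eq_mul]

/-- The Jacobi operator of the recurrence for the Al-Salam–Chihara polynomials. -/
def jacobi (a b r : ℝ) : Module.End ℂ (ℕ →₀ ℂ) :=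
  lowering (a * b) r + raising + diagonal ((a + b) / 2) r

/-- The polynomial function with given coefficients in the basis of orthogonal polynomials. -/
def expansion (a b r x : ℝ) : (ℕ →₀ ℂ) →ₗ[ℂ] ℂ :=
  linearCombination ℂ fun k => ((recPoly x a b r k : ℝ) : ℂ)

/-- The three-term recurrence, read as an intertwining of the Jacobi operator with multiplication by
x. -/
theorem expansion_jacobi (a b r x : ℝ) (v : ℕ →₀ ℂ) :
    expansion a b r x (jacobi a b r v) = x * expansion a b r x v := by
  induction v using Finsupp.induction_linear with
  | zero => simp
  | add v w hv hw => rw [map_add, map_add, map_add, hv, hw, mul_add]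
  | single k c =>
    have h := congrArg (fun y : ℝ => (y : ℂ)) (two_mul_recPoly x a b r k)
    simp only [jacobi, LinearMap.add_apply, raising_single, lowering_single, diagonal_single,
      map_add, expansion, linearCombination_single, smul_eq_mul]
    push_cast at h ⊢
    linear_combination (-c / 2) * h

theorem expansion_jacobi_pow (a b r x : ℝ) (n : ℕ) (v : ℕ →₀ ℂ) :
    expansion a b r x ((jacobi a b r ^ n) v) = x ^ n * expansion a b r x v := by
  induction n with
  | zero => simp
  | succ n ih =>
    rw [pow_succ', Module.End.mul_apply, expansion_jacobi, ih]
    ring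

theorem continuous_expansion (a b r : ℝ) (v : ℕ →₀ ℂ) :
    Continuous fun x => expansion a b r x v := by
  simp only [expansion, linearCombination_apply, Finsupp.sum]
  have := continuous_recPoly a b r
  fun_prop

theorem integral_expansion (hq0 : 0 < q) (hq1 : q < 1) {a b : ℝ} (hab : a * b < 0) (v : ℕ →₀ ℂ)
    (k : ℕ) : ∫ x, expansion a b q x v *
      ((recPoly x a b q k / (qPoch q q k * qPoch (a * b) q k) : ℝ) : ℂ) ∂measure a b q = v k := by
  have hn := isNormalized hq0 hq1 hab
  have := hn.finite
  have hi : ∀ v, Integrable (fun x => expansion a b q x v *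
      ((recPoly x a b q k / (qPoch q q k * qPoch (a * b) q k) : ℝ) : ℂ)) (measure a b q) := fun v => by
    refine integrable_of_continuous hq0 hq1 ((continuous_expansion a b q v).mul ?_)
    have := continuous_recPoly a b q k
    fun_prop
  induction v using Finsupp.induction_linear with
  | zero => simp
  | add v w hv hw =>
    simp only [map_add, add_mul]
    rw [integral_add (hi v) (hi w), hv, hw, Finsupp.add_apply]
  | single j c =>
    have e : ∀ x, expansion a b q x (single j c) *
        ((recPoly x a b q k / (qPoch q q k * qPoch (a * b) q k) : ℝ) : ℂ) =
        c * ((recPoly x a b q j * recPoly x a b q k /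
          (qPoch q q k * qPoch (a * b) q k) : ℝ) : ℂ) := fun x => by
      rw [expansion, linearCombination_single, smul_eq_mul]
      push_cast
      ring
    simp only [e]
    rw [integral_const_mul, integral_complex_ofReal, integral_div, hn.integral_mul hq0 hq1,
      single_apply]
    split_ifs with h
    · rw [h, div_self (norm_recPoly_pos hq0 hq1 hab k).ne', Complex.ofReal_one, mul_one]
    · simp

/-- The bridge between the two sides of the formula: integrating against the Poisson kernel amounts
to taking the trace of Jacobi powers with the density diag(t^k). -/
theorem integral_pow_mul_poissonTerm (hq0 : 0 < q) (hq1 : q < 1) {a b : ℝ} (hab : a * b < 0)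
    (t : ℝ) (n k : ℕ) :
    ∫ x : ℝ, (x : ℂ) ^ n * (poissonTerm t x x a b q k : ℂ) ∂measure a b q =
      t ^ k * ((jacobi a b q ^ n) (single k 1)) k := by
  rw [← integral_expansion hq0 hq1 hab, ← integral_const_mul]
  refine integral_congr_ae (ae_of_all _ fun x => ?_)
  simp only
  rw [expansion_jacobi_pow, poissonTerm_eq hq0 hq1 hab, expansion, linearCombination_single,
    smul_eq_mul]
  push_cast
  ring

end AlSalamChihara

/-! ### Algebra in the polynomial part of the quantum group -/

/-- The relations of `QSU2Relations` and their adjoints, without reference to an involution. -/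
structure QRel (q : ℂ) {R : Type*} [Ring R] [Algebra ℂ R] (a a' c c' : R) : Prop where
  ac : a * c = q • (c * a)
  ac' : a * c' = q • (c' * a)
  ca' : c * a' = q • (a' * c)
  c'a' : c' * a' = q • (a' * c')
  cc' : c * c' = c' * c
  a'a : a' * a = 1 - c' * c
  aa' : a * a' = 1 - q ^ 2 • (c' * c)

theorem QSU2Relations.qRel {q : ℝ} {A : Type*} [Ring A] [StarRing A] [Algebra ℂ A] [StarModule ℂ A]
    {a c : A} (h : QSU2Relations q a c) : QRel (q : ℂ) a (star a) c (star c) where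
  ac := h.comm
  ac' := h.comm_star
  ca' := by simpa using congrArg star h.comm_star
  c'a' := by simpa using congrArg star h.comm
  cc' := h.normal
  a'a := eq_sub_of_add_eq h.star_mul
  aa' := by rw [← h.normal]; exact eq_sub_of_add_eq h.mul_star

theorem mul_mul_eq_of_mul_eq {R : Type*} [Semigroup R] {x y z : R} (h : x * y = z) (w : R) :
    x * (y * w) = z * w := by
  rw [← mul_assoc, h]

namespace QRel

set_option linter.unusedSimpArgs false

open Complex

variable {q : ℂ} {R : Type*} [Ring R] [Algebra ℂ R] {a a' c c' : R}

theorem ca (h : QRel q a a' c c') (hq : q ≠ 0) : c * a = q⁻¹ • (a * c) := by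
  rw [h.ac, inv_smul_smul₀ hq]

theorem c'a (h : QRel q a a' c c') (hq : q ≠ 0) : c' * a = q⁻¹ • (a * c') := by
  rw [h.ac', inv_smul_smul₀ hq]

end QRel

/-- The lowering part of the spherical element. -/
def sLow {R : Type*} [Ring R] [Algebra ℂ R] (q d : ℂ) (a c : R) : R :=
  (1 / 2 : ℂ) • (a * a + q • (c * c) - (Complex.I * q * d) • (c * a))

/-- The raising part of the spherical element. -/
def sRaise {R : Type*} [Ring R] [Algebra ℂ R] (q d : ℂ) (a' c' : R) : R :=
  (1 / 2 : ℂ) • (a' * a' + q • (c' * c') + (Complex.I * q * d) • (a' * c'))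

/-- The diagonal part of the spherical element. -/
def sDiag {R : Type*} [Ring R] [Algebra ℂ R] (d : ℂ) (a a' c c' : R) : R :=
  Complex.I • (a' * c - c' * a) - d • (c' * c)

namespace QRel

set_option linter.unusedSimpArgs false

open Complex

variable {q : ℂ} {R : Type*} [Ring R] [Algebra ℂ R] {a a' c c' : R}

theorem sLow_mul_sDiag (h : QRel q a a' c c') (hq : q ≠ 0) (d : ℂ) :
    sLow q d a c * sDiag d a a' c c' = q ^ 2 • (sDiag d a a' c c' * sLow q d a c) := by
  -- Normal ordering: a or a' to the left, then c', then c, with a a' and a' a eliminated.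
  -- Afterwards the coefficients of the ordered monomials are compared.
  simp only [sLow, sRaise, sDiag, mul_add, add_mul, mul_sub, sub_mul, smul_mul_assoc,
    mul_smul_comm, smul_add, smul_sub, smul_smul, mul_assoc, pow_two, h.ca hq, h.c'a hq, h.ca',
    h.c'a', h.cc', h.aa', h.a'a, mul_mul_eq_of_mul_eq (h.ca hq), mul_mul_eq_of_mul_eq (h.c'a hq),
    mul_mul_eq_of_mul_eq h.ca', mul_mul_eq_of_mul_eq h.c'a', mul_mul_eq_of_mul_eq h.cc',
    mul_mul_eq_of_mul_eq h.aa', mul_mul_eq_of_mul_eq h.a'a, one_mul, mul_one, smul_neg, neg_mul,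
    mul_neg, neg_smul]
  match_scalars <;> field_simp <;> ring_nf <;> simp only [I_sq, I_pow_three, I_pow_four] <;> ring_nf

theorem sDiag_mul_sRaise (h : QRel q a a' c c') (hq : q ≠ 0) (d : ℂ) :
    sDiag d a a' c c' * sRaise q d a' c' = q ^ 2 • (sRaise q d a' c' * sDiag d a a' c c') := by
  simp only [sLow, sRaise, sDiag, mul_add, add_mul, mul_sub, sub_mul, smul_mul_assoc,
    mul_smul_comm, smul_add, smul_sub, smul_smul, mul_assoc, pow_two, h.ca hq, h.c'a hq, h.ca',
    h.c'a', h.cc', h.aa', h.a'a, mul_mul_eq_of_mul_eq (h.ca hq), mul_mul_eq_of_mul_eq (h.c'a hq),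
    mul_mul_eq_of_mul_eq h.ca', mul_mul_eq_of_mul_eq h.c'a', mul_mul_eq_of_mul_eq h.cc',
    mul_mul_eq_of_mul_eq h.aa', mul_mul_eq_of_mul_eq h.a'a, one_mul, mul_one, smul_neg, neg_mul,
    mul_neg, neg_smul]
  match_scalars <;> field_simp <;> ring_nf <;> simp only [I_sq, I_pow_three, I_pow_four] <;> ring_nf

theorem sRaise_mul_sLow (h : QRel q a a' c c') (hq : q ≠ 0) (d : ℂ) :
    sRaise q d a' c' * sLow q d a c =
      (1 / 4 : ℂ) • (1 - d • sDiag d a a' c c' - sDiag d a a' c c' ^ 2) := by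
  simp only [sLow, sRaise, sDiag, mul_add, add_mul, mul_sub, sub_mul, smul_mul_assoc,
    mul_smul_comm, smul_add, smul_sub, smul_smul, mul_assoc, pow_two, h.ca hq, h.c'a hq, h.ca',
    h.c'a', h.cc', h.aa', h.a'a, mul_mul_eq_of_mul_eq (h.ca hq), mul_mul_eq_of_mul_eq (h.c'a hq),
    mul_mul_eq_of_mul_eq h.ca', mul_mul_eq_of_mul_eq h.c'a', mul_mul_eq_of_mul_eq h.cc',
    mul_mul_eq_of_mul_eq h.aa', mul_mul_eq_of_mul_eq h.a'a, one_mul, mul_one, smul_neg, neg_mul,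
    mul_neg, neg_smul]
  match_scalars <;> field_simp <;> ring_nf <;> simp only [I_sq, I_pow_three, I_pow_four] <;> ring_nf

theorem sLow_mul_sRaise (h : QRel q a a' c c') (hq : q ≠ 0) (d : ℂ) :
    sLow q d a c * sRaise q d a' c' =
      (1 / 4 : ℂ) • (1 - (d * q ^ 2) • sDiag d a a' c c' - q ^ 4 • sDiag d a a' c c' ^ 2) := by
  simp only [sLow, sRaise, sDiag, mul_add, add_mul, mul_sub, sub_mul, smul_mul_assoc,
    mul_smul_comm, smul_add, smul_sub, smul_smul, mul_assoc, pow_two, h.ca hq, h.c'a hq, h.ca',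
    h.c'a', h.cc', h.aa', h.a'a, mul_mul_eq_of_mul_eq (h.ca hq), mul_mul_eq_of_mul_eq (h.c'a hq),
    mul_mul_eq_of_mul_eq h.ca', mul_mul_eq_of_mul_eq h.c'a', mul_mul_eq_of_mul_eq h.cc',
    mul_mul_eq_of_mul_eq h.aa', mul_mul_eq_of_mul_eq h.a'a, one_mul, mul_one, smul_neg, neg_mul,
    mul_neg, neg_smul]
  match_scalars <;> field_simp <;> ring_nf <;> simp only [I_sq, I_pow_three, I_pow_four] <;> ring_nf

/-- The left side is what the twisted Leibniz rule of `deriv` yields on the lowering word. That the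
result is affine in the diagonal part is the source of the moment recurrence. -/
theorem deriv_sLow (h : QRel q a a' c c') (hq : q ≠ 0) (d : ℂ) :
    (1 / 2 : ℂ) • ((q • a) * (-(q • c')) + -(q • c') * a + q • ((q • c) * a' + a' * c) -
      (I * q * d) • ((q • c) * (-(q • c')) + a' * a)) =
      (-(I * q / 2)) • ((1 + q ^ 2) • sDiag d a a' c c' + d • 1) := by
  simp only [sLow, sRaise, sDiag, mul_add, add_mul, mul_sub, sub_mul, smul_mul_assoc,
    mul_smul_comm, smul_add, smul_sub, smul_smul, mul_assoc, pow_two, h.ca hq, h.c'a hq, h.ca',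
    h.c'a', h.cc', h.aa', h.a'a, mul_mul_eq_of_mul_eq (h.ca hq), mul_mul_eq_of_mul_eq (h.c'a hq),
    mul_mul_eq_of_mul_eq h.ca', mul_mul_eq_of_mul_eq h.c'a', mul_mul_eq_of_mul_eq h.cc',
    mul_mul_eq_of_mul_eq h.aa', mul_mul_eq_of_mul_eq h.a'a, one_mul, mul_one, smul_neg, neg_mul,
    mul_neg, neg_smul]
  match_scalars <;> field_simp <;> ring_nf <;> simp only [I_sq, I_pow_three, I_pow_four] <;> ring_nf

/-- Again the twisted Leibniz rule written out: the derivation turns the diagonal part into the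
raising part, which the lowering part later converts back into a polynomial in the diagonal one. -/
theorem deriv_sDiag (h : QRel q a a' c c') (hq : q ≠ 0) (d : ℂ) :
    I • ((q⁻¹ • a') * a' - (q⁻¹ • c') * -(q • c')) - d • ((q⁻¹ • c') * a') =
      (2 * I * q⁻¹) • sRaise q d a' c' := by
  simp only [sLow, sRaise, sDiag, mul_add, add_mul, mul_sub, sub_mul, smul_mul_assoc,
    mul_smul_comm, smul_add, smul_sub, smul_smul, mul_assoc, pow_two, h.ca hq, h.c'a hq, h.ca',
    h.c'a', h.cc', h.aa', h.a'a, mul_mul_eq_of_mul_eq (h.ca hq), mul_mul_eq_of_mul_eq (h.c'a hq),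
    mul_mul_eq_of_mul_eq h.ca', mul_mul_eq_of_mul_eq h.c'a', mul_mul_eq_of_mul_eq h.cc',
    mul_mul_eq_of_mul_eq h.aa', mul_mul_eq_of_mul_eq h.a'a, one_mul, mul_one, smul_neg, neg_mul,
    mul_neg, neg_smul]
  match_scalars <;> field_simp
  rw [I_sq, mul_neg_one]

end QRel

/-- The relations between the lowering, raising and diagonal parts of the spherical element. -/
structure LadderRel (r d : ℂ) {R : Type*} [Ring R] [Algebra ℂ R] (s s' t : R) : Prop where
  st : s * t = r • (t * s)
  ts' : t * s' = r • (s' * t)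
  s's : s' * s = (1 / 4 : ℂ) • (1 - d • t - t ^ 2)
  ss' : s * s' = (1 / 4 : ℂ) • (1 - (d * r) • t - r ^ 2 • t ^ 2)

theorem QRel.ladderRel {q : ℂ} {R : Type*} [Ring R] [Algebra ℂ R] {a a' c c' : R}
    (h : QRel q a a' c c') (hq : q ≠ 0) (d : ℂ) :
    LadderRel (q ^ 2) d (sLow q d a c) (sRaise q d a' c') (sDiag d a a' c c') where
  st := h.sLow_mul_sDiag hq d
  ts' := h.sDiag_mul_sRaise hq d
  s's := h.sRaise_mul_sLow hq d
  ss' := by rw [h.sLow_mul_sRaise hq d, ← pow_mul]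

/-! ### Normal ordering under the ladder relations -/

namespace LadderRel

variable {r d : ℂ} {R R' : Type*} [Ring R] [Algebra ℂ R] [Ring R'] [Algebra ℂ R'] {s s' t : R}
  {u u' v : R'}

/-- Normal ordering in a product algebra produces one set of coefficients valid in both factors.
This replaces a basis theorem when the quantum group is compared with its models. -/
theorem prod (h : LadderRel r d s s' t) (h' : LadderRel r d u u' v) :
    LadderRel r d (s, u) (s', u') (t, v) where
  st := Prod.ext h.st h'.st
  ts' := Prod.ext h.ts' h'.ts'
  s's := Prod.ext h.s's h'.s's
  ss' := Prod.ext h.ss' h'.ss'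

theorem s_mul_pow (h : LadderRel r d s s' t) (n : ℕ) : s * t ^ n = r ^ n • (t ^ n * s) := by
  induction n with
  | zero => simp
  | succ n ih =>
    rw [pow_succ t, ← mul_assoc, ih, smul_mul_assoc, mul_assoc, h.st, mul_smul_comm, smul_smul,
      ← mul_assoc, pow_succ r]

theorem t_mul_pow (h : LadderRel r d s s' t) (n : ℕ) : t * s' ^ n = r ^ n • (s' ^ n * t) := by
  induction n with
  | zero => simp
  | succ n ih =>
    rw [pow_succ s', ← mul_assoc, ih, smul_mul_assoc, mul_assoc, h.ts', mul_smul_comm, smul_smul,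
      ← mul_assoc, pow_succ r]

/-- The span of the normally ordered monomials. -/
def normalSpan (s s' t : R) : Submodule ℂ R :=
  Submodule.span ℂ ({x | ∃ j k : ℕ, x = t ^ j * s ^ k} ∪ {x | ∃ j k : ℕ, x = s' ^ k * t ^ j})

theorem mem_left (j k : ℕ) : t ^ j * s ^ k ∈ normalSpan s s' t :=
  Submodule.subset_span (.inl ⟨j, k, rfl⟩)

theorem mem_right (j k : ℕ) : s' ^ k * t ^ j ∈ normalSpan s s' t :=
  Submodule.subset_span (.inr ⟨j, k, rfl⟩)

theorem mul_mem_of {y : R} (h1 : ∀ j k : ℕ, y * (t ^ j * s ^ k) ∈ normalSpan s s' t)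
    (h2 : ∀ j k : ℕ, y * (s' ^ k * t ^ j) ∈ normalSpan s s' t) {x : R}
    (hx : x ∈ normalSpan s s' t) : y * x ∈ normalSpan s s' t := by
  induction hx using Submodule.span_induction with
  | mem x hx =>
    rcases hx with ⟨j, k, rfl⟩ | ⟨j, k, rfl⟩
    · exact h1 j k
    · exact h2 j k
  | zero => rw [mul_zero]; exact zero_mem _
  | add x z _ _ hx hz => rw [mul_add]; exact add_mem hx hz
  | smul c x _ hx => rw [mul_smul_comm]; exact Submodule.smul_mem _ _ hx

theorem t_mul_mem (h : LadderRel r d s s' t) {x : R} (hx : x ∈ normalSpan s s' t) :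
    t * x ∈ normalSpan s s' t := by
  refine mul_mem_of (fun j k => ?_) (fun j k => ?_) hx
  · rw [← mul_assoc, ← pow_succ']; exact mem_left _ _
  · rw [← mul_assoc, h.t_mul_pow, smul_mul_assoc, mul_assoc, ← pow_succ']
    exact Submodule.smul_mem _ _ (mem_right _ _)

theorem quadratic_mul_mem (h : LadderRel r d s s' t) (b c : ℂ) {x : R}
    (hx : x ∈ normalSpan s s' t) :
    ((1 / 4 : ℂ) • (1 - b • t - c • t ^ 2)) * x ∈ normalSpan s s' t := by
  simp only [smul_mul_assoc, sub_mul, one_mul, pow_two, mul_assoc]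
  exact Submodule.smul_mem _ _ (sub_mem (sub_mem hx (Submodule.smul_mem _ _ (h.t_mul_mem hx)))
    (Submodule.smul_mem _ _ (h.t_mul_mem (h.t_mul_mem hx))))

theorem s_mul_mem (h : LadderRel r d s s' t) {x : R} (hx : x ∈ normalSpan s s' t) :
    s * x ∈ normalSpan s s' t := by
  refine mul_mem_of (fun j k => ?_) (fun j k => ?_) hx
  · rw [← mul_assoc, h.s_mul_pow, smul_mul_assoc, mul_assoc, ← pow_succ']
    exact Submodule.smul_mem _ _ (mem_left _ _)
  · cases k with
    | zero =>
      rw [pow_zero, one_mul, h.s_mul_pow]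
      simpa using Submodule.smul_mem _ (r ^ j) (mem_left (s := s) (s' := s') (t := t) j 1)
    | succ k =>
      rw [pow_succ', mul_assoc, ← mul_assoc, h.ss']
      exact h.quadratic_mul_mem _ _ (mem_right _ _)

theorem s'_mul_mem (h : LadderRel r d s s' t) (hr : r ≠ 0) {x : R} (hx : x ∈ normalSpan s s' t) :
    s' * x ∈ normalSpan s s' t := by
  refine mul_mem_of (fun j k => ?_) (fun j k => ?_) hx
  · cases k with
    | zero =>
      simpa using mem_right (s := s) (s' := s') (t := t) j 1
    | succ k =>
      have e : t ^ j * s = (r ^ j)⁻¹ • (s * t ^ j) := by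
        rw [h.s_mul_pow, inv_smul_smul₀ (pow_ne_zero _ hr)]
      rw [pow_succ', ← mul_assoc (t ^ j), e, smul_mul_assoc, mul_smul_comm, mul_assoc, ← mul_assoc,
        h.s's]
      refine Submodule.smul_mem _ _ ?_
      have := h.quadratic_mul_mem d 1 (mem_left (s := s) (s' := s') (t := t) j k)
      rwa [one_smul] at this
  · rw [← mul_assoc, ← pow_succ']; exact mem_right _ _

/-- The span is stable under left multiplication by s, s' and t, because an adjacent pair s s' or s'
s collapses to a quadratic in t. -/
theorem pow_mem (h : LadderRel r d s s' t) (hr : r ≠ 0) (c : ℂ) (n : ℕ) :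
    (s + s' + c • t) ^ n ∈ normalSpan s s' t := by
  induction n with
  | zero => simpa using mem_left (s := s) (s' := s') (t := t) 0 0
  | succ n ih =>
    rw [pow_succ', add_mul, add_mul, smul_mul_assoc]
    exact add_mem (add_mem (h.s_mul_mem ih) (h.s'_mul_mem hr ih))
      (Submodule.smul_mem _ _ (h.t_mul_mem ih))

end LadderRel

/-! ### Jacobi operators as models of the ladder relations -/

namespace AlSalamChihara

open Finsupp

/-- The lowest vector is killed by the lowering part, which forces 1 - dl - l² = 0; comparing
coefficients on the higher vectors forces ab = -r l². -/
theorem ladderRel_model {r d l ab : ℝ} (hr : r ≠ 0) (hl : l ^ 2 + d * l = 1) (hab : ab = -(r * l ^ 2)) :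
    LadderRel (r : ℂ) (d : ℂ) (lowering ab r) raising (diagonal l r) := by
  have hlC : (l : ℂ) ^ 2 + d * l = 1 := by exact_mod_cast hl
  have hrC : (r : ℂ) ≠ 0 := by exact_mod_cast hr
  constructor
  · refine Finsupp.lhom_ext fun k c => ?_
    simp only [Module.End.mul_apply, LinearMap.smul_apply, lowering_single, diagonal_single,
      smul_single, smul_eq_mul]
    cases k with
    | zero => simp
    | succ k =>
      congr 1
      push_cast
      ring
  · refine Finsupp.lhom_ext fun k c => ?_
    simp only [Module.End.mul_apply, LinearMap.smul_apply, raising_single, diagonal_single,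
      smul_single, smul_eq_mul]
    congr 1
    push_cast
    ring
  · refine Finsupp.lhom_ext fun k c => ?_
    simp only [Module.End.mul_apply, LinearMap.smul_apply, LinearMap.sub_apply, pow_two,
      Module.End.one_apply, raising_single, lowering_single, diagonal_single,
      smul_single, smul_eq_mul, ← single_sub]
    cases k with
    | zero =>
      have : c * (1 / 4) * (1 - d * l - l ^ 2) = 0 := by linear_combination (-c / 4) * hlC
      simp only [pow_zero]
      rw [eq_comm]
      have e : ∀ x : ℂ, x = 0 → single 0 x = single (0 - 1 + 1) (c * (((1 / 2 * ((1 - 1) * (1 - ab * r ^ (0 - 1 : ℕ))) : ℝ)) : ℂ) * (1 / 2)) := by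
        rintro x rfl
        simp
      refine e _ ?_
      push_cast
      linear_combination this
    | succ k =>
      rw [Nat.add_sub_cancel]
      congr 1
      rw [hab]
      push_cast
      linear_combination (c / 4 * r ^ (k + 1)) * hlC
  · refine Finsupp.lhom_ext fun k c => ?_
    simp only [Module.End.mul_apply, LinearMap.smul_apply, LinearMap.sub_apply, pow_two,
      Module.End.one_apply, raising_single, lowering_single, diagonal_single,
      smul_single, smul_eq_mul, ← single_sub]
    rw [Nat.add_sub_cancel]
    congr 1
    rw [hab]
    push_cast
    linear_combination (c / 4 * r ^ (k + 1)) * hlC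

theorem jacobi_eq (a b r l μ : ℝ) (h : a + b = 2 * μ * l) :
    jacobi a b r = lowering (a * b) r + raising + (μ : ℂ) • diagonal l r := by
  rw [jacobi, h]
  congr 1
  refine Finsupp.lhom_ext fun k c => ?_
  simp only [LinearMap.smul_apply, diagonal_single, smul_single, smul_eq_mul]
  congr 1
  push_cast
  ring

end AlSalamChihara

/-! ### Symmetries of the noncommutative polynomials -/

namespace QSU2

open FreeAlgebra Complex

/-- The scaling automorphism of the noncommutative polynomials. -/
def scaling (q : ℝ) : FreeAlgebra ℂ Gen →ₐ[ℂ] FreeAlgebra ℂ Gen :=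
  lift ℂ fun
    | .alpha => (q : ℂ) • ι ℂ .alpha
    | .alphaStar => (q : ℂ)⁻¹ • ι ℂ .alphaStar
    | .gamma => (q : ℂ) • ι ℂ .gamma
    | .gammaStar => (q : ℂ)⁻¹ • ι ℂ .gammaStar

/-- The homomorphism to triangular matrices whose corner is a twisted derivation. -/
def twist (q : ℝ) : FreeAlgebra ℂ Gen →ₐ[ℂ] Matrix (Fin 2) (Fin 2) (FreeAlgebra ℂ Gen) :=
  lift ℂ fun
    | .alpha => !![(q : ℂ) • ι ℂ .alpha, -((q : ℂ) • ι ℂ .gammaStar); 0, ι ℂ .alpha]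
    | .alphaStar => !![(q : ℂ)⁻¹ • ι ℂ .alphaStar, 0; 0, ι ℂ .alphaStar]
    | .gamma => !![(q : ℂ) • ι ℂ .gamma, ι ℂ .alphaStar; 0, ι ℂ .gamma]
    | .gammaStar => !![(q : ℂ)⁻¹ • ι ℂ .gammaStar, 0; 0, ι ℂ .gammaStar]

/-- The twisted derivation with `α ↦ -q γ⋆`, `γ ↦ α⋆`, `α⋆ ↦ 0`, `γ⋆ ↦ 0`. -/
def deriv (q : ℝ) (w : FreeAlgebra ℂ Gen) : FreeAlgebra ℂ Gen := twist q w 0 1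

/-- The rotation `α ↦ z α`, `γ ↦ z γ`. -/
def rotate (z : ℂ) : FreeAlgebra ℂ Gen →ₐ[ℂ] FreeAlgebra ℂ Gen :=
  lift ℂ fun
    | .alpha => z • ι ℂ .alpha
    | .alphaStar => starRingEnd ℂ z • ι ℂ .alphaStar
    | .gamma => z • ι ℂ .gamma
    | .gammaStar => starRingEnd ℂ z • ι ℂ .gammaStar

theorem twist_eq (q : ℝ) (w : FreeAlgebra ℂ Gen) :
    twist q w = !![scaling q w, deriv q w; 0, w] := by
  suffices h : twist q w 0 0 = scaling q w ∧ twist q w 1 0 = 0 ∧ twist q w 1 1 = w by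
    ext i j
    fin_cases i <;> fin_cases j
    · exact h.1
    · rfl
    · exact h.2.1
    · exact h.2.2
  induction w using FreeAlgebra.induction with
  | grade0 r => simp [Matrix.algebraMap_matrix_apply]
  | grade1 x => cases x <;> simp [twist, scaling]
  | mul x y hx hy =>
    simp only [map_mul, Matrix.mul_apply, Fin.sum_univ_two, hx.1, hx.2.1, hx.2.2, hy.1, hy.2.1,
      hy.2.2, mul_zero, zero_mul, add_zero, zero_add, and_self]
  | add x y hx hy =>
    simp only [map_add, Matrix.add_apply, hx.1, hx.2.1, hx.2.2, hy.1, hy.2.1, hy.2.2, add_zero,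
      and_self]

theorem deriv_mul (q : ℝ) (x y : FreeAlgebra ℂ Gen) :
    deriv q (x * y) = scaling q x * deriv q y + deriv q x * y := by
  rw [deriv, map_mul, twist_eq q x, twist_eq q y]
  simp [Matrix.mul_apply, Fin.sum_univ_two]

theorem deriv_add (q : ℝ) (x y : FreeAlgebra ℂ Gen) :
    deriv q (x + y) = deriv q x + deriv q y := by
  rw [deriv, map_add]; rfl

theorem deriv_sub (q : ℝ) (x y : FreeAlgebra ℂ Gen) :
    deriv q (x - y) = deriv q x - deriv q y := by
  rw [deriv, map_sub]; rfl

theorem deriv_smul (q : ℝ) (c : ℂ) (x : FreeAlgebra ℂ Gen) :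
    deriv q (c • x) = c • deriv q x := by
  rw [deriv, map_smul]; rfl

theorem deriv_one (q : ℝ) : deriv q 1 = 0 := by
  rw [deriv, map_one]; rfl

theorem deriv_algebraMap (q : ℝ) (c : ℂ) : deriv q (algebraMap ℂ _ c) = 0 := by
  rw [Algebra.algebraMap_eq_smul_one, deriv_smul, deriv_one, smul_zero]

theorem deriv_alpha (q : ℝ) : deriv q (ι ℂ .alpha) = -((q : ℂ) • ι ℂ .gammaStar) := by
  simp [deriv, twist]

theorem deriv_alphaStar (q : ℝ) : deriv q (ι ℂ .alphaStar) = 0 := by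
  simp [deriv, twist]

theorem deriv_gamma (q : ℝ) : deriv q (ι ℂ .gamma) = ι ℂ .alphaStar := by
  simp [deriv, twist]

theorem deriv_gammaStar (q : ℝ) : deriv q (ι ℂ .gammaStar) = 0 := by
  simp [deriv, twist]

/-- The properties of the Haar functional that determine it on the spherical subalgebra. -/
structure IsHaarLike {q : ℝ} (φ : QSU2 q →L[ℂ] ℂ) : Prop where
  map_one : φ 1 = 1
  map_rotate : ∀ z : ℂ, ‖z‖ = 1 → ∀ w, φ (value q (rotate z w)) = φ (value q w)
  map_deriv : ∀ w, scaling q w = (q : ℂ) ^ 2 • w → φ (value q (deriv q w)) = 0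

variable (q : ℝ) (d : ℂ)

/-- The lowering part of the spherical element as a noncommutative polynomial. -/
def lowWord : FreeAlgebra ℂ Gen := sLow (q : ℂ) d (ι ℂ .alpha) (ι ℂ .gamma)

/-- The raising part of the spherical element as a noncommutative polynomial. -/
def raiseWord : FreeAlgebra ℂ Gen := sRaise (q : ℂ) d (ι ℂ .alphaStar) (ι ℂ .gammaStar)

/-- The diagonal part of the spherical element as a noncommutative polynomial. -/
def diagWord : FreeAlgebra ℂ Gen :=
  sDiag d (ι ℂ .alpha) (ι ℂ .alphaStar) (ι ℂ .gamma) (ι ℂ .gammaStar)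

/-- The lowering part of the spherical element. -/
def low : QSU2 q := sLow (q : ℂ) d (α q) (γ q)

/-- The raising part of the spherical element. -/
def raise : QSU2 q := sRaise (q : ℂ) d (star (α q)) (star (γ q))

/-- The diagonal part of the spherical element. -/
def diag : QSU2 q := sDiag d (α q) (star (α q)) (γ q) (star (γ q))

@[simp] theorem value_alpha : value q (ι ℂ .alpha) = α q := by simp [value]
@[simp] theorem value_alphaStar : value q (ι ℂ .alphaStar) = star (α q) := by simp [value]
@[simp] theorem value_gamma : value q (ι ℂ .gamma) = γ q := by simp [value]
@[simp] theorem value_gammaStar : value q (ι ℂ .gammaStar) = star (γ q) := by simp [value]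

theorem value_lowWord : value q (lowWord q d) = low q d := by
  simp only [lowWord, low, sLow, map_smul, map_sub, map_add, map_mul, value_alpha, value_gamma]

theorem value_raiseWord : value q (raiseWord q d) = raise q d := by
  simp only [raiseWord, raise, sRaise, map_smul, map_add, map_mul, value_alphaStar, value_gammaStar]

theorem value_diagWord : value q (diagWord d) = diag q d := by
  simp only [diagWord, diag, sDiag, map_smul, map_sub, map_mul, value_alpha, value_alphaStar,
    value_gamma, value_gammaStar]

theorem scaling_lowWord : scaling q (lowWord q d) = (q : ℂ) ^ 2 • lowWord q d := by
  simp only [lowWord, sLow, scaling, map_smul, map_sub, map_add, map_mul, lift_ι_apply,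
    smul_mul_assoc, mul_smul_comm]
  module

theorem scaling_diagWord (hq : q ≠ 0) : scaling q (diagWord d) = diagWord d := by
  have hq' : (q : ℂ) ≠ 0 := by exact_mod_cast hq
  simp only [diagWord, sDiag, scaling, map_smul, map_sub, map_mul, lift_ι_apply,
    smul_mul_assoc, mul_smul_comm, smul_smul]
  match_scalars <;> field_simp

theorem rotate_lowWord (z : ℂ) : rotate z (lowWord q d) = z ^ 2 • lowWord q d := by
  simp only [lowWord, sLow, rotate, map_smul, map_sub, map_add, map_mul, lift_ι_apply,
    smul_mul_assoc, mul_smul_comm]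
  module

theorem rotate_raiseWord (z : ℂ) :
    rotate z (raiseWord q d) = starRingEnd ℂ z ^ 2 • raiseWord q d := by
  simp only [raiseWord, sRaise, rotate, map_smul, map_add, map_mul, lift_ι_apply,
    smul_mul_assoc, mul_smul_comm]
  module

theorem rotate_diagWord {z : ℂ} (hz : ‖z‖ = 1) : rotate z (diagWord d) = diagWord d := by
  have hz1 : z * starRingEnd ℂ z = 1 := by
    rw [mul_conj, normSq_eq_norm_sq, hz]; simp
  simp only [diagWord, sDiag, rotate, map_smul, map_sub, map_mul, lift_ι_apply,
    smul_mul_assoc, mul_smul_comm, smul_smul, hz1, one_smul]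

theorem value_deriv_lowWord (hq : q ≠ 0) : value q (deriv q (lowWord q d)) =
    (-(I * q / 2)) • ((1 + (q : ℂ) ^ 2) • diag q d + d • 1) := by
  have hq' : (q : ℂ) ≠ 0 := by exact_mod_cast hq
  rw [diag, ← (relations q).qRel.deriv_sLow hq' d]
  simp only [lowWord, sLow, deriv_smul, deriv_sub, deriv_add, deriv_mul, deriv_alpha, deriv_gamma,
    map_smul, map_sub, map_add, map_mul, map_neg, scaling, lift_ι_apply, value_alpha,
    value_alphaStar, value_gamma, value_gammaStar]

theorem value_deriv_diagWord (hq : q ≠ 0) : value q (deriv q (diagWord d)) =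
    (2 * I * (q : ℂ)⁻¹) • raise q d := by
  have hq' : (q : ℂ) ≠ 0 := by exact_mod_cast hq
  rw [raise, ← (relations q).qRel.deriv_sDiag hq' d]
  simp only [diagWord, sDiag, deriv_smul, deriv_sub, deriv_mul, deriv_alpha, deriv_gamma,
    deriv_alphaStar, deriv_gammaStar, zero_mul, add_zero,
    map_smul, map_sub, map_mul, map_neg, scaling, lift_ι_apply, value_alphaStar,
    value_gammaStar]

theorem ladderRel (hq : q ≠ 0) :
    LadderRel ((q : ℂ) ^ 2) d (low q d) (raise q d) (diag q d) :=
  (relations q).qRel.ladderRel (by exact_mod_cast hq) d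

/-- Each of the n + 1 Leibniz terms is a power of the diagonal part with one factor replaced by the
raising part. Moving that factor to the left costs powers of q², whence the geometric sum. -/
theorem value_deriv_diagWord_pow (hq : q ≠ 0) (n : ℕ) :
    value q (deriv q (diagWord d ^ (n + 1))) =
      (2 * I * (q : ℂ)⁻¹ * ∑ i ∈ Finset.range (n + 1), ((q : ℂ) ^ 2) ^ i) •
        (raise q d * diag q d ^ n) := by
  induction n with
  | zero => simp [value_deriv_diagWord q d hq]
  | succ n ih =>
    rw [pow_succ', deriv_mul, scaling_diagWord q d hq, map_add, map_mul, map_mul, ih,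
      value_deriv_diagWord q d hq, map_pow, value_diagWord, mul_smul_comm, ← mul_assoc,
      (ladderRel q d hq).ts', smul_mul_assoc, smul_mul_assoc, mul_assoc (raise q d), ← pow_succ', smul_smul,
      ← add_smul, Finset.sum_range_succ' _ (n + 1), pow_zero]
    congr 1
    simp only [pow_succ ((q : ℂ) ^ 2), ← Finset.sum_mul]
    ring

variable {q}

/-- The three-term recurrence for the moments of the diagonal part. -/
theorem IsHaarLike.moment_recurrence {φ : QSU2 q →L[ℂ] ℂ} (h : IsHaarLike φ) (hq : q ≠ 0)
    (n : ℕ) :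
    (1 - ((q : ℂ) ^ 2) ^ (n + 2)) * φ (diag q d ^ (n + 1)) =
      -d * (1 - ((q : ℂ) ^ 2) ^ (n + 1)) * φ (diag q d ^ n) +
        (1 - ((q : ℂ) ^ 2) ^ n) * φ (diag q d ^ (n - 1)) := by
  have hq' : (q : ℂ) ≠ 0 := by exact_mod_cast hq
  have hI : I ≠ 0 := I_ne_zero
  -- The word has scaling weight q², as `map_deriv` requires. Its derivative, brought to normal
  -- order, is a polynomial in the diagonal part alone.
  have hw : scaling q (lowWord q d * diagWord d ^ n) =
      (q : ℂ) ^ 2 • (lowWord q d * diagWord d ^ n) := by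
    rw [map_mul, map_pow, scaling_lowWord, scaling_diagWord q d hq, smul_mul_assoc]
  have h1 := h.map_deriv _ hw
  rw [deriv_mul, scaling_lowWord, map_add, map_mul, map_mul, value_deriv_lowWord q d hq, map_pow,
    value_diagWord, map_smul, value_lowWord, smul_mul_assoc, smul_mul_assoc, add_mul,
    smul_mul_assoc, smul_mul_assoc, one_mul, ← pow_succ'] at h1
  cases n with
  | zero =>
    rw [pow_zero, deriv_one, map_zero, mul_zero, smul_zero, zero_add, map_smul, map_add, map_smul,
      map_smul, smul_eq_mul, mul_eq_zero] at h1
    have h2 := h1.resolve_left (by simp [hI, hq'])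
    simp only [smul_eq_mul, pow_zero] at h2 ⊢
    linear_combination (1 - (q : ℂ) ^ 2) * h2
  | succ n =>
    have hgeo : (∑ i ∈ Finset.range (n + 1), ((q : ℂ) ^ 2) ^ i) * ((q : ℂ) ^ 2 - 1) =
        ((q : ℂ) ^ 2) ^ (n + 1) - 1 := geom_sum_mul _ _
    rw [value_deriv_diagWord_pow q d hq, mul_smul_comm, ← mul_assoc, (ladderRel q d hq).ss',
      smul_mul_assoc, sub_mul, sub_mul, one_mul, smul_mul_assoc, smul_mul_assoc, ← pow_succ',
      ← pow_add, add_comm 2 n] at h1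
    simp only [map_add, map_sub, map_smul, smul_eq_mul] at h1
    rw [Nat.add_sub_cancel]
    generalize (∑ i ∈ Finset.range (n + 1), ((q : ℂ) ^ 2) ^ i) = σ at *
    generalize φ (diag q d ^ n) = m0 at *
    generalize φ (diag q d ^ (n + 1)) = m1 at *
    rw [show n + 1 + 1 = n + 2 from rfl] at *
    generalize φ (diag q d ^ (n + 2)) = m2 at *
    have h2 : σ * (m0 - d * (q : ℂ) ^ 2 * m1 - (q : ℂ) ^ 4 * m2) -
        ((1 + (q : ℂ) ^ 2) * m2 + d * m1) = 0 := by
      have h3 : (I * q / 2) * (σ * (m0 - d * (q : ℂ) ^ 2 * m1 - (q : ℂ) ^ 4 * m2) -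
        ((1 + (q : ℂ) ^ 2) * m2 + d * m1)) = 0 := by
        rw [← h1]; field_simp; ring
      exact (mul_eq_zero.1 h3).resolve_left (by simp [hI, hq'])
    have e1 : ((q : ℂ) ^ 2) ^ (n + 2) = (q : ℂ) ^ 2 * ((q : ℂ) ^ 2) ^ (n + 1) := pow_succ' _ _
    have e2 : ((q : ℂ) ^ 2) ^ (n + 3) = (q : ℂ) ^ 4 * ((q : ℂ) ^ 2) ^ (n + 1) := by ring
    rw [show n + 1 + 2 = n + 3 from rfl, e1, e2]
    linear_combination ((q : ℂ) ^ 2 - 1) * h2 -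
      (m0 - d * (q : ℂ) ^ 2 * m1 - (q : ℂ) ^ 4 * m2) * hgeo

end QSU2

/-! ### Moments of the spherical element under Haar-like functionals -/

namespace AlSalamChihara

open Finsupp

theorem diagonal_pow_single (l r : ℝ) (j k : ℕ) (c : ℂ) :
    (diagonal l r ^ j) (single k c) = single k (c * ((l * r ^ k : ℝ) : ℂ) ^ j) := by
  induction j with
  | zero => simp
  | succ j ih =>
    rw [pow_succ', Module.End.mul_apply, ih, diagonal_single, pow_succ, mul_assoc]

theorem raising_pow_single (j k : ℕ) (c : ℂ) :
    (raising ^ j) (single k c) = single (k + j) (c * (1 / 2) ^ j) := by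
  induction j with
  | zero => simp
  | succ j ih =>
    rw [pow_succ', Module.End.mul_apply, ih, raising_single, pow_succ, mul_assoc, add_assoc]

theorem lowering_pow_single (ab r : ℝ) (j k : ℕ) (c : ℂ) :
    ∃ c' : ℂ, (lowering ab r ^ j) (single k c) = single (k - j) c' ∧ (k < j → c' = 0) := by
  induction j with
  | zero => exact ⟨c, by simp, by simp⟩
  | succ j ih =>
    obtain ⟨c', h1, h2⟩ := ih
    refine ⟨_, by rw [pow_succ', Module.End.mul_apply, h1, lowering_single, Nat.sub_sub], fun h => ?_⟩
    rcases (Nat.lt_succ_iff.1 h).lt_or_eq with h3 | rfl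
    · rw [h2 h3, zero_mul]
    · simp

theorem diagonal_mul_lowering_apply_self (l ab r : ℝ) (j k i : ℕ) :
    ((diagonal l r ^ j * lowering ab r ^ (k + 1)) (single i 1)) i = 0 := by
  obtain ⟨c', h1, h2⟩ := lowering_pow_single ab r (k + 1) i 1
  rw [Module.End.mul_apply, h1, diagonal_pow_single, single_apply]
  split_ifs with h
  · rw [h2 (by lia), zero_mul]
  · rfl

theorem raising_mul_diagonal_apply_self (l r : ℝ) (j k i : ℕ) :
    ((raising ^ (k + 1) * diagonal l r ^ j) (single i 1)) i = 0 := by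
  rw [Module.End.mul_apply, diagonal_pow_single, raising_pow_single, single_apply, if_neg (by lia)]

end AlSalamChihara

/-! ### The trace formula for powers of the spherical element -/

namespace QSU2

open Complex AlSalamChihara Finsupp

variable {q : ℝ}

/-- The lowering and raising parts have rotation weights 2 and -2. With this z the rotation changes
the sign of a monomial with k + 1 such factors, so its Haar value is zero. -/
theorem exists_norm_one_pow_ne_one (k : ℕ) : ∃ z : ℂ, ‖z‖ = 1 ∧ z ^ (2 * (k + 1)) = -1 := by
  refine ⟨exp (Real.pi / (2 * (k + 1) : ℕ) * I), ?_, ?_⟩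
  · have : (Real.pi / (2 * (k + 1) : ℕ) * I : ℂ) = ((Real.pi / (2 * (k + 1) : ℕ) : ℝ) : ℂ) * I := by
      push_cast; ring
    rw [this, norm_exp_ofReal_mul_I]
  · rw [← exp_nat_mul, ← mul_assoc, mul_div_cancel₀, exp_pi_mul_I]
    exact_mod_cast (by lia : 2 * (k + 1) ≠ 0)

theorem IsHaarLike.map_diag_low {φ : QSU2 q →L[ℂ] ℂ} (h : IsHaarLike φ) (d : ℂ) (j k : ℕ) :
    φ (diag q d ^ j * low q d ^ (k + 1)) = 0 := by
  obtain ⟨z, hz, hzk⟩ := exists_norm_one_pow_ne_one k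
  have h1 := h.map_rotate z hz (diagWord d ^ j * lowWord q d ^ (k + 1))
  rw [map_mul, map_pow, map_pow, rotate_diagWord d hz, rotate_lowWord, smul_pow, ← pow_mul, hzk,
    mul_smul_comm, map_smul, map_smul, map_mul, map_pow, map_pow, value_diagWord, value_lowWord,
    smul_eq_mul] at h1
  linear_combination (-1 / 2) * h1

theorem IsHaarLike.map_raise_diag {φ : QSU2 q →L[ℂ] ℂ} (h : IsHaarLike φ) (d : ℂ) (j k : ℕ) :
    φ (raise q d ^ (k + 1) * diag q d ^ j) = 0 := by
  obtain ⟨z, hz, hzk⟩ := exists_norm_one_pow_ne_one k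
  have h1 := h.map_rotate z hz (raiseWord q d ^ (k + 1) * diagWord d ^ j)
  rw [map_mul, map_pow, map_pow, rotate_diagWord d hz, rotate_raiseWord, smul_pow, ← pow_mul,
    ← map_pow (starRingEnd ℂ), hzk, map_neg, _root_.map_one,
    smul_mul_assoc, map_smul, map_smul, map_mul, map_pow, map_pow, value_diagWord, value_raiseWord,
    smul_eq_mul] at h1
  linear_combination (-1 / 2) * h1

/-- The moments of the diagonal part. -/
theorem IsHaarLike.moment {φ : QSU2 q →L[ℂ] ℂ} (h : IsHaarLike φ) (hq0 : 0 < q) (hq1 : q < 1)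
    {l₁ l₂ w₁ w₂ d : ℝ} (hl1 : l₁ ^ 2 + d * l₁ = 1) (hl2 : l₂ ^ 2 + d * l₂ = 1)
    (hw : w₁ + w₂ = 1) (hwl : w₁ * l₁ + w₂ * l₂ = -d) (n : ℕ) :
    φ (diag q d ^ n) = ((1 - q ^ 2) / (1 - (q ^ 2) ^ (n + 1)) * (w₁ * l₁ ^ n + w₂ * l₂ ^ n) : ℝ) := by
  have hr1 : q ^ 2 < 1 := pow_lt_one₀ hq0.le hq1 two_ne_zero
  have hr : ∀ n : ℕ, 1 - (q ^ 2) ^ (n + 1) ≠ 0 := fun n => by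
    have := pow_lt_one₀ (by positivity) hr1 (Nat.succ_ne_zero n)
    exact (sub_pos.2 this).ne'
  have hrec := h.moment_recurrence d hq0.ne'
  -- Multiplying the n-th moment by 1 - q^(2(n+1)) gives a sequence with M_(n+1) = -d M_n + M_(n-1),
  -- whose characteristic roots are l₁ and l₂; the weights are fixed by n = 0 and n = 1. Two
  -- consecutive moments are carried along.
  have key : ∀ n, φ (diag q d ^ n) =
        ((1 - q ^ 2) / (1 - (q ^ 2) ^ (n + 1)) * (w₁ * l₁ ^ n + w₂ * l₂ ^ n) : ℝ) ∧
      φ (diag q d ^ (n + 1)) =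
        ((1 - q ^ 2) / (1 - (q ^ 2) ^ (n + 2)) * (w₁ * l₁ ^ (n + 1) + w₂ * l₂ ^ (n + 1)) : ℝ) := by
    intro n
    induction n with
    | zero =>
      have h0 : 1 - q ^ 2 ≠ 0 := by simpa using hr 0
      have e0 : φ (diag q d ^ 0) = 1 := by rw [pow_zero, h.map_one]
      refine ⟨?_, ?_⟩
      · rw [e0, zero_add, pow_one, pow_zero, pow_zero, mul_one, mul_one, hw, mul_one, div_self h0,
          ofReal_one]
      · have h1 := hrec 0
        rw [e0] at h1
        have h2 : (1 - ((q : ℂ) ^ 2) ^ 2) ≠ 0 := by exact_mod_cast hr 1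
        refine mul_left_cancel₀ h2 ?_
        rw [h1, zero_add, pow_one, pow_one, pow_one, hwl]
        simp only [pow_zero, sub_self, zero_mul, add_zero, zero_add]
        push_cast
        rw [← mul_assoc (1 - ((q : ℂ) ^ 2) ^ 2), mul_div_cancel₀ _ h2]
        ring
    | succ n ih =>
      refine ⟨ih.2, ?_⟩
      have h1 := hrec (n + 1)
      rw [ih.2, Nat.add_sub_cancel, ih.1] at h1
      have h2 : (1 - ((q : ℂ) ^ 2) ^ (n + 3)) ≠ 0 := by exact_mod_cast hr (n + 2)
      refine mul_left_cancel₀ h2 ?_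
      rw [show n + 1 + 2 = n + 3 from rfl] at h1 ⊢
      rw [h1]
      have h3 := hr n
      have h4 := hr (n + 1)
      have h5 := hr (n + 2)
      rw [show n + 1 + 1 = n + 2 from rfl] at h4
      rw [show n + 2 + 1 = n + 3 from rfl] at h5
      norm_cast
      have g1 : ∀ x : ℝ, (1 - (q ^ 2) ^ (n + 1 + 1)) * ((1 - q ^ 2) / (1 - (q ^ 2) ^ (n + 2)) * x) =
          (1 - q ^ 2) * x := fun x => by rw [show n + 1 + 1 = n + 2 from rfl]; field_simp
      have g2 : ∀ x : ℝ, (1 - (q ^ 2) ^ (n + 1)) * ((1 - q ^ 2) / (1 - (q ^ 2) ^ (n + 1)) * x) =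
          (1 - q ^ 2) * x := fun x => by field_simp
      have g3 : ∀ x : ℝ, (1 - (q ^ 2) ^ (n + 3)) * ((1 - q ^ 2) / (1 - (q ^ 2) ^ (n + 3)) * x) =
          (1 - q ^ 2) * x := fun x => by field_simp
      rw [mul_assoc, g1, g2, g3]
      linear_combination (-(1 - q ^ 2) * w₁ * l₁ ^ n) * hl1 - ((1 - q ^ 2) * w₂ * l₂ ^ n) * hl2
  exact (key n).1

/-- The elements `x` of the algebra with a model for which `φ` is given by the weighted sum of the
diagonal entries in the model. -/
def traceSubmodule (φ : QSU2 q →L[ℂ] ℂ) (w₁ w₂ : ℂ) :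
    Submodule ℂ (QSU2 q × Module.End ℂ (ℕ →₀ ℂ) × Module.End ℂ (ℕ →₀ ℂ)) where
  carrier := {x | HasSum (fun k : ℕ => (1 - (q : ℂ) ^ 2) * ((q : ℂ) ^ 2) ^ k *
    (w₁ * x.2.1 (single k 1) k + w₂ * x.2.2 (single k 1) k)) (φ x.1)}
  zero_mem' := by
    simp only [Set.mem_ofPred_eq, Prod.fst_zero, Prod.snd_zero, map_zero, LinearMap.zero_apply,
      Finsupp.coe_zero, Pi.zero_apply, mul_zero, add_zero]
    exact hasSum_zero
  add_mem' {x y} hx hy := by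
    have h := HasSum.add hx hy
    simp only [Set.mem_ofPred_eq, Prod.fst_add, Prod.snd_add, map_add, LinearMap.add_apply,
      Finsupp.add_apply]
    refine (congrArg₂ HasSum (funext fun k => ?_) rfl).mp h
    ring
  smul_mem' c x hx := by
    have h := HasSum.mul_left c hx
    simp only [Set.mem_ofPred_eq, Prod.smul_fst, Prod.smul_snd, map_smul, LinearMap.smul_apply,
      Finsupp.smul_apply, smul_eq_mul]
    refine (congrArg₂ HasSum (funext fun k => ?_) rfl).mp h
    ring

theorem mem_traceSubmodule {φ : QSU2 q →L[ℂ] ℂ} {w₁ w₂ : ℂ}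
    {x : QSU2 q × Module.End ℂ (ℕ →₀ ℂ) × Module.End ℂ (ℕ →₀ ℂ)} :
    x ∈ traceSubmodule φ w₁ w₂ ↔ HasSum (fun k : ℕ => (1 - (q : ℂ) ^ 2) * ((q : ℂ) ^ 2) ^ k *
      (w₁ * x.2.1 (single k 1) k + w₂ * x.2.2 (single k 1) k)) (φ x.1) := Iff.rfl

/-- The claim is linear, so it suffices to check it on normally ordered monomials in the product of
the algebra with its two models. Monomials with a lowering or raising factor contribute zero on both
sides; powers of the diagonal part are covered by the moments. -/
theorem IsHaarLike.hasSum_pow {φ : QSU2 q →L[ℂ] ℂ} (h : IsHaarLike φ) (hq0 : 0 < q) (hq1 : q < 1)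
    {l₁ l₂ w₁ w₂ d a₁ b₁ a₂ b₂ μ : ℝ} (hl1 : l₁ ^ 2 + d * l₁ = 1) (hl2 : l₂ ^ 2 + d * l₂ = 1)
    (hw : w₁ + w₂ = 1) (hwl : w₁ * l₁ + w₂ * l₂ = -d) (hab1 : a₁ * b₁ = -(q ^ 2 * l₁ ^ 2))
    (hab2 : a₂ * b₂ = -(q ^ 2 * l₂ ^ 2)) (hs1 : a₁ + b₁ = 2 * μ * l₁) (hs2 : a₂ + b₂ = 2 * μ * l₂)
    (n : ℕ) :
    HasSum (fun k : ℕ => (1 - (q : ℂ) ^ 2) * ((q : ℂ) ^ 2) ^ k *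
      (w₁ * ((jacobi a₁ b₁ (q ^ 2) ^ n) (single k 1)) k +
        w₂ * ((jacobi a₂ b₂ (q ^ 2) ^ n) (single k 1)) k))
      (φ ((low q d + raise q d + (μ : ℂ) • diag q d) ^ n)) := by
  have hqr : q ^ 2 ≠ 0 := by positivity
  have hq2 : (q : ℂ) ^ 2 ≠ 0 := by exact_mod_cast hqr
  have hr1 : q ^ 2 < 1 := pow_lt_one₀ hq0.le hq1 two_ne_zero
  have L1 := ladderRel_model hqr hl1 hab1
  have L2 := ladderRel_model hqr hl2 hab2
  rw [ofReal_pow] at L1 L2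
  have L := (QSU2.ladderRel q d hq0.ne').prod (L1.prod L2)
  have hmem := L.pow_mem hq2 μ n
  have hle : LadderRel.normalSpan (low q d, lowering (a₁ * b₁) (q ^ 2), lowering (a₂ * b₂) (q ^ 2))
      (raise q d, raising, raising) (diag q d, diagonal l₁ (q ^ 2), diagonal l₂ (q ^ 2)) ≤
      traceSubmodule φ w₁ w₂ := by
    refine Submodule.span_le.2 ?_
    have hdiag : ∀ j, (diag q d, diagonal l₁ (q ^ 2), diagonal l₂ (q ^ 2)) ^ j ∈
        traceSubmodule φ w₁ w₂ := fun j => by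
      rw [mem_traceSubmodule]
      simp only [Prod.pow_fst, Prod.pow_snd, diagonal_pow_single, single_eq_same, one_mul,
        h.moment hq0 hq1 hl1 hl2 hw hwl]
      have hj : (q ^ 2) ^ (j + 1) < 1 := pow_lt_one₀ (by positivity) hr1 (Nat.succ_ne_zero j)
      -- The factor (1 - r)/(1 - r^(j+1)) in the moments is the sum over k of (1 - r) r^k (r^k)^j,
      -- that is, the weighted trace of the diagonal model.
      have hg := (hasSum_geometric_of_lt_one (by positivity) hj).mul_left
        ((1 - q ^ 2) * (w₁ * l₁ ^ j + w₂ * l₂ ^ j))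
      have hg' := Complex.hasSum_ofReal.2 hg
      refine (congrArg₂ HasSum (funext fun k => ?_) ?_).mp hg'
      · push_cast
        ring
      · congr 1
        rw [div_eq_mul_inv]
        ring
    rintro x (⟨j, k, rfl⟩ | ⟨j, k, rfl⟩)
    · cases k with
      | zero => rw [pow_zero, mul_one]; exact hdiag j
      | succ k =>
        rw [SetLike.mem_coe, mem_traceSubmodule]
        simp only [Prod.fst_mul, Prod.snd_mul, Prod.pow_fst, Prod.pow_snd,
          diagonal_mul_lowering_apply_self, h.map_diag_low, mul_zero, add_zero]
        exact hasSum_zero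
    · cases k with
      | zero => rw [pow_zero, one_mul]; exact hdiag j
      | succ k =>
        rw [SetLike.mem_coe, mem_traceSubmodule]
        simp only [Prod.fst_mul, Prod.snd_mul, Prod.pow_fst, Prod.pow_snd,
          raising_mul_diagonal_apply_self, h.map_raise_diag, mul_zero, add_zero]
        exact hasSum_zero
  have hx := mem_traceSubmodule.1 (hle hmem)
  rw [jacobi_eq a₁ b₁ _ l₁ μ hs1, jacobi_eq a₂ b₂ _ l₂ μ hs2]
  exact hx

/-- τ enters only through d, as a constant of the ladder relations, and σ only through the
coefficient of the diagonal part. -/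
theorem rho_eq (τ σ : ℝ) : rho q τ σ = low q (qDiff q τ) + raise q (qDiff q τ) +
    ((1 / 2 * q * qDiff q σ : ℝ) : ℂ) • diag q (qDiff q τ) := by
  have h := (relations q).normal
  simp only [rho, low, raise, diag, sLow, sRaise, sDiag, pow_two]
  push_cast
  module

theorem qDiff_root {q : ℝ} (hq0 : 0 < q) (τ : ℝ) : (q ^ τ) ^ 2 + qDiff q τ * q ^ τ = 1 ∧
    (-q ^ (-τ)) ^ 2 + qDiff q τ * (-q ^ (-τ)) = 1 := by
  have h : q ^ (-τ) * q ^ τ = 1 := by rw [← Real.rpow_add hq0, neg_add_cancel, Real.rpow_zero]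
  rw [qDiff]
  constructor <;> linear_combination h

/-- Both sides are sums of the same series: the trace formula on the left, the termwise integrated
Poisson kernel at t = q² on the right. -/
theorem IsHaarLike.map_rho_pow {φ : QSU2 q →L[ℂ] ℂ} (h : IsHaarLike φ) (hq0 : 0 < q) (hq1 : q < 1)
    (τ σ : ℝ) (n : ℕ) : φ (rho q τ σ ^ n) =
      (((1 - q ^ 2) / (1 + q ^ (2 * τ)) : ℝ) : ℂ) * ∫ x : ℝ, (x : ℂ) ^ n *
        (poisson (q ^ 2) x x (q ^ (1 + σ - τ)) (-q ^ (1 - σ - τ)) (q ^ 2) : ℂ) ∂(dm₁ q τ σ) +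
      (((1 - q ^ 2) / (1 + q ^ (-2 * τ)) : ℝ) : ℂ) * ∫ x : ℝ, (x : ℂ) ^ n *
        (poisson (q ^ 2) x x (q ^ (1 - σ + τ)) (-q ^ (1 + σ + τ)) (q ^ 2) : ℂ) ∂(dm₂ q τ σ) := by
  have hr0 : 0 < q ^ 2 := by positivity
  have hr1 : q ^ 2 < 1 := pow_lt_one₀ hq0.le hq1 two_ne_zero
  have hneg : ∀ x y : ℝ, q ^ x * -q ^ y < 0 := fun x y => by
    have := Real.rpow_pos_of_pos hq0 x
    have := Real.rpow_pos_of_pos hq0 y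
    rw [mul_neg, neg_lt_zero]
    positivity
  have hi : ∀ x y : ℝ, HasSum (fun k => (q ^ 2 : ℝ) ^ k *
      ((jacobi (q ^ x) (-q ^ y) (q ^ 2) ^ n) (single k 1)) k)
      (∫ z : ℝ, (z : ℂ) ^ n * (poisson (q ^ 2) z z (q ^ x) (-q ^ y) (q ^ 2) : ℂ)
        ∂AlSalamChihara.measure (q ^ x) (-q ^ y) (q ^ 2)) := fun x y => by
    have h1 := hasSum_integral_mul_poisson hr0 hr1 (hneg x y) hr0.le hr1
      (f := fun z => (z : ℂ) ^ n) (by fun_prop)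
    simp only [integral_pow_mul_poissonTerm hr0 hr1 (hneg x y)] at h1
    exact h1
  set t := q ^ τ with ht
  set s := q ^ σ with hs
  have ht0 : 0 < t := Real.rpow_pos_of_pos hq0 τ
  have hs0 : 0 < s := Real.rpow_pos_of_pos hq0 σ
  have et : q ^ (-τ) = t⁻¹ := Real.rpow_neg hq0.le τ
  have es : q ^ (-σ) = s⁻¹ := Real.rpow_neg hq0.le σ
  have e2t : q ^ (2 * τ) = t ^ 2 := by rw [mul_comm, Real.rpow_mul hq0.le]; norm_cast
  have e2t' : q ^ (-2 * τ) = (t ^ 2)⁻¹ := by rw [neg_mul, Real.rpow_neg hq0.le, e2t]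
  have ea1 : q ^ (1 + σ - τ) = q * s * t⁻¹ := by
    rw [sub_eq_add_neg, Real.rpow_add hq0, Real.rpow_add hq0, Real.rpow_one, et]
  have eb1 : q ^ (1 - σ - τ) = q * s⁻¹ * t⁻¹ := by
    rw [sub_eq_add_neg, sub_eq_add_neg, Real.rpow_add hq0, Real.rpow_add hq0, Real.rpow_one, et, es]
  have ea2 : q ^ (1 - σ + τ) = q * s⁻¹ * t := by
    rw [sub_eq_add_neg, Real.rpow_add hq0, Real.rpow_add hq0, Real.rpow_one, es]
  have eb2 : q ^ (1 + σ + τ) = q * s * t := by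
    rw [Real.rpow_add hq0, Real.rpow_add hq0, Real.rpow_one]
  have hroot := qDiff_root hq0 τ
  have ed : qDiff q τ = t⁻¹ - t := by rw [qDiff, et]
  have eds : qDiff q σ = s⁻¹ - s := by rw [qDiff, es]
  -- l₁ and l₂ are the roots of l² + dl = 1. The weights solve w₁ + w₂ = 1 and w₁l₁ + w₂l₂ = -d, and
  -- the parameter pairs have sum 2μl and product -q²l².
  have H := h.hasSum_pow hq0 hq1 (l₁ := -q ^ (-τ)) (l₂ := t) (w₁ := 1 / (1 + t ^ 2))
    (w₂ := 1 / (1 + (t ^ 2)⁻¹)) (d := qDiff q τ) (a₁ := q ^ (1 + σ - τ)) (b₁ := -q ^ (1 - σ - τ))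
    (a₂ := q ^ (1 - σ + τ)) (b₂ := -q ^ (1 + σ + τ)) (μ := 1 / 2 * q * qDiff q σ)
    hroot.2 hroot.1 (by field_simp; ring) (by rw [et, ed]; field_simp; ring)
    (by rw [ea1, eb1, et]; field_simp) (by rw [ea2, eb2]; field_simp)
    (by rw [ea1, eb1, et, eds]; field_simp; ring) (by rw [ea2, eb2, eds]; field_simp; ring) n
  rw [← rho_eq] at H
  refine H.unique ?_
  have K := ((hi (1 + σ - τ) (1 - σ - τ)).mul_left
    (((1 - q ^ 2) / (1 + q ^ (2 * τ)) : ℝ) : ℂ)).add ((hi (1 - σ + τ) (1 + σ + τ)).mul_left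
    (((1 - q ^ 2) / (1 + q ^ (-2 * τ)) : ℝ) : ℂ))
  refine (congrArg₂ HasSum (funext fun k => ?_) rfl).mp K
  rw [e2t, e2t']
  push_cast
  ring

end QSU2

/-! ### The regular-type representation on `ℓ²(ℕ × ℤ)` -/

section WeightedPullback

variable {ι : Type*}

/-- The Hilbert space of square-summable families. -/
abbrev EllTwo (ι : Type*) : Type _ := lp (fun _ : ι => ℂ) 2

theorem summable_sq_norm_weighted {c : ι → ℂ} {σ : ι → ι} (hc : ∀ i, ‖c i‖ ≤ 1)
    (hσ : Function.Injective σ) (f : EllTwo ι) :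
    Summable (fun i => ‖c i * f (σ i)‖ ^ 2) ∧
      ∑' i, ‖c i * f (σ i)‖ ^ 2 ≤ ∑' i, ‖f i‖ ^ 2 := by
  have hf : Summable fun i => ‖f i‖ ^ 2 := by
    have := lp.memℓp f
    rw [memℓp_gen_iff (by norm_num)] at this
    simpa using this
  have hfσ := hf.comp_injective hσ
  have hle : ∀ i, ‖c i * f (σ i)‖ ^ 2 ≤ ‖f (σ i)‖ ^ 2 := fun i => by
    rw [norm_mul]
    exact pow_le_pow_left₀ (by positivity) (mul_le_of_le_one_left (norm_nonneg _) (hc i)) 2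
  have hs := hfσ.of_nonneg_of_le (fun i => by positivity) hle
  refine ⟨hs, (hs.tsum_le_tsum hle hfσ).trans ?_⟩
  exact hfσ.tsum_le_tsum_of_inj σ hσ (fun i _ => by positivity) (fun i => le_rfl) hf

/-- The operator `f ↦ c · (f ∘ σ)` on square-summable families. -/
def weightedPullback (c : ι → ℂ) (σ : ι → ι) (hc : ∀ i, ‖c i‖ ≤ 1) (hσ : Function.Injective σ) :
    EllTwo ι →L[ℂ] EllTwo ι :=
  LinearMap.mkContinuous
    { toFun := fun f => ⟨fun i => c i * f (σ i), by
        refine memℓp_gen ?_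
        simpa using (summable_sq_norm_weighted hc hσ f).1⟩
      map_add' := fun f g => by ext i; exact mul_add _ _ _
      map_smul' := fun a f => by ext i; exact mul_left_comm _ _ _ } 1 fun f => by
    have h := (summable_sq_norm_weighted hc hσ f).2
    have e : ∀ g : EllTwo ι, ‖g‖ ^ 2 = ∑' i, ‖g i‖ ^ 2 := fun g => by
      have := lp.norm_rpow_eq_tsum (p := 2) (by norm_num) g
      simpa using this
    rw [one_mul]
    refine abs_le_of_sq_le_sq' ?_ (norm_nonneg _) |>.2
    rw [e, e]
    exact h

theorem weightedPullback_apply (c : ι → ℂ) (σ : ι → ι) (hc : ∀ i, ‖c i‖ ≤ 1)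
    (hσ : Function.Injective σ) (f : EllTwo ι) (i : ι) :
    weightedPullback c σ hc hσ f i = c i * f (σ i) := rfl

variable [DecidableEq ι]

theorem star_weightedPullback_single (c : ι → ℂ) (σ : ι → ι) (hc : ∀ i, ‖c i‖ ≤ 1)
    (hσ : Function.Injective σ) (i : ι) :
    star (weightedPullback c σ hc hσ) (lp.single 2 i (1 : ℂ)) =
      lp.single 2 (σ i) (starRingEnd ℂ (c i)) := by
  refine ext_inner_right ℂ fun f => ?_
  rw [ContinuousLinearMap.star_eq_adjoint, ContinuousLinearMap.adjoint_inner_left,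
    lp.inner_single_left, lp.inner_single_left, weightedPullback_apply]
  simp [mul_comm]

end WeightedPullback

namespace QSU2

open Finsupp FreeAlgebra

/-- The algebraic representation space. -/
abbrev Rep : Type := (ℕ × ℤ) →₀ ℂ

/-- The Hilbert space of the representation. -/
abbrev HRep : Type := EllTwo (ℕ × ℤ)

/-- The matrix coefficients `√(1 - q^{2n})`. -/
def rootCoeff (q : ℝ) (n : ℕ) : ℝ := √(1 - (q ^ 2) ^ n)

/-- Makes the truncated index n - 1 at n = 0 harmless: α annihilates the ground states. -/
theorem rootCoeff_zero (q : ℝ) : rootCoeff q 0 = 0 := by simp [rootCoeff]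

theorem rootCoeff_sq {q : ℝ} (hq0 : 0 ≤ q) (hq1 : q ≤ 1) (n : ℕ) :
    rootCoeff q n * rootCoeff q n = 1 - (q ^ 2) ^ n := by
  refine Real.mul_self_sqrt (sub_nonneg.2 (pow_le_one₀ (by positivity) ?_))
  exact pow_le_one₀ hq0 hq1

theorem rootCoeff_le_one {q : ℝ} (n : ℕ) : rootCoeff q n ≤ 1 := by
  have : 0 ≤ (q ^ 2) ^ n := by positivity
  exact Real.sqrt_le_one.2 (by linarith)

theorem rootCoeff_nonneg (q : ℝ) (n : ℕ) : 0 ≤ rootCoeff q n := Real.sqrt_nonneg _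

/-- The action of the generators on the algebraic representation space. -/
def genAct (q : ℝ) : Gen → Module.End ℂ Rep
  | .alpha => linearCombination ℂ fun i => single (i.1 - 1, i.2) (rootCoeff q i.1 : ℂ)
  | .alphaStar => linearCombination ℂ fun i => single (i.1 + 1, i.2) (rootCoeff q (i.1 + 1) : ℂ)
  | .gamma => linearCombination ℂ fun i => single (i.1, i.2 + 1) ((q : ℂ) ^ i.1)
  | .gammaStar => linearCombination ℂ fun i => single (i.1, i.2 - 1) ((q : ℂ) ^ i.1)

theorem genAct_alpha (q : ℝ) (i : ℕ × ℤ) (c : ℂ) : genAct q .alpha (single i c) =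
    single (i.1 - 1, i.2) (c * rootCoeff q i.1) := by
  rw [genAct, linearCombination_single, smul_single, smul_eq_mul]

theorem genAct_alphaStar (q : ℝ) (i : ℕ × ℤ) (c : ℂ) : genAct q .alphaStar (single i c) =
    single (i.1 + 1, i.2) (c * rootCoeff q (i.1 + 1)) := by
  rw [genAct, linearCombination_single, smul_single, smul_eq_mul]

theorem genAct_gamma (q : ℝ) (i : ℕ × ℤ) (c : ℂ) : genAct q .gamma (single i c) =
    single (i.1, i.2 + 1) (c * (q : ℂ) ^ i.1) := by
  rw [genAct, linearCombination_single, smul_single, smul_eq_mul]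

theorem genAct_gammaStar (q : ℝ) (i : ℕ × ℤ) (c : ℂ) : genAct q .gammaStar (single i c) =
    single (i.1, i.2 - 1) (c * (q : ℂ) ^ i.1) := by
  rw [genAct, linearCombination_single, smul_single, smul_eq_mul]

/-- The algebraic representation of noncommutative polynomials. -/
def rep (q : ℝ) : FreeAlgebra ℂ Gen →ₐ[ℂ] Module.End ℂ Rep := lift ℂ (genAct q)

/-- The embedding of finitely supported families into the Hilbert space. -/
def toEllTwo : Rep →ₗ[ℂ] HRep := linearCombination ℂ fun i => lp.single 2 i (1 : ℂ)

theorem toEllTwo_single (i : ℕ × ℤ) (c : ℂ) : toEllTwo (single i c) = lp.single 2 i c := by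
  rw [toEllTwo, linearCombination_single, ← lp.single_smul, smul_eq_mul, mul_one]

theorem toEllTwo_apply (v : Rep) (i : ℕ × ℤ) : toEllTwo v i = v i := by
  induction v using Finsupp.induction_linear with
  | zero => simp
  | add v w hv hw => rw [map_add, lp.coeFn_add, Pi.add_apply, hv, hw, Finsupp.add_apply]
  | single j c =>
    rw [toEllTwo_single, lp.single_apply, Finsupp.single_eq_pi_single]

theorem ext_toEllTwo {S T : HRep →L[ℂ] HRep} (h : ∀ v, S (toEllTwo v) = T (toEllTwo v)) : S = T := by
  refine lp.ext_continuousLinearMap (ENNReal.ofNat_ne_top (n := nat_lit 2)) fun i => ?_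
  refine ContinuousLinearMap.ext_ring ?_
  have := h (single i 1)
  rw [toEllTwo_single] at this
  exact this

variable {q : ℝ}

/-- The operator of `α`. -/
def alphaOp (q : ℝ) : HRep →L[ℂ] HRep :=
  weightedPullback (fun i => (rootCoeff q (i.1 + 1) : ℂ)) (fun i => (i.1 + 1, i.2))
    (fun i => by
      rw [Complex.norm_real, Real.norm_of_nonneg (rootCoeff_nonneg q _)]
      exact rootCoeff_le_one _)
    (fun i j h => by
      simp only [Prod.mk.injEq, add_left_inj] at h
      exact Prod.ext h.1 h.2)

/-- The operator of `γ`. -/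
def gammaOp (q : ℝ) (hq0 : 0 < q) (hq1 : q < 1) : HRep →L[ℂ] HRep :=
  weightedPullback (fun i => (q : ℂ) ^ i.1) (fun i => (i.1, i.2 - 1))
    (fun i => by
      rw [norm_pow, Complex.norm_real, Real.norm_of_nonneg hq0.le]
      exact pow_le_one₀ hq0.le hq1.le)
    (fun i j h => by
      simp only [Prod.mk.injEq, sub_left_inj] at h
      exact Prod.ext h.1 h.2)

theorem alphaOp_apply (f : HRep) (i : ℕ × ℤ) :
    alphaOp q f i = rootCoeff q (i.1 + 1) * f (i.1 + 1, i.2) := rfl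

theorem gammaOp_apply (hq0 : 0 < q) (hq1 : q < 1) (f : HRep) (i : ℕ × ℤ) :
    gammaOp q hq0 hq1 f i = (q : ℂ) ^ i.1 * f (i.1, i.2 - 1) := rfl

theorem star_alphaOp_single (i : ℕ × ℤ) : star (alphaOp q) (lp.single 2 i (1 : ℂ)) =
    lp.single 2 (i.1 + 1, i.2) (starRingEnd ℂ (rootCoeff q (i.1 + 1) : ℂ)) :=
  star_weightedPullback_single _ _ _ _ i

theorem star_gammaOp_single (hq0 : 0 < q) (hq1 : q < 1) (i : ℕ × ℤ) :
    star (gammaOp q hq0 hq1) (lp.single 2 i (1 : ℂ)) =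
      lp.single 2 (i.1, i.2 - 1) (starRingEnd ℂ ((q : ℂ) ^ i.1)) :=
  star_weightedPullback_single _ _ _ _ i

theorem intertwine_of_single {T : HRep →L[ℂ] HRep} {M : Module.End ℂ Rep}
    (h : ∀ i, T (lp.single 2 i (1 : ℂ)) = toEllTwo (M (single i 1))) (v : Rep) :
    T (toEllTwo v) = toEllTwo (M v) := by
  induction v using Finsupp.induction_linear with
  | zero => simp
  | add v w hv hw => simp only [map_add, hv, hw]
  | single i c =>
    have e : single i c = c • single i (1 : ℂ) := by rw [smul_single, smul_eq_mul, mul_one]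
    rw [e, map_smul, map_smul, map_smul, map_smul, ← h, toEllTwo_single]

theorem alphaOp_toEllTwo (v : Rep) : alphaOp q (toEllTwo v) = toEllTwo (genAct q .alpha v) := by
  refine intertwine_of_single (fun i => ?_) v
  ext j
  rw [genAct_alpha, toEllTwo_single, alphaOp_apply, lp.single_apply,
    lp.single_apply]
  obtain ⟨n, k⟩ := i
  obtain ⟨m, l⟩ := j
  cases n with
  | zero => simp [rootCoeff_zero, Pi.single_apply]
  | succ n =>
    simp only [Pi.single_apply, Prod.mk.injEq, add_left_inj, Nat.add_sub_cancel, one_mul]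
    split_ifs with h
    · rw [h.1, mul_one]
    · rw [mul_zero]

theorem star_alphaOp_toEllTwo (v : Rep) :
    star (alphaOp q) (toEllTwo v) = toEllTwo (genAct q .alphaStar v) := by
  refine intertwine_of_single (fun i => ?_) v
  rw [star_alphaOp_single, genAct_alphaStar, toEllTwo_single, one_mul,
    Complex.conj_ofReal]

theorem gammaOp_toEllTwo (hq0 : 0 < q) (hq1 : q < 1) (v : Rep) :
    gammaOp q hq0 hq1 (toEllTwo v) = toEllTwo (genAct q .gamma v) := by
  refine intertwine_of_single (fun i => ?_) v
  ext j
  rw [genAct_gamma, toEllTwo_single, gammaOp_apply, lp.single_apply,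
    lp.single_apply]
  obtain ⟨n, k⟩ := i
  obtain ⟨m, l⟩ := j
  simp only [Pi.single_apply, Prod.mk.injEq, one_mul, sub_eq_iff_eq_add]
  split_ifs with h
  · rw [h.1, mul_one]
  · rw [mul_zero]

theorem star_gammaOp_toEllTwo (hq0 : 0 < q) (hq1 : q < 1) (v : Rep) :
    star (gammaOp q hq0 hq1) (toEllTwo v) = toEllTwo (genAct q .gammaStar v) := by
  refine intertwine_of_single (fun i => ?_) v
  rw [star_gammaOp_single, genAct_gammaStar, toEllTwo_single, one_mul,
    map_pow, Complex.conj_ofReal]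

theorem genAct_comm (q : ℝ) :
    genAct q .alpha * genAct q .gamma = (q : ℂ) • (genAct q .gamma * genAct q .alpha) := by
  refine Finsupp.lhom_ext fun i c => ?_
  simp only [Module.End.mul_apply, LinearMap.smul_apply, genAct_alpha, genAct_gamma, smul_single,
    smul_eq_mul]
  obtain ⟨n, k⟩ := i
  cases n with
  | zero => simp [rootCoeff_zero]
  | succ n =>
    congr 1
    simp only [Nat.add_sub_cancel]
    ring

theorem genAct_comm_star (q : ℝ) :
    genAct q .alpha * genAct q .gammaStar = (q : ℂ) • (genAct q .gammaStar * genAct q .alpha) := by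
  refine Finsupp.lhom_ext fun i c => ?_
  simp only [Module.End.mul_apply, LinearMap.smul_apply, genAct_alpha, genAct_gammaStar, smul_single,
    smul_eq_mul]
  obtain ⟨n, k⟩ := i
  cases n with
  | zero => simp [rootCoeff_zero]
  | succ n =>
    congr 1
    simp only [Nat.add_sub_cancel]
    ring

theorem genAct_normal (q : ℝ) :
    genAct q .gamma * genAct q .gammaStar = genAct q .gammaStar * genAct q .gamma := by
  refine Finsupp.lhom_ext fun i c => ?_
  simp only [Module.End.mul_apply, genAct_gamma, genAct_gammaStar, sub_add_cancel, add_sub_cancel_right]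

theorem genAct_star_mul (hq0 : 0 < q) (hq1 : q < 1) : genAct q .alphaStar * genAct q .alpha +
    genAct q .gammaStar * genAct q .gamma = 1 := by
  refine Finsupp.lhom_ext fun i c => ?_
  simp only [Module.End.mul_apply, LinearMap.add_apply, genAct_gamma, genAct_gammaStar,
    genAct_alpha, genAct_alphaStar, add_sub_cancel_right, Module.End.one_apply]
  obtain ⟨n, k⟩ := i
  have h := congrArg (fun x : ℝ => (x : ℂ)) (rootCoeff_sq hq0.le hq1.le n)
  cases n with
  | zero => simp [rootCoeff_zero]
  | succ n =>
    simp only [Nat.add_sub_cancel, ← single_add]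
    congr 1
    push_cast at h
    linear_combination c * h

theorem genAct_mul_star (hq0 : 0 < q) (hq1 : q < 1) : genAct q .alpha * genAct q .alphaStar +
    (q : ℂ) ^ 2 • (genAct q .gamma * genAct q .gammaStar) = 1 := by
  refine Finsupp.lhom_ext fun i c => ?_
  simp only [Module.End.mul_apply, LinearMap.add_apply, LinearMap.smul_apply, genAct_gamma,
    genAct_gammaStar, genAct_alpha, genAct_alphaStar, sub_add_cancel, Module.End.one_apply,
    Nat.add_sub_cancel, smul_single, smul_eq_mul, ← single_add]
  have h := congrArg (fun x : ℝ => (x : ℂ)) (rootCoeff_sq hq0.le hq1.le (i.1 + 1))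
  congr 1
  push_cast at h
  linear_combination c * h

theorem relations_ops (hq0 : 0 < q) (hq1 : q < 1) :
    QSU2Relations q (alphaOp q) (gammaOp q hq0 hq1) where
  comm := ext_toEllTwo fun v => by
    simpa only [mul_apply_eq_comp, _root_.smul_apply, _root_.add_apply, one_apply_eq_self,
      alphaOp_toEllTwo, gammaOp_toEllTwo, star_alphaOp_toEllTwo, star_gammaOp_toEllTwo,
      Module.End.mul_apply, LinearMap.smul_apply, LinearMap.add_apply, map_smul, map_add,
      Module.End.one_apply] using congrArg toEllTwo (LinearMap.congr_fun (genAct_comm q) v)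
  comm_star := ext_toEllTwo fun v => by
    simpa only [mul_apply_eq_comp, _root_.smul_apply, _root_.add_apply, one_apply_eq_self,
      alphaOp_toEllTwo, gammaOp_toEllTwo, star_alphaOp_toEllTwo, star_gammaOp_toEllTwo,
      Module.End.mul_apply, LinearMap.smul_apply, LinearMap.add_apply, map_smul, map_add,
      Module.End.one_apply] using congrArg toEllTwo (LinearMap.congr_fun (genAct_comm_star q) v)
  normal := ext_toEllTwo fun v => by
    simpa only [mul_apply_eq_comp, _root_.smul_apply, _root_.add_apply, one_apply_eq_self,
      alphaOp_toEllTwo, gammaOp_toEllTwo, star_alphaOp_toEllTwo, star_gammaOp_toEllTwo,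
      Module.End.mul_apply, LinearMap.smul_apply, LinearMap.add_apply, map_smul, map_add,
      Module.End.one_apply] using congrArg toEllTwo (LinearMap.congr_fun (genAct_normal q) v)
  star_mul := ext_toEllTwo fun v => by
    simpa only [mul_apply_eq_comp, _root_.smul_apply, _root_.add_apply, one_apply_eq_self,
      alphaOp_toEllTwo, gammaOp_toEllTwo, star_alphaOp_toEllTwo, star_gammaOp_toEllTwo,
      Module.End.mul_apply, LinearMap.smul_apply, LinearMap.add_apply, map_smul, map_add,
      Module.End.one_apply] using congrArg toEllTwo (LinearMap.congr_fun (genAct_star_mul hq0 hq1) v)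
  mul_star := ext_toEllTwo fun v => by
    simpa only [mul_apply_eq_comp, _root_.smul_apply, _root_.add_apply, one_apply_eq_self,
      alphaOp_toEllTwo, gammaOp_toEllTwo, star_alphaOp_toEllTwo, star_gammaOp_toEllTwo,
      Module.End.mul_apply, LinearMap.smul_apply, LinearMap.add_apply, map_smul, map_add,
      Module.End.one_apply] using congrArg toEllTwo (LinearMap.congr_fun (genAct_mul_star hq0 hq1) v)

/-- The representation of `A_q(SU(2))` on `ℓ²(ℕ × ℤ)`. -/
def hrep (q : ℝ) (hq0 : 0 < q) (hq1 : q < 1) : QSU2 q →⋆ₐ[ℂ] (HRep →L[ℂ] HRep) :=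
  (universal q _ _ _ (relations_ops hq0 hq1)).choose

theorem hrep_alpha (hq0 : 0 < q) (hq1 : q < 1) : hrep q hq0 hq1 (α q) = alphaOp q :=
  (universal q _ _ _ (relations_ops hq0 hq1)).choose_spec.1.1

theorem hrep_gamma (hq0 : 0 < q) (hq1 : q < 1) : hrep q hq0 hq1 (γ q) = gammaOp q hq0 hq1 :=
  (universal q _ _ _ (relations_ops hq0 hq1)).choose_spec.1.2

theorem norm_hrep_le (hq0 : 0 < q) (hq1 : q < 1) (x : QSU2 q) : ‖hrep q hq0 hq1 x‖ ≤ ‖x‖ :=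
  NonUnitalStarAlgHom.norm_apply_le (hrep q hq0 hq1) x

theorem hrep_value (hq0 : 0 < q) (hq1 : q < 1) (w : FreeAlgebra ℂ Gen) (v : Rep) :
    hrep q hq0 hq1 (value q w) (toEllTwo v) = toEllTwo (rep q w v) := by
  induction w using FreeAlgebra.induction generalizing v with
  | grade0 r => simp [Algebra.algebraMap_eq_smul_one]
  | grade1 x =>
    cases x with
    | alpha => rw [value_alpha, hrep_alpha, alphaOp_toEllTwo, rep, lift_ι_apply]
    | alphaStar =>
      rw [value_alphaStar, map_star, hrep_alpha, star_alphaOp_toEllTwo, rep, lift_ι_apply]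
    | gamma => rw [value_gamma, hrep_gamma, gammaOp_toEllTwo, rep, lift_ι_apply]
    | gammaStar =>
      rw [value_gammaStar, map_star, hrep_gamma, star_gammaOp_toEllTwo, rep, lift_ι_apply]
  | mul x y hx hy =>
    rw [map_mul, map_mul, map_mul, mul_apply_eq_comp, hy, hx, Module.End.mul_apply]
  | add x y hx hy =>
    rw [map_add, map_add, map_add, _root_.add_apply, hx, hy, LinearMap.add_apply,
      map_add]

theorem toEllTwo_injective : Function.Injective toEllTwo := fun v w h => by
  ext i
  rw [← toEllTwo_apply, h, toEllTwo_apply]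

/-- The algebraic representation lives on words. It depends only on their values because the Hilbert
space representation extends it. -/
theorem rep_eq_zero_of_value_eq_zero (hq0 : 0 < q) (hq1 : q < 1) {w : FreeAlgebra ℂ Gen}
    (hw : value q w = 0) : rep q w = 0 := by
  refine LinearMap.ext fun v => toEllTwo_injective ?_
  rw [← hrep_value hq0 hq1, hw]
  simp

end QSU2

/-! ### The Haar functional is determined on the spherical subalgebra -/

namespace QSU2

open Finsupp FreeAlgebra

/-- If `X` twisted-commutes with the images of the generators, then it does so with all images. -/
theorem mul_eq_scaling_mul_add_deriv {q : ℝ} {B : Type*} [Semiring B] [Algebra ℂ B]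
    (ρ : FreeAlgebra ℂ Gen →ₐ[ℂ] B) (X : B)
    (h : ∀ g : Gen, X * ρ (ι ℂ g) = ρ (scaling q (ι ℂ g)) * X + ρ (deriv q (ι ℂ g)))
    (w : FreeAlgebra ℂ Gen) : X * ρ w = ρ (scaling q w) * X + ρ (deriv q w) := by
  induction w using FreeAlgebra.induction with
  | grade0 r =>
    rw [deriv_algebraMap, map_zero, add_zero, AlgHom.commutes, AlgHom.commutes, AlgHom.commutes,
      Algebra.commutes]
  | grade1 g => exact h g
  | mul x y hx hy =>
    rw [deriv_mul, map_mul, map_mul, map_mul, map_add, map_mul, map_mul, ← mul_assoc, hx, add_mul,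
      mul_assoc, hy, mul_add, mul_assoc, add_assoc]
  | add x y hx hy =>
    rw [deriv_add, map_add, map_add, map_add, map_add, mul_add, hx, hy, add_mul]
    abel

/-- The coefficients of the twisted-commuting operator. -/
def xCoeff (q : ℝ) (n : ℕ) : ℝ := (q⁻¹ - q)⁻¹ * (q⁻¹ ^ (n + 1) * rootCoeff q (n + 1))

/-- An operator that twisted-commutes with the representation. -/
def xOp (q : ℝ) : Module.End ℂ Rep :=
  linearCombination ℂ fun i => single (i.1 + 1, i.2 - 1) (xCoeff q i.1 : ℂ)

theorem xOp_single (q : ℝ) (i : ℕ × ℤ) (c : ℂ) :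
    xOp q (single i c) = single (i.1 + 1, i.2 - 1) (c * xCoeff q i.1) := by
  rw [xOp, linearCombination_single, smul_single, smul_eq_mul]

variable {q : ℝ}

theorem inv_sub_self_ne_zero (hq0 : 0 < q) (hq1 : q < 1) : q⁻¹ - q ≠ 0 := by
  have := (one_lt_inv₀ hq0).2 hq1
  linarith

/-- `xOp` is (q⁻¹ - q)⁻¹ γ⁻¹ α*: the operator of γ is invertible on finitely supported families,
though its inverse is unbounded. The commutation relations with this operator produce exactly the
values of the twisted derivation on the generators. -/
theorem xOp_mul_alpha (hq0 : 0 < q) (hq1 : q < 1) : xOp q * genAct q .alpha =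
    (q : ℂ) • (genAct q .alpha * xOp q) - (q : ℂ) • genAct q .gammaStar := by
  have hne := inv_sub_self_ne_zero hq0 hq1
  refine Finsupp.lhom_ext fun i c => ?_
  obtain ⟨n, k⟩ := i
  simp only [Module.End.mul_apply, LinearMap.smul_apply, LinearMap.sub_apply, genAct_alpha,
    genAct_gammaStar, xOp_single, Nat.add_sub_cancel, smul_single, smul_eq_mul, ← single_sub]
  have h2 := rootCoeff_sq hq0.le hq1.le (n + 1)
  have hc : (q⁻¹ - q)⁻¹ * (1 - q ^ 2) = q := by
    have : 1 - q ^ 2 = (q⁻¹ - q) * q := by field_simp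
    rw [this, inv_mul_cancel_left₀ hne]
  cases n with
  | zero =>
    simp only [rootCoeff_zero, Complex.ofReal_zero, mul_zero, zero_mul, single_zero, pow_zero,
      mul_one, zero_add]
    rw [eq_comm, single_eq_zero]
    have : q * (xCoeff q 0 * rootCoeff q 1) - q = 0 := by
      rw [xCoeff, zero_add, pow_one]
      rw [zero_add, pow_one] at h2
      have e : q * q⁻¹ = 1 := mul_inv_cancel₀ hq0.ne'
      linear_combination (q⁻¹ - q)⁻¹ * q * q⁻¹ * h2 + q * q⁻¹ * hc + (q * 1) * e
    have h3 : (q : ℂ) * (xCoeff q 0 * rootCoeff q 1) - q = 0 := by exact_mod_cast this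
    linear_combination c * h3
  | succ n =>
    have h1 := rootCoeff_sq hq0.le hq1.le (n + 1)
    simp only [Nat.add_sub_cancel]
    congr 1
    have : rootCoeff q (n + 1) * xCoeff q n =
        q * (xCoeff q (n + 1) * rootCoeff q (n + 1 + 1)) - q * q ^ (n + 1) := by
      rw [xCoeff, xCoeff]
      have e : q⁻¹ ^ (n + 1) * (q ^ (n + 1)) = 1 := by
        rw [← mul_pow, inv_mul_cancel₀ hq0.ne', one_pow]
      have e2 : q⁻¹ ^ (n + 1 + 1) * q = q⁻¹ ^ (n + 1) := by
        rw [pow_succ, mul_assoc, inv_mul_cancel₀ hq0.ne', mul_one]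
      have e3 : (q ^ 2) ^ (n + 1) = q ^ (n + 1) * q ^ (n + 1) := by ring
      have e4 : (q ^ 2) ^ (n + 1 + 1) = q ^ 2 * (q ^ (n + 1) * q ^ (n + 1)) := by ring
      rw [e3] at h1
      rw [e4] at h2
      generalize rootCoeff q (n + 1 + 1) = u at *
      generalize rootCoeff q (n + 1) = v at *
      linear_combination (q⁻¹ - q)⁻¹ * q⁻¹ ^ (n + 1) * (h1 - h2) -
        (q⁻¹ - q)⁻¹ * u * u * e2 - (q⁻¹ - q)⁻¹ * (1 - q ^ 2) * q ^ (n + 1) * e - q ^ (n + 1) * hc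
    have h3 : (rootCoeff q (n + 1) : ℂ) * xCoeff q n =
        q * (xCoeff q (n + 1) * rootCoeff q (n + 1 + 1)) - q * q ^ (n + 1) := by exact_mod_cast this
    linear_combination c * h3

theorem xOp_mul_alpha_eq_add (hq0 : 0 < q) (hq1 : q < 1) : xOp q * genAct q .alpha =
    (q : ℂ) • (genAct q .alpha * xOp q) + (-(q : ℂ)) • genAct q .gammaStar := by
  rw [xOp_mul_alpha hq0 hq1]
  refine LinearMap.ext fun v => ?_
  rw [LinearMap.sub_apply, LinearMap.add_apply, LinearMap.smul_apply, LinearMap.smul_apply,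
    LinearMap.smul_apply, neg_smul, sub_eq_add_neg]

theorem xOp_mul_gamma (hq0 : 0 < q) (hq1 : q < 1) : xOp q * genAct q .gamma =
    (q : ℂ) • (genAct q .gamma * xOp q) + genAct q .alphaStar := by
  have hne := inv_sub_self_ne_zero hq0 hq1
  refine Finsupp.lhom_ext fun i c => ?_
  obtain ⟨n, k⟩ := i
  simp only [Module.End.mul_apply, LinearMap.smul_apply, LinearMap.add_apply, genAct_gamma,
    genAct_alphaStar, xOp_single, smul_single, smul_eq_mul, add_sub_cancel_right, sub_add_cancel,
    ← single_add]
  congr 1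
  have : q ^ n * xCoeff q n = q * (xCoeff q n * q ^ (n + 1)) + rootCoeff q (n + 1) := by
    rw [xCoeff]
    have e : q⁻¹ ^ (n + 1) * q ^ n = q⁻¹ := by
      rw [pow_succ, mul_right_comm, ← mul_pow, inv_mul_cancel₀ hq0.ne', one_pow, one_mul]
    have hc : (q⁻¹ - q)⁻¹ * (q⁻¹ * (1 - q ^ 2)) = 1 := by
      have : q⁻¹ * (1 - q ^ 2) = q⁻¹ - q := by field_simp
      rw [this, inv_mul_cancel₀ hne]
    linear_combination (q⁻¹ - q)⁻¹ * rootCoeff q (n + 1) * (1 - q ^ 2) * e +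
      rootCoeff q (n + 1) * hc
  have h3 : (q : ℂ) ^ n * xCoeff q n = q * (xCoeff q n * q ^ (n + 1)) + rootCoeff q (n + 1) := by
    exact_mod_cast this
  linear_combination c * h3

theorem xOp_mul_alphaStar : xOp q * genAct q .alphaStar =
    (q : ℂ)⁻¹ • (genAct q .alphaStar * xOp q) := by
  refine Finsupp.lhom_ext fun i c => ?_
  simp only [Module.End.mul_apply, LinearMap.smul_apply, genAct_alphaStar, xOp_single, smul_single,
    smul_eq_mul]
  congr 1
  rw [xCoeff, xCoeff]
  push_cast
  ring

theorem xOp_mul_gammaStar (hq0 : 0 < q) : xOp q * genAct q .gammaStar =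
    (q : ℂ)⁻¹ • (genAct q .gammaStar * xOp q) := by
  have hq : (q : ℂ) ≠ 0 := by exact_mod_cast hq0.ne'
  refine Finsupp.lhom_ext fun i c => ?_
  simp only [Module.End.mul_apply, LinearMap.smul_apply, genAct_gammaStar, xOp_single, smul_single,
    smul_eq_mul]
  congr 1
  rw [pow_succ]
  field_simp

/-- In the representation the twisted derivation becomes inner, implemented by `xOp`. -/
theorem xOp_mul_rep (hq0 : 0 < q) (hq1 : q < 1) (w : FreeAlgebra ℂ Gen) :
    xOp q * rep q w = rep q (scaling q w) * xOp q + rep q (deriv q w) := by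
  refine mul_eq_scaling_mul_add_deriv (rep q) (xOp q) (fun g => ?_) w
  cases g with
  | alpha =>
    simp only [scaling, deriv_alpha, rep, lift_ι_apply, map_smul, map_neg, smul_mul_assoc,
      xOp_mul_alpha hq0 hq1]
    refine LinearMap.ext fun v => ?_
    rw [LinearMap.sub_apply, LinearMap.add_apply, LinearMap.neg_apply, sub_eq_add_neg]
  | alphaStar => simp [scaling, deriv_alphaStar, rep, xOp_mul_alphaStar]
  | gamma => 
    simp only [scaling, deriv_gamma, rep, lift_ι_apply, map_smul, smul_mul_assoc,
      xOp_mul_gamma hq0 hq1]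
  | gammaStar => simp [scaling, deriv_gammaStar, rep, xOp_mul_gammaStar hq0]

/-- The comultiplication on noncommutative polynomials. -/
def freeComul (q : ℝ) :
    FreeAlgebra ℂ Gen →ₐ[ℂ] FreeAlgebra ℂ Gen ⊗[ℂ] FreeAlgebra ℂ Gen :=
  lift ℂ fun
    | .alpha => ι ℂ .alpha ⊗ₜ[ℂ] ι ℂ .alpha - (q : ℂ) • (ι ℂ .gammaStar ⊗ₜ[ℂ] ι ℂ .gamma)
    | .alphaStar => ι ℂ .alphaStar ⊗ₜ[ℂ] ι ℂ .alphaStar -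
        (q : ℂ) • (ι ℂ .gamma ⊗ₜ[ℂ] ι ℂ .gammaStar)
    | .gamma => ι ℂ .gamma ⊗ₜ[ℂ] ι ℂ .alpha + ι ℂ .alphaStar ⊗ₜ[ℂ] ι ℂ .gamma
    | .gammaStar => ι ℂ .gammaStar ⊗ₜ[ℂ] ι ℂ .alphaStar + ι ℂ .alpha ⊗ₜ[ℂ] ι ℂ .gammaStar

theorem map_value_freeComul (q : ℝ) (w : FreeAlgebra ℂ Gen) :
    Algebra.TensorProduct.map (value q) (value q) (freeComul q w) = comul q w := by
  rw [← AlgHom.comp_apply]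
  congr 1
  refine FreeAlgebra.hom_ext (funext fun g => ?_)
  cases g <;> simp [freeComul, comul]

/-- Contraction of the first tensor factor with a functional. -/
def slice {A M : Type*} [AddCommMonoid A] [Module ℂ A] [AddCommMonoid M] [Module ℂ M]
    (f : A →ₗ[ℂ] ℂ) : A ⊗[ℂ] M →ₗ[ℂ] M :=
  (TensorProduct.lid ℂ M).toLinearMap ∘ₗ f.rTensor M

theorem slice_tmul {A M : Type*} [AddCommMonoid A] [Module ℂ A] [AddCommMonoid M] [Module ℂ M]
    (f : A →ₗ[ℂ] ℂ) (a : A) (m : M) : slice f (a ⊗ₜ m) = f a • m := by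
  simp [slice]

theorem slice_one_tmul_mul {A M : Type*} [Semiring A] [Algebra ℂ A] [Semiring M] [Algebra ℂ M]
    (f : A →ₗ[ℂ] ℂ) (X : M) (z : A ⊗[ℂ] M) :
    slice f (1 ⊗ₜ X * z) = X * slice f z := by
  induction z using TensorProduct.induction_on with
  | zero => simp
  | tmul a m => rw [Algebra.TensorProduct.tmul_mul_tmul, slice_tmul, slice_tmul, one_mul, mul_smul_comm]
  | add x y hx hy => rw [mul_add, map_add, map_add, hx, hy, mul_add]

theorem slice_mul_one_tmul {A M : Type*} [Semiring A] [Algebra ℂ A] [Semiring M] [Algebra ℂ M]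
    (f : A →ₗ[ℂ] ℂ) (X : M) (z : A ⊗[ℂ] M) :
    slice f (z * 1 ⊗ₜ X) = slice f z * X := by
  induction z using TensorProduct.induction_on with
  | zero => simp
  | tmul a m => rw [Algebra.TensorProduct.tmul_mul_tmul, slice_tmul, slice_tmul, mul_one, smul_mul_assoc]
  | add x y hx hy => rw [add_mul, map_add, map_add, hx, hy, add_mul]

theorem slice_map {A A' M M' : Type*} [Semiring A] [Algebra ℂ A] [Semiring A'] [Algebra ℂ A'] [Semiring M]
    [Algebra ℂ M] [Semiring M'] [Algebra ℂ M'] (f : A' →ₗ[ℂ] ℂ) (φ : A →ₐ[ℂ] A') (ψ : M →ₐ[ℂ] M')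
    (z : A ⊗[ℂ] M) : slice f (Algebra.TensorProduct.map φ ψ z) =
      ψ (slice (f ∘ₗ φ.toLinearMap) z) := by
  induction z using TensorProduct.induction_on with
  | zero => simp
  | tmul a m =>
    rw [Algebra.TensorProduct.map_tmul, slice_tmul, slice_tmul, map_smul]
    rfl
  | add x y hx hy => rw [map_add, map_add, map_add, map_add, hx, hy]

/-- The comultiplication with the second leg represented. -/
def repComul (q : ℝ) : FreeAlgebra ℂ Gen →ₐ[ℂ] FreeAlgebra ℂ Gen ⊗[ℂ] Module.End ℂ Rep :=
  (Algebra.TensorProduct.map (AlgHom.id ℂ _) (rep q)).comp (freeComul q)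

/-- Invariance of the derivation: applying it to the second leg of the comultiplication is the same
as applying it before comultiplying. It is enough to check the generators. -/
theorem xOp_mul_repComul (hq0 : 0 < q) (hq1 : q < 1) (w : FreeAlgebra ℂ Gen) :
    (1 ⊗ₜ[ℂ] xOp q) * repComul q w =
      repComul q (scaling q w) * (1 ⊗ₜ[ℂ] xOp q) + repComul q (deriv q w) := by
  refine mul_eq_scaling_mul_add_deriv (repComul q) (1 ⊗ₜ[ℂ] xOp q) (fun g => ?_) w
  cases g with
  | alpha =>
    simp only [scaling, deriv_alpha, repComul, AlgHom.comp_apply, lift_ι_apply, freeComul, map_smul,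
      map_sub, map_add, map_neg, Algebra.TensorProduct.map_tmul, AlgHom.id_apply, rep, mul_sub, sub_mul,
      mul_smul_comm, smul_mul_assoc, Algebra.TensorProduct.tmul_mul_tmul, one_mul, mul_one,
      xOp_mul_alpha_eq_add hq0 hq1, xOp_mul_gamma hq0 hq1, TensorProduct.tmul_add,
      TensorProduct.tmul_smul]
    module
  | alphaStar =>
    simp only [scaling, deriv_alphaStar, repComul, AlgHom.comp_apply, lift_ι_apply, freeComul,
      map_smul, map_sub, map_zero, Algebra.TensorProduct.map_tmul, AlgHom.id_apply, rep, mul_sub, sub_mul,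
      mul_smul_comm, smul_mul_assoc, Algebra.TensorProduct.tmul_mul_tmul, one_mul, mul_one,
      xOp_mul_alphaStar, xOp_mul_gammaStar hq0, TensorProduct.tmul_smul]
    module
  | gamma =>
    simp only [scaling, deriv_gamma, repComul, AlgHom.comp_apply, lift_ι_apply, freeComul, map_smul,
      map_sub, map_add, Algebra.TensorProduct.map_tmul, AlgHom.id_apply, rep, mul_add, add_mul,
      smul_mul_assoc, Algebra.TensorProduct.tmul_mul_tmul, one_mul, mul_one,
      xOp_mul_alpha_eq_add hq0 hq1, xOp_mul_gamma hq0 hq1, TensorProduct.tmul_add,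
      TensorProduct.tmul_smul]
    module
  | gammaStar =>
    simp only [scaling, deriv_gammaStar, repComul, AlgHom.comp_apply, lift_ι_apply, freeComul,
      map_smul, map_add, map_zero, Algebra.TensorProduct.map_tmul, AlgHom.id_apply, rep, mul_add, add_mul,
      smul_mul_assoc, Algebra.TensorProduct.tmul_mul_tmul, one_mul, mul_one,
      xOp_mul_alphaStar, xOp_mul_gammaStar hq0, TensorProduct.tmul_smul]
    module

theorem relations_circle (q : ℝ) {z : ℂ} (hz : ‖z‖ = 1) : QSU2Relations q z 0 where
  comm := by simp
  comm_star := by simp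
  normal := by simp
  star_mul := by
    simp only [star_zero, mul_zero, add_zero, Complex.star_def]
    rw [Complex.conj_mul', hz]
    simp
  mul_star := by
    simp only [star_zero, mul_zero, add_zero, smul_zero, Complex.star_def]
    rw [Complex.mul_conj', hz]
    simp

/-- The character of `A_q(SU(2))` at a point of the circle. -/
def character (q : ℝ) {z : ℂ} (hz : ‖z‖ = 1) : QSU2 q →⋆ₐ[ℂ] ℂ :=
  (universal q _ _ _ (relations_circle q hz)).choose

theorem character_alpha (q : ℝ) {z : ℂ} (hz : ‖z‖ = 1) : character q hz (α q) = z :=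
  (universal q _ _ _ (relations_circle q hz)).choose_spec.1.1

theorem character_gamma (q : ℝ) {z : ℂ} (hz : ‖z‖ = 1) : character q hz (γ q) = 0 :=
  (universal q _ _ _ (relations_circle q hz)).choose_spec.1.2

theorem character_star (q : ℝ) {z : ℂ} (hz : ‖z‖ = 1) (x : QSU2 q) :
    character q hz (star x) = starRingEnd ℂ (character q hz x) := map_star _ _

/-- Rotation is translation by the point z of the diagonal circle subgroup, i.e. evaluating the
second leg at the character α ↦ z, γ ↦ 0. -/
theorem rotate_eq (q : ℝ) {z : ℂ} (hz : ‖z‖ = 1) (w : FreeAlgebra ℂ Gen) : rotate z w =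
    Algebra.TensorProduct.rid ℂ ℂ _ (Algebra.TensorProduct.map (AlgHom.id ℂ _)
      ((character q hz).toAlgHom.comp (value q)) (freeComul q w)) := by
  have e : rotate z = (Algebra.TensorProduct.rid ℂ ℂ (FreeAlgebra ℂ Gen)).toAlgHom.comp
      ((Algebra.TensorProduct.map (AlgHom.id ℂ _)
      ((character q hz).toAlgHom.comp (value q))).comp (freeComul q)) := by
    refine FreeAlgebra.hom_ext (funext fun g => ?_)
    cases g <;> simp [rotate, freeComul, character_alpha, character_gamma, character_star]
  rw [e]
  rfl

theorem apply_rid_map {A B : Type*} [Semiring A] [Algebra ℂ A] [Semiring B] [Algebra ℂ B]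
    (f : A →ₗ[ℂ] ℂ) (χ : B →ₐ[ℂ] ℂ) (z : A ⊗[ℂ] B) :
    f (Algebra.TensorProduct.rid ℂ ℂ _ (Algebra.TensorProduct.map (AlgHom.id ℂ A) χ z)) =
      χ (slice f z) := by
  induction z using TensorProduct.induction_on with
  | zero => simp
  | tmul a b =>
    rw [Algebra.TensorProduct.map_tmul, Algebra.TensorProduct.rid_tmul, slice_tmul, map_smul,
      map_smul, smul_eq_mul, smul_eq_mul, mul_comm]
    rfl
  | add x y hx hy => simp only [map_add, hx, hy]

/-- The Haar functional as a functional on noncommutative polynomials. -/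
theorem IsHaarFunctional.value_slice {h : QSU2 q →L[ℂ] ℂ} (hh : IsHaarFunctional h)
    (w : FreeAlgebra ℂ Gen) :
    value q (slice ((h : QSU2 q →ₗ[ℂ] ℂ) ∘ₗ (value q).toLinearMap) (freeComul q w)) =
      h (value q w) • (1 : QSU2 q) := by
  rw [← slice_map, map_value_freeComul, ← hh.left_inv w]
  rfl

/-- Invariance turns the contracted first leg into a scalar. Evaluating the second leg at a
character gives rotation invariance; contracting `xOp_mul_repComul` gives X h(w) = h(scaled w) X +
h(derivative of w). -/
theorem IsHaarFunctional.isHaarLike {h : QSU2 q →L[ℂ] ℂ} (hh : IsHaarFunctional h) (hq0 : 0 < q)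
    (hq1 : q < 1) : IsHaarLike h where
  map_one := hh.map_one
  map_rotate z hz w := by
    have h1 := apply_rid_map ((h : QSU2 q →ₗ[ℂ] ℂ) ∘ₗ (value q).toLinearMap)
      ((character q hz).toAlgHom.comp (value q)) (freeComul q w)
    rw [← rotate_eq, AlgHom.comp_apply, hh.value_slice, map_smul, _root_.map_one, smul_eq_mul,
      mul_one] at h1
    exact h1
  map_deriv w _ := by
    set f := (h : QSU2 q →ₗ[ℂ] ℂ) ∘ₗ (value q).toLinearMap
    have key : ∀ w, slice f (repComul q w) = h (value q w) • (1 : Module.End ℂ Rep) := fun w => by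
      have h1 := slice_map f (AlgHom.id ℂ _) (rep q) (freeComul q w)
      have h2 : value q (slice f (freeComul q w) - h (value q w) • 1) = 0 := by
        rw [map_sub, hh.value_slice, map_smul, _root_.map_one, sub_self]
      have h3 := rep_eq_zero_of_value_eq_zero hq0 hq1 h2
      rw [map_sub, map_smul, _root_.map_one, sub_eq_zero] at h3
      rw [← h3]
      exact h1
    have h1 := congrArg (slice f) (xOp_mul_repComul hq0 hq1 w)
    rw [slice_one_tmul_mul, map_add, slice_mul_one_tmul, key, key, key] at h1
    -- The diagonal entry of `xOp` at (0, 0) is zero, so only the scalar h(derivative of w) remains.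
    have h2 := DFunLike.congr_fun (LinearMap.congr_fun h1 (single (0, 0) 1)) (0, 0)
    simpa [xOp_single, single_apply] using h2.symm

end QSU2

/-! ### The concrete Haar functional -/

namespace QSU2

open Finsupp FreeAlgebra

variable {q : ℝ}

theorem exists_value_eq {y : QSU2Product q}
    (hy : y ∈ StarAlgebra.adjoin ℂ {QSU2Product.a q, QSU2Product.c q}) :
    ∃ w : FreeAlgebra ℂ Gen, (value q w : QSU2Sub q).1 = y := by
  have hy' : y ∈ Algebra.adjoin ℂ ({QSU2Product.a q, QSU2Product.c q} ∪
      star {QSU2Product.a q, QSU2Product.c q}) := by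
    rw [← StarAlgebra.adjoin_toSubalgebra]
    exact hy
  clear hy
  induction hy' using Algebra.adjoin_induction with
  | mem x hx =>
    rcases hx with (rfl | rfl) | hx
    · exact ⟨ι ℂ .alpha, by rw [value_alpha]; rfl⟩
    · exact ⟨ι ℂ .gamma, by rw [value_gamma]; rfl⟩
    · rcases hx with hx | hx
      · refine ⟨ι ℂ .alphaStar, ?_⟩
        rw [value_alphaStar, ← star_star x, hx]; rfl
      · refine ⟨ι ℂ .gammaStar, ?_⟩
        rw [value_gammaStar, ← star_star x, hx]; rfl
  | algebraMap r => exact ⟨algebraMap ℂ _ r, by rw [AlgHom.commutes]; rfl⟩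
  | add x y hx hy h1 h2 =>
    obtain ⟨w, rfl⟩ := h1
    obtain ⟨v, rfl⟩ := h2
    exact ⟨w + v, by rw [map_add]; rfl⟩
  | mul x y hx hy h1 h2 =>
    obtain ⟨w, rfl⟩ := h1
    obtain ⟨v, rfl⟩ := h2
    exact ⟨w * v, by rw [map_mul]; rfl⟩

theorem denseRange_value (q : ℝ) : DenseRange (value q) := by
  refine Metric.denseRange_iff.2 fun x ε hε => ?_
  have hx : (x : QSU2Sub q).1 ∈ closure
      (StarAlgebra.adjoin ℂ {QSU2Product.a q, QSU2Product.c q} : Set (QSU2Product q)) :=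
    (x : QSU2Sub q).2
  obtain ⟨y, hy, hxy⟩ := Metric.mem_closure_iff.1 hx ε hε
  obtain ⟨w, rfl⟩ := exists_value_eq hy
  exact ⟨w, hxy⟩

theorem mul_rep_eq {θ : FreeAlgebra ℂ Gen →ₐ[ℂ] FreeAlgebra ℂ Gen} {U : Module.End ℂ Rep}
    (h : ∀ g : Gen, U * rep q (ι ℂ g) = rep q (θ (ι ℂ g)) * U) (w : FreeAlgebra ℂ Gen) :
    U * rep q w = rep q (θ w) * U := by
  induction w using FreeAlgebra.induction with
  | grade0 r =>
    rw [AlgHom.commutes, AlgHom.commutes, AlgHom.commutes, Algebra.commutes]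
  | grade1 g => exact h g
  | mul x y hx hy => rw [map_mul, map_mul, map_mul, ← mul_assoc, hx, mul_assoc, hy, mul_assoc]
  | add x y hx hy => rw [map_add, map_add, map_add, mul_add, hx, hy, add_mul]

/-- The diagonal operator implementing the rotation. -/
def rotOp (z : ℂ) : Module.End ℂ Rep :=
  linearCombination ℂ fun i => single i (z ^ (i.2 - i.1))

theorem rotOp_single (z : ℂ) (i : ℕ × ℤ) (c : ℂ) :
    rotOp z (single i c) = single i (c * z ^ (i.2 - i.1)) := by
  rw [rotOp, linearCombination_single, smul_single, smul_eq_mul]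

theorem rotOp_apply (z : ℂ) (v : Rep) (i : ℕ × ℤ) : rotOp z v i = v i * z ^ (i.2 - i.1) := by
  induction v using Finsupp.induction_linear with
  | zero => simp
  | add v w hv hw => rw [map_add, Finsupp.add_apply, hv, hw, Finsupp.add_apply, add_mul]
  | single j c =>
    rw [rotOp_single, single_apply, single_apply]
    split_ifs with h
    · rw [h]
    · rw [zero_mul]

theorem rotOp_mul_rep {z : ℂ} (hz : ‖z‖ = 1) (w : FreeAlgebra ℂ Gen) :
    rotOp z * rep q w = rep q (rotate z w) * rotOp z := by
  have hz0 : z ≠ 0 := norm_ne_zero_iff.1 (by rw [hz]; exact one_ne_zero)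
  have hz1 : starRingEnd ℂ z = z⁻¹ := by
    rw [Complex.inv_def, Complex.normSq_eq_norm_sq, hz]; simp
  refine mul_rep_eq (fun g => Finsupp.lhom_ext fun i c => ?_) w
  obtain ⟨n, k⟩ := i
  cases g with
  | alpha =>
    simp only [rep, rotate, lift_ι_apply, map_smul, Module.End.mul_apply, LinearMap.smul_apply,
      genAct_alpha, rotOp_single, smul_single, smul_eq_mul]
    cases n with
    | zero => simp [rootCoeff_zero]
    | succ n =>
      congr 1
      have : z ^ (k - ((n + 1 - 1 : ℕ) : ℤ)) = z ^ (k - ((n + 1 : ℕ) : ℤ)) * z := by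
        rw [← zpow_add_one₀ hz0]; congr 1; push_cast; ring_nf
      rw [this]; ring
  | alphaStar =>
    simp only [rep, rotate, lift_ι_apply, map_smul, Module.End.mul_apply, LinearMap.smul_apply,
      genAct_alphaStar, rotOp_single, smul_single, smul_eq_mul]
    congr 1
    have : z ^ (k - ((n + 1 : ℕ) : ℤ)) = z ^ (k - (n : ℤ)) * z⁻¹ := by
      rw [← zpow_sub_one₀ hz0]; congr 1; push_cast; ring
    rw [this, hz1]; ring
  | gamma =>
    simp only [rep, rotate, lift_ι_apply, map_smul, Module.End.mul_apply, LinearMap.smul_apply,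
      genAct_gamma, rotOp_single, smul_single, smul_eq_mul]
    congr 1
    have : z ^ (k + 1 - (n : ℤ)) = z ^ (k - (n : ℤ)) * z := by
      rw [← zpow_add_one₀ hz0]; congr 1; ring
    rw [this]; ring
  | gammaStar =>
    simp only [rep, rotate, lift_ι_apply, map_smul, Module.End.mul_apply, LinearMap.smul_apply,
      genAct_gammaStar, rotOp_single, smul_single, smul_eq_mul]
    congr 1
    have : z ^ (k - 1 - (n : ℤ)) = z ^ (k - (n : ℤ)) * z⁻¹ := by
      rw [← zpow_sub_one₀ hz0]; congr 1; ring
    rw [this, hz1]; ring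

theorem rep_rotate_apply {z : ℂ} (hz : ‖z‖ = 1) (w : FreeAlgebra ℂ Gen) (i : ℕ × ℤ) :
    rep q (rotate z w) (single i 1) i = rep q w (single i 1) i := by
  have hz0 : z ≠ 0 := norm_ne_zero_iff.1 (by rw [hz]; exact one_ne_zero)
  have h := DFunLike.congr_fun (LinearMap.congr_fun (rotOp_mul_rep (q := q) hz w) (single i 1)) i
  rw [Module.End.mul_apply, Module.End.mul_apply, rotOp_apply, rotOp_single, one_mul] at h
  have e : single i (z ^ (i.2 - i.1)) = (z ^ (i.2 - i.1)) • single i (1 : ℂ) := by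
    rw [smul_single, smul_eq_mul, mul_one]
  rw [e, map_smul, Finsupp.smul_apply, smul_eq_mul, mul_comm] at h
  exact (mul_left_cancel₀ (zpow_ne_zero _ hz0) h).symm

/-- The shift operator commuting with the representation. -/
def shiftOp : Module.End ℂ Rep := linearCombination ℂ fun i => single (i.1, i.2 + 1) 1

theorem shiftOp_single (i : ℕ × ℤ) (c : ℂ) : shiftOp (single i c) = single (i.1, i.2 + 1) c := by
  rw [shiftOp, linearCombination_single, smul_single, smul_eq_mul, mul_one]

theorem shiftOp_apply (v : Rep) (i : ℕ × ℤ) : shiftOp v (i.1, i.2 + 1) = v i := by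
  induction v using Finsupp.induction_linear with
  | zero => simp
  | add v w hv hw => rw [map_add, Finsupp.add_apply, hv, hw, Finsupp.add_apply]
  | single j c =>
    rw [shiftOp_single, single_apply, single_apply]
    simp [Prod.ext_iff]

theorem shiftOp_mul_rep (w : FreeAlgebra ℂ Gen) : shiftOp * rep q w = rep q w * shiftOp := by
  refine mul_rep_eq (θ := AlgHom.id ℂ _) (fun g => Finsupp.lhom_ext fun i c => ?_) w
  cases g with
  | alpha => 
    simp only [rep, lift_ι_apply, AlgHom.id_apply, Module.End.mul_apply, genAct_alpha,
      shiftOp_single]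
  | alphaStar => 
    simp only [rep, lift_ι_apply, AlgHom.id_apply, Module.End.mul_apply, genAct_alphaStar,
      shiftOp_single]
  | gamma => 
    simp only [rep, lift_ι_apply, AlgHom.id_apply, Module.End.mul_apply, genAct_gamma,
      shiftOp_single]
  | gammaStar => 
    simp only [rep, lift_ι_apply, AlgHom.id_apply, Module.End.mul_apply, genAct_gammaStar,
      shiftOp_single, sub_add_cancel, add_sub_cancel_right]

theorem rep_shift_apply (w : FreeAlgebra ℂ Gen) (i j : ℕ × ℤ) :
    rep q w (single (i.1, i.2 + 1) 1) (j.1, j.2 + 1) = rep q w (single i 1) j := by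
  rw [← shiftOp_single, ← Module.End.mul_apply, ← shiftOp_mul_rep, Module.End.mul_apply,
    shiftOp_apply]

/-- The matrix entries of the representation. -/
def entry (hq0 : 0 < q) (hq1 : q < 1) (i j : ℕ × ℤ) : QSU2 q →L[ℂ] ℂ :=
  LinearMap.mkContinuous
    { toFun := fun x => hrep q hq0 hq1 x (lp.single 2 i 1) j
      map_add' := fun x y => by rw [map_add]; rfl
      map_smul' := fun c x => by rw [map_smul]; rfl } 1 fun x => by
    refine (lp.norm_apply_le_norm (by norm_num) _ j).trans ?_
    refine (ContinuousLinearMap.le_opNorm _ _).trans ?_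
    rw [lp.norm_single (by norm_num), norm_one, mul_one, one_mul]
    exact norm_hrep_le hq0 hq1 x

theorem entry_apply (hq0 : 0 < q) (hq1 : q < 1) (i j : ℕ × ℤ) (x : QSU2 q) :
    entry hq0 hq1 i j x = hrep q hq0 hq1 x (lp.single 2 i 1) j := rfl

theorem norm_entry_le (hq0 : 0 < q) (hq1 : q < 1) (i j : ℕ × ℤ) (x : QSU2 q) :
    ‖entry hq0 hq1 i j x‖ ≤ ‖x‖ := by
  have := (entry hq0 hq1 i j).le_of_opNorm_le (LinearMap.mkContinuous_norm_le _ zero_le_one _) x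
  rwa [one_mul] at this

theorem entry_value (hq0 : 0 < q) (hq1 : q < 1) (i j : ℕ × ℤ) (w : FreeAlgebra ℂ Gen) :
    entry hq0 hq1 i j (value q w) = rep q w (single i 1) j := by
  rw [entry_apply, ← toEllTwo_single, hrep_value, toEllTwo_apply]

theorem entry_shift (hq0 : 0 < q) (hq1 : q < 1) (i j : ℕ × ℤ) :
    entry hq0 hq1 (i.1, i.2 + 1) (j.1, j.2 + 1) = entry hq0 hq1 i j := by
  refine ContinuousLinearMap.coeFn_injective ((denseRange_value q).equalizer
    (ContinuousLinearMap.continuous _) (ContinuousLinearMap.continuous _) (funext fun w => ?_))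
  simp only [Function.comp_apply, entry_value, rep_shift_apply]

/-- The representation commutes with translation in ℤ, so entries depend only on the difference of
the ℤ-indices. -/
theorem entry_eq_entry_zero (hq0 : 0 < q) (hq1 : q < 1) (n m : ℕ) (k l : ℤ) :
    entry hq0 hq1 (n, k) (m, l) = entry hq0 hq1 (n, 0) (m, l - k) := by
  induction k using Int.induction_on generalizing l with
  | zero => rw [sub_zero]
  | succ k ih =>
    have := entry_shift hq0 hq1 (n, k) (m, l - 1)
    simp only [sub_add_cancel] at this
    rw [this, ih]
    congr 2; ring
  | pred k ih =>
    rw [← entry_shift hq0 hq1 (n, -k - 1) (m, l)]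
    simp only [sub_add_cancel]
    rw [ih]
    congr 2; ring

theorem summable_pow_mul_entry (hq0 : 0 < q) (hq1 : q < 1) (x : QSU2 q) :
    Summable fun n : ℕ => ((q : ℂ) ^ 2) ^ n * entry hq0 hq1 (n, 0) (n, 0) x := by
  have hq : q ^ 2 < 1 := by nlinarith
  refine Summable.of_norm_bounded ((summable_geometric_of_lt_one (by positivity) hq).mul_right ‖x‖)
    fun n => ?_
  rw [norm_mul, norm_pow, norm_pow, Complex.norm_real, Real.norm_of_nonneg hq0.le]
  gcongr
  exact norm_entry_le _ _ _ _ _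

/-- The concrete Haar functional. -/
def haar (hq0 : 0 < q) (hq1 : q < 1) : QSU2 q →L[ℂ] ℂ :=
  LinearMap.mkContinuous
    { toFun := fun x => (1 - (q : ℂ) ^ 2) *
        ∑' n : ℕ, ((q : ℂ) ^ 2) ^ n * entry hq0 hq1 (n, 0) (n, 0) x
      map_add' := fun x y => by
        rw [← mul_add, ← (summable_pow_mul_entry hq0 hq1 x).tsum_add
          (summable_pow_mul_entry hq0 hq1 y)]
        simp only [map_add, mul_add]
      map_smul' := fun c x => by
        simp only [map_smul, smul_eq_mul, RingHom.id_apply, mul_left_comm _ c, tsum_mul_left] } 1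
    fun x => by
      have hq : q ^ 2 < 1 := by nlinarith
      have h1 : ‖∑' n : ℕ, ((q : ℂ) ^ 2) ^ n * entry hq0 hq1 (n, 0) (n, 0) x‖ ≤
          (1 - q ^ 2)⁻¹ * ‖x‖ := by
        refine tsum_of_norm_bounded
          ((hasSum_geometric_of_lt_one (by positivity) hq).mul_right ‖x‖) fun n => ?_
        rw [norm_mul, norm_pow, norm_pow, Complex.norm_real, Real.norm_of_nonneg hq0.le]
        gcongr
        exact norm_entry_le _ _ _ _ _
      have h2 : ‖1 - (q : ℂ) ^ 2‖ = 1 - q ^ 2 := by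
        rw [← Complex.ofReal_pow, ← Complex.ofReal_one, ← Complex.ofReal_sub, Complex.norm_real,
          Real.norm_of_nonneg (by linarith)]
      change ‖(1 - (q : ℂ) ^ 2) *
        ∑' n : ℕ, ((q : ℂ) ^ 2) ^ n * entry hq0 hq1 (n, 0) (n, 0) x‖ ≤ 1 * ‖x‖
      rw [norm_mul, h2, one_mul]
      calc _ ≤ (1 - q ^ 2) * ((1 - q ^ 2)⁻¹ * ‖x‖) := by
            refine mul_le_mul_of_nonneg_left h1 (by linarith)
        _ = ‖x‖ := mul_inv_cancel_left₀ (by linarith) _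

theorem haar_apply (hq0 : 0 < q) (hq1 : q < 1) (x : QSU2 q) : haar hq0 hq1 x =
    (1 - (q : ℂ) ^ 2) * ∑' n : ℕ, ((q : ℂ) ^ 2) ^ n * entry hq0 hq1 (n, 0) (n, 0) x := rfl

theorem xOp_apply_zero (v : Rep) (k : ℤ) : xOp q v (0, k) = 0 := by
  induction v using Finsupp.induction_linear with
  | zero => simp
  | add v w hv hw => rw [map_add, Finsupp.add_apply, hv, hw, add_zero]
  | single j c => rw [xOp_single, single_apply, if_neg (by simp)]

theorem xOp_apply_succ (v : Rep) (n : ℕ) (k : ℤ) :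
    xOp q v (n + 1, k) = v (n, k + 1) * xCoeff q n := by
  induction v using Finsupp.induction_linear with
  | zero => simp
  | add v w hv hw => rw [map_add, Finsupp.add_apply, hv, hw, Finsupp.add_apply, add_mul]
  | single j c =>
    rw [xOp_single, single_apply, single_apply]
    by_cases h : j = (n, k + 1)
    · subst h; simp
    · rw [if_neg h, if_neg, zero_mul]
      contrapose! h
      simp only [Prod.mk.injEq, add_left_inj] at h
      exact Prod.ext h.1 (by rw [← h.2]; ring)

/-- The functional is a trace with density proportional to q^(2n). Diagonal entries are rotation
invariant. A derivative of a word of weight q² is X w - q² w X in the representation, and the factor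
q² matches the density, so the weighted diagonal entries telescope. -/
theorem haar_isHaarLike (hq0 : 0 < q) (hq1 : q < 1) : IsHaarLike (haar hq0 hq1) where
  map_one := by
    have hq : ‖(q : ℂ) ^ 2‖ < 1 := by
      rw [norm_pow, Complex.norm_real, Real.norm_of_nonneg hq0.le]; nlinarith
    have h1 : (1 : ℂ) - q ^ 2 ≠ 0 := sub_ne_zero.2 fun h => by
      rw [← h, norm_one] at hq; exact lt_irrefl _ hq
    have h2 : ∀ n : ℕ, entry hq0 hq1 (n, 0) (n, 0) (1 : QSU2 q) = 1 := fun n => by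
      rw [← _root_.map_one (value q), entry_value, _root_.map_one]
      simp
    rw [haar_apply]
    simp only [h2, mul_one]
    rw [tsum_geometric_of_norm_lt_one hq, mul_inv_cancel₀ h1]
  map_rotate z hz w := by simp only [haar_apply, entry_value, rep_rotate_apply hz]
  map_deriv w hw := by
    rw [haar_apply]
    set b : ℕ → ℂ := fun n => ((q : ℂ) ^ 2) ^ n * xOp q (rep q w (single (n, 0) 1)) (n, 0) with hb
    have hterm : ∀ n, ((q : ℂ) ^ 2) ^ n * entry hq0 hq1 (n, 0) (n, 0) (value q (deriv q w)) =
        b n - b (n + 1) := fun n => by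
      have h := DFunLike.congr_fun (LinearMap.congr_fun (xOp_mul_rep hq0 hq1 w) (single (n, 0) 1))
        (n, 0)
      have hs := rep_shift_apply (q := q) w (n + 1, -1) (n, 0)
      simp only [neg_add_cancel, zero_add] at hs
      have e : single (n + 1, -1) (xCoeff q n : ℂ) =
          (xCoeff q n : ℂ) • single (n + 1, (-1 : ℤ)) (1 : ℂ) := by
        rw [smul_single, smul_eq_mul, mul_one]
      rw [hw, map_smul, LinearMap.add_apply, Finsupp.add_apply, Module.End.mul_apply,
        Module.End.mul_apply, xOp_single, LinearMap.smul_apply, Finsupp.smul_apply] at h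
      simp only [zero_sub, one_mul] at h
      rw [e, map_smul, Finsupp.smul_apply, ← hs, smul_eq_mul, smul_eq_mul] at h
      rw [entry_value, hb]
      simp only [xOp_apply_succ, zero_add]
      rw [h, pow_succ]
      ring
    have hlim : Filter.Tendsto b Filter.atTop (nhds 0) := by
      -- The coefficients of X grow like q^(-n), which the density q^(2n) more than compensates;
      -- hence the boundary term at infinity vanishes.
      have hbound : ∀ n, ‖b n‖ ≤ q ^ n * (|(q⁻¹ - q)⁻¹| * ‖value q w‖) := fun n => by
        cases n with
        | zero => simp only [hb, xOp_apply_zero, mul_zero, norm_zero]; positivity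
        | succ n =>
          have h1 := norm_entry_le hq0 hq1 (n + 1, 0) (n, 1) (value q w)
          rw [entry_value] at h1
          simp only [hb, xOp_apply_succ, zero_add]
          rw [norm_mul, norm_mul, norm_pow, norm_pow, Complex.norm_real, Complex.norm_real,
            Real.norm_of_nonneg hq0.le, xCoeff, Real.norm_eq_abs, abs_mul, abs_mul,
            abs_of_nonneg (rootCoeff_nonneg q _), abs_of_nonneg (by positivity : 0 ≤ q⁻¹ ^ (n + 1))]
          have h2 := rootCoeff_le_one (q := q) (n + 1)
          have h3 : (q ^ 2) ^ (n + 1) = q ^ (n + 1) * q ^ (n + 1) := by ring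
          have h4 : q ^ (n + 1) * q⁻¹ ^ (n + 1) = 1 := by
            rw [← mul_pow, mul_inv_cancel₀ hq0.ne', one_pow]
          calc _ = q ^ (n + 1) * (q ^ (n + 1) * q⁻¹ ^ (n + 1)) * (|(q⁻¹ - q)⁻¹| *
                (‖rep q w (single (n + 1, 0) 1) (n, 1)‖ * rootCoeff q (n + 1))) := by
                rw [h3]; ring
            _ ≤ q ^ (n + 1) * (|(q⁻¹ - q)⁻¹| * (‖value q w‖ * 1)) := by
                rw [h4, mul_one]
                gcongr
                exact rootCoeff_nonneg q _
            _ = _ := by rw [mul_one]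
      refine squeeze_zero_norm hbound ?_
      have := (tendsto_pow_atTop_nhds_zero_of_lt_one hq0.le hq1).mul_const
        (|(q⁻¹ - q)⁻¹| * ‖value q w‖)
      rwa [zero_mul] at this
    have h1 := (summable_pow_mul_entry hq0 hq1 (value q (deriv q w))).hasSum.tendsto_sum_nat
    simp only [hterm, Finset.sum_range_sub'] at h1
    have h2 : Filter.Tendsto (fun n => b 0 - b n) Filter.atTop (nhds (b 0 - 0)) :=
      tendsto_const_nhds.sub hlim
    simp only [hterm]
    rw [tendsto_nhds_unique h1 h2]
    simp only [hb, xOp_apply_zero, mul_zero, sub_zero]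

/-- Every weight q^(2n) is positive, so x annihilates all basis vectors (n, 0), and by translation
in ℤ all others. The functional is faithful modulo the kernel of the representation. -/
theorem hrep_eq_zero_of_haar (hq0 : 0 < q) (hq1 : q < 1) {x : QSU2 q}
    (hx : haar hq0 hq1 (star x * x) = 0) : hrep q hq0 hq1 x = 0 := by
  have hq : q ^ 2 < 1 := by nlinarith
  have hentry : ∀ n : ℕ, entry hq0 hq1 (n, 0) (n, 0) (star x * x) =
      ((‖hrep q hq0 hq1 x (lp.single 2 (n, 0) 1)‖ ^ 2 : ℝ) : ℂ) := fun n => by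
    have h1 := lp.inner_single_left (𝕜 := ℂ) ((n, 0) : ℕ × ℤ) (1 : ℂ)
      (hrep q hq0 hq1 (star x * x) (lp.single 2 (n, 0) 1))
    rw [entry_apply]
    simp only [RCLike.inner_apply, _root_.map_one, mul_one] at h1
    rw [← h1, map_mul, map_star, mul_apply_eq_comp, ContinuousLinearMap.star_eq_adjoint,
      ContinuousLinearMap.adjoint_inner_right, inner_self_eq_norm_sq_to_K]
    push_cast
    rfl
  have hs := summable_pow_mul_entry hq0 hq1 (star x * x)
  rw [haar_apply, mul_eq_zero] at hx
  have h2 : (1 : ℂ) - q ^ 2 ≠ 0 := by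
    rw [← Complex.ofReal_pow, ← Complex.ofReal_one, ← Complex.ofReal_sub]
    exact_mod_cast (by linarith : 1 - q ^ 2 ≠ 0)
  have h3 := hx.resolve_left h2
  have e : ∀ n : ℕ, ((q : ℂ) ^ 2) ^ n * entry hq0 hq1 (n, 0) (n, 0) (star x * x) =
      (((q ^ 2) ^ n * ‖hrep q hq0 hq1 x (lp.single 2 (n, 0) 1)‖ ^ 2 : ℝ) : ℂ) := fun n => by
    rw [hentry]; push_cast; rfl
  simp only [e] at h3 hs
  rw [← Complex.ofReal_tsum, Complex.ofReal_eq_zero] at h3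
  have hs' := Complex.summable_ofReal.1 hs
  have h4 := (hasSum_zero_iff_of_nonneg fun n => by positivity).1 (h3 ▸ hs'.hasSum)
  have h5 : ∀ n : ℕ, hrep q hq0 hq1 x (lp.single 2 (n, 0) 1) = 0 := fun n => by
    have := congrFun h4 n
    simpa [hq0.ne'] using this
  refine ext_toEllTwo fun v => ?_
  rw [_root_.zero_apply]
  induction v using Finsupp.induction_linear with
  | zero => simp
  | add v w hv hw => rw [map_add, map_add, hv, hw, add_zero]
  | single i c =>
    have e : single i c = c • single i (1 : ℂ) := by rw [smul_single, smul_eq_mul, mul_one]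
    rw [e, map_smul, map_smul, toEllTwo_single]
    refine smul_eq_zero_of_right _ (lp.ext (funext fun j => ?_))
    have := DFunLike.congr_fun (entry_eq_entry_zero hq0 hq1 i.1 j.1 i.2 j.2) x
    rw [entry_apply, entry_apply, h5] at this
    exact this

end QSU2

/-! ### The vacuum projection -/

/-- A continuous function that is `0` below `q²` and `1` at `1`. -/
def vacFun (q x : ℝ) : ℝ := max 0 ((x - q ^ 2) / (1 - q ^ 2))

theorem continuous_vacFun (q : ℝ) : Continuous (vacFun q) := by unfold vacFun; fun_prop

theorem vacFun_eq_zero {q x : ℝ} (hq0 : 0 < q) (hq1 : q < 1) (hx : x ≤ q ^ 2) :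
    vacFun q x = 0 := by
  have : q ^ 2 < 1 := by nlinarith
  exact max_eq_left (div_nonpos_of_nonpos_of_nonneg (by linarith) (by linarith))

theorem vacFun_one {q : ℝ} (hq0 : 0 < q) (hq1 : q < 1) : vacFun q 1 = 1 := by
  have : 1 - q ^ 2 ≠ 0 := by nlinarith
  rw [vacFun, div_self this, max_eq_right zero_le_one]

/-- A continuous function that is `(1 - x)^{-1/2}` below `q²` and `0` at `1`. -/
def invSqrtFun (q x : ℝ) : ℝ := (1 - vacFun q x) * (√(max (1 - x) (1 - q ^ 2)))⁻¹

theorem continuous_invSqrtFun {q : ℝ} (hq0 : 0 < q) (hq1 : q < 1) :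
    Continuous (invSqrtFun q) := by
  have h : q ^ 2 < 1 := by nlinarith
  refine (continuous_const.sub (continuous_vacFun q)).mul (Continuous.inv₀ (by fun_prop) fun x => ?_)
  exact (Real.sqrt_pos.2 (lt_max_of_lt_right (by linarith))).ne'

theorem invSqrtFun_mul {q x : ℝ} (hq0 : 0 < q) (hq1 : q < 1) (hx : x ≤ q ^ 2 ∨ x = 1) :
    invSqrtFun q x * ((1 - x) * invSqrtFun q x) = 1 - vacFun q x := by
  rcases hx with hx | rfl
  · have h : q ^ 2 < 1 := by nlinarith
    rw [invSqrtFun, vacFun_eq_zero hq0 hq1 hx, max_eq_left (by linarith), sub_zero, one_mul,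
      mul_left_comm, ← mul_inv, Real.mul_self_sqrt (by linarith), mul_inv_cancel₀ (by linarith)]
  · rw [vacFun_one hq0 hq1]; simp

namespace QSU2Relations

variable {q : ℝ} {A : Type*} [CStarAlgebra A] {a c : A}

/-- For x ≠ 1, 1 - x is a nonzero spectral value of a*a = 1 - c*c, hence of aa* = 1 - q²c*c. So x/q²
is a spectral value of c*c, and these are at most 1. -/
theorem le_sq_or_eq_one (h : QSU2Relations q a c) (hq0 : 0 < q) {x : ℝ}
    (hx : x ∈ spectrum ℝ (star c * c)) : x ≤ q ^ 2 ∨ x = 1 := by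
  have hA : Nontrivial A := by
    by_contra hA
    rw [not_nontrivial_iff_subsingleton] at hA
    rw [spectrum.of_subsingleton] at hx
    exact hx
  have hN : ∀ y ∈ spectrum ℝ (star c * c), y ≤ 1 := fun y hy => by
    have h1 := spectrum.norm_le_norm_of_mem hy
    rw [CStarRing.norm_star_mul_self] at h1
    have h2 := h.norm_le.2
    have h3 := le_abs_self y
    rw [← Real.norm_eq_abs] at h3
    nlinarith [norm_nonneg c]
  by_contra! hc
  have h1 : (1 - x) ∈ spectrum ℝ (star a * a) := by
    rw [spectrum.mem_iff] at hx ⊢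
    rw [h.qRel.a'a, map_sub, map_one, sub_sub_sub_cancel_left, ← IsUnit.neg_iff, neg_sub]
    exact hx
  have h2 : (1 - x) ∈ spectrum ℝ (a * star a) :=
    ((spectrum.nonzero_mul_comm (𝕜 := ℝ) (star a) a).subset
      ⟨h1, fun h0 => hc.2 (sub_eq_zero.1 (Set.mem_singleton_iff.1 h0)).symm⟩).1
  have hq : q ^ 2 ≠ 0 := by positivity
  have h3 : x / q ^ 2 ∈ spectrum ℝ (star c * c) := by
    rw [spectrum.mem_iff] at h2 ⊢
    intro hu
    apply h2
    have e : algebraMap ℝ A (1 - x) - a * star a =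
        -(algebraMap ℝ A (q ^ 2) * (algebraMap ℝ A (x / q ^ 2) - star c * c)) := by
      have e1 : ((q : ℂ) ^ 2) • (star c * c) = algebraMap ℝ A (q ^ 2) * (star c * c) := by
        rw [← Algebra.smul_def, ← Complex.ofReal_pow, Complex.coe_smul]
      rw [h.qRel.aa', e1, mul_sub, ← map_mul, mul_div_cancel₀ _ hq, map_sub, map_one]
      abel
    rw [e, IsUnit.neg_iff]
    exact ((IsUnit.mk0 _ hq).map (algebraMap ℝ A)).mul hu
  have h4 := hN _ h3
  rw [div_le_one (by positivity)] at h4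
  linarith

/-- The vacuum projection. -/
def vac (_ : QSU2Relations q a c) : A := cfc (vacFun q) (star c * c)

theorem isSelfAdjoint_vac (h : QSU2Relations q a c) : IsSelfAdjoint h.vac := cfc_predicate _ _

theorem star_mul_self_mul_vac (h : QSU2Relations q a c) (hq0 : 0 < q) (hq1 : q < 1) :
    star c * c * h.vac = h.vac := by
  have hN : IsSelfAdjoint (star c * c) := .star_mul_self c
  have hc := (continuous_vacFun q).continuousOn (s := spectrum ℝ (star c * c))
  conv_lhs => rw [vac]; enter [1]; rw [← cfc_id' ℝ (star c * c)]
  rw [← cfc_mul _ _ _ (by fun_prop) hc, vac]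
  refine cfc_congr fun x hx => ?_
  rcases h.le_sq_or_eq_one hq0 hx with hx | rfl
  · simp only [vacFun_eq_zero hq0 hq1 hx, mul_zero]
  · exact one_mul _

theorem vac_mul_vac (h : QSU2Relations q a c) (hq0 : 0 < q) (hq1 : q < 1) :
    h.vac * h.vac = h.vac := by
  have hc := (continuous_vacFun q).continuousOn (s := spectrum ℝ (star c * c))
  rw [vac, ← cfc_mul _ _ _ hc hc]
  refine cfc_congr fun x hx => ?_
  rcases h.le_sq_or_eq_one hq0 hx with hx | rfl
  · simp only [vacFun_eq_zero hq0 hq1 hx, mul_zero]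
  · simp only [vacFun_one hq0 hq1, mul_one]

/-- On the vacuum c*c = 1, so a*a = 1 - c*c vanishes there. -/
theorem mul_vac (h : QSU2Relations q a c) (hq0 : 0 < q) (hq1 : q < 1) : a * h.vac = 0 := by
  rw [← CStarRing.star_mul_self_eq_zero_iff, StarMul.star_mul, mul_assoc, ← mul_assoc (star a),
    h.qRel.a'a, sub_mul, one_mul, h.star_mul_self_mul_vac hq0 hq1, sub_self, mul_zero]

theorem vac_mul_star (h : QSU2Relations q a c) (hq0 : 0 < q) (hq1 : q < 1) :
    h.vac * star a = 0 := by
  have := congrArg star (h.mul_vac hq0 hq1)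
  rwa [StarMul.star_mul, h.isSelfAdjoint_vac.star_eq, star_zero] at this

theorem commute_star_mul_self (h : QSU2Relations q a c) : Commute (star c * c) c := by
  change _ * _ = _ * _
  rw [← mul_assoc, h.normal]

theorem commute_star_mul_self_star (h : QSU2Relations q a c) : Commute (star c * c) (star c) := by
  change _ * _ = _ * _
  rw [mul_assoc, h.normal]

theorem commute_vac (h : QSU2Relations q a c) : Commute h.vac c :=
  h.commute_star_mul_self.cfc_real _

theorem commute_vac_star (h : QSU2Relations q a c) : Commute h.vac (star c) :=
  h.commute_star_mul_self_star.cfc_real _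

/-- The partial isometry in the polar decomposition of `a`. -/
def isom (_ : QSU2Relations q a c) : A := a * cfc (invSqrtFun q) (star c * c)

/-- The spectral gap makes (1 - x)^(-1/2), cut off at x = 1, continuous on the spectrum; this
normalises a off the vacuum. -/
theorem star_isom_mul_isom (h : QSU2Relations q a c) (hq0 : 0 < q) (hq1 : q < 1) :
    star h.isom * h.isom = 1 - h.vac := by
  have hN : IsSelfAdjoint (star c * c) := .star_mul_self c
  have hc := (continuous_vacFun q).continuousOn (s := spectrum ℝ (star c * c))
  have hi := (continuous_invSqrtFun hq0 hq1).continuousOn (s := spectrum ℝ (star c * c))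
  have hsa : IsSelfAdjoint (cfc (invSqrtFun q) (star c * c)) := cfc_predicate _ _
  have e : 1 - star c * c = cfc (fun x : ℝ => 1 - x) (star c * c) := by
    rw [cfc_sub _ _ _, cfc_const_one ℝ _, cfc_id' ℝ _]
  rw [isom, StarMul.star_mul, hsa.star_eq, mul_assoc, ← mul_assoc (star a), h.qRel.a'a, e,
    ← cfc_mul _ _ _ (by fun_prop) hi, ← cfc_mul _ _ _ hi (by fun_prop), vac,
    ← cfc_const_one ℝ (star c * c), ← cfc_sub _ _ _ (by fun_prop) hc]
  exact cfc_congr fun x hx => invSqrtFun_mul hq0 hq1 (h.le_sq_or_eq_one hq0 hx)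

theorem isom_mul (h : QSU2Relations q a c) : h.isom * c = (q : ℂ) • (c * h.isom) := by
  rw [isom, mul_assoc, (h.commute_star_mul_self.cfc_real (invSqrtFun q)).eq, ← mul_assoc, h.comm,
    smul_mul_assoc, mul_assoc]

/-- The unitary that agrees with `c` on the vacuum. -/
def vacUnit (h : QSU2Relations q a c) (hq0 : 0 < q) (hq1 : q < 1) : Aˣ where
  val := c * h.vac + (1 - h.vac)
  inv := star c * h.vac + (1 - h.vac)
  val_inv := by
    have h1 := h.vac_mul_vac hq0 hq1
    have h2 := h.star_mul_self_mul_vac hq0 hq1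
    have e : c * h.vac * (star c * h.vac) = h.vac := by
      rw [mul_assoc, ← mul_assoc h.vac, h.commute_vac_star.eq, mul_assoc (star c), h1, ← mul_assoc,
        h.normal, h2]
    have e1 : (1 - h.vac) * (star c * h.vac) = 0 := by
      rw [sub_mul, one_mul, ← mul_assoc, h.commute_vac_star.eq, mul_assoc, h1, sub_self]
    have e2 : h.vac * (1 - h.vac) = 0 := by rw [mul_sub, mul_one, h1, sub_self]
    rw [add_mul, mul_add, mul_add, e, e1, mul_assoc, e2, sub_mul, one_mul, e2]
    simp
  inv_val := by
    have h1 := h.vac_mul_vac hq0 hq1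
    have h2 := h.star_mul_self_mul_vac hq0 hq1
    have e : star c * h.vac * (c * h.vac) = h.vac := by
      rw [mul_assoc, ← mul_assoc h.vac, h.commute_vac.eq, mul_assoc c, h1, ← mul_assoc, h2]
    have e1 : (1 - h.vac) * (c * h.vac) = 0 := by
      rw [sub_mul, one_mul, ← mul_assoc, h.commute_vac.eq, mul_assoc, h1, sub_self]
    have e2 : h.vac * (1 - h.vac) = 0 := by rw [mul_sub, mul_one, h1, sub_self]
    rw [add_mul, mul_add, mul_add, e, e1, mul_assoc, e2, sub_mul, one_mul, e2]
    simp

variable (h : QSU2Relations q a c) (hq0 : 0 < q) (hq1 : q < 1)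

theorem val_vacUnit : (h.vacUnit hq0 hq1 : A) = c * h.vac + (1 - h.vac) := rfl

theorem val_inv_vacUnit : ((h.vacUnit hq0 hq1)⁻¹ : Aˣ) = star c * h.vac + (1 - h.vac) := rfl

theorem star_vacUnit : star (h.vacUnit hq0 hq1 : A) = ((h.vacUnit hq0 hq1)⁻¹ : Aˣ) := by
  rw [val_vacUnit, val_inv_vacUnit, star_add, StarMul.star_mul, star_sub, star_one,
    h.isSelfAdjoint_vac.star_eq, h.commute_vac_star.eq]

theorem vacUnit_mem_unitary : (h.vacUnit hq0 hq1 : A) ∈ unitary A := by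
  rw [Unitary.mem_iff, star_vacUnit]
  exact ⟨Units.inv_mul _, Units.mul_inv _⟩

theorem vacUnit_mul_vac : (h.vacUnit hq0 hq1 : A) * h.vac = c * h.vac := by
  rw [val_vacUnit, add_mul, sub_mul, one_mul, mul_assoc, h.vac_mul_vac hq0 hq1, sub_self, add_zero]

theorem inv_vacUnit_mul_vac : ((h.vacUnit hq0 hq1)⁻¹ : Aˣ) * h.vac = star c * h.vac := by
  rw [val_inv_vacUnit, add_mul, sub_mul, one_mul, mul_assoc, h.vac_mul_vac hq0 hq1, sub_self,
    add_zero]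

theorem commute_vacUnit_vac : Commute (h.vacUnit hq0 hq1 : A) h.vac := by
  rw [val_vacUnit]
  exact ((h.commute_vac.symm.mul_left (Commute.refl _))).add_left
    ((Commute.one_left _).sub_left (Commute.refl _))

theorem commute_zpow_vac (k : ℤ) : Commute ((h.vacUnit hq0 hq1 ^ k : Aˣ) : A) h.vac :=
  (h.commute_vacUnit_vac hq0 hq1).units_zpow_left k

theorem mul_zpow_mul_vac (k : ℤ) : c * (((h.vacUnit hq0 hq1 ^ k : Aˣ) : A) * h.vac) =
    ((h.vacUnit hq0 hq1 ^ (k + 1) : Aˣ) : A) * h.vac := by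
  have hk := (h.commute_zpow_vac hq0 hq1 k).eq
  rw [hk, ← mul_assoc, ← h.vacUnit_mul_vac hq0 hq1, mul_assoc, ← hk, ← mul_assoc, ← Units.val_mul,
    ← zpow_one_add, add_comm]

theorem star_mul_zpow_mul_vac (k : ℤ) : star c * (((h.vacUnit hq0 hq1 ^ k : Aˣ) : A) * h.vac) =
    ((h.vacUnit hq0 hq1 ^ (k - 1) : Aˣ) : A) * h.vac := by
  have hk := (h.commute_zpow_vac hq0 hq1 k).eq
  rw [hk, ← mul_assoc, ← h.inv_vacUnit_mul_vac hq0 hq1, mul_assoc, ← hk, ← mul_assoc,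
    ← Units.val_mul, ← zpow_neg_one, ← zpow_add, neg_add_eq_sub]

theorem vac_mul_zpow_mul_vac (k : ℤ) : h.vac * (((h.vacUnit hq0 hq1 ^ k : Aˣ) : A) * h.vac) =
    ((h.vacUnit hq0 hq1 ^ k : Aˣ) : A) * h.vac := by
  rw [← mul_assoc, ← (h.commute_zpow_vac hq0 hq1 k).eq, mul_assoc, h.vac_mul_vac hq0 hq1]

theorem mul_zpow_mul_vac_eq_zero (k : ℤ) :
    a * (((h.vacUnit hq0 hq1 ^ k : Aˣ) : A) * h.vac) = 0 := by
  rw [← vac_mul_zpow_mul_vac, ← mul_assoc, h.mul_vac hq0 hq1, zero_mul]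

theorem mul_star_pow (h : QSU2Relations q a c) (n : ℕ) : c * star a ^ n = (q : ℂ) ^ n • (star a ^ n * c) := by
  induction n with
  | zero => simp
  | succ n ih =>
    rw [pow_succ, ← mul_assoc, ih, smul_mul_assoc, mul_assoc, h.qRel.ca', mul_smul_comm, smul_smul,
      ← pow_succ, ← mul_assoc]

theorem star_mul_star_pow (h : QSU2Relations q a c) (n : ℕ) : star c * star a ^ n = (q : ℂ) ^ n • (star a ^ n * star c) := by
  induction n with
  | zero => simp
  | succ n ih =>
    rw [pow_succ, ← mul_assoc, ih, smul_mul_assoc, mul_assoc, h.qRel.c'a', mul_smul_comm, smul_smul,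
      ← pow_succ, ← mul_assoc]

/-- The creation operators star a build, on the vacuum, vectors on which a has the same coefficients
as in the representation on ℓ²(ℕ × ℤ). -/
theorem mul_star_pow_succ_mul (n : ℕ) (k : ℤ) :
    a * (star a ^ (n + 1) * (((h.vacUnit hq0 hq1 ^ k : Aˣ) : A) * h.vac)) =
      (1 - ((q : ℂ) ^ 2) ^ (n + 1)) • (star a ^ n * (((h.vacUnit hq0 hq1 ^ k : Aˣ) : A) * h.vac)) := by
  have e : a * star a ^ (n + 1) =
      star a ^ n - ((q : ℂ) ^ 2) ^ (n + 1) • (star a ^ n * (star c * c)) := by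
    rw [pow_succ', ← mul_assoc, h.qRel.aa', sub_mul, one_mul, smul_mul_assoc, mul_assoc,
      h.mul_star_pow, mul_smul_comm, ← mul_assoc, h.star_mul_star_pow, smul_mul_assoc, smul_smul,
      smul_smul, mul_assoc]
    congr 2
    · ring
    · rw [mul_assoc]
  rw [← mul_assoc, e, sub_mul, smul_mul_assoc, mul_assoc, mul_assoc, h.mul_zpow_mul_vac hq0 hq1,
    h.star_mul_zpow_mul_vac hq0 hq1, add_sub_cancel_right, sub_smul, one_smul]

/-- Functional calculus of a unitary: its spectrum lies on the circle, so a Laurent polynomial in it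
is bounded by its supremum there. -/
theorem norm_sum_vacUnit_le (f : ℤ →₀ ℂ) {C : ℝ}
    (hC : ∀ t : ℂ, ‖t‖ = 1 → ‖f.sum fun k b => b * t ^ k‖ ≤ C) :
    ‖f.sum fun k b => b • ((h.vacUnit hq0 hq1 ^ k : Aˣ) : A)‖ ≤ C := by
  have hC0 : 0 ≤ C := (norm_nonneg _).trans (hC 1 norm_one)
  have hn : IsStarNormal (h.vacUnit hq0 hq1 : A) :=
    ⟨by rw [star_vacUnit]; exact (Units.inv_mul _).trans (Units.mul_inv _).symm⟩
  have e : (f.sum fun k b => b • ((h.vacUnit hq0 hq1 ^ k : Aˣ) : A)) =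
      cfc (∑ k ∈ f.support, fun t : ℂ => f k * t ^ k) (h.vacUnit hq0 hq1 : A) := by
    rw [cfc_sum _ _ _ fun k _ => (Units.continuousOn_zpow₀_spectrum _ k).const_mul _]
    refine Finset.sum_congr rfl fun k _ => ?_
    rw [cfc_const_mul _ _ _ (Units.continuousOn_zpow₀_spectrum _ k), cfc_zpow _ _ hn]
  rw [e]
  refine norm_cfc_le hC0 fun t ht => ?_
  rw [Finset.sum_apply]
  exact hC t (by simpa using
    spectrum.subset_circle_of_unitary (h.vacUnit_mem_unitary hq0 hq1) ht)

end QSU2Relations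

/-! ### The kernel of the representation -/

namespace QSU2

open Finsupp FreeAlgebra

variable {q : ℝ}

/-- Normalisation constants of the basis vectors. -/
def basisCoeff (q : ℝ) (n : ℕ) : ℝ := (∏ j ∈ Finset.range n, rootCoeff q (j + 1))⁻¹

theorem rootCoeff_succ_ne_zero (hq0 : 0 < q) (hq1 : q < 1) (n : ℕ) : rootCoeff q (n + 1) ≠ 0 := by
  have : (q ^ 2) ^ (n + 1) < 1 :=
    pow_lt_one₀ (by positivity) (pow_lt_one₀ hq0.le hq1 two_ne_zero) n.succ_ne_zero
  exact (Real.sqrt_pos.2 (by linarith)).ne'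

theorem basisCoeff_succ (hq0 : 0 < q) (hq1 : q < 1) (n : ℕ) :
    rootCoeff q (n + 1) * basisCoeff q (n + 1) = basisCoeff q n := by
  rw [basisCoeff, Finset.prod_range_succ, mul_inv, mul_left_comm,
    mul_inv_cancel₀ (rootCoeff_succ_ne_zero hq0 hq1 n), mul_one, basisCoeff]

/-- The powers of the vacuum unitary on the vacuum. -/
def vacPow (hq0 : 0 < q) (hq1 : q < 1) (k : ℤ) : QSU2 q :=
  (((relations q).vacUnit hq0 hq1 ^ k : (QSU2 q)ˣ) : QSU2 q) * (relations q).vac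

/-- The intertwiner from the algebraic representation to the left ideal of the vacuum. -/
def orbit (hq0 : 0 < q) (hq1 : q < 1) : Rep →ₗ[ℂ] QSU2 q :=
  linearCombination ℂ fun i => (basisCoeff q i.1 : ℂ) • (star (α q) ^ i.1 * vacPow hq0 hq1 i.2)

theorem orbit_single (hq0 : 0 < q) (hq1 : q < 1) (i : ℕ × ℤ) (b : ℂ) :
    orbit hq0 hq1 (single i b) =
      (b * basisCoeff q i.1) • (star (α q) ^ i.1 * vacPow hq0 hq1 i.2) := by
  rw [orbit, linearCombination_single, smul_smul]

/-- Holds in the universal algebra itself, so words acting on the vacuum ideal are governed by the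
algebraic representation even before that representation is known to be faithful there. -/
theorem value_mul_orbit (hq0 : 0 < q) (hq1 : q < 1) (w : FreeAlgebra ℂ Gen) (v : Rep) :
    value q w * orbit hq0 hq1 v = orbit hq0 hq1 (rep q w v) := by
  induction w using FreeAlgebra.induction generalizing v with
  | grade0 r =>
    rw [AlgHom.commutes, AlgHom.commutes, ← Algebra.smul_def, Module.algebraMap_end_apply, map_smul]
  | mul x y hx hy => rw [map_mul, map_mul, Module.End.mul_apply, mul_assoc, hy, hx]
  | add x y hx hy => rw [map_add, map_add, LinearMap.add_apply, add_mul, hx, hy, map_add]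
  | grade1 g =>
    induction v using Finsupp.induction_linear with
    | zero => simp only [map_zero, mul_zero]
    | add v w hv hw => rw [map_add, map_add, map_add, mul_add, hv, hw]
    | single i b =>
      obtain ⟨n, k⟩ := i
      have hr := relations q
      have hc : ∀ n, (basisCoeff q n : ℂ) = rootCoeff q (n + 1) * basisCoeff q (n + 1) := fun n => by
        exact_mod_cast (basisCoeff_succ hq0 hq1 n).symm
      cases g with
      | alpha =>
        rw [value_alpha, rep, lift_ι_apply, genAct_alpha, orbit_single, orbit_single,
          mul_smul_comm]
        cases n with
        | zero =>
          simp only [pow_zero, one_mul, vacPow, hr.mul_zpow_mul_vac_eq_zero hq0 hq1,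
            rootCoeff_zero]
          simp
        | succ n =>
          have h2 : (1 : ℂ) - ((q : ℂ) ^ 2) ^ (n + 1) = rootCoeff q (n + 1) * rootCoeff q (n + 1) := by
            exact_mod_cast (rootCoeff_sq hq0.le hq1.le (n + 1)).symm
          simp only [Nat.add_sub_cancel, vacPow]
          rw [hr.mul_star_pow_succ_mul hq0 hq1, smul_smul, h2, hc n]
          congr 1
          ring
      | alphaStar =>
        rw [value_alphaStar, rep, lift_ι_apply, genAct_alphaStar, orbit_single, orbit_single,
          mul_smul_comm, ← mul_assoc, ← pow_succ', hc n, mul_assoc b]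
      | gamma =>
        rw [value_gamma, rep, lift_ι_apply, genAct_gamma, orbit_single, orbit_single,
          mul_smul_comm, ← mul_assoc, hr.mul_star_pow, smul_mul_assoc, mul_assoc (_ ^ n), vacPow,
          hr.mul_zpow_mul_vac hq0 hq1, smul_smul, vacPow]
        congr 1
        ring
      | gammaStar =>
        rw [value_gammaStar, rep, lift_ι_apply, genAct_gammaStar, orbit_single, orbit_single,
          mul_smul_comm, ← mul_assoc, hr.star_mul_star_pow, smul_mul_assoc, mul_assoc (_ ^ n),
          vacPow, hr.star_mul_zpow_mul_vac hq0 hq1, smul_smul, vacPow]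
        congr 1
        ring

theorem prodMk_zero_injective : Function.Injective (Prod.mk 0 : ℤ → ℕ × ℤ) :=
  Prod.mk_right_injective 0

/-- The restriction of a family to the ground states. -/
def ground : Rep →ₗ[ℂ] (ℤ →₀ ℂ) := lcomapDomain (Prod.mk 0) prodMk_zero_injective

theorem ground_apply (v : Rep) (k : ℤ) : ground v k = v (0, k) := rfl

theorem vac_mul_orbit (hq0 : 0 < q) (hq1 : q < 1) (v : Rep) :
    (relations q).vac * orbit hq0 hq1 v = linearCombination ℂ (vacPow hq0 hq1) (ground v) := by
  have hr := relations q
  induction v using Finsupp.induction_linear with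
  | zero => simp only [map_zero, mul_zero]
  | add v w hv hw => rw [map_add, map_add, map_add, mul_add, hv, hw]
  | single i b =>
    obtain ⟨n, k⟩ := i
    rw [orbit_single, mul_smul_comm]
    cases n with
    | zero =>
      have e : ground (single (0, k) b) = single k b := by
        ext l; rw [ground_apply, single_apply, single_apply]; simp
      rw [e, linearCombination_single]
      simp only [pow_zero, one_mul, vacPow, hr.vac_mul_zpow_mul_vac hq0 hq1]
      simp [basisCoeff]
    | succ n =>
      have e : ground (single (n + 1, k) b) = 0 := by
        ext l; rw [ground_apply, single_apply]; simp
      rw [e, map_zero]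
      simp only [pow_succ']
      rw [← mul_assoc, ← mul_assoc, hr.vac_mul_star hq0 hq1, zero_mul, zero_mul, smul_zero]

/-- Compression to the vacuum turns a word into a Laurent polynomial in one unitary, with
coefficients read off from the representation. -/
theorem vac_mul_value_mul_vac (hq0 : 0 < q) (hq1 : q < 1) (w : FreeAlgebra ℂ Gen) :
    (relations q).vac * (value q w * (relations q).vac) =
      ((ground (rep q w (single (0, 0) 1))).sum fun k b =>
        b • (((relations q).vacUnit hq0 hq1 ^ k : (QSU2 q)ˣ) : QSU2 q)) * (relations q).vac := by
  have e : orbit hq0 hq1 (single (0, 0) 1) = (relations q).vac := by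
    rw [orbit_single]; simp [basisCoeff, vacPow]
  conv_lhs => rw [← e, value_mul_orbit, e, vac_mul_orbit]
  rw [linearCombination_apply, Finsupp.sum, Finsupp.sum, Finset.sum_mul]
  simp only [vacPow, smul_mul_assoc]

/-- A finite piece of a generalised eigenvector of the shift. -/
def testVec (t : ℂ) (s : Finset ℤ) : Rep := ∑ l ∈ s, single (0, l) (t ^ (-l))

theorem norm_sq_toEllTwo_testVec {t : ℂ} (ht : ‖t‖ = 1) (s : Finset ℤ) :
    ‖toEllTwo (testVec t s)‖ ^ 2 = s.card := by
  have h := lp.norm_sum_single (E := fun _ : ℕ × ℤ => ℂ) (p := 2) (by norm_num)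
    (fun i => t ^ (-i.2)) (s.map ⟨Prod.mk 0, prodMk_zero_injective⟩)
  rw [Finset.sum_map, Finset.sum_map] at h
  have e : toEllTwo (testVec t s) =
      ∑ l ∈ s, lp.single 2 ((0, l) : ℕ × ℤ) (t ^ (-l)) := by
    rw [testVec, map_sum]
    exact Finset.sum_congr rfl fun l _ => toEllTwo_single _ _
  rw [e]
  simpa [ht] using h

theorem inner_testVec {t : ℂ} (ht : ‖t‖ = 1) (s : Finset ℤ) (y : HRep) :
    inner ℂ (toEllTwo (testVec t s)) y = ∑ l ∈ s, t ^ l * y (0, l) := by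
  have hz1 : starRingEnd ℂ t = t⁻¹ := by
    rw [Complex.inv_def, Complex.normSq_eq_norm_sq, ht]; simp
  rw [testVec, map_sum, sum_inner]
  refine Finset.sum_congr rfl fun l _ => ?_
  rw [toEllTwo_single, lp.inner_single_left, RCLike.inner_apply, map_zpow₀, hz1, mul_comm]
  simp

theorem rep_ground_apply (hq0 : 0 < q) (hq1 : q < 1) (w : FreeAlgebra ℂ Gen) (k l : ℤ) :
    rep q w (single (0, k) 1) (0, l) = ground (rep q w (single (0, 0) 1)) (l - k) := by
  rw [ground_apply, ← entry_value hq0 hq1, ← entry_value hq0 hq1,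
    entry_eq_entry_zero hq0 hq1 0 0 k l]

/-- On the ground states the compressed operator is convolution by a finitely supported sequence on
ℤ. Its symbol at t is bounded by the operator norm, tested on truncations of the generalised
eigenvector with entries t^(-l). -/
theorem norm_sum_ground_le (hq0 : 0 < q) (hq1 : q < 1) (w : FreeAlgebra ℂ Gen) {t : ℂ}
    (ht : ‖t‖ = 1) : ‖(ground (rep q w (single (0, 0) 1))).sum fun k b => b * t ^ k‖ ≤
      ‖hrep q hq0 hq1 (value q w)‖ := by
  have ht0 : t ≠ 0 := norm_ne_zero_iff.1 (by rw [ht]; exact one_ne_zero)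
  set a := ground (rep q w (single (0, 0) 1)) with ha
  set B := ‖hrep q hq0 hq1 (value q w)‖
  set S := a.sum fun k b => b * t ^ k with hS
  obtain ⟨M, hM⟩ : ∃ M : ℕ, ∀ m ∈ a.support, |m| < M := by
    refine ⟨∑ m ∈ a.support, (m.natAbs + 1), fun m hm => ?_⟩
    have := Finset.single_le_sum (f := fun m : ℤ => m.natAbs + 1) (fun _ _ => Nat.zero_le _) hm
    rw [Int.abs_eq_natAbs]
    exact_mod_cast Nat.lt_of_succ_le this
  have hsum : ∀ N : ℕ, ∀ k ∈ Finset.Ico (0 : ℤ) N,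
      ∑ l ∈ Finset.Ico (-M : ℤ) (N + M), t ^ (l - k) * a (l - k) = S := fun N k hk => by
    rw [Finset.mem_Ico] at hk
    have h1 : ∑ m ∈ (Finset.Ico (-M : ℤ) (N + M)).map (Equiv.subRight k).toEmbedding,
        t ^ m * a m = S := by
      rw [hS, Finsupp.sum]
      simp only [mul_comm (a _)]
      refine (Finset.sum_subset (fun m hm => ?_) fun m _ hm => ?_).symm
      · have := abs_lt.1 (hM m hm)
        rw [Finset.mem_map_equiv, Finset.mem_Ico]
        simp only [Equiv.subRight_symm_apply]
        omega
      · rw [notMem_support_iff.1 hm, mul_zero]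
    rw [Finset.sum_map] at h1
    exact h1
  -- The left test vector is longer by M at both ends, so that each of the N entries on the right
  -- sees the whole symbol. The loss 2M is negligible as N → ∞.
  have key : ∀ N : ℕ, ((N : ℝ) * ‖S‖) ^ 2 ≤ (N + 2 * M) * (B ^ 2 * N) := fun N => by
    have h1 : inner ℂ (toEllTwo (testVec t (Finset.Ico (-M : ℤ) (N + M))))
        (hrep q hq0 hq1 (value q w) (toEllTwo (testVec t (Finset.Ico (0 : ℤ) N)))) = N * S := by
      rw [hrep_value, inner_testVec ht]
      simp only [toEllTwo_apply]
      have e : ∀ l : ℤ, rep q w (testVec t (Finset.Ico (0 : ℤ) N)) (0, l) =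
          ∑ k ∈ Finset.Ico (0 : ℤ) N, t ^ (-k) * a (l - k) := fun l => by
        rw [testVec, map_sum, Finsupp.finsetSum_apply]
        refine Finset.sum_congr rfl fun k _ => ?_
        rw [ha, ← rep_ground_apply hq0 hq1, ← mul_one (t ^ (-k)), ← smul_eq_mul (t ^ (-k)),
          ← smul_single, map_smul, Finsupp.smul_apply, smul_eq_mul, smul_eq_mul, mul_one]
      simp only [e, Finset.mul_sum]
      rw [Finset.sum_comm]
      have e2 : ∀ k ∈ Finset.Ico (0 : ℤ) N, ∑ l ∈ Finset.Ico (-M : ℤ) (N + M),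
          t ^ l * (t ^ (-k) * a (l - k)) = S := fun k hk => by
        rw [← hsum N k hk]
        refine Finset.sum_congr rfl fun l _ => ?_
        rw [← mul_assoc, ← zpow_add₀ ht0, ← sub_eq_add_neg]
      rw [Finset.sum_congr rfl e2]
      simp
    have h2 := norm_inner_le_norm (𝕜 := ℂ) (toEllTwo (testVec t (Finset.Ico (-M : ℤ) (N + M))))
        (hrep q hq0 hq1 (value q w) (toEllTwo (testVec t (Finset.Ico (0 : ℤ) N))))
    rw [h1, norm_mul, Complex.norm_natCast] at h2
    have h3 := h2.trans (mul_le_mul_of_nonneg_left (ContinuousLinearMap.le_opNorm _ _)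
      (norm_nonneg _))
    have h4 := pow_le_pow_left₀ (by positivity) h3 2
    rw [mul_pow ‖toEllTwo _‖, mul_pow ‖hrep q hq0 hq1 _‖, norm_sq_toEllTwo_testVec ht,
      norm_sq_toEllTwo_testVec ht, Int.card_Ico, Int.card_Ico] at h4
    refine h4.trans (le_of_eq ?_)
    have e1 : (((N + M - -M : ℤ).toNat : ℕ) : ℝ) = N + 2 * M := by
      have : (N + M - -M : ℤ).toNat = N + 2 * M := by omega
      rw [this]; push_cast; ring
    rw [e1, sub_zero, Int.toNat_natCast]
  by_contra! hc
  have hB : 0 ≤ B := norm_nonneg _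
  have h1 : 0 < ‖S‖ ^ 2 - B ^ 2 := by nlinarith
  obtain ⟨N, hN⟩ := exists_nat_gt (2 * M * B ^ 2 / (‖S‖ ^ 2 - B ^ 2))
  rw [div_lt_iff₀ h1] at hN
  have hN0 : (0 : ℝ) < N := by
    rcases Nat.eq_zero_or_pos N with rfl | h
    · have : (0 : ℝ) ≤ 2 * M * B ^ 2 := by positivity
      simp at hN; linarith
    · exact_mod_cast h
  nlinarith [key N]

theorem norm_le_one_of_projection {A : Type*} [CStarAlgebra A] {e : A} (h : IsSelfAdjoint e)
    (he : e * e = e) : ‖e‖ ≤ 1 := by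
  have h1 := CStarRing.norm_star_mul_self (x := e)
  rw [h.star_eq, he] at h1
  by_contra! hc
  nlinarith

theorem norm_vac_le (hq0 : 0 < q) (hq1 : q < 1) : ‖(relations q).vac‖ ≤ 1 :=
  norm_le_one_of_projection (relations q).isSelfAdjoint_vac ((relations q).vac_mul_vac hq0 hq1)

theorem continuous_hrep (hq0 : 0 < q) (hq1 : q < 1) : Continuous (hrep q hq0 hq1) :=
  AddMonoidHomClass.continuous_of_bound (hrep q hq0 hq1) 1 fun x => by
    rw [one_mul]; exact norm_hrep_le hq0 hq1 x

/-- For words both sides are compared with the supremum of the symbol on the circle; density of the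
words and continuity do the rest. -/
theorem norm_vac_mul_mul_vac_le (hq0 : 0 < q) (hq1 : q < 1) (x : QSU2 q) :
    ‖(relations q).vac * (x * (relations q).vac)‖ ≤ ‖hrep q hq0 hq1 x‖ := by
  refine (denseRange_value q).induction_on x (isClosed_le ?_ ?_) fun w => ?_
  · fun_prop
  · exact (continuous_hrep hq0 hq1).norm
  · rw [vac_mul_value_mul_vac hq0 hq1]
    refine (norm_mul_le _ _).trans ?_
    refine (mul_le_of_le_one_right (norm_nonneg _) (norm_vac_le hq0 hq1)).trans ?_
    exact (relations q).norm_sum_vacUnit_le hq0 hq1 _ fun t ht => norm_sum_ground_le hq0 hq1 w ht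

/-- The compression estimate applied to x*x gives (x vac)*(x vac) = 0. -/
theorem mul_vac_eq_zero (hq0 : 0 < q) (hq1 : q < 1) {x : QSU2 q} (hx : hrep q hq0 hq1 x = 0) :
    x * (relations q).vac = 0 := by
  rw [← CStarRing.star_mul_self_eq_zero_iff, star_mul, (relations q).isSelfAdjoint_vac.star_eq,
    mul_assoc, ← mul_assoc (star x), ← norm_le_zero_iff]
  refine (norm_vac_mul_mul_vac_le hq0 hq1 _).trans (le_of_eq ?_)
  rw [map_mul, hx, mul_zero, norm_zero]

/-- In the kernel y vac = 0, so y = y V*V with V the partial isometry. Since Vγ = qγV, yγ = q(yV*)γV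
with yV* again in the kernel, and iteration gives ‖yγ‖ ≤ q^n ‖y‖. -/
theorem mul_gamma_eq_zero (hq0 : 0 < q) (hq1 : q < 1) {x : QSU2 q} (hx : hrep q hq0 hq1 x = 0) :
    x * γ q = 0 := by
  have hr := relations q
  have hV : ‖star hr.isom‖ * ‖hr.isom‖ ≤ 1 := by
    rw [norm_star, ← CStarRing.norm_star_mul_self, hr.star_isom_mul_isom hq0 hq1]
    refine norm_le_one_of_projection ((IsSelfAdjoint.one _).sub hr.isSelfAdjoint_vac) ?_
    rw [mul_sub, mul_one, sub_mul, one_mul, hr.vac_mul_vac hq0 hq1, sub_self, sub_zero]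
  have key : ∀ (n : ℕ) (y : QSU2 q), hrep q hq0 hq1 y = 0 → ‖y * γ q‖ ≤ q ^ n * ‖y‖ := fun n => by
    induction n with
    | zero =>
      intro y _
      rw [pow_zero, one_mul]
      exact (norm_mul_le _ _).trans (mul_le_of_le_one_right (norm_nonneg _)
        (by
          rcases subsingleton_or_nontrivial (QSU2 q) with h | h
          · rw [Subsingleton.elim (γ q) 0, norm_zero]; exact zero_le_one
          · exact hr.norm_le.2))
    | succ n ih =>
      intro y hy
      have e : y * γ q = (q : ℂ) • (y * star hr.isom * γ q * hr.isom) := by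
        have e1 : y = y * star hr.isom * hr.isom := by
          rw [mul_assoc, hr.star_isom_mul_isom hq0 hq1, mul_sub, mul_one,
            mul_vac_eq_zero hq0 hq1 hy, sub_zero]
        conv_lhs => rw [e1]
        rw [mul_assoc, hr.isom_mul, mul_smul_comm, mul_assoc _ (γ q)]
      rw [e, norm_smul, Complex.norm_real, Real.norm_of_nonneg hq0.le, pow_succ', mul_assoc q]
      refine mul_le_mul_of_nonneg_left ?_ hq0.le
      calc _ ≤ ‖y * star hr.isom * γ q‖ * ‖hr.isom‖ := norm_mul_le _ _
        _ ≤ (q ^ n * ‖y * star hr.isom‖) * ‖hr.isom‖ := by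
          gcongr
          exact ih _ (by rw [map_mul, hy, zero_mul])
        _ ≤ (q ^ n * (‖y‖ * ‖star hr.isom‖)) * ‖hr.isom‖ := by
          gcongr
          exact norm_mul_le _ _
        _ = q ^ n * ‖y‖ * (‖star hr.isom‖ * ‖hr.isom‖) := by ring
        _ ≤ q ^ n * ‖y‖ := mul_le_of_le_one_right (by positivity) hV
  have hlim : Filter.Tendsto (fun n : ℕ => q ^ n * ‖x‖) Filter.atTop (nhds 0) := by
    simpa using (tendsto_pow_atTop_nhds_zero_of_lt_one hq0.le hq1).mul_const ‖x‖
  rw [← norm_le_zero_iff]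
  exact ge_of_tendsto' hlim fun n => key n x hx

theorem mul_gammaStar_eq_zero (hq0 : 0 < q) (hq1 : q < 1) {x : QSU2 q}
    (hx : hrep q hq0 hq1 x = 0) : x * star (γ q) = 0 := by
  rw [← CStarRing.mul_star_self_eq_zero_iff, star_mul, star_star, mul_assoc, ← mul_assoc (star (γ q)),
    ← (relations q).normal, ← mul_assoc, ← mul_assoc, mul_gamma_eq_zero hq0 hq1 hx, zero_mul,
    zero_mul]

/-- On the kernel all terms of ρ with γ or γ* vanish, and what is left is (α² + α*²)/2 with ‖α‖ ≤ 1.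
-/
theorem norm_rho_mul_le (hq0 : 0 < q) (hq1 : q < 1) (τ σ : ℝ) {x : QSU2 q}
    (hx : hrep q hq0 hq1 x = 0) : ‖rho q τ σ * x‖ ≤ ‖x‖ := by
  have hq : (q : ℂ) ≠ 0 := by exact_mod_cast hq0.ne'
  have hr := relations q
  have hs : hrep q hq0 hq1 (star x) = 0 := by rw [map_star, hx, star_zero]
  have h1 : γ q * x = 0 := by
    have := congrArg star (mul_gammaStar_eq_zero hq0 hq1 hs)
    rwa [star_mul, star_star, star_star, star_zero] at this
  have h2 : star (γ q) * x = 0 := by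
    have := congrArg star (mul_gamma_eq_zero hq0 hq1 hs)
    rwa [star_mul, star_star, star_zero] at this
  have h3 : γ q * (α q * x) = 0 := by
    rw [← mul_assoc, hr.qRel.ca hq, smul_mul_assoc, mul_assoc, h1, mul_zero, smul_zero]
  have h4 : star (γ q) * (α q * x) = 0 := by
    rw [← mul_assoc, hr.qRel.c'a hq, smul_mul_assoc, mul_assoc, h2, mul_zero, smul_zero]
  have e : rho q τ σ * x = (1 / 2 : ℂ) • (α q * (α q * x) + star (α q) * (star (α q) * x)) := by
    simp only [rho, smul_mul_assoc, add_mul, sub_mul, pow_two, mul_assoc, h1, h2, h3, h4, mul_zero,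
      smul_zero, sub_zero, add_zero]
  have ha : ‖α q‖ ≤ 1 := by
    rcases subsingleton_or_nontrivial (QSU2 q) with h | h
    · rw [Subsingleton.elim (α q) 0, norm_zero]; exact zero_le_one
    · exact hr.norm_le.1
  have hm : ∀ b : QSU2 q, ‖b‖ ≤ 1 → ∀ y, ‖b * y‖ ≤ ‖y‖ := fun b hb y =>
    (norm_mul_le _ _).trans (mul_le_of_le_one_left (norm_nonneg _) hb)
  have ha' : ‖star (α q)‖ ≤ 1 := by rwa [norm_star]
  rw [e, norm_smul]
  have h5 := norm_add_le (α q * (α q * x)) (star (α q) * (star (α q) * x))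
  have h6 := (hm _ ha _).trans (hm _ ha x)
  have h7 := (hm _ ha' _).trans (hm _ ha' x)
  have h8 : ‖(1 / 2 : ℂ)‖ = 1 / 2 := by norm_num
  rw [h8]
  linarith

/-- A function of `ρ` in the kernel of the representation vanishes off `[-1, 1]`. -/
theorem eq_zero_of_hrep_cfc_eq_zero (hq0 : 0 < q) (hq1 : q < 1) (τ σ : ℝ) {f : ℝ → ℝ}
    (hf : Continuous f) (h : hrep q hq0 hq1 (cfc f (rho q τ σ)) = 0) {x : ℝ}
    (hx : x ∈ spectrum ℝ (rho q τ σ)) (hx1 : 1 < |x|) : f x = 0 := by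
  have hsa := rho_isSelfAdjoint q τ σ
  -- The functions y^n f(y) of ρ stay bounded in norm, whereas |x|^n |f x| is unbounded unless f x =
  -- 0.
  have h1 : ∀ n : ℕ, ‖rho q τ σ ^ n * cfc f (rho q τ σ)‖ ≤ ‖cfc f (rho q τ σ)‖ := fun n => by
    induction n with
    | zero => rw [pow_zero, one_mul]
    | succ n ih =>
      rw [pow_succ', mul_assoc]
      exact (norm_rho_mul_le hq0 hq1 τ σ (by rw [map_mul, h, mul_zero])).trans ih
  by_contra hne
  have hpos : 0 < |f x| := abs_pos.2 hne
  obtain ⟨n, hn⟩ := pow_unbounded_of_one_lt (‖cfc f (rho q τ σ)‖ / |f x|) hx1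
  rw [div_lt_iff₀ hpos] at hn
  have h2 : rho q τ σ ^ n * cfc f (rho q τ σ) = cfc (fun y : ℝ => y ^ n * f y) (rho q τ σ) := by
    rw [cfc_mul _ _ _ (by fun_prop) hf.continuousOn, cfc_pow_id _ n]
  have h3 := norm_apply_le_norm_cfc (fun y : ℝ => y ^ n * f y) (rho q τ σ) hx
    (by fun_prop) hsa
  rw [← h2, Real.norm_eq_abs, abs_mul, abs_pow] at h3
  linarith [h1 n]

end QSU2

/-! ### From polynomials to continuous functions -/

open MeasureTheory AlSalamChihara

/-- Weierstrass approximation on [-R, R], outside of which D does not see its argument. -/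
theorem linearMap_eq_zero_of_pow {D : C(ℝ, ℝ) →ₗ[ℝ] ℂ} {C R : ℝ}
    (hC : ∀ (f : C(ℝ, ℝ)) (M : ℝ), (∀ x ∈ Set.Icc (-R) R, |f x| ≤ M) → ‖D f‖ ≤ C * M)
    (hD : ∀ n : ℕ, D ⟨fun x => x ^ n, by fun_prop⟩ = 0) : D = 0 := by
  have hp : ∀ p : Polynomial ℝ, D p.toContinuousMap = 0 := fun p => by
    induction p using Polynomial.induction_on' with
    | add p r hp hr =>
      have e : (p + r).toContinuousMap = p.toContinuousMap + r.toContinuousMap := by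
        ext x; simp
      rw [e, map_add, hp, hr, add_zero]
    | monomial n c =>
      have e : (Polynomial.monomial n c).toContinuousMap =
          c • (⟨fun x => x ^ n, by fun_prop⟩ : C(ℝ, ℝ)) := by
        ext x; simp
      rw [e, map_smul, hD, smul_zero]
  refine LinearMap.ext fun f => ?_
  rw [LinearMap.zero_apply, ← norm_le_zero_iff]
  have hle : ∀ ε : ℝ, 0 < ε → ‖D f‖ ≤ C * ε := fun ε hε => by
    obtain ⟨p, hpf⟩ := exists_polynomial_near_of_continuousOn (-R) R f f.continuous.continuousOn ε hε
    have h1 := hC (f - p.toContinuousMap) ε fun x hx => by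
      have := hpf x hx
      rw [abs_sub_comm] at this
      exact this.le
    rwa [map_sub, hp, sub_zero] at h1
  have hlim : Filter.Tendsto (fun ε : ℝ => C * ε) (nhdsWithin 0 (Set.Ioi 0)) (nhds 0) := by
    have : Filter.Tendsto (fun ε : ℝ => C * ε) (nhds 0) (nhds (C * 0)) :=
      (continuous_const.mul continuous_id).tendsto 0
    rw [mul_zero] at this
    exact this.mono_left nhdsWithin_le_nhds
  exact ge_of_tendsto hlim (Filter.eventually_of_mem self_mem_nhdsWithin hle)

/-! ### Positive functionals given by the Poisson kernel -/

namespace AlSalamChihara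

variable {q : ℝ}

theorem poisson_nonneg (hq0 : 0 < q) (hq1 : q < 1) {a b t : ℝ} (hab : a * b < 0) (ht : 0 ≤ t)
    (x : ℝ) : 0 ≤ poisson t x x a b q :=
  tsum_nonneg fun k => poissonTerm_nonneg hq0 hq1 hab ht x k

/-- Integration against the diagonal of the Poisson kernel. -/
def integralPoisson (hq0 : 0 < q) (hq1 : q < 1) {a b t : ℝ} (hab : a * b < 0) (ht : 0 ≤ t)
    (ht1 : t < 1) : C(ℝ, ℝ) →ₗ[ℝ] ℂ where
  toFun f := ∫ x, (f x : ℂ) * (poisson t x x a b q : ℂ) ∂measure a b q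
  map_add' f g := by
    have hi : ∀ f : C(ℝ, ℝ), Integrable (fun x => (f x : ℂ) * (poisson t x x a b q : ℂ))
        (measure a b q) := fun f => integrable_mul_poisson hq0 hq1 hab ht ht1
      (f := fun x => (f x : ℂ)) (by fun_prop)
    rw [← integral_add (hi f) (hi g)]
    refine integral_congr_ae (.of_forall fun x => ?_)
    simp [add_mul]
  map_smul' c f := by
    rw [RingHom.id_apply, ← integral_smul]
    refine integral_congr_ae (.of_forall fun x => ?_)
    simp [mul_assoc]

theorem norm_integralPoisson_le (hq0 : 0 < q) (hq1 : q < 1) {a b t : ℝ} (hab : a * b < 0)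
    (ht : 0 ≤ t) (ht1 : t < 1) {f : C(ℝ, ℝ)} {M R : ℝ} (hR : ∀ᵐ x ∂measure a b q, |x| ≤ R)
    (hf : ∀ x ∈ Set.Icc (-R) R, |f x| ≤ M) : ‖integralPoisson hq0 hq1 hab ht ht1 f‖ ≤
      (∫ x, poisson t x x a b q ∂measure a b q) * M := by
  rw [← integral_mul_const]
  refine norm_integral_le_of_norm_le ((integrable_poisson hq0 hq1 hab ht ht1).mul_const M) ?_
  filter_upwards [hR] with x hx
  rw [norm_mul, Complex.norm_real, Complex.norm_real, Real.norm_eq_abs,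
    Real.norm_of_nonneg (poisson_nonneg hq0 hq1 hab ht x), mul_comm]
  exact mul_le_mul_of_nonneg_left (hf x (abs_le.1 hx)) (poisson_nonneg hq0 hq1 hab ht x)

theorem integralPoisson_eq_integral (hq0 : 0 < q) (hq1 : q < 1) {a b t : ℝ} (hab : a * b < 0)
    (ht : 0 ≤ t) (ht1 : t < 1) (f : C(ℝ, ℝ)) : integralPoisson hq0 hq1 hab ht ht1 f =
      ((∫ x, f x * poisson t x x a b q ∂measure a b q : ℝ) : ℂ) := by
  rw [← integral_complex_ofReal]
  simp only [Complex.ofReal_mul]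
  rfl

theorem integral_mul_poisson_nonneg (hq0 : 0 < q) (hq1 : q < 1) {a b t : ℝ} (hab : a * b < 0)
    (ht : 0 ≤ t) {f : C(ℝ, ℝ)} (hf : ∀ x, 0 ≤ f x) :
    0 ≤ ∫ x, f x * poisson t x x a b q ∂measure a b q :=
  integral_nonneg fun x => mul_nonneg (hf x) (poisson_nonneg hq0 hq1 hab ht x)

/-- The kernel is at least 1 on the support, so positivity of f on a neighbourhood of a support
point is not lost. -/
theorem integral_mul_poisson_pos (hq0 : 0 < q) (hq1 : q < 1) {a b t : ℝ} (hab : a * b < 0)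
    (ht : 0 ≤ t) (ht1 : t < 1) {f : C(ℝ, ℝ)} (hf : ∀ x, 0 ≤ f x) {x : ℝ}
    (hx : x ∈ (measure a b q).support) (hfx : 0 < f x) :
    0 < ∫ x, f x * poisson t x x a b q ∂measure a b q := by
  have hi : Integrable (fun x => f x * poisson t x x a b q) (measure a b q) := by
    have := (integrable_mul_poisson hq0 hq1 hab ht ht1 (f := fun x => (f x : ℂ))
      (by fun_prop)).re
    refine this.congr (.of_forall fun x => ?_)
    simp
  rw [integral_pos_iff_support_of_nonneg
    (fun x => mul_nonneg (hf x) (poisson_nonneg hq0 hq1 hab ht x)) hi]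
  have h1 : 0 < measure a b q {y | 0 < f y} :=
    (Measure.mem_support_iff_forall _).1 hx _ ((isOpen_lt continuous_const f.continuous).mem_nhds hfx)
  refine h1.trans_le (measure_mono_ae ?_)
  filter_upwards [Measure.support_mem_ae] with y hy hfy
  have := one_le_poisson hq0 hq1 hab ht (summable_poissonTerm hq0 hq1 hab ht ht1 hy)
  exact (mul_pos hfy (by linarith)).ne'

theorem integralPoisson_eq_zero (hq0 : 0 < q) (hq1 : q < 1) {a b t : ℝ} (hab : a * b < 0)
    (ht : 0 ≤ t) (ht1 : t < 1) {f : C(ℝ, ℝ)} (hf : ∀ x ∈ (measure a b q).support, f x = 0) :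
    integralPoisson hq0 hq1 hab ht ht1 f = 0 := by
  refine integral_eq_zero_of_ae ?_
  filter_upwards [Measure.support_mem_ae] with y hy
  simp [hf y hy]

end AlSalamChihara

/-! ### The integration formula for real continuous functions -/

namespace QSU2

variable {q : ℝ}

/-- A functional applied to the functional calculus of `ρ`. -/
def cfcFunctional (φ : QSU2 q →L[ℂ] ℂ) (τ σ : ℝ) : C(ℝ, ℝ) →ₗ[ℝ] ℂ where
  toFun f := φ (cfc f (rho q τ σ))
  map_add' f g := by
    rw [← map_add, ← cfc_add _ _ _ f.continuous.continuousOn g.continuous.continuousOn]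
    rfl
  map_smul' c f := by
    have h := cfc_const_mul c f (rho q τ σ) f.continuous.continuousOn
    rw [RingHom.id_apply, ← Complex.coe_smul, ← map_smul, Complex.coe_smul, ← h]
    rfl

theorem rpow_mul_neg_rpow_neg (hq0 : 0 < q) (x y : ℝ) : q ^ x * -q ^ y < 0 := by
  have := Real.rpow_pos_of_pos hq0 x
  have := Real.rpow_pos_of_pos hq0 y
  rw [mul_neg, neg_lt_zero]
  positivity

/-- The right-hand side of the integration formula for a continuous function. -/
def haarIntegral (hq0 : 0 < q) (hq1 : q < 1) (τ σ : ℝ) : C(ℝ, ℝ) →ₗ[ℝ] ℂ :=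
  ((1 - q ^ 2) / (1 + q ^ (2 * τ)) : ℝ) • integralPoisson (q := q ^ 2) (t := q ^ 2) (by positivity)
      (pow_lt_one₀ hq0.le hq1 two_ne_zero) (rpow_mul_neg_rpow_neg hq0 (1 + σ - τ) (1 - σ - τ))
      (by positivity) (pow_lt_one₀ hq0.le hq1 two_ne_zero) +
    ((1 - q ^ 2) / (1 + q ^ (-2 * τ)) : ℝ) • integralPoisson (q := q ^ 2) (t := q ^ 2)
      (by positivity) (pow_lt_one₀ hq0.le hq1 two_ne_zero)
      (rpow_mul_neg_rpow_neg hq0 (1 - σ + τ) (1 + σ + τ))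
      (by positivity) (pow_lt_one₀ hq0.le hq1 two_ne_zero)

theorem haarIntegral_apply (hq0 : 0 < q) (hq1 : q < 1) (τ σ : ℝ) (f : C(ℝ, ℝ)) :
    haarIntegral hq0 hq1 τ σ f =
      (((1 - q ^ 2) / (1 + q ^ (2 * τ)) : ℝ) : ℂ) * ∫ x : ℝ, (f x : ℂ) *
        (poisson (q ^ 2) x x (q ^ (1 + σ - τ)) (-q ^ (1 - σ - τ)) (q ^ 2) : ℂ) ∂(dm₁ q τ σ) +
      (((1 - q ^ 2) / (1 + q ^ (-2 * τ)) : ℝ) : ℂ) * ∫ x : ℝ, (f x : ℂ) *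
        (poisson (q ^ 2) x x (q ^ (1 - σ + τ)) (-q ^ (1 + σ + τ)) (q ^ 2) : ℂ) ∂(dm₂ q τ σ) := by
  rw [haarIntegral, LinearMap.add_apply, LinearMap.smul_apply, LinearMap.smul_apply,
    Complex.real_smul, Complex.real_smul]
  rfl

/-- Both functionals are bounded by the supremum on one compact interval that contains the spectrum
and carries both measures, and they agree on powers by `map_rho_pow`. -/
theorem IsHaarLike.cfcFunctional_eq {φ : QSU2 q →L[ℂ] ℂ} (h : IsHaarLike φ) (hq0 : 0 < q)
    (hq1 : q < 1) (τ σ : ℝ) : cfcFunctional φ τ σ = haarIntegral hq0 hq1 τ σ := by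
  have hsa := rho_isSelfAdjoint q τ σ
  have hr0 : 0 < q ^ 2 := by positivity
  have hr1 : q ^ 2 < 1 := pow_lt_one₀ hq0.le hq1 two_ne_zero
  obtain ⟨R₁, hR₁⟩ := exists_ae_abs_le hr0 hr1 (q ^ (1 + σ - τ)) (-q ^ (1 - σ - τ))
  obtain ⟨R₂, hR₂⟩ := exists_ae_abs_le hr0 hr1 (q ^ (1 - σ + τ)) (-q ^ (1 + σ + τ))
  obtain ⟨R₃, hR₃⟩ := (spectrum.isBounded (𝕜 := ℝ) (rho q τ σ)).exists_norm_le
  set R := max R₁ (max R₂ |R₃|)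
  rw [← sub_eq_zero]
  refine linearMap_eq_zero_of_pow (R := R) (C := ‖φ‖ +
    (‖(1 - q ^ 2) / (1 + q ^ (2 * τ))‖ * (∫ x, poisson (q ^ 2) x x (q ^ (1 + σ - τ))
      (-q ^ (1 - σ - τ)) (q ^ 2) ∂AlSalamChihara.measure (q ^ (1 + σ - τ)) (-q ^ (1 - σ - τ))
        (q ^ 2)) +
    ‖(1 - q ^ 2) / (1 + q ^ (-2 * τ))‖ * (∫ x, poisson (q ^ 2) x x (q ^ (1 - σ + τ))
      (-q ^ (1 + σ + τ)) (q ^ 2) ∂AlSalamChihara.measure (q ^ (1 - σ + τ)) (-q ^ (1 + σ + τ))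
        (q ^ 2)))) (fun f M hf => ?_) fun n => ?_
  · have hR : 0 ≤ R := le_max_of_le_right (le_max_of_le_right (abs_nonneg R₃))
    have hM : 0 ≤ M := (abs_nonneg _).trans (hf 0 ⟨by linarith, hR⟩)
    rw [LinearMap.sub_apply, haarIntegral, LinearMap.add_apply, LinearMap.smul_apply,
      LinearMap.smul_apply, add_mul, add_mul, mul_assoc, mul_assoc]
    refine (norm_sub_le _ _).trans (add_le_add ?_ ((norm_add_le _ _).trans (add_le_add ?_ ?_)))
    · refine φ.le_opNorm_of_le (norm_cfc_le hM fun x hx => hf x (abs_le.1 ?_))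
      exact (hR₃ x hx).trans ((le_abs_self _).trans
        ((le_max_right _ _).trans (le_max_right _ _)))
    · rw [norm_smul]
      refine mul_le_mul_of_nonneg_left (norm_integralPoisson_le _ _ _ _ _ ?_ hf) (norm_nonneg _)
      filter_upwards [hR₁] with x hx using hx.trans (le_max_left _ _)
    · rw [norm_smul]
      refine mul_le_mul_of_nonneg_left (norm_integralPoisson_le _ _ _ _ _ ?_ hf) (norm_nonneg _)
      filter_upwards [hR₂] with x hx using hx.trans ((le_max_left _ _).trans (le_max_right _ _))
  · rw [LinearMap.sub_apply, haarIntegral_apply, sub_eq_zero]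
    have h1 := h.map_rho_pow hq0 hq1 τ σ n
    have h2 : cfcFunctional φ τ σ ⟨fun x => x ^ n, by fun_prop⟩ = φ (rho q τ σ ^ n) :=
      congrArg φ (cfc_pow_id (rho q τ σ) n)
    rw [h2, h1]
    simp

end QSU2

/-! ### The spectrum of the spherical element -/

open MeasureTheory AlSalamChihara

namespace QSU2

variable {q : ℝ}

theorem support_eq_zero_of_haarIntegral (hq0 : 0 < q) (hq1 : q < 1) (τ σ : ℝ) {f : C(ℝ, ℝ)}
    (hf : ∀ x, 0 ≤ f x) (h : haarIntegral hq0 hq1 τ σ f = 0) {x : ℝ}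
    (hx : x ∈ (dm₁ q τ σ).support ∪ (dm₂ q τ σ).support) : f x = 0 := by
  have hr0 : 0 < q ^ 2 := by positivity
  have hr1 : q ^ 2 < 1 := pow_lt_one₀ hq0.le hq1 two_ne_zero
  have hc : ∀ y : ℝ, 0 < (1 - q ^ 2) / (1 + q ^ y) := fun y => by
    have := Real.rpow_pos_of_pos hq0 y
    exact div_pos (by linarith) (by linarith)
  have h1 := rpow_mul_neg_rpow_neg hq0 (1 + σ - τ) (1 - σ - τ)
  have h2 := rpow_mul_neg_rpow_neg hq0 (1 - σ + τ) (1 + σ + τ)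
  rw [haarIntegral, LinearMap.add_apply, LinearMap.smul_apply, LinearMap.smul_apply,
    integralPoisson_eq_integral, integralPoisson_eq_integral, Complex.real_smul, Complex.real_smul,
    ← Complex.ofReal_mul, ← Complex.ofReal_mul, ← Complex.ofReal_add, Complex.ofReal_eq_zero] at h
  have k1 := mul_nonneg (hc (2 * τ)).le (integral_mul_poisson_nonneg hr0 hr1 h1 hr0.le hf)
  have k2 := mul_nonneg (hc (-2 * τ)).le (integral_mul_poisson_nonneg hr0 hr1 h2 hr0.le hf)
  by_contra hne
  have hpos := lt_of_le_of_ne (hf x) (Ne.symm hne)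
  rcases hx with hx | hx
  · have := mul_pos (hc (2 * τ)) (integral_mul_poisson_pos hr0 hr1 h1 hr0.le hr1 hf hx hpos)
    linarith
  · have := mul_pos (hc (-2 * τ)) (integral_mul_poisson_pos hr0 hr1 h2 hr0.le hr1 hf hx hpos)
    linarith

theorem haarIntegral_eq_zero (hq0 : 0 < q) (hq1 : q < 1) (τ σ : ℝ) {f : C(ℝ, ℝ)}
    (hf : ∀ x ∈ (dm₁ q τ σ).support ∪ (dm₂ q τ σ).support, f x = 0) :
    haarIntegral hq0 hq1 τ σ f = 0 := by
  rw [haarIntegral, LinearMap.add_apply, LinearMap.smul_apply, LinearMap.smul_apply,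
    integralPoisson_eq_zero _ _ _ _ _ fun x hx => hf x (.inl hx),
    integralPoisson_eq_zero _ _ _ _ _ fun x hx => hf x (.inr hx), smul_zero, smul_zero, add_zero]

/-- The formula for `haar` is tested on distance functions, which are nonnegative and vanish exactly
on a given closed set. -/
theorem real_spectrum_rho (hq0 : 0 < q) (hq1 : q < 1) (τ σ : ℝ) :
    spectrum ℝ (rho q τ σ) = (dm₁ q τ σ).support ∪ (dm₂ q τ σ).support := by
  have hsa := rho_isSelfAdjoint q τ σ
  have hφ := haar_isHaarLike hq0 hq1
  have hφI := hφ.cfcFunctional_eq hq0 hq1 τ σ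
  have hnt : Nontrivial (QSU2 q) := by
    refine nontrivial_of_ne 1 0 fun h => ?_
    have := hφ.map_one
    rw [h, _root_.map_zero] at this
    exact zero_ne_one this
  have hI : Set.Icc (-1 : ℝ) 1 ⊆ (dm₁ q τ σ).support ∪ (dm₂ q τ σ).support :=
    (Icc_subset_support (by positivity) (pow_lt_one₀ hq0.le hq1 two_ne_zero)
      (rpow_mul_neg_rpow_neg hq0 _ _)).trans Set.subset_union_left
  refine Set.Subset.antisymm (fun x hx => ?_) fun x hx => ?_
  · set s := (dm₁ q τ σ).support ∪ (dm₂ q τ σ).support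
    have hs : IsClosed s := Measure.isClosed_support.union Measure.isClosed_support
    have hne : s.Nonempty := ⟨0, hI (by simp)⟩
    by_contra hxs
    let f : C(ℝ, ℝ) := ⟨fun y => Metric.infDist y s, Metric.continuous_infDist_pt s⟩
    -- f vanishes on the supports, so f(ρ)*f(ρ) has value zero and f(ρ) lies in the kernel of the
    -- representation. That decides the points outside [-1, 1]; those inside belong to the supports
    -- anyway.
    have h0 : haar hq0 hq1 (star (cfc f (rho q τ σ)) * cfc f (rho q τ σ)) = 0 := by
      have hstar : star (cfc f (rho q τ σ)) = cfc f (rho q τ σ) :=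
        (cfc_predicate (R := ℝ) f (rho q τ σ) : IsSelfAdjoint _)
      rw [hstar, ← cfc_mul _ _ _ f.continuous.continuousOn f.continuous.continuousOn]
      have h1 := LinearMap.congr_fun hφI (f * f)
      have h2 : ∀ y ∈ s, (f * f) y = 0 := fun y hy => by
        rw [ContinuousMap.mul_apply]
        exact mul_eq_zero_of_left (Metric.infDist_zero_of_mem hy) _
      rw [haarIntegral_eq_zero hq0 hq1 τ σ h2] at h1
      exact h1
    have h1 := eq_zero_of_hrep_cfc_eq_zero hq0 hq1 τ σ f.continuous
      (hrep_eq_zero_of_haar hq0 hq1 h0) hx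
      (by by_contra hc; exact hxs (hI (abs_le.1 (not_lt.1 hc))))
    exact hxs ((hs.mem_iff_infDist_zero hne).2 h1)
  · have hs : IsClosed (spectrum ℝ (rho q τ σ)) := spectrum.isClosed _
    have hne : (spectrum ℝ (rho q τ σ)).Nonempty :=
      ContinuousFunctionalCalculus.spectrum_nonempty _ hsa
    let f : C(ℝ, ℝ) := ⟨fun y => Metric.infDist y (spectrum ℝ (rho q τ σ)),
      Metric.continuous_infDist_pt _⟩
    -- Conversely, with the distance to the spectrum the left side of the formula is zero, and
    -- strict positivity of the right side forces f = 0 on the supports.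
    have h0 : cfc f (rho q τ σ) = 0 := by
      rw [← cfc_zero ℝ (rho q τ σ)]
      exact cfc_congr fun y hy => Metric.infDist_zero_of_mem hy
    have h1 := LinearMap.congr_fun hφI f
    have h2 : cfcFunctional (haar hq0 hq1) τ σ f = 0 := by
      change haar hq0 hq1 (cfc f (rho q τ σ)) = 0
      rw [h0, _root_.map_zero]
    rw [h2] at h1
    have h3 := support_eq_zero_of_haarIntegral hq0 hq1 τ σ (fun y => Metric.infDist_nonneg) h1.symm hx
    exact (hs.mem_iff_infDist_zero hne).2 h3

theorem spectrum_rho (hq0 : 0 < q) (hq1 : q < 1) (τ σ : ℝ) : spectrum ℂ (rho q τ σ) =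
    (fun x : ℝ => (x : ℂ)) '' ((dm₁ q τ σ).support ∪ (dm₂ q τ σ).support) := by
  rw [← real_spectrum_rho hq0 hq1]
  exact (rho_isSelfAdjoint q τ σ).spectrumRestricts.algebraMap_image.symm

/-- Tietze extension from the closed union of the supports. -/
theorem exists_continuousMap_eq_ofReal (hq0 : 0 < q) (hq1 : q < 1) (τ σ : ℝ) {p : ℂ → ℂ}
    (hp : ContinuousOn p (spectrum ℂ (rho q τ σ))) : ∃ g : C(ℝ, ℂ),
      ∀ x ∈ (dm₁ q τ σ).support ∪ (dm₂ q τ σ).support, g x = p x := by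
  have hs : IsClosed ((dm₁ q τ σ).support ∪ (dm₂ q τ σ).support) :=
    Measure.isClosed_support.union Measure.isClosed_support
  have hc : ContinuousOn (fun x : ℝ => p x) ((dm₁ q τ σ).support ∪ (dm₂ q τ σ).support) := by
    rw [spectrum_rho hq0 hq1] at hp
    exact hp.comp Complex.continuous_ofReal.continuousOn (Set.mapsTo_image _ _)
  obtain ⟨g, hg⟩ := ContinuousMap.exists_restrict_eq hs ⟨_, hc.domRestrict⟩
  exact ⟨g, fun x hx => DFunLike.congr_fun hg ⟨x, hx⟩⟩

/-- Complex linearity: real and imaginary part of a continuous extension of p reduce the claim to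
real functions, because both sides depend only on the values of p on the supports. -/
theorem IsHaarLike.map_cfc {φ : QSU2 q →L[ℂ] ℂ} (h : IsHaarLike φ) (hq0 : 0 < q) (hq1 : q < 1)
    (τ σ : ℝ) {p : ℂ → ℂ} (hp : ContinuousOn p (spectrum ℂ (rho q τ σ))) :
    φ (cfc p (rho q τ σ)) =
      (((1 - q ^ 2) / (1 + q ^ (2 * τ)) : ℝ) : ℂ) * ∫ x : ℝ, p x *
        (poisson (q ^ 2) x x (q ^ (1 + σ - τ)) (-q ^ (1 - σ - τ)) (q ^ 2) : ℂ) ∂(dm₁ q τ σ) +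
      (((1 - q ^ 2) / (1 + q ^ (-2 * τ)) : ℝ) : ℂ) * ∫ x : ℝ, p x *
        (poisson (q ^ 2) x x (q ^ (1 - σ + τ)) (-q ^ (1 + σ + τ)) (q ^ 2) : ℂ) ∂(dm₂ q τ σ) := by
  have hsa := rho_isSelfAdjoint q τ σ
  obtain ⟨g, hg⟩ := exists_continuousMap_eq_ofReal hq0 hq1 τ σ hp
  let u : C(ℝ, ℝ) := ⟨fun x => (g x).re, by fun_prop⟩
  let v : C(ℝ, ℝ) := ⟨fun x => (g x).im, by fun_prop⟩
  have e : cfc p (rho q τ σ) = cfc u (rho q τ σ) + Complex.I • cfc v (rho q τ σ) := by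
    rw [cfc_real_eq_complex u hsa, cfc_real_eq_complex v hsa,
      ← cfc_smul _ _ _ (by fun_prop), ← cfc_add _ _ _ (by fun_prop) (by fun_prop)]
    refine cfc_congr fun z hz => ?_
    rw [spectrum_rho hq0 hq1] at hz
    obtain ⟨x, hx, rfl⟩ := hz
    simp only [u, v, ContinuousMap.coe_mk, Complex.ofReal_re, smul_eq_mul, ← hg x hx]
    rw [mul_comm, Complex.re_add_im]
  have hint : ∀ {a b : ℝ} (hab : a * b < 0),
      (AlSalamChihara.measure a b (q ^ 2)).support ⊆ (dm₁ q τ σ).support ∪ (dm₂ q τ σ).support →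
      ∫ x : ℝ, p x * (poisson (q ^ 2) x x a b (q ^ 2) : ℂ) ∂AlSalamChihara.measure a b (q ^ 2) =
      (∫ x : ℝ, (u x : ℂ) * (poisson (q ^ 2) x x a b (q ^ 2) : ℂ)
        ∂AlSalamChihara.measure a b (q ^ 2)) + Complex.I * ∫ x : ℝ, (v x : ℂ) *
        (poisson (q ^ 2) x x a b (q ^ 2) : ℂ) ∂AlSalamChihara.measure a b (q ^ 2) := by
    intro a b hab hsub
    have hi : ∀ f : C(ℝ, ℝ), Integrable (fun x => (f x : ℂ) * (poisson (q ^ 2) x x a b (q ^ 2) : ℂ))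
        (AlSalamChihara.measure a b (q ^ 2)) := fun f =>
      integrable_mul_poisson (by positivity) (pow_lt_one₀ hq0.le hq1 two_ne_zero) hab
        (by positivity) (pow_lt_one₀ hq0.le hq1 two_ne_zero) (f := fun x => (f x : ℂ)) (by fun_prop)
    rw [← integral_const_mul, ← integral_add (hi u) ((hi v).const_mul _)]
    refine integral_congr_ae ?_
    filter_upwards [Measure.support_mem_ae] with x hx
    rw [← hg x (hsub hx)]
    conv_lhs => rw [← Complex.re_add_im (g x)]
    simp only [u, v, ContinuousMap.coe_mk]
    ring
  have hu : φ (cfc u (rho q τ σ)) = _ :=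
    (LinearMap.congr_fun (h.cfcFunctional_eq hq0 hq1 τ σ) u).trans (haarIntegral_apply _ _ _ _ _)
  have hv : φ (cfc v (rho q τ σ)) = _ :=
    (LinearMap.congr_fun (h.cfcFunctional_eq hq0 hq1 τ σ) v).trans (haarIntegral_apply _ _ _ _ _)
  have i1 := hint (rpow_mul_neg_rpow_neg hq0 (1 + σ - τ) (1 - σ - τ)) Set.subset_union_left
  have i2 := hint (rpow_mul_neg_rpow_neg hq0 (1 - σ + τ) (1 + σ + τ)) Set.subset_union_right
  rw [e, map_add, map_smul, hu, hv, dm₁, dm₂, i1, i2, smul_eq_mul]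
  ring

end QSU2

end

/-! ### The main theorem -/

theorem proposition6p3 (q : ℝ) (hq0 : 0 < q) (hq1 : q < 1) (τ σ : ℝ) :
    -- the spectrum of `ρ_{τ,σ}` is the union of the supports of `dm₁` and `dm₂`
    spectrum ℂ (QSU2.rho q τ σ) =
        (fun x : ℝ => (x : ℂ)) '' ((dm₁ q τ σ).support ∪ (dm₂ q τ σ).support) ∧
    -- the two Poisson kernels converge absolutely on the supports
    (∀ x ∈ (dm₁ q τ σ).support, Summable
      (AlSalamChihara.poissonTerm (q ^ 2) x x (q ^ (1 + σ - τ)) (-q ^ (1 - σ - τ)) (q ^ 2))) ∧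
    (∀ x ∈ (dm₂ q τ σ).support, Summable
      (AlSalamChihara.poissonTerm (q ^ 2) x x (q ^ (1 - σ + τ)) (-q ^ (1 + σ + τ)) (q ^ 2))) ∧
    ∀ h : QSU2 q →L[ℂ] ℂ, QSU2.IsHaarFunctional h →
      ∀ p : ℂ → ℂ, ContinuousOn p (spectrum ℂ (QSU2.rho q τ σ)) →
        MeasureTheory.Integrable (fun x : ℝ => p x *
          (AlSalamChihara.poisson (q ^ 2) x x (q ^ (1 + σ - τ)) (-q ^ (1 - σ - τ)) (q ^ 2) : ℂ))
          (dm₁ q τ σ) ∧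
        MeasureTheory.Integrable (fun x : ℝ => p x *
          (AlSalamChihara.poisson (q ^ 2) x x (q ^ (1 - σ + τ)) (-q ^ (1 + σ + τ)) (q ^ 2) : ℂ))
          (dm₂ q τ σ) ∧
        h (cfc p (QSU2.rho q τ σ)) =
          (((1 - q ^ 2) / (1 + q ^ (2 * τ)) : ℝ) : ℂ) * ∫ x : ℝ, p x *
            (AlSalamChihara.poisson (q ^ 2) x x (q ^ (1 + σ - τ)) (-q ^ (1 - σ - τ)) (q ^ 2) : ℂ)
            ∂(dm₁ q τ σ) +
          (((1 - q ^ 2) / (1 + q ^ (-2 * τ)) : ℝ) : ℂ) * ∫ x : ℝ, p x *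
            (AlSalamChihara.poisson (q ^ 2) x x (q ^ (1 - σ + τ)) (-q ^ (1 + σ + τ)) (q ^ 2) : ℂ)
            ∂(dm₂ q τ σ) := by
  have hr0 : 0 < q ^ 2 := by positivity
  have hr1 : q ^ 2 < 1 := pow_lt_one₀ hq0.le hq1 two_ne_zero
  have hc := fun {x y : ℝ} => QSU2.rpow_mul_neg_rpow_neg hq0 x y
  refine ⟨QSU2.spectrum_rho hq0 hq1 τ σ,
    fun x hx => AlSalamChihara.summable_poissonTerm hr0 hr1 hc hr0.le hr1 hx,
    fun x hx => AlSalamChihara.summable_poissonTerm hr0 hr1 hc hr0.le hr1 hx, fun h hh p hp => ?_⟩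
  have hp' : ContinuousOn (fun x : ℝ => p x) ((dm₁ q τ σ).support ∪ (dm₂ q τ σ).support) := by
    rw [QSU2.spectrum_rho hq0 hq1] at hp
    exact hp.comp Complex.continuous_ofReal.continuousOn (Set.mapsTo_image _ _)
  exact ⟨AlSalamChihara.integrable_mul_poisson hr0 hr1 hc hr0.le hr1
      (hp'.mono Set.subset_union_left),
    AlSalamChihara.integrable_mul_poisson hr0 hr1 hc hr0.le hr1
      (hp'.mono Set.subset_union_right),
    (hh.isHaarLike hq0 hq1).map_cfc hq0 hq1 τ σ hp⟩
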